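/- **Theorem (the classical representation is equivalent to LSN).** *Notation.* Let $n,k,m\in\mathbb N$ with $k\le n$ and $p\in[0,1]$. A phase-free $n$-qubit Pauli operator $P$ is identified with its symplectic representation $\mathrm{Symp}(P)\in\mathbb Z_2^{2n}$ ($X$ part followed by $Z$ part), and $v\odot w=v^{T}\begin{bmatrix}0&I\\I&0\end{bmatrix}w$ is the symplectic inner product. $\mathcal D_p^{\otimes n}$ is $n$-qubit depolarizing noise: on each qubit independently, $I$ has probability $1-p$ and $X,Y,Z$ have probability $p/3$ each. $\mathcal C_n$ is the finite group of $n$-qubit Clifford unitaries modulo global phase; its elements are described by their tableaux, i.e. the signed Paulis $CX_jC^\dagger$, $CZ_jC^\dagger$. *$\mathsf{LSN}^m(k,n,p)$.* A structured instance consists of $(C_i,\,E_iC_i|0^{n-k},x\rangle)$, $i=1,\dots,m$, with $C_i\sim\mathcal C_n$ uniform, $E_i\sim\mathcal D_p^{\otimes n}$, all independent, and one uniform secret $x\in\mathbb Z_2^k$ common to all samples; an unstructured instance consists of $(C_i,\,I/2^n)$, $i=1,\dots,m$, with independent uniform $C_i$. *Classical representation.* A structured instance consists of $\big([A_i|B_i],\,A_ir_i+B_iy+e_i\big)$,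 $i=1,\dots,m$, where independently for each $i$ the pair $A_i\in\mathbb Z_2^{2n\times n}$, $B_i\in\mathbb Z_2^{2n\times k}$ is uniform among the pairs for which the columns of $A_i$ are pairwise symplectically orthogonal, the columns of $B_i$ are pairwise symplectically orthogonal, and $[A_i|B_i]$ has full rank $n+k$; $r_i\in\mathbb Z_2^n$ is uniform; $e_i=\mathrm{Symp}(E_i)$ with $E_i\sim\mathcal D_p^{\otimes n}$; and one uniform secret $y\in\mathbb Z_2^k$ is common to all samples. An unstructured instance consists of $([A_i|B_i],u_i)$, with $u_i\in\mathbb Z_2^{2n}$ uniform and independent. In either formulation, the Search problem is to output the secret of a structured instance, and the Decision problem is to decide whether the instance is structured or unstructured, each type having probability $1/2$. The success probability of a solver is the probability, over the instance and the internal randomness, that its output is correct. An oracle for the quantum formulation is an arbitrary quantum measurement of the $m$ registers that depends on the descriptions of $C_1,\dots,C_m$; an oracle for the classical formulation is an arbitrary randomized map. *Efficient quantum algorithm.* One fixed program of a random access machine with classical memory (natural numbers, with addition, truncated subtraction, integer division, remainder and comparison, branching and bounded loops) and qubits (gates $H,S,T,\mathrm{CX}$ and measurement in the computational basis) that can sample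 exactly uniformly from $\{0,\dots,N\}$ for a computed number $N$. Every executed command and the oracle call cost one time unit. The running time on every input is bounded by a polynomial in $n+m$. The program receives $n,k,m$ and the instance, but not $p$. *Statement.* For the Search problem, and likewise for the Decision problem, each of the two formulations strongly reduces to the other: 1. There is an efficient quantum algorithm that makes exactly one oracle call and that, for all $n,m$, all $k\le n$, all $p\in[0,1]$ and every oracle $\mathcal O$ for the classical representation with success probability $q$, solves $\mathsf{LSN}^m(k,n,p)$ with success probability exactly $q$ when its oracle is $\mathcal O$. 2. There is an efficient quantum algorithm that makes exactly one oracle call and that, for all $n,m$, all $k\le n$, all $p\in[0,1]$ and every oracle $\mathcal O$ for $\mathsf{LSN}^m(k,n,p)$ with success probability $q$, solves the classical representation with success probability exactly $q$ when its oracle is $\mathcal O$. -/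

import Mathlib

open scoped BigOperators ComplexOrder

namespace LSN

/-! ## Pauli operators, Clifford operators, depolarizing noise -/

/-- Bit strings of length `ℓ`. -/
abbrev Bits (ℓ : ℕ) := Fin ℓ → ZMod 2

/-- `ℤ₂²ⁿ`: the symplectic representation of an `n`-qubit Pauli operator. The first block of `n`
coordinates (`Sum.inl`) is the `X` part, the second block (`Sum.inr`) is the `Z` part. -/
abbrev PVec (n : ℕ) := Fin n ⊕ Fin n → ZMod 2

/-- The symplectic inner product `vᵀ Ω w` with `Ω = [0 I; I 0]`. -/
def sympInner {n : ℕ} (v w : PVec n) : ZMod 2 :=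
  v ⬝ᵥ (Matrix.fromBlocks 0 1 1 0 : Matrix (Fin n ⊕ Fin n) (Fin n ⊕ Fin n) (ZMod 2)).mulVec w

/-- The one-qubit Pauli operator with symplectic representation `(a, b)`:
`(0,0) ↦ I`, `(1,0) ↦ X`, `(0,1) ↦ Z`, `(1,1) ↦ Y`. -/
noncomputable def pauli1 (a b : ZMod 2) : Matrix (ZMod 2) (ZMod 2) ℂ :=
  if a = 0 then
    if b = 0 then 1 else Matrix.diagonal fun s => if s = 0 then 1 else -1
  else
    if b = 0 then Matrix.of fun s t => if s = t then 0 else 1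
    else Matrix.of fun s t => if s = t then 0 else if s = 0 then -Complex.I else Complex.I

/-- The `n`-qubit Pauli operator (a tensor product of one-qubit Pauli operators, without phase)
whose symplectic representation is `v`, in the computational basis. -/
noncomputable def pauli {n : ℕ} (v : PVec n) : Matrix (Bits n) (Bits n) ℂ :=
  Matrix.of fun s t => ∏ j, pauli1 (v (Sum.inl j)) (v (Sum.inr j)) (s j) (t j)

/-- The probability of the Pauli operator `e` under `n`-qubit depolarizing noise: on every qubit
independently `I` has probability `1 - p` and each of `X`, `Y`, `Z` has probability `p / 3`. -/
noncomputable def depol (p : ℝ) {n : ℕ} (e : PVec n) : ℝ :=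
  ∏ j, if e (Sum.inl j) = 0 ∧ e (Sum.inr j) = 0 then 1 - p else p / 3

/-- Clifford operators: unitaries that conjugate every Pauli operator to a Pauli operator, up to a
phase in `{±1, ±i}`. -/
def IsClifford {n : ℕ} (U : Matrix.unitaryGroup (Bits n) ℂ) : Prop :=
  ∀ v : PVec n, ∃ w : PVec n, ∃ c ∈ ({1, -1, Complex.I, -Complex.I} : Set ℂ),
    U.1 * pauli v * U.1.conjTranspose = c • pauli w

/-- The standard classical description of an `n`-qubit Clifford operator (up to a global phase):
for each of the generators `X_j` (index `Sum.inl j`) and `Z_j` (index `Sum.inr j`), the sign bit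
and the symplectic representation of the conjugated generator. -/
abbrev Tableau (n : ℕ) := Fin n ⊕ Fin n → ZMod 2 × PVec n

/-- `U` conjugates the generators as described by the tableau `τ`. -/
def HasTableau {n : ℕ} (U : Matrix.unitaryGroup (Bits n) ℂ) (τ : Tableau n) : Prop :=
  ∀ g, U.1 * pauli (Pi.single g 1) * U.1.conjTranspose
    = (if (τ g).1 = 0 then (1 : ℂ) else -1) • pauli (τ g).2

theorem pauli_single_inr {n : ℕ} (j : Fin n) :
    pauli (Pi.single (Sum.inr j) 1 : PVec n)
      = Matrix.diagonal fun s => if s j = 0 then (1 : ℂ) else -1 := by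
  ext s t
  simp only [pauli, Matrix.of_apply, Matrix.diagonal_apply]
  by_cases h : s = t
  · subst h
    rw [Finset.prod_eq_single j]
    · simp [pauli1]
    · intro i _ hi
      simp [pauli1, hi]
    · simp
  · obtain ⟨i, hi⟩ := Function.ne_iff.mp h
    rw [if_neg h]
    apply Finset.prod_eq_zero (Finset.mem_univ i)
    by_cases hij : i = j
    · subst hij
      simp [pauli1, hi]
    · simp [pauli1, hi, hij]

theorem pauli_single_inl {n : ℕ} (j : Fin n) (s t : Bits n) :
    pauli (Pi.single (Sum.inl j) 1 : PVec n) s t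
      = if s = t + Pi.single j 1 then (1 : ℂ) else 0 := by
  have key : ∀ a b : ZMod 2, (a ≠ b) ↔ a = b + 1 := by decide
  simp only [pauli, Matrix.of_apply]
  by_cases h : s = t + Pi.single j 1
  · rw [if_pos h]
    apply Finset.prod_eq_one
    intro i _
    by_cases hij : i = j
    · subst hij
      have : s i ≠ t i := by rw [key, h]; simp
      simp [pauli1, this]
    · have : s i = t i := by rw [h]; simp [hij]
      simp [pauli1, hij, Matrix.one_apply, this]
  · rw [if_neg h]
    obtain ⟨i, hi⟩ := Function.ne_iff.mp h
    apply Finset.prod_eq_zero (Finset.mem_univ i)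
    by_cases hij : i = j
    · subst hij
      have : s i = t i := by
        by_contra hne
        exact hi (by simpa using (key _ _).mp hne)
      simp [pauli1, this]
    · have : s i ≠ t i := by simpa [hij] using hi
      simp [pauli1, this, hij]

/-- A tableau determines a unitary up to a global phase. -/
theorem eq_smul_of_hasTableau {n : ℕ} {U V : Matrix.unitaryGroup (Bits n) ℂ} {τ : Tableau n}
    (hU : HasTableau U τ) (hV : HasTableau V τ) : ∃ c : ℂ, ‖c‖ = 1 ∧ V.1 = c • U.1 := by
  have hUU : U.1.conjTranspose * U.1 = 1 := Matrix.mem_unitaryGroup_iff'.mp U.2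
  have hVV : V.1.conjTranspose * V.1 = 1 := Matrix.mem_unitaryGroup_iff'.mp V.2
  have hUU' : U.1 * U.1.conjTranspose = 1 := Matrix.mem_unitaryGroup_iff.mp U.2
  have hVV' : V.1 * V.1.conjTranspose = 1 := Matrix.mem_unitaryGroup_iff.mp V.2
  obtain ⟨W, hW⟩ : ∃ W, W = U.1.conjTranspose * V.1 := ⟨_, rfl⟩
  have hcomm : ∀ g, W * pauli (Pi.single g 1) = pauli (Pi.single g 1) * W := by
    intro g
    have h := (hV g).trans (hU g).symm
    calc W * pauli (Pi.single g 1)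
        = U.1.conjTranspose * (V.1 * pauli (Pi.single g 1) * V.1.conjTranspose) * V.1 := by
          simp only [hW, Matrix.mul_assoc, hVV, Matrix.mul_one]
      _ = (U.1.conjTranspose * U.1) * pauli (Pi.single g 1) * W := by
          rw [h, hW]; simp only [Matrix.mul_assoc]
      _ = pauli (Pi.single g 1) * W := by rw [hUU, Matrix.one_mul]
  have hoff : ∀ s t, s ≠ t → W s t = 0 := by
    intro s t hst
    obtain ⟨j, hj⟩ := Function.ne_iff.mp hst
    have h := congrFun (congrFun (hcomm (Sum.inr j)) s) t
    rw [pauli_single_inr, Matrix.mul_diagonal, Matrix.diagonal_mul] at h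
    have key : ∀ a b : ZMod 2, a ≠ b → (a = 0 ↔ ¬ b = 0) := by decide
    have k := key _ _ hj
    by_cases hs : s j = 0
    · have ht := k.mp hs
      simp only [hs, ht, if_true, if_false] at h
      linear_combination (-1 / 2 : ℂ) * h
    · have ht : t j = 0 := by
        by_contra hc
        exact hs (k.mpr hc)
      simp only [hs, ht, if_true, if_false] at h
      linear_combination (1 / 2 : ℂ) * h
  have hstep : ∀ (s : Bits n) (j : Fin n),
      W (s + Pi.single j 1) (s + Pi.single j 1) = W s s := by
    intro s j
    have h := congrFun (congrFun (hcomm (Sum.inl j)) (s + Pi.single j 1)) s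
    simp only [Matrix.mul_apply, pauli_single_inl] at h
    rw [Finset.sum_eq_single (s + Pi.single j 1), Finset.sum_eq_single s] at h
    · simpa using h
    · intro b _ hb
      rw [if_neg, zero_mul]
      intro hc
      exact hb (add_right_cancel hc).symm
    · simp
    · intro b _ hb
      rw [if_neg hb, mul_zero]
    · simp
  have hdiag : ∀ s, W s s = W 0 0 := by
    have : ∀ T : Finset (Fin n), W (∑ j ∈ T, Pi.single j 1) (∑ j ∈ T, Pi.single j 1) = W 0 0 := by
      intro T
      induction T using Finset.induction_on with
      | empty => simp
      | insert j T hj ih => rw [Finset.sum_insert hj, add_comm, hstep, ih]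
    intro s
    have hs : s = ∑ j ∈ Finset.univ.filter (fun j => s j ≠ 0), Pi.single j 1 := by
      have key : ∀ a : ZMod 2, a = if a ≠ 0 then 1 else 0 := by decide
      ext i
      rw [Finset.sum_apply, Finset.sum_filter]
      simp only [Pi.single_apply]
      rw [Finset.sum_eq_single i]
      · simpa using key (s i)
      · intro b _ hb
        simp [hb.symm]
      · simp
    rw [hs, this]
  have hWc : W = W 0 0 • (1 : Matrix (Bits n) (Bits n) ℂ) := by
    ext s t
    by_cases h : s = t
    · subst h
      simp [hdiag s]
    · simp [hoff s t h, h]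
  have hVc : V.1 = W 0 0 • U.1 := by
    calc V.1 = U.1 * W := by rw [hW, ← Matrix.mul_assoc, hUU', Matrix.one_mul]
      _ = W 0 0 • U.1 := by
        conv_lhs => rw [hWc]
        rw [Matrix.mul_smul, Matrix.mul_one]
  refine ⟨W 0 0, ?_, hVc⟩
  have h1 : W.conjTranspose * W = 1 := by
    rw [hW, Matrix.conjTranspose_mul, Matrix.conjTranspose_conjTranspose, Matrix.mul_assoc,
      ← Matrix.mul_assoc U.1, hUU', Matrix.one_mul, hVV]
  have h2 := congrFun (congrFun h1 0) 0
  rw [hWc] at h2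
  simp at h2
  have h3 : ‖W 0 0‖ ^ 2 = 1 := by
    have := congrArg norm h2
    simpa [pow_two] using this
  exact (pow_eq_one_iff_of_nonneg (norm_nonneg _) two_ne_zero).mp h3

open Classical in
/-- The `n`-qubit Clifford group up to global phases (a finite set), every element being
represented by its tableau. -/
noncomputable def cliffords (n : ℕ) : Finset (Tableau n) :=
  Finset.univ.filter fun τ => ∃ U, IsClifford U ∧ HasTableau U τ

open Classical in
/-- A Clifford unitary with the given tableau (the identity if there is none). By
`eq_smul_of_hasTableau` it is determined up to a global phase. -/
noncomputable def cliffordOf {n : ℕ} (τ : Tableau n) : Matrix.unitaryGroup (Bits n) ℂ :=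
  if h : ∃ U, IsClifford U ∧ HasTableau U τ then h.choose else 1

/-- The string `0ⁿ⁻ᵏ x`. -/
def pad (n : ℕ) {k : ℕ} (x : Bits k) : Bits n := fun j =>
  if h : n - k ≤ j.1 then x ⟨j.1 - (n - k), by have := j.2; omega⟩ else 0

/-- The state `E C |0ⁿ⁻ᵏ, x⟩`, where `C` has tableau `τ` and `E` is the Pauli operator of `e`. -/
noncomputable def noisyCodeword {n k : ℕ} (τ : Tableau n) (e : PVec n) (x : Bits k) :
    Bits n → ℂ :=
  (pauli e).mulVec ((cliffordOf τ).1.mulVec (Pi.single (pad n x) 1))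

/-- The product state of `m` states of `n` qubits each. -/
noncomputable def productState {m n : ℕ} (ψ : Fin m → Bits n → ℂ) : (Fin m → Bits n) → ℂ :=
  fun s => ∏ i, ψ i (s i)

/-! ## Learning Stabilizers with Noise -/

/-- The input-output behaviour of a procedure that is given `m` Clifford operators and `m`
registers of `n` qubits and that outputs `ℓ` bits: the probability of every output, for every
pure state of the registers. -/
abbrev QuantumSolver (n m ℓ : ℕ) :=
  (Fin m → Tableau n) → ((Fin m → Bits n) → ℂ) → Bits ℓ → ℝ

/-- The probability that `S` outputs `out` on `m` structured samples with secret `x`. -/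
noncomputable def quantumStructured {n k m ℓ : ℕ} (p : ℝ) (S : QuantumSolver n m ℓ) (x : Bits k)
    (out : Bits ℓ) : ℝ :=
  𝔼 τ ∈ Fintype.piFinset (fun _ : Fin m => cliffords n), ∑ e : Fin m → PVec n,
    (∏ i, depol p (e i)) * S τ (productState fun i => noisyCodeword (τ i) (e i) x) out

/-- The probability that `S` outputs `out` on `m` unstructured samples, the registers being
maximally mixed (a uniformly random computational basis state). -/
noncomputable def quantumUnstructured {n m ℓ : ℕ} (S : QuantumSolver n m ℓ) (out : Bits ℓ) : ℝ :=
  𝔼 τ ∈ Fintype.piFinset (fun _ : Fin m => cliffords n), 𝔼 s : Fin m → Bits n,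
    S τ (Pi.single s 1) out

/-- The success probability of `S` for Search `LSNᵐ(k, n, p)`. -/
noncomputable def quantumSearchSuccess {n k m : ℕ} (p : ℝ) (S : QuantumSolver n m k) : ℝ :=
  𝔼 x : Bits k, quantumStructured p S x x

/-- The success probability of `S` for Decision `LSNᵐ(k, n, p)`, the type of the instance being
chosen uniformly at random; the output bit `1` means "structured". -/
noncomputable def quantumDecisionSuccess {n m : ℕ} (k : ℕ) (p : ℝ) (S : QuantumSolver n m 1) :
    ℝ :=
  (𝔼 x : Bits k, quantumStructured p S x 1) / 2 + quantumUnstructured S 0 / 2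

/-! ## The classical representation -/

open Classical in
/-- The matrices `[A | B]` of full rank, `A` of size `2n × n` and `B` of size `2n × k`, such that
the columns of `A`, and likewise those of `B`, are pairwise symplectically orthogonal. -/
noncomputable def encoders (n k : ℕ) :
    Finset (Matrix (Fin n ⊕ Fin n) (Fin n ⊕ Fin k) (ZMod 2)) :=
  Finset.univ.filter fun G =>
    (∀ j j', sympInner (G.toCols₁.col j) (G.toCols₁.col j') = 0) ∧
    (∀ j j', sympInner (G.toCols₂.col j) (G.toCols₂.col j') = 0) ∧
    G.rank = n + k

/-- A pair `([A | B], t)`. -/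
abbrev ClassicalSample (n k : ℕ) :=
  Matrix (Fin n ⊕ Fin n) (Fin n ⊕ Fin k) (ZMod 2) × PVec n

/-- The input-output behaviour of a procedure that is given `m` classical samples and outputs
`ℓ` bits: the probability of every output. -/
abbrev ClassicalSolver (n k m ℓ : ℕ) := (Fin m → ClassicalSample n k) → Bits ℓ → ℝ

/-- The probability that `S` outputs `out` on `m` structured samples
`([A | B], [A | B] (r, y) + e)` with secret `y`. -/
noncomputable def classicalStructured {n k m ℓ : ℕ} (p : ℝ) (S : ClassicalSolver n k m ℓ)
    (y : Bits k) (out : Bits ℓ) : ℝ :=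
  𝔼 G ∈ Fintype.piFinset (fun _ : Fin m => encoders n k), 𝔼 r : Fin m → Bits n,
    ∑ e : Fin m → PVec n, (∏ i, depol p (e i)) *
      S (fun i => (G i, (G i).mulVec (Sum.elim (r i) y) + e i)) out

/-- The probability that `S` outputs `out` on `m` unstructured samples `([A | B], u)`. -/
noncomputable def classicalUnstructured {n k m ℓ : ℕ} (S : ClassicalSolver n k m ℓ)
    (out : Bits ℓ) : ℝ :=
  𝔼 G ∈ Fintype.piFinset (fun _ : Fin m => encoders n k), 𝔼 u : Fin m → PVec n,
    S (fun i => (G i, u i)) out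

/-- The success probability of `S` for the classical representation of Search `LSNᵐ(k, n, p)`. -/
noncomputable def classicalSearchSuccess {n k m : ℕ} (p : ℝ) (S : ClassicalSolver n k m k) : ℝ :=
  𝔼 y : Bits k, classicalStructured p S y y

/-- The success probability of `S` for the classical representation of Decision
`LSNᵐ(k, n, p)`, the type of the instance being chosen uniformly at random; the output bit `1`
means "structured". -/
noncomputable def classicalDecisionSuccess {n k m : ℕ} (p : ℝ) (S : ClassicalSolver n k m 1) :
    ℝ :=
  (𝔼 y : Bits k, classicalStructured p S y 1) / 2 + classicalUnstructured S 0 / 2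

/-! ## Oracles -/

/-- An oracle for the classical problem: an arbitrary randomized map. -/
abbrev ClassicalOracle (n k m ℓ : ℕ) := (Fin m → ClassicalSample n k) → PMF (Bits ℓ)

/-- The input-output behaviour of a classical oracle. -/
noncomputable def ClassicalOracle.solver {n k m ℓ : ℕ} (O : ClassicalOracle n k m ℓ) :
    ClassicalSolver n k m ℓ := fun inst out => (O inst out).toReal

/-- An oracle for the quantum problem: for every tuple of Clifford descriptions, an arbitrary
quantum measurement (POVM) of the `m` registers of `n` qubits. -/
structure QuantumOracle (n m ℓ : ℕ) where
  effect : (Fin m → Tableau n) → Bits ℓ → Matrix (Fin m → Bits n) (Fin m → Bits n) ℂ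
  posSemidef : ∀ τ out, (effect τ out).PosSemidef
  sum_eq_one : ∀ τ, ∑ out, effect τ out = 1

/-- The input-output behaviour of a quantum oracle (the Born rule). -/
noncomputable def QuantumOracle.solver {n m ℓ : ℕ} (O : QuantumOracle n m ℓ) :
    QuantumSolver n m ℓ := fun τ φ out => (star φ ⬝ᵥ (O.effect τ out).mulVec φ).re

/-! ## Quantum algorithms: a random access machine with quantum memory

The classical memory consists of three-dimensional arrays of natural numbers, the quantum memory
of qubits with addresses in `ℕ × ℕ`. Every executed command costs one time unit. There is no
multiplication, so all numbers that occur in `T` steps have `O(T)` bits more than the numbers in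
the input, and unit cost agrees with bit cost up to a polynomial. -/

/-- Classical memory: the entry with indices `i j l` of array number `a` is `mem a i j l`. -/
abbrev Mem := ℕ → ℕ → ℕ → ℕ → ℕ

/-- (Unnormalized) pure states of the quantum memory. A basis state is given by the finite set of
the qubits that are in state `1`. -/
abbrev QMem := Finset (ℕ × ℕ) →₀ ℂ

/-- Arithmetic expressions over the classical memory. -/
inductive Expr where
  | lit (c : ℕ)
  | get (a : ℕ) (i j l : Expr)
  | add (e f : Expr)
  | sub (e f : Expr)
  | div (e f : Expr)
  | mod (e f : Expr)
  | eq (e f : Expr)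
  | lt (e f : Expr)

/-- The value of an expression. Subtraction is truncated; a comparison has value `1` or `0`. -/
def Expr.eval (μ : Mem) : Expr → ℕ
  | .lit c => c
  | .get a i j l => μ a (i.eval μ) (j.eval μ) (l.eval μ)
  | .add e f => e.eval μ + f.eval μ
  | .sub e f => e.eval μ - f.eval μ
  | .div e f => e.eval μ / f.eval μ
  | .mod e f => e.eval μ % f.eval μ
  | .eq e f => if e.eval μ = f.eval μ then 1 else 0
  | .lt e f => if e.eval μ < f.eval μ then 1 else 0

/-- Programs. `set a i j l e` and `rand a i j l e` store in cell `i j l` of array `a` the value of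
`e`, respectively a uniformly random element of `{0, …, value of e}`. The gates act on the qubits
with the given addresses, and `measure a i j l q r` stores in a cell the result of measuring the
qubit `(q, r)` in the computational basis. `loop e c` executes `c` exactly `N` times, where `N`
is the value of `e` on entry. -/
inductive Cmd where
  | skip
  | set (a : ℕ) (i j l : Expr) (e : Expr)
  | rand (a : ℕ) (i j l : Expr) (e : Expr)
  | gateH (q r : Expr)
  | gateS (q r : Expr)
  | gateT (q r : Expr)
  | gateCX (q r q' r' : Expr)
  | measure (a : ℕ) (i j l : Expr) (q r : Expr)
  | seq (c d : Cmd)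
  | ite (e : Expr) (c d : Cmd)
  | loop (e : Expr) (c : Cmd)

/-- A configuration of the machine: memory contents and elapsed time. -/
structure Config where
  mem : Mem
  qmem : QMem
  time : ℕ

/-- The classical memory after `v` has been stored in cell `i j l` of array `a`. -/
def store (μ : Mem) (a i j l v : ℕ) : Mem := fun a' i' j' l' =>
  if a' = a ∧ i' = i ∧ j' = j ∧ l' = l then v else μ a' i' j' l'

/-- Hadamard gate on qubit `q`. -/
noncomputable def applyH (q : ℕ × ℕ) : QMem →ₗ[ℂ] QMem :=
  Finsupp.linearCombination ℂ fun b : Finset (ℕ × ℕ) =>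
    (1 / (√2 : ℂ)) • (Finsupp.single (b.erase q) (1 : ℂ)
      + (if q ∈ b then (-1 : ℂ) else 1) • Finsupp.single (insert q b) (1 : ℂ))

/-- The gate `|0⟩⟨0| + ω |1⟩⟨1|` on qubit `q`. -/
noncomputable def applyPhase (ω : ℂ) (q : ℕ × ℕ) : QMem →ₗ[ℂ] QMem :=
  Finsupp.linearCombination ℂ fun b : Finset (ℕ × ℕ) =>
    Finsupp.single b (if q ∈ b then ω else 1)

/-- Controlled-`X` gate with control `q` and target `q'` (the identity if `q = q'`). -/
noncomputable def applyCX (q q' : ℕ × ℕ) : QMem →ₗ[ℂ] QMem :=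
  Finsupp.linearCombination ℂ fun b : Finset (ℕ × ℕ) =>
    Finsupp.single (if q ∈ b ∧ q ≠ q' then symmDiff b {q'} else b) (1 : ℂ)

/-- The squared norm. -/
noncomputable def normSq (ψ : QMem) : ℝ := ψ.sum fun _ z => ‖z‖ ^ 2

/-- The list of all branches of an execution. The state in every branch is scaled such that its
squared norm is multiplied by the probability of the branch. -/
noncomputable def run : Cmd → Config → List Config
  | .skip, s => [⟨s.mem, s.qmem, s.time + 1⟩]
  | .set a i j l e, s =>
      [⟨store s.mem a (i.eval s.mem) (j.eval s.mem) (l.eval s.mem) (e.eval s.mem),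
        s.qmem, s.time + 1⟩]
  | .rand a i j l e, s =>
      (List.range (e.eval s.mem + 1)).map fun v =>
        ⟨store s.mem a (i.eval s.mem) (j.eval s.mem) (l.eval s.mem) v,
          (1 / (√((e.eval s.mem : ℝ) + 1) : ℂ)) • s.qmem, s.time + 1⟩
  | .gateH q r, s => [⟨s.mem, applyH (q.eval s.mem, r.eval s.mem) s.qmem, s.time + 1⟩]
  | .gateS q r, s =>
      [⟨s.mem, applyPhase Complex.I (q.eval s.mem, r.eval s.mem) s.qmem, s.time + 1⟩]
  | .gateT q r, s =>
      [⟨s.mem, applyPhase (Complex.exp (Complex.I * Real.pi / 4))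
        (q.eval s.mem, r.eval s.mem) s.qmem, s.time + 1⟩]
  | .gateCX q r q' r', s =>
      [⟨s.mem, applyCX (q.eval s.mem, r.eval s.mem) (q'.eval s.mem, r'.eval s.mem) s.qmem,
        s.time + 1⟩]
  | .measure a i j l q r, s =>
      [⟨store s.mem a (i.eval s.mem) (j.eval s.mem) (l.eval s.mem) 0,
          s.qmem.filter fun b => (q.eval s.mem, r.eval s.mem) ∉ b, s.time + 1⟩,
        ⟨store s.mem a (i.eval s.mem) (j.eval s.mem) (l.eval s.mem) 1,
          s.qmem.filter fun b => (q.eval s.mem, r.eval s.mem) ∈ b, s.time + 1⟩]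
  | .seq c d, s => (run c s).flatMap (run d)
  | .ite e c d, s =>
      if e.eval s.mem ≠ 0 then run c ⟨s.mem, s.qmem, s.time + 1⟩
      else run d ⟨s.mem, s.qmem, s.time + 1⟩
  | .loop e c, s =>
      (fun L : List Config => L.flatMap (run c))^[e.eval s.mem] [⟨s.mem, s.qmem, s.time + 1⟩]

/-! ## Memory layout

Array `0` holds the parameters `n, k, m`. The input is in arrays `1` and `2`, the query to the
oracle is read from arrays `3` and `4`, the answer of the oracle is written to array `5`, and the
output of the algorithm is read from array `6`. Row and column indices in a block matrix are
counted through, the first block coming first. The qubit `j` of sample `i` has address `(i, j)`.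
All other cells are initially `0`, and all other qubits are initially in state `|0⟩`. -/

/-- The content of an array that holds the entries of `M`. -/
def tensorEntry {m r c : ℕ} (M : Fin m → Fin r → Fin c → ZMod 2) (i j l : ℕ) : ℕ :=
  if h : i < m ∧ j < r ∧ l < c then (M ⟨i, h.1⟩ ⟨j, h.2.1⟩ ⟨l, h.2.2⟩).val else 0

/-- The initial classical memory with parameters `n, k, m` and input arrays `M` and `N`. -/
def initMem (n k m : ℕ) (M N : ℕ → ℕ → ℕ → ℕ) : Mem := fun a i j l =>
  if a = 0 then
    if j = 0 ∧ l = 0 then if i = 0 then n else if i = 1 then k else if i = 2 then m else 0 else 0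
  else if a = 1 then M i j l
  else if a = 2 then N i j l
  else 0

/-- Encoding of `m` Clifford descriptions: bit `l` of the image of generator `j` in sample `i` is
in cell `i j l` of array `1`, the sign bit of this image is in cell `i j 0` of array `2`. -/
def quantumInput {n m : ℕ} (k : ℕ) (τ : Fin m → Tableau n) : Mem :=
  initMem n k m
    (tensorEntry fun i (j l : Fin (n + n)) =>
      (τ i (finSumFinEquiv.symm j)).2 (finSumFinEquiv.symm l))
    (tensorEntry fun i (j : Fin (n + n)) (_ : Fin 1) => (τ i (finSumFinEquiv.symm j)).1)

/-- The query to a quantum oracle: its classical part, in the same format as `quantumInput`. -/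
def quantumQuery (n m : ℕ) (μ : Mem) : Fin m → Tableau n := fun i g =>
  ((μ 4 i (finSumFinEquiv g).1 0 : ZMod 2),
    fun h => (μ 3 i (finSumFinEquiv g).1 (finSumFinEquiv h).1 : ZMod 2))

/-- Encoding of `m` classical samples: the entry `(j, l)` of `[A | B]` in sample `i` is in cell
`i j l` of array `1`, the entry `j` of `t` in sample `i` is in cell `i j 0` of array `2`. -/
def classicalInput {n k m : ℕ} (inst : Fin m → ClassicalSample n k) : Mem :=
  initMem n k m
    (tensorEntry fun i (j : Fin (n + n)) (l : Fin (n + k)) =>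
      (inst i).1 (finSumFinEquiv.symm j) (finSumFinEquiv.symm l))
    (tensorEntry fun i (j : Fin (n + n)) (_ : Fin 1) => (inst i).2 (finSumFinEquiv.symm j))

/-- The query to a classical oracle, in the same format as `classicalInput`. -/
def classicalQuery (n k m : ℕ) (μ : Mem) : Fin m → ClassicalSample n k := fun i =>
  (Matrix.of fun g h => (μ 3 i (finSumFinEquiv g).1 (finSumFinEquiv h).1 : ZMod 2),
    fun g => (μ 4 i (finSumFinEquiv g).1 0 : ZMod 2))

/-- The memory after the oracle has written its answer to cells `i 0 0` of array `5`. -/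
def writeAnswer {ℓ : ℕ} (μ : Mem) (ans : Bits ℓ) : Mem := fun a i j l =>
  if a = 5 then if h : i < ℓ ∧ j = 0 ∧ l = 0 then (ans ⟨i, h.1⟩).val else 0 else μ a i j l

/-- The output of an algorithm: the cells `i 0 0` of array `6`. -/
def output (ℓ : ℕ) (μ : Mem) : Bits ℓ := fun i => (μ 6 i 0 0 : ZMod 2)

/-- The set of qubits in state `1` when the `m` registers are in the basis state `s` and all other
qubits are in state `0`. -/
def ones {n m : ℕ} (s : Fin m → Bits n) : Finset (ℕ × ℕ) :=
  (Finset.univ.filter fun ij : Fin m × Fin n => s ij.1 ij.2 = 1).image fun ij =>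
    (ij.1.1, ij.2.1)

/-- The quantum memory when the `m` registers are in state `φ` and all other qubits are in state
`0`. -/
noncomputable def loadState {n m : ℕ} (φ : (Fin m → Bits n) → ℂ) : QMem :=
  ∑ s, φ s • Finsupp.single (ones s) (1 : ℂ)

/-- The probability (times the squared norm) that a quantum oracle which is given the `m` registers
answers `ans`, when the quantum memory is in state `ψ`: the squared norm for the effect `M ⊗ I`,
summed over the basis states `b` of the qubits outside the registers. -/
noncomputable def answerWeight {n m ℓ : ℕ} (O : QuantumOracle n m ℓ) (τ : Fin m → Tableau n)
    (ans : Bits ℓ) (ψ : QMem) : ℝ :=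
  ∑ b ∈ ψ.support.image fun b => b \ (Finset.range m ×ˢ Finset.range n),
    O.solver τ (fun s => ψ (ones s ∪ b)) ans

/-! ## Reductions with a single oracle call -/

/-- An algorithm with exactly one oracle call: the part before and the part after the call. -/
structure OneCallAlgorithm where
  pre : Cmd
  post : Cmd

/-- The start of an algorithm on an instance of the quantum problem. -/
noncomputable def startQuantum {n m : ℕ} (k : ℕ) (τ : Fin m → Tableau n)
    (φ : (Fin m → Bits n) → ℂ) : Config := ⟨quantumInput k τ, loadState φ, 0⟩

/-- The start of an algorithm on an instance of the classical problem. -/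
noncomputable def startClassical {n k m : ℕ} (inst : Fin m → ClassicalSample n k) : Config :=
  ⟨classicalInput inst, Finsupp.single ∅ 1, 0⟩

/-- The configuration after a classical oracle has answered. The call costs one time unit. -/
def Config.afterClassical {ℓ : ℕ} (s : Config) (ans : Bits ℓ) : Config :=
  ⟨writeAnswer s.mem ans, s.qmem, s.time + 1⟩

/-- The configuration after a quantum oracle has answered. The call costs one time unit, and the
algorithm continues with fresh qubits. -/
noncomputable def Config.afterQuantum {ℓ : ℕ} (s : Config) (ans : Bits ℓ) : Config :=
  ⟨writeAnswer s.mem ans, Finsupp.single ∅ 1, s.time + 1⟩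

/-- The probability (times the squared norm) that `c`, started at `s`, ends with output `out`. -/
noncomputable def outputWeight {ℓ : ℕ} (c : Cmd) (s : Config) (out : Bits ℓ) : ℝ :=
  ((run c s).map fun t => if output ℓ t.mem = out then normSq t.qmem else 0).sum

/-- The behaviour of an algorithm for the quantum problem that calls an oracle for the classical
problem. -/
noncomputable def OneCallAlgorithm.withClassical (R : OneCallAlgorithm) {n k m ℓ : ℕ}
    (O : ClassicalOracle n k m ℓ) : QuantumSolver n m ℓ := fun τ φ out =>
  ((run R.pre (startQuantum k τ φ)).map fun s =>
    ∑ ans : Bits ℓ, O.solver (classicalQuery n k m s.mem) ans *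
      outputWeight R.post (s.afterClassical ans) out).sum

/-- The behaviour of an algorithm for the classical problem that calls an oracle for the quantum
problem. -/
noncomputable def OneCallAlgorithm.withQuantum (R : OneCallAlgorithm) {n m ℓ : ℕ} (k : ℕ)
    (O : QuantumOracle n m ℓ) : ClassicalSolver n k m ℓ := fun inst out =>
  ((run R.pre (startClassical inst)).map fun s =>
    ∑ ans : Bits ℓ, answerWeight O (quantumQuery n m s.mem) ans s.qmem *
      outputWeight R.post (s.afterQuantum ans) out).sum

/-- On all instances of the quantum problem with parameters `n, k, m`, all initial states and all
answers of the oracle (of length `ℓ`), the algorithm halts within `T` steps. -/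
def OneCallAlgorithm.QuantumTimeLe (R : OneCallAlgorithm) (n k m ℓ T : ℕ) : Prop :=
  ∀ (τ : Fin m → Tableau n) (φ : (Fin m → Bits n) → ℂ), ∀ s ∈ run R.pre (startQuantum k τ φ),
    ∀ ans : Bits ℓ, ∀ t ∈ run R.post (s.afterClassical ans), t.time ≤ T

/-- On all instances of the classical problem with parameters `n, k, m` and all answers of the
oracle (of length `ℓ`), the algorithm halts within `T` steps. -/
def OneCallAlgorithm.ClassicalTimeLe (R : OneCallAlgorithm) (n k m ℓ T : ℕ) : Prop :=
  ∀ inst : Fin m → ClassicalSample n k, ∀ s ∈ run R.pre (startClassical inst),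
    ∀ ans : Bits ℓ, ∀ t ∈ run R.post (s.afterQuantum ans), t.time ≤ T

end LSN

namespace LSN

/-! ## Running time -/

/-! A Clifford operator modulo phase is a symplectic matrix S = [S_X | S_Z] together with completely
arbitrary signs (`mem_cliffords`). The states C|z⟩ are, up to phase, the joint eigenvectors of the
images of the Z_j, one for each pattern of eigenvalues (`eq_smul_codeState`). A Pauli error e flips
these eigenvalues according to its symplectic pairings with the columns of S_Z, so a noisy codeword
is, up to phase, C|z⟩ with z = (0, x) + S_Zᵀ J e (`noisyCodeword_eq`). Measuring the commuting
images of the Z_j reveals z without disturbing this state: a structured quantum sample carries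
exactly the information (C, z), and a maximally mixed register amounts to a uniform z.

From quantum to classical, measure z, draw a uniform r and a uniform invertible P, and output A =
S_Z P, B = S_X [0; I], t = S_X z + S_Z r. Since S_X S_Zᵀ J e + S_Z S_Xᵀ J e = e
(`symplectic_completeness`), t equals A r' + B x + e, where r' is the image of r under an affine
bijection and hence uniform (`expect_sample`). The pair [A | B] is uniform because symplectic
matrices acting on the left and invertible matrices acting on A from the right are together
transitive on encoders (`expect_encoderOf`). To draw P exactly uniformly, GLₙ is peeled column by
column: there are 2ⁿ - 2ʲ choices in step j, and these are the binary expansions of the numbers from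
2ʲ to 2ⁿ - 1 (`expect_colProduct_digits`).

From classical to quantum, column operations turn A into A' with A'ᵀ J B = [0; I]. A matrix X dual
to A' whose last columns are B is corrected to X + A' V, so that [X + A' V | A'] is symplectic
(`completion_spec`). The completions with given A' and B form a torsor under the symmetric matrices
supported on the first n - k coordinates (`exists_shear`), and a random element of it makes the
symplectic matrix uniform (`expect_completion`). Because A' is orthogonal to A, the vector z = A'ᵀ J
t equals (0, y) + A'ᵀ J e, which is the label of the required noisy codeword. The state C|z⟩ itself
comes from a random basis state on which the stabilizers are measured. The outcomes w are uniform,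
and rather than correcting the state one gives the Z generators the signs w + z, which are uniform
as they should be (`expect_signs`).

Both arguments work for each fixed error pattern, so the programs need not know p. They yield
equality of output distributions for every secret and every output, from which all four equalities
of success probabilities follow.

The programs are verified backwards: `wp` sums a functional over all branches, and `exec_for`,
`wp_for` and `wp_fill` are the loop rules that turn programs into the averages above. Running times
come from the fact that all loops are bounded by expressions in the parameters, which are never
overwritten (`Cmd.time_le`). -/

/-- Expressions built from literals and program parameters by addition and subtraction. -/
def Expr.isParam : Expr → Bool
  | .lit _ => true
  | .get a _ _ _ => a == 0
  | .add e f => e.isParam && f.isParam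
  | .sub e _ => e.isParam
  | _ => false

/-- An upper bound of a parameter expression, as a polynomial in a bound of the parameters. -/
noncomputable def Expr.bound : Expr → Polynomial ℕ
  | .lit c => .C c
  | .get _ _ _ _ => .X
  | .add e f => e.bound + f.bound
  | .sub e _ => e.bound
  | _ => 0

/-- Truncated subtraction never exceeds its first argument, which is why the subtrahend may be an
arbitrary expression. -/
theorem Expr.eval_le_bound {μ : Mem} {N : ℕ} (hμ : ∀ i j l, μ 0 i j l ≤ N) :
    ∀ {e : Expr}, e.isParam → e.eval μ ≤ e.bound.eval N
  | .lit c, _ => by simp [Expr.eval, Expr.bound]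
  | .get a i j l, h => by
    have : a = 0 := by simpa [Expr.isParam] using h
    subst this
    simpa [Expr.eval, Expr.bound] using hμ _ _ _
  | .add e f, h => by
    have h' : e.isParam ∧ f.isParam := by simpa [Expr.isParam] using h
    simpa [Expr.eval, Expr.bound] using
      add_le_add (eval_le_bound hμ h'.1) (eval_le_bound hμ h'.2)
  | .sub e f, h => by
    have h' : e.isParam := by simpa [Expr.isParam] using h
    exact (Nat.sub_le _ _).trans (eval_le_bound hμ h')

/-- The parameters are never overwritten, and all loops are bounded by parameter expressions. -/
def Cmd.hasParamLoops : Cmd → Bool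
  | .set a _ _ _ _ => a != 0
  | .rand a _ _ _ _ => a != 0
  | .measure a _ _ _ _ _ => a != 0
  | .seq c d => c.hasParamLoops && d.hasParamLoops
  | .ite _ c d => c.hasParamLoops && d.hasParamLoops
  | .loop e c => e.isParam && c.hasParamLoops
  | _ => true

/-- An upper bound of the running time, as a polynomial in a bound of the parameters. -/
noncomputable def Cmd.timeBound : Cmd → Polynomial ℕ
  | .seq c d => c.timeBound + d.timeBound
  | .ite _ c d => 1 + c.timeBound + d.timeBound
  | .loop e c => 1 + e.bound * c.timeBound
  | _ => 1

theorem store_of_ne {μ : Mem} {a b i j l v : ℕ} (h : b ≠ a) : store μ a i j l v b = μ b := by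
  funext i' j' l'
  simp [store, h]

/-- The induction has to carry the invariance of array `0` along with the time: a loop bound is
evaluated in a memory that earlier commands have changed, and it is still controlled by `N` only
because the parameters survive. -/
theorem Cmd.time_le {N : ℕ} : ∀ {c : Cmd}, c.hasParamLoops → ∀ {s : Config},
    (∀ i j l, s.mem 0 i j l ≤ N) → ∀ t ∈ run c s,
      t.time ≤ s.time + c.timeBound.eval N ∧ t.mem 0 = s.mem 0
  | .skip, _, s, _, t, ht => by simp [run] at ht; simp [ht, timeBound]
  | .set a i j l e, h, s, _, t, ht => by
    have ha : (0 : ℕ) ≠ a := Ne.symm (by simpa [hasParamLoops] using h)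
    simp only [run, List.mem_singleton] at ht
    subst ht
    exact ⟨by simp [timeBound], store_of_ne ha⟩
  | .rand a i j l e, h, s, _, t, ht => by
    have ha : (0 : ℕ) ≠ a := Ne.symm (by simpa [hasParamLoops] using h)
    simp only [run, List.mem_map] at ht
    obtain ⟨v, _, rfl⟩ := ht
    exact ⟨by simp [timeBound], store_of_ne ha⟩
  | .gateH q r, _, s, _, t, ht => by simp [run] at ht; simp [ht, timeBound]
  | .gateS q r, _, s, _, t, ht => by simp [run] at ht; simp [ht, timeBound]
  | .gateT q r, _, s, _, t, ht => by simp [run] at ht; simp [ht, timeBound]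
  | .gateCX q r q' r', _, s, _, t, ht => by simp [run] at ht; simp [ht, timeBound]
  | .measure a i j l q r, h, s, _, t, ht => by
    have ha : (0 : ℕ) ≠ a := Ne.symm (by simpa [hasParamLoops] using h)
    simp only [run, List.mem_cons, List.not_mem_nil, or_false] at ht
    rcases ht with rfl | rfl <;> exact ⟨by simp [timeBound], store_of_ne ha⟩
  | .seq c d, h, s, hs, t, ht => by
    have h' : c.hasParamLoops ∧ d.hasParamLoops := by simpa [hasParamLoops] using h
    simp only [run, List.mem_flatMap] at ht
    obtain ⟨u, hu, htu⟩ := ht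
    obtain ⟨h1, h2⟩ := time_le h'.1 hs u hu
    obtain ⟨h3, h4⟩ := time_le h'.2 (s := u) (by rw [h2]; exact hs) t htu
    refine ⟨?_, h4.trans h2⟩
    simp only [timeBound, Polynomial.eval_add]
    omega
  | .ite e c d, h, s, hs, t, ht => by
    have h' : c.hasParamLoops ∧ d.hasParamLoops := by simpa [hasParamLoops] using h
    simp only [run] at ht
    split_ifs at ht with he
    · obtain ⟨h1, h2⟩ := time_le h'.1 (s := ⟨s.mem, s.qmem, s.time + 1⟩) hs t ht
      refine ⟨?_, h2⟩
      simp only [timeBound, Polynomial.eval_add, Polynomial.eval_one] at h1 ⊢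
      omega
    · obtain ⟨h1, h2⟩ := time_le h'.2 (s := ⟨s.mem, s.qmem, s.time + 1⟩) hs t ht
      refine ⟨?_, h2⟩
      simp only [timeBound, Polynomial.eval_add, Polynomial.eval_one] at h1 ⊢
      omega
  | .loop e c, h, s, hs, t, ht => by
    have h' : e.isParam ∧ c.hasParamLoops := by simpa [hasParamLoops] using h
    have key : ∀ R : ℕ, ∀ t ∈ (fun L : List Config => L.flatMap (run c))^[R]
        [⟨s.mem, s.qmem, s.time + 1⟩],
        t.time ≤ s.time + 1 + R * c.timeBound.eval N ∧ t.mem 0 = s.mem 0 := by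
      intro R
      induction R with
      | zero => intro t ht; simp at ht; simp [ht]
      | succ R ih =>
        intro t ht
        rw [Function.iterate_succ_apply', List.mem_flatMap] at ht
        obtain ⟨u, hu, htu⟩ := ht
        obtain ⟨h1, h2⟩ := ih u hu
        obtain ⟨h3, h4⟩ := time_le h'.2 (s := u) (by rw [h2]; exact hs) t htu
        refine ⟨?_, h4.trans h2⟩
        rw [add_mul, one_mul]
        omega
    obtain ⟨h1, h2⟩ := key _ t ht
    refine ⟨h1.trans ?_, h2⟩
    simp only [timeBound, Polynomial.eval_add, Polynomial.eval_one, Polynomial.eval_mul]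
    have := Nat.mul_le_mul_right (c.timeBound.eval N) (Expr.eval_le_bound hs h'.1)
    omega

/-- This is where `k ≤ n` enters the running time: it makes a polynomial in `n + m` alone
sufficient. -/
theorem initMem_zero_le {n k m : ℕ} (hk : k ≤ n) (M N : ℕ → ℕ → ℕ → ℕ) (i j l : ℕ) :
    initMem n k m M N 0 i j l ≤ n + m := by
  simp only [initMem]
  split_ifs <;> omega

/-- The polynomial that bounds the running time of a reduction. -/
noncomputable def OneCallAlgorithm.timeBound (R : OneCallAlgorithm) : Polynomial ℕ :=
  R.pre.timeBound + 1 + R.post.timeBound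

theorem OneCallAlgorithm.quantumTimeLe {R : OneCallAlgorithm} (h₁ : R.pre.hasParamLoops)
    (h₂ : R.post.hasParamLoops) {n k m : ℕ} (hk : k ≤ n) (ℓ : ℕ) :
    R.QuantumTimeLe n k m ℓ (R.timeBound.eval (n + m)) := by
  intro τ φ s hs ans t ht
  have h0 : ∀ i j l, (startQuantum k τ φ).mem 0 i j l ≤ n + m := by
    intro i j l
    simp only [startQuantum, quantumInput]
    exact initMem_zero_le hk _ _ i j l
  obtain ⟨h3, h4⟩ := Cmd.time_le h₁ h0 s hs
  have h5 : ∀ i j l, (s.afterClassical ans).mem 0 i j l ≤ n + m := by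
    intro i j l
    simpa [Config.afterClassical, writeAnswer, h4] using h0 i j l
  obtain ⟨h6, -⟩ := Cmd.time_le h₂ h5 t ht
  simp only [startQuantum, Config.afterClassical] at h3 h6
  simp only [timeBound, Polynomial.eval_add, Polynomial.eval_one]
  omega

theorem OneCallAlgorithm.classicalTimeLe {R : OneCallAlgorithm} (h₁ : R.pre.hasParamLoops)
    (h₂ : R.post.hasParamLoops) {n k m : ℕ} (hk : k ≤ n) (ℓ : ℕ) :
    R.ClassicalTimeLe n k m ℓ (R.timeBound.eval (n + m)) := by
  intro inst s hs ans t ht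
  have h0 : ∀ i j l, (startClassical inst).mem 0 i j l ≤ n + m := by
    intro i j l
    simp only [startClassical, classicalInput]
    exact initMem_zero_le hk _ _ i j l
  obtain ⟨h3, h4⟩ := Cmd.time_le h₁ h0 s hs
  have h5 : ∀ i j l, (s.afterQuantum ans).mem 0 i j l ≤ n + m := by
    intro i j l
    simpa [Config.afterQuantum, writeAnswer, h4] using h0 i j l
  obtain ⟨h6, -⟩ := Cmd.time_le h₂ h5 t ht
  simp only [startClassical, Config.afterQuantum] at h3 h6
  simp only [timeBound, Polynomial.eval_add, Polynomial.eval_one]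
  omega

/-! ## Weakest preexpectations -/

/-- The sum of `F` over all branches of an execution of a command. -/
noncomputable def wp : Cmd → (Mem → QMem → ℝ) → Mem → QMem → ℝ
  | .skip, F => F
  | .set a i j l e, F => fun μ ψ =>
      F (store μ a (i.eval μ) (j.eval μ) (l.eval μ) (e.eval μ)) ψ
  | .rand a i j l e, F => fun μ ψ => ∑ v ∈ Finset.range (e.eval μ + 1),
      F (store μ a (i.eval μ) (j.eval μ) (l.eval μ) v)
        ((1 / (√((e.eval μ : ℝ) + 1) : ℂ)) • ψ)
  | .gateH q r, F => fun μ ψ => F μ (applyH (q.eval μ, r.eval μ) ψ)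
  | .gateS q r, F => fun μ ψ => F μ (applyPhase Complex.I (q.eval μ, r.eval μ) ψ)
  | .gateT q r, F => fun μ ψ =>
      F μ (applyPhase (Complex.exp (Complex.I * Real.pi / 4)) (q.eval μ, r.eval μ) ψ)
  | .gateCX q r q' r', F => fun μ ψ =>
      F μ (applyCX (q.eval μ, r.eval μ) (q'.eval μ, r'.eval μ) ψ)
  | .measure a i j l q r, F => fun μ ψ =>
      F (store μ a (i.eval μ) (j.eval μ) (l.eval μ) 0)
          (ψ.filter fun b => (q.eval μ, r.eval μ) ∉ b) +
        F (store μ a (i.eval μ) (j.eval μ) (l.eval μ) 1)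
          (ψ.filter fun b => (q.eval μ, r.eval μ) ∈ b)
  | .seq c d, F => wp c (wp d F)
  | .ite e c d, F => fun μ ψ => if e.eval μ ≠ 0 then wp c F μ ψ else wp d F μ ψ
  | .loop e c, F => fun μ ψ => (wp c)^[e.eval μ] F μ ψ

theorem sum_map_flatMap {α β : Type*} (g : α → List β) (f : β → ℝ) (L : List α) :
    ((L.flatMap g).map f).sum = (L.map fun a => ((g a).map f).sum).sum := by
  induction L with
  | nil => simp
  | cons a L ih => simp [ih]

/-- Passage from the forward list of branches to the backward calculus. The elapsed time disappears
because the functionals of interest do not look at it; it is bounded separately. -/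
theorem sum_map_run (c : Cmd) : ∀ (F : Mem → QMem → ℝ) (s : Config),
    ((run c s).map fun t => F t.mem t.qmem).sum = wp c F s.mem s.qmem := by
  induction c with
  | skip | set | gateH | gateS | gateT | gateCX | measure => intro F s; simp [run, wp]
  | rand a i j l e =>
    intro F s
    simp only [run, wp, List.map_map, Function.comp_def]
    rfl
  | seq c d hc hd =>
    intro F s
    simp only [run, wp, sum_map_flatMap, hd, hc]
  | ite e c d hc hd =>
    intro F s
    simp only [run, wp]
    split_ifs <;> simp [hc, hd]
  | loop e c hc =>
    intro F s
    have key : ∀ (N : ℕ) (L : List Config) (F : Mem → QMem → ℝ),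
        (((fun L : List Config => L.flatMap (run c))^[N] L).map fun t => F t.mem t.qmem).sum
          = (L.map fun t => (wp c)^[N] F t.mem t.qmem).sum := by
      intro N
      induction N with
      | zero => intro L F; rfl
      | succ N ih =>
        intro L F
        rw [Function.iterate_succ_apply', sum_map_flatMap]
        simp only [hc]
        rw [ih, Function.iterate_succ_apply]
    simp only [run, wp, key, List.map_cons, List.map_nil, List.sum_singleton]

/-- Functions that scale like the squared norm. -/
def Homogeneous (F : Mem → QMem → ℝ) : Prop :=
  ∀ μ (z : ℂ) ψ, F μ (z • ψ) = ‖z‖ ^ 2 * F μ ψ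

/-- Gates and measurement projections act linearly on the quantum memory, so scaling passes through
every command. This is what later lets the amplitude `1 / √(N + 1)` that `rand` attaches to a branch
be read as the probability `1 / (N + 1)`. -/
theorem Homogeneous.wp {c : Cmd} : ∀ {F : Mem → QMem → ℝ}, Homogeneous F →
    Homogeneous (wp c F) := by
  induction c with
  | skip => exact id
  | set => intro F h μ z ψ; simp [LSN.wp, h _ _ _]
  | gateH | gateS | gateT | gateCX => intro F h μ z ψ; simp [LSN.wp, h _ _ _]
  | measure =>
    intro F h μ z ψ
    simp only [LSN.wp, Finsupp.filter_smul, h _ _ _, mul_add]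
  | rand a i j l e =>
    intro F h μ z ψ
    simp only [LSN.wp, smul_comm _ z, h _ z _, Finset.mul_sum]
  | seq c d hc hd => exact fun h => hc (hd h)
  | ite e c d hc hd =>
    intro F h μ z ψ
    simp only [LSN.wp]
    split_ifs
    · exact hc h _ _ _
    · exact hd h _ _ _
  | loop e c hc =>
    intro F h μ z ψ
    have : ∀ N, Homogeneous ((LSN.wp c)^[N] F) := by
      intro N
      induction N with
      | zero => exact h
      | succ N ih => rw [Function.iterate_succ_apply']; exact hc ih
    exact this _ _ _ _

theorem wp_rand {a : ℕ} {i j l e : Expr} {F : Mem → QMem → ℝ} (hF : Homogeneous F) (μ : Mem)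
    (ψ : QMem) : wp (.rand a i j l e) F μ ψ = (1 / ((e.eval μ : ℝ) + 1)) *
      ∑ v ∈ Finset.range (e.eval μ + 1),
        F (store μ a (i.eval μ) (j.eval μ) (l.eval μ) v) ψ := by
  have h : ‖(1 / (√((e.eval μ : ℝ) + 1) : ℂ))‖ ^ 2 = 1 / ((e.eval μ : ℝ) + 1) := by
    rw [norm_div, norm_one, Complex.norm_real, div_pow, one_pow, Real.norm_eq_abs, sq_abs,
      Real.sq_sqrt (by positivity)]
  simp only [wp, hF _ _ _, h, Finset.mul_sum]

/-! ## Deterministic commands -/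

/-- The effect on the classical memory of a command without randomness. -/
def exec : Cmd → Mem → Mem
  | .set a i j l e, μ => store μ a (i.eval μ) (j.eval μ) (l.eval μ) (e.eval μ)
  | .seq c d, μ => exec d (exec c μ)
  | .ite e c d, μ => if e.eval μ ≠ 0 then exec c μ else exec d μ
  | .loop e c, μ => (exec c)^[e.eval μ] μ
  | _, μ => μ

/-- Commands that use neither randomness nor the quantum memory. -/
def Cmd.isDet : Cmd → Bool
  | .skip => true
  | .set _ _ _ _ _ => true
  | .seq c d => c.isDet && d.isDet
  | .ite _ c d => c.isDet && d.isDet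
  | .loop _ c => c.isDet
  | _ => false

theorem wp_of_isDet {c : Cmd} : c.isDet → ∀ (F : Mem → QMem → ℝ) (μ : Mem) (ψ : QMem),
    wp c F μ ψ = F (exec c μ) ψ := by
  induction c with
  | skip | set => intro _ F μ ψ; rfl
  | rand | gateH | gateS | gateT | gateCX | measure => intro h; simp [Cmd.isDet] at h
  | seq c d hc hd =>
    intro h F μ ψ
    have h' : c.isDet ∧ d.isDet := by simpa [Cmd.isDet] using h
    simp only [wp, exec, hc h'.1, hd h'.2]
  | ite e c d hc hd =>
    intro h F μ ψ
    have h' : c.isDet ∧ d.isDet := by simpa [Cmd.isDet] using h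
    simp only [wp, exec, hc h'.1, hd h'.2]
    split_ifs <;> rfl
  | loop e c hc =>
    intro h F μ ψ
    have h' : c.isDet := by simpa [Cmd.isDet] using h
    have key : ∀ N μ, (wp c)^[N] F μ ψ = F ((exec c)^[N] μ) ψ := by
      intro N
      induction N with
      | zero => intro μ; rfl
      | succ N ih =>
        intro μ
        rw [Function.iterate_succ_apply', Function.iterate_succ_apply, hc h', ih]
    exact key _ _

/-- The arrays that a command may modify. -/
def Cmd.writes : Cmd → List ℕ
  | .set a _ _ _ _ => [a]
  | .rand a _ _ _ _ => [a]
  | .measure a _ _ _ _ _ => [a]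
  | .seq c d => c.writes ++ d.writes
  | .ite _ c d => c.writes ++ d.writes
  | .loop _ c => c.writes
  | _ => []

theorem exec_of_notMem {b : ℕ} {c : Cmd} : b ∉ c.writes → ∀ μ, exec c μ b = μ b := by
  induction c with
  | skip | rand | gateH | gateS | gateT | gateCX | measure => intro _ μ; rfl
  | set => intro h μ; exact store_of_ne (by simpa [Cmd.writes] using h)
  | seq c d hc hd =>
    intro h μ
    simp only [Cmd.writes, List.mem_append, not_or] at h
    simp only [exec, hc h.1, hd h.2]
  | ite e c d hc hd =>
    intro h μ
    simp only [Cmd.writes, List.mem_append, not_or] at h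
    simp only [exec]
    split_ifs
    · exact hc h.1 μ
    · exact hd h.2 μ
  | loop e c hc =>
    intro h μ
    have key : ∀ N μ, (exec c)^[N] μ b = μ b := by
      intro N
      induction N with
      | zero => intro μ; rfl
      | succ N ih => intro μ; rw [Function.iterate_succ_apply, ih, hc h]
    exact key _ _

/-! ## Counting loops -/

/-- The scalar variable that is stored in array `x`. -/
abbrev Expr.var (x : ℕ) : Expr := .get x (.lit 0) (.lit 0) (.lit 0)

/-- The memory after the scalar variable in array `x` has been set to `v`. -/
abbrev setVar (μ : Mem) (x v : ℕ) : Mem := store μ x 0 0 0 v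

theorem store_self {μ : Mem} {a i j l : ℕ} : store μ a i j l (μ a i j l) = μ := by
  funext a' i' j' l'
  simp only [store]
  split_ifs with h
  · obtain ⟨rfl, rfl, rfl, rfl⟩ := h; rfl
  · rfl

theorem store_store {μ : Mem} {a i j l v w : ℕ} :
    store (store μ a i j l v) a i j l w = store μ a i j l w := by
  funext a' i' j' l'
  simp only [store]
  split_ifs <;> rfl

theorem store_apply_self {μ : Mem} {a i j l v : ℕ} : store μ a i j l v a i j l = v := by
  simp [store]

theorem setVar_zero {μ : Mem} {x : ℕ} (h : μ x 0 0 0 = 0) : setVar μ x 0 = μ := by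
  have h' := store_self (μ := μ) (a := x) (i := 0) (j := 0) (l := 0)
  rwa [h] at h'

/-- `for x = 0, …, e - 1 do c`. The counter `x` is `0` at the end. -/
def Cmd.for_ (x : ℕ) (e : Expr) (c : Cmd) : Cmd :=
  .seq (.set x (.lit 0) (.lit 0) (.lit 0) (.lit 0))
    (.seq (.loop e (.seq c (.set x (.lit 0) (.lit 0) (.lit 0) (.add (.var x) (.lit 1)))))
      (.set x (.lit 0) (.lit 0) (.lit 0) (.lit 0)))

/-- Invariant rule for counting loops. The body is only told that the arrays it does not write are
as at the start and that the counter has its value; everything else must be in `I`. Insensitivity of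
`I` to the counter absorbs the resets and increments. -/
theorem exec_for {x N : ℕ} {e : Expr} {c : Cmd} {μ : Mem} (I : ℕ → Mem → Prop)
    (hx : x ∉ c.writes) (hN : e.eval (setVar μ x 0) = N)
    (hI : ∀ j ν v, I j ν → I j (setVar ν x v)) (h0 : I 0 μ)
    (hs : ∀ j < N, ∀ ν, (∀ b, b ≠ x → b ∉ c.writes → ν b = μ b) → ν x 0 0 0 = j → I j ν →
      I (j + 1) (exec c ν)) :
    I N (exec (.for_ x e c) μ) := by
  have key : ∀ j ≤ N, ∀ ν,
      ν = (exec (.seq c (.set x (.lit 0) (.lit 0) (.lit 0) (.add (.var x) (.lit 1)))))^[j]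
        (setVar μ x 0) →
      (∀ b, b ≠ x → b ∉ c.writes → ν b = μ b) ∧ ν x 0 0 0 = j ∧ I j ν := by
    intro j
    induction j with
    | zero =>
      rintro - ν rfl
      exact ⟨fun b hb _ => store_of_ne hb, store_apply_self, hI _ _ _ h0⟩
    | succ j ih =>
      rintro hj ν rfl
      rw [Function.iterate_succ_apply']
      obtain ⟨h1, h2, h3⟩ := ih (by omega) _ rfl
      refine ⟨?_, ?_, ?_⟩
      · intro b hb hb'
        rw [exec, exec, store_of_ne hb, exec_of_notMem hb', h1 b hb hb']
      · rw [exec, exec]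
        simp only [Expr.eval, store_apply_self, exec_of_notMem hx]
        rw [h2]
      · exact hI _ _ _ (hs j (by omega) _ h1 h2 h3)
  simp only [Cmd.for_]
  simp only [exec, Expr.eval, hN]
  exact hI _ _ _ (key N le_rfl _ rfl).2.2

theorem sum_snoc {α : ℕ → Type} [∀ j, Fintype (α j)] (N : ℕ)
    (g : (∀ i : Fin (N + 1), α i) → ℝ) :
    ∑ f, g f = ∑ f : ∀ i : Fin N, α i, ∑ v : α N,
      g (Fin.snoc (α := fun i : Fin (N + 1) => α i) f v) := by
  rw [← (Fin.snocEquiv fun i : Fin (N + 1) => α i).sum_comp, Fintype.sum_prod_type,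
    Finset.sum_comm]
  rfl

/-- Loop rule for branching bodies. The history `f` of the outcomes so far determines memory and
quantum state exactly, and `κ j` is the common weight of the branches of iteration `j`, so that the
weights multiply and the histories are summed. `M` describes the memory with the counter at zero;
the running counter is laid over it by `setVar`. -/
theorem wp_for {α : ℕ → Type} [∀ j, Fintype (α j)] {x N : ℕ} {e : Expr} {c : Cmd}
    (M : ∀ j, (∀ i : Fin j, α i) → Mem) (Ψ : ∀ j, (∀ i : Fin j, α i) → QMem) (κ : ℕ → ℝ)
    (hx : ∀ j f, M j f x 0 0 0 = 0) (hN : ∀ f, e.eval (M 0 f) = N)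
    (hc : ∀ j < N, ∀ f F, Homogeneous F → wp c F (setVar (M j f) x j) (Ψ j f)
      = κ j * ∑ v : α j, F (setVar (M (j + 1) (Fin.snoc (α := fun i : Fin (j + 1) => α i) f v))
          x j) (Ψ (j + 1) (Fin.snoc (α := fun i : Fin (j + 1) => α i) f v)))
    {F : Mem → QMem → ℝ} (hF : Homogeneous F) (f₀ : ∀ i : Fin 0, α i) :
    wp (.for_ x e c) F (M 0 f₀) (Ψ 0 f₀)
      = (∏ j ∈ Finset.range N, κ j) * ∑ f : ∀ i : Fin N, α i, F (M N f) (Ψ N f) := by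
  have key : ∀ j ≤ N, ∀ F, Homogeneous F →
      (wp (.seq c (.set x (.lit 0) (.lit 0) (.lit 0) (.add (.var x) (.lit 1)))))^[j] F
        (setVar (M 0 f₀) x 0) (Ψ 0 f₀)
      = (∏ j ∈ Finset.range j, κ j) * ∑ f : ∀ i : Fin j, α i,
          F (setVar (M j f) x j) (Ψ j f) := by
    intro j
    induction j with
    | zero =>
      intro _ F hF
      have : ∀ f : ∀ i : Fin 0, α i, f = f₀ := fun f => funext fun i => i.elim0
      rw [Fintype.sum_eq_single f₀ fun f hf => absurd (this f) hf]
      simp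
    | succ j ih =>
      intro hj F hF
      rw [Function.iterate_succ_apply, ih (by omega) _ hF.wp, Finset.prod_range_succ, mul_assoc,
        sum_snoc, Finset.mul_sum _ _ (κ j)]
      congr 1
      refine Finset.sum_congr rfl fun f _ => ?_
      rw [wp, hc j (by omega) f _ hF.wp]
      simp only [wp, Expr.eval, setVar, store_apply_self, store_store]
  have h1 : setVar (M 0 f₀) x 0 = M 0 f₀ := setVar_zero (hx 0 f₀)
  have h2 : ∀ f, setVar (setVar (M N f) x N) x 0 = M N f := by
    intro f
    rw [setVar, setVar, store_store]
    exact setVar_zero (hx N f)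
  have h3 : ∀ {F}, Homogeneous F →
      Homogeneous (wp (.set x (.lit 0) (.lit 0) (.lit 0) (.lit 0)) F) := fun h => h.wp
  have h4 := key N le_rfl _ (h3 hF)
  simp only [h1] at h4
  simp only [Cmd.for_]
  change (wp _)^[e.eval (setVar (M 0 f₀) x 0)] _ (setVar (M 0 f₀) x 0) _ = _
  rw [h1, hN, h4]
  congr 1
  refine Finset.sum_congr rfl fun f _ => ?_
  change F (setVar (setVar (M N f) x N) x 0) _ = _
  rw [h2]

/-- A counting loop without branching that only modifies the quantum memory. -/
theorem wp_for_unitary {x N : ℕ} {e : Expr} {c : Cmd} {μ : Mem} (Ψ : ℕ → QMem)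
    (hx : μ x 0 0 0 = 0) (hN : e.eval μ = N) (F : Mem → QMem → ℝ)
    (hc : ∀ j < N, ∀ F, wp c F (setVar μ x j) (Ψ j) = F (setVar μ x j) (Ψ (j + 1))) :
    wp (.for_ x e c) F μ (Ψ 0) = F μ (Ψ N) := by
  have key : ∀ j ≤ N, ∀ F : Mem → QMem → ℝ,
      (wp (.seq c (.set x (.lit 0) (.lit 0) (.lit 0) (.add (.var x) (.lit 1)))))^[j] F
        (setVar μ x 0) (Ψ 0) = F (setVar μ x j) (Ψ j) := by
    intro j
    induction j with
    | zero => intro _ F; rfl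
    | succ j ih =>
      intro hj F
      rw [Function.iterate_succ_apply, ih (by omega), wp, hc j (by omega)]
      simp only [wp, Expr.eval, setVar, store_apply_self, store_store]
  have h1 : setVar μ x 0 = μ := setVar_zero hx
  simp only [Cmd.for_]
  change (wp _)^[e.eval (setVar μ x 0)] _ (setVar μ x 0) _ = _
  rw [h1, hN]
  have h4 := key N le_rfl (wp (.set x (.lit 0) (.lit 0) (.lit 0) (.lit 0)) F)
  rw [h1] at h4
  rw [h4]
  change F (setVar (setVar μ x N) x 0) _ = _
  rw [setVar, store_store]
  exact congrArg (F · _) h1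

end LSN

namespace LSN

/-! ## Filling an array with sums -/

/-- The cell of array `a` at the indices stored in the counters `30`, `31`, `32`. -/
abbrev Expr.cell (a : ℕ) : Expr := .get a (.var 30) (.var 31) (.var 32)

/-- `a[i][j][l] := ∑ q < e₄, E` for all `i < e₁`, `j < e₂`, `l < e₃`. The expression `E` refers
to `i, j, l, q` as the scalar variables `30, 31, 32, 33`. -/
def Cmd.tabulate (a : ℕ) (e₁ e₂ e₃ e₄ E : Expr) : Cmd :=
  .for_ 30 e₁ <| .for_ 31 e₂ <| .for_ 32 e₃ <|
    .seq (.set a (.var 30) (.var 31) (.var 32) (.lit 0)) <|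
      .for_ 33 e₄ <| .set a (.var 30) (.var 31) (.var 32) (.add (.cell a) E)

theorem Cmd.writes_for {x : ℕ} {e : Expr} {c : Cmd} :
    (Cmd.for_ x e c).writes = x :: (c.writes ++ [x] ++ [x]) := rfl

theorem Cmd.notMem_writes_for {b x : ℕ} {e : Expr} {c : Cmd} (h : b ≠ x) (h' : b ∉ c.writes) :
    b ∉ (Cmd.for_ x e c).writes := by
  simp [Cmd.writes_for, h, h']

theorem Cmd.notMem_writes_tabulate {a b : ℕ} (hb : b < 30) (hab : b ≠ a) {e₁ e₂ e₃ e₄ E : Expr} :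
    b ∉ (Cmd.tabulate a e₁ e₂ e₃ e₄ E).writes := by
  simp only [Cmd.tabulate, Cmd.writes_for, Cmd.writes, List.mem_cons, List.mem_append,
    List.not_mem_nil, or_false, not_or]
  omega

theorem exec_tabulate_of_ne {a b : ℕ} (hb : b < 30) (hab : b ≠ a) {e₁ e₂ e₃ e₄ E : Expr}
    (μ : Mem) : exec (.tabulate a e₁ e₂ e₃ e₄ E) μ b = μ b :=
  exec_of_notMem (Cmd.notMem_writes_tabulate hb hab) μ

theorem store_apply {μ : Mem} {a i j l v i' j' l' : ℕ} :
    store μ a i j l v a i' j' l' = if i' = i ∧ j' = j ∧ l' = l then v else μ a i' j' l' := by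
  simp [store]

/-- All linear algebra of the programs goes through this rule. It is stated over any semiring
because matrix products need only residues modulo two, whereas the search for a pivot needs a true
count. Array `a` is below `30` to stay clear of the counters, and `E` may not depend on array `a`,
which is only partly filled when `E` is evaluated. Each inner loop also has to assert that the
remaining cells are untouched, for the sake of the loop around it. -/
theorem exec_tabulate {R : Type*} [Semiring R] {a : ℕ} (ha : a < 30) (ha0 : a ≠ 0)
    {e₁ e₂ e₃ e₄ E : Expr} {μ : Mem} {N₁ N₂ N₃ N₄ : ℕ} (val : ℕ → ℕ → ℕ → ℕ → R)
    (h₁ : ∀ ν : Mem, ν 0 = μ 0 → e₁.eval ν = N₁) (h₂ : ∀ ν : Mem, ν 0 = μ 0 → e₂.eval ν = N₂)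
    (h₃ : ∀ ν : Mem, ν 0 = μ 0 → e₃.eval ν = N₃) (h₄ : ∀ ν : Mem, ν 0 = μ 0 → e₄.eval ν = N₄)
    (hE : ∀ (ν : Mem) (i j l q : ℕ), i < N₁ → j < N₂ → l < N₃ → q < N₄ →
      (∀ b < 30, b ≠ a → ν b = μ b) → ν 30 0 0 0 = i → ν 31 0 0 0 = j → ν 32 0 0 0 = l →
      ν 33 0 0 0 = q → (E.eval ν : R) = val i j l q)
    {i j l : ℕ} (hi : i < N₁) (hj : j < N₂) (hl : l < N₃) :
    (exec (.tabulate a e₁ e₂ e₃ e₄ E) μ a i j l : R) = ∑ q ∈ Finset.range N₄, val i j l q := by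
  have a0 : 0 ≠ a := ha0.symm
  have a1 : a ≠ 30 := by omega
  have a2 : a ≠ 31 := by omega
  have a3 : a ≠ 32 := by omega
  have a4 : a ≠ 33 := by omega
  unfold Cmd.tabulate
  set c₃ : Cmd := .set a (.var 30) (.var 31) (.var 32) (.add (.cell a) E) with hc₃
  set c₂ : Cmd := .seq (.set a (.var 30) (.var 31) (.var 32) (.lit 0)) (.for_ 33 e₄ c₃) with hc₂
  have w₂ : ∀ b, b ≠ a → b ≠ 33 → b ∉ c₂.writes := by
    intro b hb hb'
    simp [hc₂, hc₃, Cmd.writes, Cmd.writes_for, hb, hb']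
  have w₁ : ∀ b, b ≠ a → b ≠ 33 → b ≠ 32 → b ∉ (Cmd.for_ 32 e₃ c₂).writes := fun b h h' h'' =>
    Cmd.notMem_writes_for h'' (w₂ b h h')
  have w₀ : ∀ b, b ≠ a → b ≠ 33 → b ≠ 32 → b ≠ 31 →
      b ∉ (Cmd.for_ 31 e₂ (.for_ 32 e₃ c₂)).writes := fun b h h' h'' h''' =>
    Cmd.notMem_writes_for h''' (w₁ b h h' h'')
  -- the innermost loop
  have s₃ : ∀ (ν : Mem) (i j l : ℕ), i < N₁ → j < N₂ → l < N₃ →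
      (∀ b < 30, b ≠ a → ν b = μ b) → ν 30 0 0 0 = i → ν 31 0 0 0 = j → ν 32 0 0 0 = l →
      (exec c₂ ν a i j l : R) = (∑ q ∈ Finset.range N₄, val i j l q) ∧
        ∀ i' j' l', ¬ (i' = i ∧ j' = j ∧ l' = l) → exec c₂ ν a i' j' l' = ν a i' j' l' := by
    intro ν i j l hi hj hl hν v0 v1 v2
    refine exec_for (fun t ρ => (ρ a i j l : R) = (∑ q ∈ Finset.range t, val i j l q) ∧
        ∀ i' j' l', ¬ (i' = i ∧ j' = j ∧ l' = l) → ρ a i' j' l' = ν a i' j' l')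
      (x := 33) (e := e₄) (c := c₃) (N := N₄) ?_ ?_ ?_ ?_ ?_
    · simp only [hc₃, Cmd.writes, List.mem_singleton]; omega
    · exact h₄ _ (by rw [setVar, store_of_ne (by omega), exec, store_of_ne a0, hν 0 (by omega) a0])
    · intro t ρ v h
      simpa only [setVar, store_of_ne a4] using h
    · simp only [exec, Expr.eval, store_apply, v0, v1, v2]
      refine ⟨by simp, fun i' j' l' h => if_neg h⟩
    · intro t ht ρ hρ hρt ⟨hI1, hI2⟩
      have e0 : ∀ b, b ≠ a → b ≠ 33 → ρ b = ν b := by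
        intro b hb hb'
        rw [hρ b hb' (by simp [hc₃, Cmd.writes, hb]), exec, store_of_ne hb]
      have r0 : ρ 30 0 0 0 = i := by rw [e0 30 a1.symm (by omega), v0]
      have r1 : ρ 31 0 0 0 = j := by rw [e0 31 a2.symm (by omega), v1]
      have r2 : ρ 32 0 0 0 = l := by rw [e0 32 a3.symm (by omega), v2]
      have hEv := hE ρ i j l t hi hj hl ht
        (fun b hb hba => by rw [e0 b hba (by omega), hν b hb hba]) r0 r1 r2 hρt
      simp only [hc₃, exec, Expr.eval, r0, r1, r2, store_apply]
      refine ⟨?_, fun i' j' l' h => by rw [if_neg h, hI2 i' j' l' h]⟩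
      simp only [and_self, if_true, Nat.cast_add, hEv, hI1, Finset.sum_range_succ]
  have s₂ : ∀ (ν : Mem) (i j : ℕ), i < N₁ → j < N₂ →
      (∀ b < 30, b ≠ a → ν b = μ b) → ν 30 0 0 0 = i → ν 31 0 0 0 = j →
      (∀ l < N₃, (exec (.for_ 32 e₃ c₂) ν a i j l : R) = ∑ q ∈ Finset.range N₄, val i j l q) ∧
        ∀ i' j' l', ¬ (i' = i ∧ j' = j) → exec (.for_ 32 e₃ c₂) ν a i' j' l' = ν a i' j' l' := by
    intro ν i j hi hj hν v0 v1
    refine exec_for (fun t ρ =>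
      (∀ l < t, (ρ a i j l : R) = (∑ q ∈ Finset.range N₄, val i j l q)) ∧
        ∀ i' j' l', ¬ (i' = i ∧ j' = j) → ρ a i' j' l' = ν a i' j' l')
      (x := 32) (e := e₃) (c := c₂) (N := N₃) (w₂ _ a3.symm (by omega)) ?_ ?_ ?_ ?_
    · exact h₃ _ (by rw [setVar, store_of_ne (by omega), hν 0 (by omega) a0])
    · intro t ρ v h
      simpa only [setVar, store_of_ne a3] using h
    · exact ⟨fun l hl => absurd hl (by omega), fun _ _ _ _ => rfl⟩
    · intro t ht ρ hρ hρt ⟨hI1, hI2⟩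
      have e0 : ∀ b, b ≠ a → b ≠ 33 → b ≠ 32 → ρ b = ν b := fun b hb hb' hb'' =>
        hρ b hb'' (w₂ b hb hb')
      obtain ⟨g1, g2⟩ := s₃ ρ i j t hi hj ht
        (fun b hb hba => by rw [e0 b hba (by omega) (by omega), hν b hb hba])
        (by rw [e0 30 a1.symm (by omega) (by omega), v0])
        (by rw [e0 31 a2.symm (by omega) (by omega), v1]) hρt
      refine ⟨fun l hl => ?_, fun i' j' l' h => ?_⟩
      · by_cases hlt : l = t
        · rw [hlt, g1]
        · rw [g2 _ _ _ (by tauto), hI1 l (by omega)]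
      · rw [g2 _ _ _ (by tauto), hI2 _ _ _ h]
  have s₁ : ∀ (ν : Mem) (i : ℕ), i < N₁ →
      (∀ b < 30, b ≠ a → ν b = μ b) → ν 30 0 0 0 = i →
      (∀ j < N₂, ∀ l < N₃, (exec (.for_ 31 e₂ (.for_ 32 e₃ c₂)) ν a i j l : R)
        = ∑ q ∈ Finset.range N₄, val i j l q) ∧
        ∀ i' j' l', i' ≠ i →
          exec (.for_ 31 e₂ (.for_ 32 e₃ c₂)) ν a i' j' l' = ν a i' j' l' := by
    intro ν i hi hν v0
    refine exec_for (fun t ρ =>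
      (∀ j < t, ∀ l < N₃, (ρ a i j l : R) = (∑ q ∈ Finset.range N₄, val i j l q)) ∧
        ∀ i' j' l', i' ≠ i → ρ a i' j' l' = ν a i' j' l')
      (x := 31) (e := e₂) (N := N₂) (w₁ _ a2.symm (by omega) (by omega)) ?_ ?_ ?_ ?_
    · exact h₂ _ (by rw [setVar, store_of_ne (by omega), hν 0 (by omega) a0])
    · intro t ρ v h
      simpa only [setVar, store_of_ne a2] using h
    · exact ⟨fun l hl => absurd hl (by omega), fun _ _ _ _ => rfl⟩
    · intro t ht ρ hρ hρt ⟨hI1, hI2⟩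
      have e0 : ∀ b, b ≠ a → b ≠ 33 → b ≠ 32 → b ≠ 31 → ρ b = ν b := fun b hb hb' hb'' hb3 =>
        hρ b hb3 (w₁ b hb hb' hb'')
      obtain ⟨g1, g2⟩ := s₂ ρ i t hi ht
        (fun b hb hba => by rw [e0 b hba (by omega) (by omega) (by omega), hν b hb hba])
        (by rw [e0 30 a1.symm (by omega) (by omega) (by omega), v0]) hρt
      refine ⟨fun j hj l hl => ?_, fun i' j' l' h => ?_⟩
      · by_cases hjt : j = t
        · rw [hjt, g1 l hl]
        · rw [g2 _ _ _ (by tauto), hI1 j (by omega) l hl]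
      · rw [g2 _ _ _ (by tauto), hI2 _ _ _ h]
  have s₀ : ∀ i < N₁, ∀ j < N₂, ∀ l < N₃,
      (exec (.for_ 30 e₁ (.for_ 31 e₂ (.for_ 32 e₃ c₂))) μ a i j l : R)
        = ∑ q ∈ Finset.range N₄, val i j l q := by
    refine exec_for (fun t ρ =>
      ∀ i < t, ∀ j < N₂, ∀ l < N₃, (ρ a i j l : R) = ∑ q ∈ Finset.range N₄, val i j l q)
      (x := 30) (e := e₁) (N := N₁) (w₀ _ a1.symm (by omega) (by omega) (by omega)) ?_ ?_ ?_ ?_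
    · exact h₁ _ (by rw [setVar, store_of_ne (by omega)])
    · intro t ρ v h
      simpa only [setVar, store_of_ne a1] using h
    · exact fun i hi => absurd hi (by omega)
    · intro t ht ρ hρ hρt hI1
      obtain ⟨g1, g2⟩ := s₁ ρ t ht
        (fun b hb hba => hρ b (by omega) (w₀ b hba (by omega) (by omega) (by omega))) hρt
      intro i hi j hj l hl
      by_cases hit : i = t
      · rw [hit, g1 j hj l hl]
      · rw [g2 _ _ _ hit, hI1 i (by omega) j hj l hl]
  exact s₀ i hi j hj l hl

/-! ## Arithmetic modulo two -/

/-- The product modulo `2`. -/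
def Expr.and (e f : Expr) : Expr := .div (.add (.mod e (.lit 2)) (.mod f (.lit 2))) (.lit 2)

/-- For bits `a` and `b` the integer quotient `(a + b) / 2` equals `a * b`; the machine itself has
no multiplication. -/
theorem Expr.cast_eval_and (e f : Expr) (μ : Mem) :
    ((Expr.and e f).eval μ : ZMod 2) = (e.eval μ : ZMod 2) * (f.eval μ : ZMod 2) := by
  simp only [Expr.and, Expr.eval]
  rw [← ZMod.natCast_mod (e.eval μ) 2, ← ZMod.natCast_mod (f.eval μ) 2]
  have h1 := Nat.mod_lt (e.eval μ) (by norm_num : 2 > 0)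
  have h2 := Nat.mod_lt (f.eval μ) (by norm_num : 2 > 0)
  interval_cases e.eval μ % 2 <;> interval_cases f.eval μ % 2 <;> simp

theorem Expr.cast_eval_add (e f : Expr) (μ : Mem) :
    ((Expr.add e f).eval μ : ZMod 2) = (e.eval μ : ZMod 2) + (f.eval μ : ZMod 2) := by
  simp [Expr.eval]

/-- The indicator of `P`, as a bit. -/
def bit (P : Prop) [Decidable P] : ZMod 2 := if P then 1 else 0

theorem Expr.cast_eval_eq (e f : Expr) (μ : Mem) :
    ((Expr.eq e f).eval μ : ZMod 2) = bit (e.eval μ = f.eval μ) := by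
  simp only [Expr.eval, bit]
  split_ifs <;> simp

theorem Expr.cast_eval_lt (e f : Expr) (μ : Mem) :
    ((Expr.lt e f).eval μ : ZMod 2) = bit (e.eval μ < f.eval μ) := by
  simp only [Expr.eval, bit]
  split_ifs <;> simp

end LSN

namespace LSN

/-! ## Uniformly random invertible matrices -/

theorem zmod2_eq_one_of_ne {a : ZMod 2} (h : a ≠ 0) : a = 1 := by
  revert h; revert a; decide

theorem zmod2_add_self (a : ZMod 2) : a + a = 0 := by
  revert a; decide

/-- The indicator of the last nonzero entry of a vector. -/
def lastOne {N : ℕ} (y : Fin N → ZMod 2) : Fin N → ZMod 2 := fun q =>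
  y q * bit (∀ q' : Fin N, q < q' → y q' = 0)

/-- The pivot of a vector, obtained by a closed formula instead of a search. Programs and matrices
can thus be written without branching on its position, which enters only through this indicator. -/
theorem exists_lastOne {N : ℕ} {y : Fin N → ZMod 2} (hy : y ≠ 0) :
    ∃ p, y p = 1 ∧ (∀ q, p < q → y q = 0) ∧ ∀ q, lastOne y q = bit (q = p) := by
  have hne : (Finset.univ.filter fun q => y q ≠ 0).Nonempty := by
    obtain ⟨q, hq⟩ := Function.ne_iff.mp hy
    exact ⟨q, by simpa using hq⟩
  obtain ⟨p, hp⟩ : ∃ p, p = (Finset.univ.filter fun q => y q ≠ 0).max' hne := ⟨_, rfl⟩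
  have h1 : y p ≠ 0 := by
    have := Finset.max'_mem _ hne
    rw [← hp] at this
    simpa using this
  have h2 : ∀ q, p < q → y q = 0 := by
    intro q hq
    by_contra h
    have := Finset.le_max' (Finset.univ.filter fun q => y q ≠ 0) q (by simpa using h)
    rw [← hp] at this
    exact absurd hq (not_lt.mpr this)
  refine ⟨p, zmod2_eq_one_of_ne h1, h2, fun q => ?_⟩
  simp only [lastOne, bit]
  by_cases hqp : q = p
  · subst hqp
    rw [if_pos h2, if_pos rfl, mul_one, zmod2_eq_one_of_ne h1]
  · rw [if_neg hqp]
    rcases lt_or_gt_of_ne hqp with h | h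
    · rw [if_neg fun hc => h1 (hc p h), mul_zero]
    · rw [h2 q h, zero_mul]

/-- A matrix with column `j` equal to `v`. If `v` has a last nonzero entry, in row `p`, then column
`p` is the `j`-th unit vector for `p ≠ j`; the other columns are those of the unit matrix. -/
def colMatrix {n : ℕ} (j : Fin n) (v : Fin n → ZMod 2) : Matrix (Fin n) (Fin n) (ZMod 2) :=
  Matrix.of fun q' q => if q = j then v q' else
    lastOne v q * bit (q' = j) + (1 + lastOne v q) * bit (q' = q)

/-- The vectors that are not supported on the first `j` coordinates. -/
def freshVectors (n j : ℕ) : Finset (Fin n → ZMod 2) :=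
  Finset.univ.filter fun v => ∃ q : Fin n, j ≤ q ∧ v q ≠ 0

/-- The invertible matrices whose first `j` columns are those of the unit matrix. -/
noncomputable def glFixing (n j : ℕ) : Finset (Matrix (Fin n) (Fin n) (ZMod 2)) :=
  open Classical in Finset.univ.filter fun h =>
    IsUnit h ∧ ∀ i : Fin n, i.1 < j → h.mulVec (Pi.single i 1) = Pi.single i 1

theorem exists_last_of_fresh {n j : ℕ} {v : Fin n → ZMod 2} (hv : v ∈ freshVectors n j) :
    ∃ p : Fin n, j ≤ p ∧ v p = 1 ∧ ∀ q, lastOne v q = bit (q = p) := by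
  obtain ⟨q, hq, hvq⟩ : ∃ q : Fin n, j ≤ q ∧ v q ≠ 0 := by simpa [freshVectors] using hv
  obtain ⟨p, h1, h2, h3⟩ := exists_lastOne (Function.ne_iff.mpr ⟨q, hvq⟩)
  refine ⟨p, ?_, h1, h3⟩
  by_contra hc
  exact hvq (h2 q (Fin.lt_def.mpr (by omega)))

theorem colMatrix_col_self {n : ℕ} (j : Fin n) (v : Fin n → ZMod 2) :
    (colMatrix j v).mulVec (Pi.single j 1) = v := by
  ext q
  simp [colMatrix]

theorem colMatrix_col_lt {n : ℕ} {j : Fin n} {v : Fin n → ZMod 2} (hv : v ∈ freshVectors n j)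
    {i : Fin n} (hi : i < j) : (colMatrix j v).mulVec (Pi.single i 1) = Pi.single i 1 := by
  obtain ⟨p, hp, -, h⟩ := exists_last_of_fresh hv
  have hip : i ≠ p := by
    rintro rfl
    exact absurd hi (not_lt.mpr (Fin.le_def.mpr hp))
  ext q
  simp [colMatrix, h, hi.ne, hip, bit, Pi.single_apply]

/-- The range contains every unit vector: the columns other than `j` supply all of them except the
one at the pivot `p` (column `p` standing in for unit vector `j`), and column `j` is a vector with
entry `1` at `p`. -/
theorem isUnit_colMatrix {n : ℕ} {j : Fin n} {v : Fin n → ZMod 2} (hv : v ∈ freshVectors n j) :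
    IsUnit (colMatrix j v) := by
  obtain ⟨p, hp, hvp, h⟩ := exists_last_of_fresh hv
  rw [← Matrix.mulVec_surjective_iff_isUnit, ← Matrix.coe_mulVecLin, ← LinearMap.range_eq_top]
  set W := LinearMap.range (colMatrix j v).mulVecLin with hW
  have hmem : ∀ x, (colMatrix j v).mulVec x ∈ W := fun x => ⟨x, rfl⟩
  have h1 : ∀ q, q ≠ p → (Pi.single q 1 : Fin n → ZMod 2) ∈ W := by
    intro q hq
    by_cases hqj : q = j
    · have hpj : p ≠ j := fun hc => hq (hqj.trans hc.symm)
      convert hmem (Pi.single p 1)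
      ext r
      simp [colMatrix, h, hpj, hqj, bit, Pi.single_apply]
      exact fun _ => by decide
    · convert hmem (Pi.single q 1)
      ext r
      simp [colMatrix, h, hq, hqj, bit, Pi.single_apply]
  have h2 : (Pi.single p 1 : Fin n → ZMod 2) ∈ W := by
    have hv' : v = Pi.single p 1 + ∑ q ∈ Finset.univ.erase p, v q • Pi.single q 1 := by
      have : v = ∑ q, v q • (Pi.single q 1 : Fin n → ZMod 2) := by
        ext r
        simp only [Finset.sum_apply, Pi.smul_apply, Pi.single_apply]
        simp
      conv_lhs => rw [this, ← Finset.add_sum_erase _ _ (Finset.mem_univ p), hvp, one_smul]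
    have hvW : v ∈ W := by
      have := hmem (Pi.single j 1)
      rwa [colMatrix_col_self] at this
    rw [eq_sub_of_add_eq hv'.symm]
    refine W.sub_mem hvW (W.sum_mem fun q hq => W.smul_mem _ (h1 q (Finset.ne_of_mem_erase hq)))
  have h3 : ∀ q, (Pi.single q 1 : Fin n → ZMod 2) ∈ W := by
    intro q
    by_cases hq : q = p
    · rwa [hq]
    · exact h1 q hq
  refine Submodule.eq_top_iff'.mpr fun x => ?_
  have : x = ∑ q, x q • (Pi.single q 1 : Fin n → ZMod 2) := by
    ext r
    simp only [Finset.sum_apply, Pi.smul_apply, Pi.single_apply]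
    simp
  rw [this]
  exact W.sum_mem fun q _ => W.smul_mem _ (h3 q)

theorem mem_glFixing {n j : ℕ} {h : Matrix (Fin n) (Fin n) (ZMod 2)} : h ∈ glFixing n j ↔
    IsUnit h ∧ ∀ i : Fin n, i.1 < j → h.mulVec (Pi.single i 1) = Pi.single i 1 := by
  classical
  simp [glFixing]

/-- Were column `j` supported on the first `j` coordinates, it would be a combination of the first
`j` columns, which are unit vectors, against invertibility. -/
theorem mulVec_mem_freshVectors {n : ℕ} {j : Fin n} {h : Matrix (Fin n) (Fin n) (ZMod 2)}
    (hh : h ∈ glFixing n j) : h.mulVec (Pi.single j 1) ∈ freshVectors n j := by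
  obtain ⟨h1, h2⟩ := mem_glFixing.mp hh
  by_contra hc
  simp only [freshVectors, Finset.mem_filter, Finset.mem_univ, true_and, not_exists, not_and,
    not_not] at hc
  have hinj := Matrix.mulVec_injective_iff_isUnit.mpr h1
  set w := h.mulVec (Pi.single j 1) with hw
  -- The coefficients of this combination are the entries of `w` itself, as the columns involved are
  -- unit vectors.
  have e : h.mulVec (fun q => if q < j then w q else 0) = w := by
    have : (fun q => if q < j then w q else 0)
        = ∑ q, (if q < j then w q else 0) • (Pi.single q 1 : Fin n → ZMod 2) := by
      ext r
      simp only [Finset.sum_apply, Pi.smul_apply, Pi.single_apply]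
      simp
    rw [this, Matrix.mulVec_sum]
    simp only [Matrix.mulVec_smul]
    have e3 : ∀ q : Fin n, (if q < j then w q else 0) • h.mulVec (Pi.single q 1)
        = w q • Pi.single q 1 := by
      intro q
      by_cases hq : q < j
      · rw [if_pos hq, h2 q hq]
      · rw [if_neg hq, hc q (by simpa using hq), zero_smul, zero_smul]
    simp only [e3]
    ext r
    simp only [Finset.sum_apply, Pi.smul_apply, Pi.single_apply]
    simp
  have := hinj (e.trans hw)
  have := congrFun this j
  simp at this

theorem nonsing_inv_mulVec_eq {n : ℕ} {g : Matrix (Fin n) (Fin n) (ZMod 2)} (hg : IsUnit g)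
    {x y : Fin n → ZMod 2} (h : g.mulVec x = y) : g⁻¹.mulVec y = x := by
  rw [← h, Matrix.mulVec_mulVec, Matrix.nonsing_inv_mul _ ((Matrix.isUnit_iff_isUnit_det _).mp hg),
    Matrix.one_mulVec]

/-- A coset decomposition: dividing `h` from the left by the standard matrix with the same column
`j` leaves a matrix that also fixes unit vector `j`. Every fresh vector occurs as column `j`, with
the same number of remainders. -/
theorem expect_glFixing {n : ℕ} (j : Fin n) (f : Matrix (Fin n) (Fin n) (ZMod 2) → ℝ) :
    𝔼 h ∈ glFixing n j, f h
      = 𝔼 v ∈ freshVectors n j, 𝔼 h ∈ glFixing n (j + 1), f (colMatrix j v * h) := by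
  rw [← Finset.expect_product']
  have hdet : ∀ {g : Matrix (Fin n) (Fin n) (ZMod 2)}, IsUnit g → IsUnit g.det :=
    fun hg => (Matrix.isUnit_iff_isUnit_det _).mp hg
  refine Finset.expect_nbij' (fun h => (h.mulVec (Pi.single j 1),
      (colMatrix j (h.mulVec (Pi.single j 1)))⁻¹ * h)) (fun x => colMatrix j x.1 * x.2)
      ?_ ?_ ?_ ?_ ?_
  · intro h hh
    have hv := mulVec_mem_freshVectors hh
    have hg := isUnit_colMatrix hv
    obtain ⟨h1, h2⟩ := mem_glFixing.mp hh
    rw [Finset.mem_product]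
    refine ⟨hv, mem_glFixing.mpr ⟨?_, ?_⟩⟩
    · exact ((Matrix.isUnit_nonsing_inv_iff).mpr hg).mul h1
    · intro i hi
      dsimp only
      rw [← Matrix.mulVec_mulVec]
      rcases Nat.lt_succ_iff_lt_or_eq.mp hi with hlt | heq
      · rw [h2 i hlt]
        exact nonsing_inv_mulVec_eq hg (colMatrix_col_lt hv hlt)
      · obtain rfl : i = j := Fin.ext heq
        exact nonsing_inv_mulVec_eq hg (colMatrix_col_self _ _)
  · rintro ⟨v, h⟩ hx
    obtain ⟨hv, hh⟩ := Finset.mem_product.mp hx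
    obtain ⟨h1, h2⟩ := mem_glFixing.mp hh
    refine mem_glFixing.mpr ⟨(isUnit_colMatrix hv).mul h1, fun i hi => ?_⟩
    rw [← Matrix.mulVec_mulVec, h2 i (by omega), colMatrix_col_lt hv hi]
  · intro h hh
    have hg := isUnit_colMatrix (mulVec_mem_freshVectors hh)
    exact Matrix.mul_nonsing_inv_cancel_left _ _ (hdet hg)
  · rintro ⟨v, h⟩ hx
    obtain ⟨hv, hh⟩ := Finset.mem_product.mp hx
    obtain ⟨h1, h2⟩ := mem_glFixing.mp hh
    have e : (colMatrix j v * h).mulVec (Pi.single j 1) = v := by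
      rw [← Matrix.mulVec_mulVec, h2 j (by omega), colMatrix_col_self]
    dsimp only
    rw [e, Matrix.nonsing_inv_mul_cancel_left _ _ (hdet (isUnit_colMatrix hv))]
  · intro h hh
    have hg := isUnit_colMatrix (mulVec_mem_freshVectors hh)
    dsimp only
    rw [Matrix.mul_nonsing_inv_cancel_left _ _ (hdet hg)]

/-- Resampling one coordinate does not change an average. -/
theorem expect_update {ι : Type*} [Fintype ι] [DecidableEq ι] {α : ι → Type*}
    [∀ i, DecidableEq (α i)] (s : ∀ i, Finset (α i)) (j : ι) (hs : (s j).Nonempty)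
    (f : (∀ i, α i) → ℝ) :
    𝔼 v ∈ Fintype.piFinset s, 𝔼 w ∈ s j, f (Function.update v j w)
      = 𝔼 v ∈ Fintype.piFinset s, f v := by
  have h : 𝔼 v ∈ Fintype.piFinset s, f v = 𝔼 v ∈ Fintype.piFinset s, 𝔼 _w ∈ s j, f v := by
    refine Finset.expect_congr rfl fun v _ => ?_
    rw [Finset.expect_const hs]
  rw [h, ← Finset.expect_product', ← Finset.expect_product']
  -- Exchanging coordinate `j` with the new value is an involution on pairs, hence its own inverse.
  refine Finset.expect_nbij' (fun x => (Function.update x.1 j x.2, x.1 j))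
    (fun x => (Function.update x.1 j x.2, x.1 j)) ?_ ?_ ?_ ?_ ?_
  · rintro ⟨v, w⟩ hx
    simp only [Finset.mem_product, Fintype.mem_piFinset] at hx ⊢
    refine ⟨fun i => ?_, hx.1 j⟩
    by_cases hi : i = j
    · subst hi; simpa using hx.2
    · simpa [hi] using hx.1 i
  · rintro ⟨v, w⟩ hx
    simp only [Finset.mem_product, Fintype.mem_piFinset] at hx ⊢
    refine ⟨fun i => ?_, hx.1 j⟩
    by_cases hi : i = j
    · subst hi; simpa using hx.2
    · simpa [hi] using hx.1 i
  · rintro ⟨v, w⟩ _; simp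
  · rintro ⟨v, w⟩ _; simp
  · rintro ⟨v, w⟩ _; rfl

/-- The product of the first `t` column matrices. -/
def colProduct {n : ℕ} (v : Fin n → Fin n → ZMod 2) : ℕ → Matrix (Fin n) (Fin n) (ZMod 2)
  | 0 => 1
  | t + 1 => if h : t < n then colProduct v t * colMatrix ⟨t, h⟩ (v ⟨t, h⟩) else colProduct v t

theorem colProduct_update {n : ℕ} (v : Fin n → Fin n → ZMod 2) (j : Fin n) (w : Fin n → ZMod 2) :
    ∀ t ≤ j.1, colProduct (Function.update v j w) t = colProduct v t
  | 0, _ => rfl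
  | t + 1, ht => by
    have hne : (⟨t, by omega⟩ : Fin n) ≠ j := by
      intro h
      rw [← h] at ht
      simp at ht
    rw [colProduct, colProduct, colProduct_update v j w t (by omega)]
    simp only [Function.update_of_ne hne]

theorem freshVectors_nonempty {n : ℕ} (j : Fin n) : (freshVectors n j).Nonempty :=
  ⟨Pi.single j 1, by
    simp only [freshVectors, Finset.mem_filter, Finset.mem_univ, true_and]
    exact ⟨j, le_rfl, by simp⟩⟩

/-- The product of the matrices whose columns are fresh vectors is uniformly distributed. -/
theorem expect_colProduct {n : ℕ} (f : Matrix (Fin n) (Fin n) (ZMod 2) → ℝ) :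
    𝔼 v ∈ Fintype.piFinset (fun j : Fin n => freshVectors n j), f (colProduct v n)
      = 𝔼 h ∈ glFixing n 0, f h := by
  have hne : (Fintype.piFinset (fun j : Fin n => freshVectors n j)).Nonempty :=
    Fintype.piFinset_nonempty.mpr fun j => freshVectors_nonempty j
  -- Hybrid argument: the first `t` factors come from the sampled vectors, and the rest of the
  -- matrix is still uniform among those fixing the first `t` unit vectors.
  have key : ∀ t ≤ n, 𝔼 v ∈ Fintype.piFinset (fun j : Fin n => freshVectors n j),
      𝔼 h ∈ glFixing n t, f (colProduct v t * h) = 𝔼 h ∈ glFixing n 0, f h := by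
    intro t
    induction t with
    | zero => intro _; simp [colProduct, Finset.expect_const hne]
    | succ t ih =>
      intro ht
      rw [← ih (by omega)]
      -- The product of `t` factors ignores coordinate `t`, so the column split off from the uniform
      -- rest may be written into that coordinate. `expect_update` then removes the resampling.
      have e : ∀ v, 𝔼 h ∈ glFixing n t, f (colProduct v t * h)
          = 𝔼 w ∈ freshVectors n t, (fun v => 𝔼 h ∈ glFixing n (t + 1),
            f (colProduct v (t + 1) * h)) (Function.update v (⟨t, ht⟩ : Fin n) w) := by
        intro v
        rw [expect_glFixing ⟨t, ht⟩]
        refine Finset.expect_congr rfl fun w _ => Finset.expect_congr rfl fun h _ => ?_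
        rw [colProduct, dif_pos (show t < n from ht), colProduct_update _ _ _ _ le_rfl,
          Function.update_self, Matrix.mul_assoc]
      simp only [e]
      exact (expect_update (fun j : Fin n => freshVectors n j) ⟨t, ht⟩
        (freshVectors_nonempty _) _).symm
  rw [← key n le_rfl]
  have hone : glFixing n n = {1} := by
    ext h
    rw [mem_glFixing, Finset.mem_singleton]
    constructor
    · rintro ⟨-, h2⟩
      ext q i
      have := congrFun (h2 i i.2) q
      simpa [Matrix.one_apply, Pi.single_apply] using this
    · rintro rfl
      exact ⟨isUnit_one, fun i _ => Matrix.one_mulVec _⟩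
  simp [hone]

end LSN

namespace LSN

open Matrix

/-! ## Symplectic matrices over `ℤ₂` -/

/-- The Gram matrix of the symplectic inner product. -/
def symJ (n : ℕ) : Matrix (Fin n ⊕ Fin n) (Fin n ⊕ Fin n) (ZMod 2) := fromBlocks 0 1 1 0

theorem symJ_transpose (n : ℕ) : (symJ n)ᵀ = symJ n := by
  simp [symJ, fromBlocks_transpose]

theorem symJ_mul_self (n : ℕ) : symJ n * symJ n = 1 := by
  simp [symJ, fromBlocks_multiply]

theorem symJ_mulVec {n : ℕ} (v : PVec n) : (symJ n).mulVec v = fun g => v g.swap := by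
  ext g
  rcases g with j | j <;>
    simp [symJ, mulVec, dotProduct, fromBlocks, Matrix.one_apply, Fintype.sum_sum_type]

theorem sympInner_eq {n : ℕ} (v w : PVec n) : sympInner v w = ∑ g, v g * w g.swap := by
  change v ⬝ᵥ (symJ n).mulVec w = _
  rw [symJ_mulVec]
  rfl

theorem transpose_mul_symJ_mul_apply {n : ℕ} {α β : Type*} (A : Matrix (Fin n ⊕ Fin n) α (ZMod 2))
    (B : Matrix (Fin n ⊕ Fin n) β (ZMod 2)) (a : α) (b : β) :
    (Aᵀ * symJ n * B) a b = sympInner (A.col a) (B.col b) := by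
  rw [Matrix.mul_assoc, Matrix.mul_apply]
  rfl

theorem sympInner_comm {n : ℕ} (v w : PVec n) : sympInner v w = sympInner w v := by
  rw [sympInner_eq, sympInner_eq, ← (Equiv.sumComm (Fin n) (Fin n)).sum_comp]
  refine Finset.sum_congr rfl fun g _ => ?_
  simp [mul_comm]

theorem sympInner_self {n : ℕ} (v : PVec n) : sympInner v v = 0 := by
  rw [sympInner_eq, Fintype.sum_sum_type, ← Finset.sum_add_distrib]
  refine Finset.sum_eq_zero fun j _ => ?_
  simp only [Sum.swap_inl, Sum.swap_inr]
  rw [mul_comm (v (Sum.inr j))]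
  exact zmod2_add_self _

theorem matrix_add_self {α β : Type*} (A : Matrix α β (ZMod 2)) : A + A = 0 := by
  ext
  exact zmod2_add_self _

theorem eq_of_matrix_add_eq_zero {α β : Type*} {A B : Matrix α β (ZMod 2)} (h : A + B = 0) :
    A = B := by
  rw [eq_neg_of_add_eq_zero_left h, eq_comm]
  exact eq_neg_of_add_eq_zero_left (matrix_add_self B)

/-- The symplectic matrices. The `X` columns come first. -/
def symplectics (n : ℕ) : Finset (Matrix (Fin n ⊕ Fin n) (Fin n ⊕ Fin n) (ZMod 2)) :=
  Finset.univ.filter fun S => Sᵀ * symJ n * S = symJ n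

theorem mem_symplectics {n : ℕ} {S : Matrix (Fin n ⊕ Fin n) (Fin n ⊕ Fin n) (ZMod 2)} :
    S ∈ symplectics n ↔ Sᵀ * symJ n * S = symJ n := by
  simp [symplectics]

/-- The two off-diagonal blocks of the Gram matrix are transposes of each other, so only one of them
needs to be tested. -/
theorem fromCols_mem_symplectics {n : ℕ} {X Z : Matrix (Fin n ⊕ Fin n) (Fin n) (ZMod 2)} :
    fromCols X Z ∈ symplectics n ↔
      Xᵀ * symJ n * X = 0 ∧ Zᵀ * symJ n * X = 1 ∧ Zᵀ * symJ n * Z = 0 := by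
  rw [mem_symplectics, transpose_fromCols, fromRows_mul, fromRows_mul_fromCols]
  have h : Xᵀ * symJ n * Z = (Zᵀ * symJ n * X)ᵀ := by
    rw [transpose_mul, transpose_mul, transpose_transpose, symJ_transpose, Matrix.mul_assoc]
  rw [symJ, fromBlocks_inj, ← symJ, h]
  constructor
  · rintro ⟨h1, -, h3, h4⟩
    exact ⟨h1, h3, h4⟩
  · rintro ⟨h1, h3, h4⟩
    exact ⟨h1, by rw [h3, transpose_one], h3, h4⟩

theorem symplectics_inverse {n : ℕ} {S : Matrix (Fin n ⊕ Fin n) (Fin n ⊕ Fin n) (ZMod 2)}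
    (hS : S ∈ symplectics n) : (symJ n * Sᵀ * symJ n) * S = 1 ∧
      S * (symJ n * Sᵀ * symJ n) = 1 := by
  have h : (symJ n * Sᵀ * symJ n) * S = 1 := by
    rw [Matrix.mul_assoc, Matrix.mul_assoc, ← Matrix.mul_assoc Sᵀ, mem_symplectics.mp hS,
      symJ_mul_self]
  exact ⟨h, mul_eq_one_comm.mp h⟩

theorem one_mem_symplectics (n : ℕ) : 1 ∈ symplectics n := by
  simp [mem_symplectics]

theorem mul_mem_symplectics {n : ℕ} {S T : Matrix (Fin n ⊕ Fin n) (Fin n ⊕ Fin n) (ZMod 2)}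
    (hS : S ∈ symplectics n) (hT : T ∈ symplectics n) : S * T ∈ symplectics n := by
  rw [mem_symplectics, transpose_mul]
  calc Tᵀ * Sᵀ * symJ n * (S * T) = Tᵀ * (Sᵀ * symJ n * S) * T := by simp only [Matrix.mul_assoc]
    _ = symJ n := by rw [mem_symplectics.mp hS, mem_symplectics.mp hT]

theorem inverse_mem_symplectics {n : ℕ} {S : Matrix (Fin n ⊕ Fin n) (Fin n ⊕ Fin n) (ZMod 2)}
    (hS : S ∈ symplectics n) : symJ n * Sᵀ * symJ n ∈ symplectics n := by
  have h := symplectics_inverse hS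
  set R := symJ n * Sᵀ * symJ n
  have h1 : Rᵀ * Sᵀ = 1 := by rw [← transpose_mul, h.2, transpose_one]
  rw [mem_symplectics]
  calc Rᵀ * symJ n * R = Rᵀ * (Sᵀ * symJ n * S) * R := by rw [mem_symplectics.mp hS]
    _ = (Rᵀ * Sᵀ) * symJ n * (S * R) := by simp only [Matrix.mul_assoc]
    _ = symJ n := by rw [h1, h.2, Matrix.one_mul, Matrix.mul_one]

theorem expect_symplectics_mul_right {n : ℕ}
    {T : Matrix (Fin n ⊕ Fin n) (Fin n ⊕ Fin n) (ZMod 2)} (hT : T ∈ symplectics n)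
    (f : Matrix (Fin n ⊕ Fin n) (Fin n ⊕ Fin n) (ZMod 2) → ℝ) :
    𝔼 S ∈ symplectics n, f (S * T) = 𝔼 S ∈ symplectics n, f S := by
  refine Finset.expect_nbij' (fun S => S * T) (fun S => S * (symJ n * Tᵀ * symJ n))
    (fun S hS => mul_mem_symplectics hS hT)
    (fun S hS => mul_mem_symplectics hS (inverse_mem_symplectics hT)) ?_ ?_ fun _ _ => rfl
  · intro S _
    rw [Matrix.mul_assoc, (symplectics_inverse hT).2, Matrix.mul_one]
  · intro S _
    rw [Matrix.mul_assoc, (symplectics_inverse hT).1, Matrix.mul_one]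

/-! ## Encoders -/

/-- The required rank is the number of columns, so by rank and nullity it amounts to injectivity,
the form in which the condition is used throughout. -/
theorem mem_encoders {n k : ℕ} {G : Matrix (Fin n ⊕ Fin n) (Fin n ⊕ Fin k) (ZMod 2)} :
    G ∈ encoders n k ↔ G.toCols₁ᵀ * symJ n * G.toCols₁ = 0 ∧
      G.toCols₂ᵀ * symJ n * G.toCols₂ = 0 ∧ Function.Injective G.mulVec := by
  have hr : G.rank = n + k ↔ Function.Injective G.mulVec := by
    rw [← Matrix.coe_mulVecLin, ← LinearMap.ker_eq_bot, ← Submodule.finrank_eq_zero]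
    have := LinearMap.finrank_range_add_finrank_ker G.mulVecLin
    rw [Module.finrank_fintype_fun_eq_card, Fintype.card_sum, Fintype.card_fin,
      Fintype.card_fin] at this
    rw [Matrix.rank]
    omega
  have hA : ∀ {α : Type} [Fintype α] (A : Matrix (Fin n ⊕ Fin n) α (ZMod 2)),
      Aᵀ * symJ n * A = 0 ↔ ∀ j j', sympInner (A.col j) (A.col j') = 0 := by
    intro α _ A
    rw [← Matrix.ext_iff]
    simp only [transpose_mul_symJ_mul_apply, Matrix.zero_apply]
  rw [hA, hA, ← hr]
  simp [encoders]

theorem fromCols_mem_encoders {n k : ℕ} {A : Matrix (Fin n ⊕ Fin n) (Fin n) (ZMod 2)}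
    {B : Matrix (Fin n ⊕ Fin n) (Fin k) (ZMod 2)} : fromCols A B ∈ encoders n k ↔
      Aᵀ * symJ n * A = 0 ∧ Bᵀ * symJ n * B = 0 ∧ Function.Injective (fromCols A B).mulVec := by
  rw [mem_encoders, toCols₁_fromCols, toCols₂_fromCols]

/-- The columns of an isotropic matrix of full rank `n` span their own orthogonal complement. -/
theorem exists_mulVec_eq_of_isotropic {n : ℕ} {A : Matrix (Fin n ⊕ Fin n) (Fin n) (ZMod 2)}
    (hA : Aᵀ * symJ n * A = 0) (hinj : Function.Injective A.mulVec) {v : PVec n}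
    (hv : (Aᵀ * symJ n).mulVec v = 0) : ∃ r, A.mulVec r = v := by
  have h1 : LinearMap.range A.mulVecLin ≤ LinearMap.ker (Aᵀ * symJ n).mulVecLin := by
    rintro _ ⟨r, rfl⟩
    rw [LinearMap.mem_ker, mulVecLin_apply, mulVecLin_apply, mulVec_mulVec, hA, zero_mulVec]
  have h2 : Module.finrank (ZMod 2) (LinearMap.range A.mulVecLin) = n := by
    rw [LinearMap.finrank_range_of_inj hinj, Module.finrank_fintype_fun_eq_card, Fintype.card_fin]
  have h3 : (Aᵀ * symJ n).rank = n := by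
    rw [rank_mul_eq_left_of_isUnit_det, rank_transpose]
    · exact h2
    · exact (isUnit_iff_isUnit_det _).mp (IsUnit.of_mul_eq_one _ (symJ_mul_self n))
  have h4 := LinearMap.finrank_range_add_finrank_ker (Aᵀ * symJ n).mulVecLin
  rw [Module.finrank_fintype_fun_eq_card, Fintype.card_sum, Fintype.card_fin] at h4
  rw [Matrix.rank] at h3
  -- Both spaces have dimension `n`: the column space by injectivity, the complement because it is
  -- the kernel of a matrix of rank `n` on a space of dimension `n + n`.
  have h5 := Submodule.eq_of_le_of_finrank_eq h1 (by omega)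
  have : v ∈ LinearMap.range A.mulVecLin := by
    rw [h5]
    exact hv
  exact this

/-- If `B y` pairs to zero with all columns of `A`, then it lies in their span, a Lagrangian being
its own orthogonal complement. Full rank of `[A | B]` then forces `y = 0`. This is what makes the
elimination against `B` possible. -/
theorem encoder_pairing_injective {n k : ℕ} {A : Matrix (Fin n ⊕ Fin n) (Fin n) (ZMod 2)}
    {B : Matrix (Fin n ⊕ Fin n) (Fin k) (ZMod 2)} (h : fromCols A B ∈ encoders n k) :
    Function.Injective A.mulVec ∧ Function.Injective (Aᵀ * symJ n * B).mulVec := by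
  obtain ⟨h1, h2, h3⟩ := fromCols_mem_encoders.mp h
  rw [← coe_mulVecLin, injective_iff_map_eq_zero] at h3
  simp only [mulVecLin_apply] at h3
  have hA : Function.Injective A.mulVec := by
    rw [← coe_mulVecLin, injective_iff_map_eq_zero]
    intro r hr
    have := h3 (Sum.elim r 0) (by
      rw [fromCols_mulVec]
      simpa using hr)
    ext i
    exact congrFun this (Sum.inl i)
  refine ⟨hA, ?_⟩
  rw [← coe_mulVecLin, injective_iff_map_eq_zero]
  intro y hy
  obtain ⟨r, hr⟩ := exists_mulVec_eq_of_isotropic h1 hA (v := B.mulVec y) (by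
    rw [mulVec_mulVec]; exact hy)
  have := h3 (Sum.elim r y) (by
    rw [fromCols_mulVec]
    simp only [Sum.elim_comp_inl, Sum.elim_comp_inr, hr]
    ext
    exact zmod2_add_self _)
  ext i
  exact congrFun this (Sum.inr i)

/-- The `n × k` matrix `[0; I]`. -/
def padMatrix (n k : ℕ) : Matrix (Fin n) (Fin k) (ZMod 2) :=
  Matrix.of fun i l => bit (i.1 = n - k + l.1)

theorem padMatrix_mulVec {n k : ℕ} (y : Bits k) : (padMatrix n k).mulVec y = pad n y := by
  ext i
  simp only [mulVec, dotProduct, padMatrix, of_apply, pad, bit]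
  split_ifs with h
  · rw [Finset.sum_eq_single ⟨i.1 - (n - k), by have := i.2; omega⟩]
    · rw [if_pos (by dsimp only; omega), one_mul]
    · intro l _ hl
      rw [if_neg, zero_mul]
      intro hc
      apply hl
      ext
      dsimp only
      omega
    · simp
  · refine Finset.sum_eq_zero fun l _ => ?_
    rw [if_neg (by omega), zero_mul]

theorem pad_injective {n k : ℕ} (hk : k ≤ n) : Function.Injective (pad n : Bits k → Bits n) := by
  intro x y h
  ext l
  have := congrFun h ⟨n - k + l.1, by have := l.2; omega⟩
  simpa [pad] using this

/-- The encoder `[S_Z P | S_X [0; I]]`. -/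
def encoderOf {n : ℕ} (k : ℕ) (S : Matrix (Fin n ⊕ Fin n) (Fin n ⊕ Fin n) (ZMod 2))
    (P : Matrix (Fin n) (Fin n) (ZMod 2)) : Matrix (Fin n ⊕ Fin n) (Fin n ⊕ Fin k) (ZMod 2) :=
  fromCols (S.toCols₂ * P) (S.toCols₁ * padMatrix n k)

theorem toCols_of_mem_symplectics {n : ℕ} {S : Matrix (Fin n ⊕ Fin n) (Fin n ⊕ Fin n) (ZMod 2)}
    (hS : S ∈ symplectics n) : S.toCols₁ᵀ * symJ n * S.toCols₁ = 0 ∧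
      S.toCols₂ᵀ * symJ n * S.toCols₁ = 1 ∧ S.toCols₂ᵀ * symJ n * S.toCols₂ = 0 ∧
      S.toCols₁ᵀ * symJ n * S.toCols₂ = 1 := by
  rw [← fromCols_toCols S, fromCols_mem_symplectics] at hS
  refine ⟨hS.1, hS.2.1, hS.2.2, ?_⟩
  rw [← transpose_inj, transpose_mul, transpose_mul, transpose_transpose, symJ_transpose,
    ← Matrix.mul_assoc, hS.2.1, transpose_one]

/-- For injectivity, pairing a vanishing combination with the `X` columns isolates `P` applied to
the first part of the coefficients, and pairing with the `Z` columns isolates the padded second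
part. -/
theorem encoderOf_mem {n k : ℕ} (hk : k ≤ n)
    {S : Matrix (Fin n ⊕ Fin n) (Fin n ⊕ Fin n) (ZMod 2)} (hS : S ∈ symplectics n)
    {P : Matrix (Fin n) (Fin n) (ZMod 2)} (hP : IsUnit P) : encoderOf k S P ∈ encoders n k := by
  obtain ⟨h1, h2, h3, h4⟩ := toCols_of_mem_symplectics hS
  rw [encoderOf, fromCols_mem_encoders]
  refine ⟨?_, ?_, ?_⟩
  · calc (S.toCols₂ * P)ᵀ * symJ n * (S.toCols₂ * P)
        = Pᵀ * (S.toCols₂ᵀ * symJ n * S.toCols₂) * P := by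
          simp only [transpose_mul, Matrix.mul_assoc]
      _ = 0 := by rw [h3]; simp
  · calc (S.toCols₁ * padMatrix n k)ᵀ * symJ n * (S.toCols₁ * padMatrix n k)
        = (padMatrix n k)ᵀ * (S.toCols₁ᵀ * symJ n * S.toCols₁) * padMatrix n k := by
          simp only [transpose_mul, Matrix.mul_assoc]
      _ = 0 := by rw [h1]; simp
  · rw [← coe_mulVecLin, injective_iff_map_eq_zero]
    intro w hw
    rw [mulVecLin_apply, fromCols_mulVec] at hw
    have e1 : P.mulVec (w ∘ Sum.inl) = 0 := by
      have := congrArg (S.toCols₁ᵀ * symJ n).mulVec hw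
      rw [mulVec_add, mulVec_mulVec, mulVec_mulVec, ← Matrix.mul_assoc, ← Matrix.mul_assoc, h1,
        h4] at this
      simpa using this
    have e2 : (padMatrix n k).mulVec (w ∘ Sum.inr) = 0 := by
      have := congrArg (S.toCols₂ᵀ * symJ n).mulVec hw
      rw [mulVec_add, mulVec_mulVec, mulVec_mulVec, ← Matrix.mul_assoc, ← Matrix.mul_assoc, h2,
        h3] at this
      simpa using this
    have e3 : w ∘ Sum.inl = 0 := by
      apply mulVec_injective_iff_isUnit.mpr hP
      rw [e1, mulVec_zero]
    have e4 : w ∘ Sum.inr = 0 := by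
      apply pad_injective hk
      rw [← padMatrix_mulVec, ← padMatrix_mulVec, e2, mulVec_zero]
    ext g
    rcases g with i | l
    · exact congrFun e3 i
    · exact congrFun e4 l

end LSN

namespace LSN

open Matrix

/-! ## Elimination -/

/-- The column operation with pivot among the first entries of `y`, up to position `T`: its
transpose maps `y` to the `T`-th unit vector and fixes all later unit vectors. -/
def elimMatrix {n : ℕ} (T : Fin n) (y : Fin n → ZMod 2) : Matrix (Fin n) (Fin n) (ZMod 2) :=
  let u := lastOne fun q => y q * bit (q ≤ T)
  of fun q' q => if q = T then u q' else
    u q * (bit (q' = T) + y T * u q') + (1 + u q) * (bit (q' = q) + y q * u q')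

theorem sum_bit_mul {ι : Type*} [Fintype ι] [DecidableEq ι] (p : ι) (f : ι → ZMod 2) :
    ∑ q, bit (q = p) * f q = f p := by
  simp [bit]

/-- Entry `T` receives the pivot entry, entry `p` receives the old entry `T`, and multiples of the
pivot entry are then added everywhere except at `T`. For `w = y` this leaves the unit vector at `T`,
since `y p = 1`. Truncating `y` before taking the pivot gives `p ≤ T`; testing `q = T` first covers
the case `p = T`. -/
theorem exists_elimMatrix {n : ℕ} {T : Fin n} {y : Fin n → ZMod 2} (hy : ∃ q ≤ T, y q ≠ 0) :
    ∃ p ≤ T, y p = 1 ∧ ∀ w q, ((elimMatrix T y)ᵀ).mulVec w q =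
      if q = T then w p else if q = p then w T + y T * w p else w q + y q * w p := by
  obtain ⟨q, hq, hyq⟩ := hy
  obtain ⟨p, h1, -, h2⟩ := exists_lastOne (y := fun q => y q * bit (q ≤ T))
    (Function.ne_iff.mpr ⟨q, by simpa [bit, hq] using hyq⟩)
  have hpT : p ≤ T := by
    by_contra hc
    simp [bit, hc] at h1
  refine ⟨p, hpT, by simpa [bit, hpT] using h1, fun w q => ?_⟩
  simp only [mulVec, dotProduct, transpose_apply, elimMatrix, of_apply, h2]
  have h11 : (1 : ZMod 2) + 1 = 0 := by decide
  by_cases hqT : q = T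
  · simp only [hqT, if_true, sum_bit_mul]
  by_cases hqp : q = p
  · have hpT' : p ≠ T := by rwa [← hqp]
    simp only [hqp, hpT', if_true, if_false, bit, h11, one_mul, zero_mul, add_zero]
    simp [add_mul, Finset.sum_add_distrib]
  · simp only [hqT, hqp, if_false, bit, zero_mul, zero_add, add_zero, one_mul]
    simp [add_mul, Finset.sum_add_distrib]

theorem isUnit_elimMatrix {n : ℕ} {T : Fin n} {y : Fin n → ZMod 2} (hy : ∃ q ≤ T, y q ≠ 0) :
    IsUnit (elimMatrix T y) := by
  obtain ⟨p, hp, hyp, h⟩ := exists_elimMatrix hy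
  rw [← isUnit_transpose, ← mulVec_injective_iff_isUnit, ← coe_mulVecLin,
    injective_iff_map_eq_zero]
  intro w hw
  have hw' : ∀ q, ((elimMatrix T y)ᵀ).mulVec w q = 0 := fun q => congrFun hw q
  simp only [h] at hw'
  have h1 : w p = 0 := by simpa using hw' T
  have h2 : w T = 0 := by
    by_cases hpT : p = T
    · rw [← hpT, h1]
    · simpa [hpT, h1] using hw' p
  ext q
  by_cases hqT : q = T
  · rw [hqT, h2]; rfl
  by_cases hqp : q = p
  · rw [hqp, h1]; rfl
  · simpa [hqT, hqp, h1] using hw' q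

/-- The product of the column operations for the last `t` columns of `N`. -/
def elimProduct {n k : ℕ} (hk : k ≤ n) (N : Matrix (Fin n) (Fin k) (ZMod 2)) :
    ℕ → Matrix (Fin n) (Fin n) (ZMod 2)
  | 0 => 1
  | t + 1 => if h : t < k then
      elimProduct hk N t * elimMatrix ⟨n - 1 - t, by omega⟩
        fun q => ((elimProduct hk N t)ᵀ * N) q ⟨k - 1 - t, by omega⟩
    else elimProduct hk N t

/-- The columns are put into standard form from the last one backwards. A later step uses only rows
up to its own `T`, where the finished columns vanish, and therefore does not disturb them. -/
theorem elimProduct_spec {n k : ℕ} (hk : k ≤ n) {N : Matrix (Fin n) (Fin k) (ZMod 2)}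
    (hN : Function.Injective N.mulVec) : ∀ t ≤ k, IsUnit (elimProduct hk N t) ∧
      ∀ l : Fin k, k - t ≤ l → ∀ q, ((elimProduct hk N t)ᵀ * N) q l = padMatrix n k q l
  | 0, _ => ⟨isUnit_one, fun l hl => absurd l.2 (by omega)⟩
  | t + 1, ht => by
    obtain ⟨ih1, ih2⟩ := elimProduct_spec hk hN t (by omega)
    rw [elimProduct, dif_pos (show t < k from ht)]
    set Q := elimProduct hk N t with hQ
    set T : Fin n := ⟨n - 1 - t, by omega⟩ with hT
    set l₀ : Fin k := ⟨k - 1 - t, by omega⟩ with hl₀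
    set y : Fin n → ZMod 2 := fun q => (Qᵀ * N) q l₀ with hy
    have hpiv : ∃ q ≤ T, y q ≠ 0 := by
      by_contra hc
      push Not at hc
      have hinj : Function.Injective (Qᵀ * N).mulVec := by
        have hQ' := mulVec_injective_iff_isUnit.mpr ((isUnit_transpose (A := Q)).mpr ih1)
        intro a b hab
        rw [← mulVec_mulVec, ← mulVec_mulVec] at hab
        exact hN (hQ' hab)
      -- Without a pivot up to row `T`, column `l₀` would be supported on the rows below `T`. The
      -- finished columns are exactly the unit vectors of these rows, so column `l₀` would be a
      -- combination of them, against injectivity.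
      have e : (Qᵀ * N).mulVec (fun l => if l₀ < l then
          (if h : n - k + l.1 < n then y ⟨n - k + l.1, h⟩ else 0) else 0)
          = (Qᵀ * N).mulVec (Pi.single l₀ 1) := by
        ext q
        rw [mulVec_single_one]
        simp only [mulVec, dotProduct, col_apply]
        change _ = y q
        have e1 : ∀ l : Fin k, (Qᵀ * N) q l * (if l₀ < l then
            (if h : n - k + l.1 < n then y ⟨n - k + l.1, h⟩ else 0) else 0)
            = if l₀ < l ∧ q.1 = n - k + l.1 then y q else 0 := by
          intro l
          by_cases hl : l₀ < l
          · have hlv : k - 1 - t < l.1 := hl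
            rw [ih2 l (by omega) q, if_pos hl, dif_pos (by have := l.2; omega)]
            simp only [padMatrix, of_apply, bit, hl, true_and]
            split_ifs with h
            · rw [one_mul]
              congr 1
              ext
              exact h.symm
            · rw [zero_mul]
          · simp [hl]
        simp only [e1]
        by_cases hq : q ≤ T
        · rw [hc q hq]
          simp
        · have hq' : n - 1 - t < q.1 := not_le.mp hq
          rw [Finset.sum_eq_single ⟨q.1 - (n - k), by have := q.2; omega⟩]
          · rw [if_pos]
            refine ⟨?_, by dsimp only; omega⟩
            rw [Fin.lt_def]
            dsimp only [l₀]
            omega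
          · intro l _ hl
            rw [if_neg]
            rintro ⟨-, h⟩
            exact hl (Fin.ext (by dsimp only; omega))
          · simp
      have := congrFun (hinj e) l₀
      simp at this
    obtain ⟨p, hp, hyp, hE⟩ := exists_elimMatrix hpiv
    refine ⟨ih1.mul (isUnit_elimMatrix hpiv), fun l hl q => ?_⟩
    rw [transpose_mul, Matrix.mul_assoc]
    have e : ((elimMatrix T y)ᵀ * (Qᵀ * N)) q l
        = ((elimMatrix T y)ᵀ).mulVec (fun q => (Qᵀ * N) q l) q := rfl
    rw [e, hE]
    by_cases hl' : l = l₀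
    · subst hl'
      have e1 : ∀ q, padMatrix n k q l₀ = bit (q = T) := by
        intro q
        simp only [padMatrix, of_apply, bit, Fin.ext_iff, hT, hl₀]
        congr 1
        have := q.2
        exact propext ⟨fun _ => by omega, fun _ => by omega⟩
      rw [e1]
      change (if q = T then y p else if q = p then y T + y T * y p else y q + y q * y p) = _
      simp only [hyp, mul_one, zmod2_add_self, bit]
      split_ifs <;> rfl
    · have hlt : l₀.1 < l.1 := by
        have h1 : l.1 ≠ l₀.1 := fun h => hl' (Fin.ext h)
        dsimp only [l₀] at h1 ⊢
        omega
      dsimp only [l₀] at hlt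
      -- A finished column `l` has its only entry in row `n - k + l`, strictly below row `T`.
      have e2 : ∀ q ≤ T, (Qᵀ * N) q l = 0 := by
        intro q hq
        have hq' : q.1 ≤ n - 1 - t := hq
        rw [ih2 l (by omega)]
        simp only [padMatrix, of_apply, bit]
        rw [if_neg]
        omega
      have e3 := e2 p hp
      have e4 := e2 T le_rfl
      rw [← ih2 l (by omega) q, e3, e4]
      split_ifs with h1 h2
      · rw [h1, e4]
      · rw [h2, e3, mul_zero, add_zero]
      · rw [mul_zero, add_zero]

/-! ## A left inverse of an injective matrix -/

/-- One step of the computation of a left inverse: `F` is a left inverse for the columns before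
column `j`. -/
def leftInvStep {N n : ℕ} (A : Matrix (Fin N) (Fin n) (ZMod 2))
    (F : Matrix (Fin n) (Fin N) (ZMod 2)) (j : Fin n) : Matrix (Fin n) (Fin N) (ZMod 2) :=
  let y : Fin n → ZMod 2 := fun q => ∑ h, F q h * A h j
  let u := lastOne fun h => ∑ q, (y q + bit (q = j)) * A h q
  let s : Fin n → ZMod 2 := fun q => ∑ h, u h * A h q
  let f : Fin N → ZMod 2 := fun h => ∑ q, (s q * F q h + bit (q = j) * u h)
  of fun q h => F q h + (y q + bit (q = j)) * f h

/-- The first `t` steps of the computation of a left inverse. -/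
def leftInv {N n : ℕ} (A : Matrix (Fin N) (Fin n) (ZMod 2)) : ℕ → Matrix (Fin n) (Fin N) (ZMod 2)
  | 0 => 0
  | t + 1 => if h : t < n then leftInvStep A (leftInv A t) ⟨t, h⟩ else leftInv A t

/-- The residual of column `j` is `A (y + e_j)`, where `y` is `F` applied to that column. At a pivot
`g` of the residual, the functional `f`, row `g` of `1 + A F`, vanishes on the earlier columns and
takes the value `1` on column `j`. Adding `(y + e_j) f` to `F` therefore repairs column `j` and
changes nothing on the earlier ones. Keeping the unused rows of `F` zero makes all sums range over
full index sets. -/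
theorem leftInvStep_spec {N n : ℕ} {A : Matrix (Fin N) (Fin n) (ZMod 2)}
    (hA : Function.Injective A.mulVec) {F : Matrix (Fin n) (Fin N) (ZMod 2)} {j : Fin n}
    (h1 : ∀ q i, q < j → i < j → ∑ h, F q h * A h i = bit (q = i))
    (h2 : ∀ q h, j ≤ q → F q h = 0) :
    (∀ q i, q ≤ j → i ≤ j → ∑ h, leftInvStep A F j q h * A h i = bit (q = i)) ∧
      ∀ q h, j < q → leftInvStep A F j q h = 0 := by
  set y : Fin n → ZMod 2 := fun q => ∑ h, F q h * A h j with hy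
  have hy0 : ∀ q, j ≤ q → y q = 0 := fun q hq => Finset.sum_eq_zero fun h _ => by
    rw [h2 q h hq, zero_mul]
  -- The residual is nonzero by injectivity of `A`: its coefficient vector has entry `1` at `j`,
  -- since `y` vanishes from `j` on.
  obtain ⟨g, hg1, -, hg2⟩ := exists_lastOne (y := fun h => ∑ q, (y q + bit (q = j)) * A h q) (by
    intro hc
    have h3 : A.mulVec (fun q => y q + bit (q = j)) = A.mulVec 0 := by
      rw [mulVec_zero, ← hc]
      ext h
      simp only [mulVec, dotProduct]
      exact Finset.sum_congr rfl fun q _ => mul_comm _ _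
    have := congrFun (hA h3) j
    simp [hy0 j le_rfl, bit] at this)
  set f : Fin N → ZMod 2 := fun h => (∑ q, A g q * F q h) + bit (h = g) with hf
  have e : ∀ q h, leftInvStep A F j q h = F q h + (y q + bit (q = j)) * f h := by
    intro q h
    have hu : lastOne (fun h => ∑ q, (y q + bit (q = j)) * A h q) = fun h => bit (h = g) :=
      funext hg2
    have e' : leftInvStep A F j q h = F q h + (y q + bit (q = j)) * ∑ q',
        ((∑ h', lastOne (fun h => ∑ q, (y q + bit (q = j)) * A h q) h' * A h' q') * F q' h
          + bit (q' = j) * lastOne (fun h => ∑ q, (y q + bit (q = j)) * A h q) h) := rfl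
    rw [e', hu]
    simp only [hf, sum_bit_mul, Finset.sum_add_distrib]
  have hfi : ∀ i < j, ∑ h, f h * A h i = 0 := by
    intro i hi
    have e1 : ∑ h, f h * A h i = (∑ q, A g q * ∑ h, F q h * A h i) + A g i := by
      simp only [hf, add_mul, Finset.sum_add_distrib, sum_bit_mul, Finset.sum_mul, Finset.mul_sum,
        mul_assoc]
      rw [Finset.sum_comm]
    have e2 : ∀ q, A g q * ∑ h, F q h * A h i = bit (q = i) * A g q := by
      intro q
      rcases lt_or_ge q j with hq | hq
      · rw [h1 q i hq hi, mul_comm]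
      · rw [Finset.sum_eq_zero fun h _ => by rw [h2 q h hq, zero_mul], bit,
          if_neg (by rintro rfl; exact absurd hi (not_lt.mpr hq)), mul_zero, zero_mul]
    simp only [e1, e2, sum_bit_mul, zmod2_add_self]
  have hfj : ∑ h, f h * A h j = 1 := by
    rw [← hg1]
    simp only [hf, add_mul, Finset.sum_add_distrib, sum_bit_mul, Finset.sum_mul, mul_assoc]
    rw [Finset.sum_comm]
    congr 1
    refine Finset.sum_congr rfl fun q _ => ?_
    rw [← Finset.mul_sum, mul_comm]
  refine ⟨fun q i hq hi => ?_, fun q h hq => ?_⟩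
  · have e3 : ∑ h, leftInvStep A F j q h * A h i
        = (∑ h, F q h * A h i) + (y q + bit (q = j)) * ∑ h, f h * A h i := by
      simp only [e, add_mul, Finset.sum_add_distrib, Finset.mul_sum, mul_assoc]
    rw [e3]
    rcases hi.lt_or_eq with hi | rfl
    · rw [hfi i hi, mul_zero, add_zero]
      rcases hq.lt_or_eq with hq | rfl
      · exact h1 q i hq hi
      · rw [Finset.sum_eq_zero fun h _ => by rw [h2 q h le_rfl, zero_mul], bit,
          if_neg hi.ne']
    · rw [hfj, mul_one, ← add_assoc]
      change y q + y q + _ = _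
      rw [zmod2_add_self, zero_add]
  · rw [e, h2 q h hq.le, hy0 q hq.le, bit, if_neg hq.ne']
    simp

theorem leftInv_mul {N n : ℕ} {A : Matrix (Fin N) (Fin n) (ZMod 2)}
    (hA : Function.Injective A.mulVec) : leftInv A n * A = 1 := by
  have key : ∀ t ≤ n, (∀ q i : Fin n, q.1 < t → i.1 < t →
      ∑ h, leftInv A t q h * A h i = bit (q = i)) ∧
      ∀ (q : Fin n) h, t ≤ q → leftInv A t q h = 0 := by
    intro t
    induction t with
    | zero => exact fun _ => ⟨fun q i hq => absurd hq (by omega), fun _ _ _ => rfl⟩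
    | succ t ih =>
      intro ht
      obtain ⟨h1, h2⟩ := ih (by omega)
      obtain ⟨h3, h4⟩ := leftInvStep_spec hA (F := leftInv A t) (j := ⟨t, ht⟩)
        (fun q i hq hi => h1 q i hq hi) (fun q h hq => h2 q h hq)
      rw [leftInv, dif_pos (show t < n from ht)]
      exact ⟨fun q i hq hi => h3 q i (Nat.lt_succ_iff.mp hq) (Nat.lt_succ_iff.mp hi),
        fun q h hq => h4 q h hq⟩
  ext q i
  rw [Matrix.mul_apply, (key n le_rfl).1 q i q.2 i.2, Matrix.one_apply]
  rfl

end LSN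

namespace LSN

open Matrix

/-! ## Completing an encoder to a symplectic matrix -/

/-- The matrix with dual columns to `A` in front and `B` as last columns. -/
def dualColumns {n k : ℕ} (A : Matrix (Fin n ⊕ Fin n) (Fin n) (ZMod 2))
    (B : Matrix (Fin n ⊕ Fin n) (Fin k) (ZMod 2)) : Matrix (Fin n ⊕ Fin n) (Fin n) (ZMod 2) :=
  of fun g j => if h : n - k ≤ j.1 then B g ⟨j.1 - (n - k), by have := j.2; omega⟩
    else leftInv (A.submatrix finSumFinEquiv.symm id) n j (finSumFinEquiv g.swap)

theorem dualColumns_mul_padMatrix {n k : ℕ} (hk : k ≤ n)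
    (A : Matrix (Fin n ⊕ Fin n) (Fin n) (ZMod 2)) (B : Matrix (Fin n ⊕ Fin n) (Fin k) (ZMod 2)) :
    dualColumns A B * padMatrix n k = B := by
  ext g l
  have hl := l.2
  simp only [Matrix.mul_apply, padMatrix, of_apply]
  rw [Finset.sum_eq_single ⟨n - k + l.1, by omega⟩]
  · simp only [dualColumns, of_apply, bit, if_true, mul_one]
    rw [dif_pos (Nat.le_add_right _ _)]
    simp
  · intro j _ hj
    rw [bit, if_neg fun hc => hj (Fin.ext hc), mul_zero]
  · simp

/-- For the last `k` columns this is the normal form reached by elimination. The other columns are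
rows of a left inverse with their two halves exchanged, so that pairing them with `A` is
multiplication of `A` by the left inverse. -/
theorem dualColumns_pairing {n k : ℕ} {A : Matrix (Fin n ⊕ Fin n) (Fin n) (ZMod 2)}
    {B : Matrix (Fin n ⊕ Fin n) (Fin k) (ZMod 2)} (hA : Function.Injective A.mulVec)
    (hAB : Aᵀ * symJ n * B = padMatrix n k) : Aᵀ * symJ n * dualColumns A B = 1 := by
  ext i j
  by_cases hj : n - k ≤ j.1
  · have hj2 := j.2
    have e : (Aᵀ * symJ n * dualColumns A B) i j
        = (Aᵀ * symJ n * B) i ⟨j.1 - (n - k), by omega⟩ := by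
      rw [Matrix.mul_apply, Matrix.mul_apply]
      refine Finset.sum_congr rfl fun g _ => ?_
      rw [dualColumns, of_apply, dif_pos hj]
    rw [e, hAB, padMatrix, of_apply, bit, Matrix.one_apply]
    congr 1
    rw [Fin.ext_iff]
    dsimp only
    exact propext ⟨fun _ => by omega, fun _ => by omega⟩
  · have hinj : Function.Injective (A.submatrix (finSumFinEquiv (m := n) (n := n)).symm
        id).mulVec := by
      intro x y hxy
      apply hA
      ext g
      have := congrFun hxy (finSumFinEquiv g)
      simpa [mulVec, dotProduct] using this
    have h := congrFun (congrFun (leftInv_mul hinj) j) i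
    rw [transpose_mul_symJ_mul_apply, sympInner_comm, sympInner_eq]
    rw [Matrix.mul_apply, ← finSumFinEquiv.sum_comp] at h
    rw [← (Equiv.sumComm (Fin n) (Fin n)).sum_comp]
    simp only [Equiv.sumComm_apply, Sum.swap_swap, col_apply]
    rw [Matrix.one_apply] at h ⊢
    simp only [eq_comm (a := i)]
    rw [← h]
    refine Finset.sum_congr rfl fun g _ => ?_
    rw [dualColumns, of_apply, dif_neg hj]
    simp

/-- The entries below the diagonal. -/
def lowerPart {n : ℕ} (N : Matrix (Fin n) (Fin n) (ZMod 2)) : Matrix (Fin n) (Fin n) (ZMod 2) :=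
  of fun i j => bit (j < i) * N i j

/-- In characteristic two a Gram matrix of the symplectic form is symmetric with zero diagonal, and
cannot be halved. Its strictly lower part is the substitute for one half of it. -/
theorem lowerPart_add_transpose {n : ℕ} {N : Matrix (Fin n) (Fin n) (ZMod 2)} (hN : Nᵀ = N)
    (h0 : ∀ i, N i i = 0) : lowerPart N + (lowerPart N)ᵀ = N := by
  ext i j
  have h1 : N j i = N i j := congrFun (congrFun hN i) j
  simp only [lowerPart, Matrix.add_apply, transpose_apply, of_apply, h1, bit]
  rcases lt_trichotomy i j with h | rfl | h
  · simp [h, h.not_gt]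
  · simp [h0]
  · simp [h, h.not_gt]

/-- The columns of `A` after the elimination that makes the pairing with `B` standard. -/
def reducedColumns {n k : ℕ} (hk : k ≤ n)
    (G : Matrix (Fin n ⊕ Fin n) (Fin n ⊕ Fin k) (ZMod 2)) :
    Matrix (Fin n ⊕ Fin n) (Fin n) (ZMod 2) :=
  G.toCols₁ * elimProduct hk (G.toCols₁ᵀ * symJ n * G.toCols₂) k

/-- The completion of an encoder to a symplectic matrix that is described by the symmetric
matrix `Y`. -/
def completion {n k : ℕ} (hk : k ≤ n) (G : Matrix (Fin n ⊕ Fin n) (Fin n ⊕ Fin k) (ZMod 2))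
    (Y : Matrix (Fin n) (Fin n) (ZMod 2)) : Matrix (Fin n ⊕ Fin n) (Fin n ⊕ Fin n) (ZMod 2) :=
  let A := reducedColumns hk G
  let X := dualColumns A G.toCols₂
  fromCols (X + A * (lowerPart (Xᵀ * symJ n * X) + Y)) A

/-- The symmetric matrices that are supported on the first `n - k` rows and columns. -/
def IsShear {n : ℕ} (k : ℕ) (Y : Matrix (Fin n) (Fin n) (ZMod 2)) : Prop :=
  Yᵀ = Y ∧ Y * padMatrix n k = 0

theorem isShear_zero {n k : ℕ} : IsShear k (0 : Matrix (Fin n) (Fin n) (ZMod 2)) :=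
  ⟨transpose_zero, Matrix.zero_mul _⟩

/-- Write `A'` for the reduced columns, `X` for their duals and `N` for the Gram matrix of `X`.
Replacing `X` by `X + A' V` keeps the duality, because `A'` is isotropic, and changes the Gram
matrix to `N + V + Vᵀ`. This vanishes for the lower part of `N` plus any symmetric `Y`. The last
columns remain those of the encoder because both summands of `V` annihilate `[0; I]`. -/
theorem completion_spec {n k : ℕ} (hk : k ≤ n)
    {G : Matrix (Fin n ⊕ Fin n) (Fin n ⊕ Fin k) (ZMod 2)} (hG : G ∈ encoders n k)
    {Y : Matrix (Fin n) (Fin n) (ZMod 2)} (hY : IsShear k Y) :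
    completion hk G Y ∈ symplectics n ∧
      (completion hk G Y).toCols₁ * padMatrix n k = G.toCols₂ ∧
      (reducedColumns hk G)ᵀ * symJ n * G.toCols₁ = 0 ∧
      (reducedColumns hk G)ᵀ * symJ n * G.toCols₂ = padMatrix n k ∧
      ∃ P : Matrix (Fin n) (Fin n) (ZMod 2), IsUnit P ∧ G.toCols₁ = reducedColumns hk G * P := by
  set A := G.toCols₁ with hA
  set B := G.toCols₂ with hB
  have hG' : fromCols A B ∈ encoders n k := by rwa [fromCols_toCols]
  obtain ⟨g1, g2, -⟩ := fromCols_mem_encoders.mp hG'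
  obtain ⟨g3, g4⟩ := encoder_pairing_injective hG'
  obtain ⟨q1, q2⟩ := elimProduct_spec hk g4 k le_rfl
  set Q := elimProduct hk (Aᵀ * symJ n * B) k with hQ
  have hA' : reducedColumns hk G = A * Q := rfl
  set A' := reducedColumns hk G with hA'0
  set X := dualColumns A' B with hX
  have e0 : A'ᵀ * symJ n * A = 0 := by
    rw [hA', transpose_mul, Matrix.mul_assoc, Matrix.mul_assoc, ← Matrix.mul_assoc Aᵀ, g1,
      Matrix.mul_zero]
  have e1 : A'ᵀ * symJ n * A' = 0 := by
    conv_lhs => rw [hA', ← Matrix.mul_assoc, ← hA', e0]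
    rw [Matrix.zero_mul]
  have e2 : A'ᵀ * symJ n * B = padMatrix n k := by
    rw [hA', transpose_mul, Matrix.mul_assoc, Matrix.mul_assoc, ← Matrix.mul_assoc Aᵀ]
    ext q l
    exact q2 l (by omega) q
  have hinj : Function.Injective A'.mulVec := by
    intro x y hxy
    rw [hA', ← mulVec_mulVec, ← mulVec_mulVec] at hxy
    exact mulVec_injective_iff_isUnit.mpr q1 (g3 hxy)
  have e3 : A'ᵀ * symJ n * X = 1 := dualColumns_pairing hinj e2
  have e4 : Xᵀ * symJ n * A' = 1 := by
    rw [← transpose_inj, transpose_mul, transpose_mul, transpose_transpose, symJ_transpose,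
      ← Matrix.mul_assoc, e3, transpose_one]
  set N := Xᵀ * symJ n * X with hN
  have hNt : Nᵀ = N := by
    rw [hN, transpose_mul, transpose_mul, transpose_transpose, symJ_transpose, Matrix.mul_assoc]
  have hN0 : ∀ i, N i i = 0 := by
    intro i
    rw [hN, transpose_mul_symJ_mul_apply, sympInner_self]
  have hXB : X * padMatrix n k = B := dualColumns_mul_padMatrix hk A' B
  -- A strictly lower entry in one of the last `k` columns also lies in one of the last `k` rows,
  -- and that block of `N` is the Gram matrix of the second half of the encoder, which is zero.
  have e5 : lowerPart N * padMatrix n k = 0 := by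
    ext i l
    have hl := l.2
    rw [Matrix.mul_apply, Finset.sum_eq_single ⟨n - k + l.1, by omega⟩]
    · simp only [lowerPart, of_apply, padMatrix, bit, if_true, mul_one]
      rw [ite_mul, zero_mul, one_mul, Matrix.zero_apply]
      split_ifs with h
      · have hi : n - k + l.1 < i.1 := h
        have hi2 := i.2
        have e6 : (padMatrix n k)ᵀ * N * padMatrix n k = 0 := by
          rw [← g2, ← hXB]
          simp only [hN, transpose_mul, Matrix.mul_assoc]
        have e7 := congrFun (congrFun e6 ⟨i.1 - (n - k), by omega⟩) l
        rw [Matrix.mul_apply, Finset.sum_eq_single ⟨n - k + l.1, by omega⟩, Matrix.mul_apply,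
          Finset.sum_eq_single i] at e7
        · have h8 : i.1 = n - k + (i.1 - (n - k)) := by omega
          simpa [padMatrix, bit, ← h8] using e7
        · intro j _ hj
          rw [transpose_apply, padMatrix, of_apply, bit, if_neg, zero_mul]
          intro hc
          exact hj (Fin.ext (by dsimp only at hc; omega))
        · simp
        · intro j _ hj
          rw [padMatrix, of_apply, bit, if_neg fun hc => hj (Fin.ext hc), mul_zero]
        · simp
      · rfl
    · intro j _ hj
      rw [padMatrix, of_apply, bit, if_neg fun hc => hj (Fin.ext hc), mul_zero]
    · simp
  have hC : completion hk G Y = fromCols (X + A' * (lowerPart N + Y)) A' := rfl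
  refine ⟨?_, ?_, e0, e2, Q⁻¹, isUnit_nonsing_inv_iff.mpr q1, ?_⟩
  · rw [hC, fromCols_mem_symplectics]
    set V := lowerPart N + Y with hV
    have hVV : N + V + Vᵀ = 0 := by
      rw [hV, transpose_add, hY.1]
      calc N + (lowerPart N + Y) + ((lowerPart N)ᵀ + Y)
          = (N + (lowerPart N + (lowerPart N)ᵀ)) + (Y + Y) := by abel
        _ = 0 := by rw [lowerPart_add_transpose hNt hN0, matrix_add_self, matrix_add_self, add_zero]
    refine ⟨?_, ?_, e1⟩
    · calc (X + A' * V)ᵀ * symJ n * (X + A' * V)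
          = Xᵀ * symJ n * X + (Xᵀ * symJ n * A') * V + Vᵀ * (A'ᵀ * symJ n * X)
            + Vᵀ * (A'ᵀ * symJ n * A') * V := by
            simp only [transpose_add, transpose_mul, Matrix.add_mul, Matrix.mul_add,
              Matrix.mul_assoc]
            abel
        _ = 0 := by
            rw [e4, e3, e1, Matrix.one_mul, Matrix.mul_one, Matrix.mul_zero, Matrix.zero_mul,
              add_zero, ← hN, hVV]
    · rw [Matrix.mul_add, e3, ← Matrix.mul_assoc, e1, Matrix.zero_mul, add_zero]
  · rw [hC, toCols₁_fromCols, Matrix.add_mul, hXB, Matrix.mul_assoc, Matrix.add_mul, e5, hY.2,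
      add_zero, Matrix.mul_zero, add_zero]
  · rw [hA', Matrix.mul_assoc, mul_nonsing_inv _ ((isUnit_iff_isUnit_det _).mp q1),
      Matrix.mul_one]

theorem completion_toCols₂ {n k : ℕ} (hk : k ≤ n)
    (G : Matrix (Fin n ⊕ Fin n) (Fin n ⊕ Fin k) (ZMod 2)) (Y : Matrix (Fin n) (Fin n) (ZMod 2)) :
    (completion hk G Y).toCols₂ = reducedColumns hk G := by
  simp [completion]

theorem completion_add {n k : ℕ} (hk : k ≤ n)
    (G : Matrix (Fin n ⊕ Fin n) (Fin n ⊕ Fin k) (ZMod 2)) (Y Y' : Matrix (Fin n) (Fin n) (ZMod 2)) :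
    completion hk G (Y' + Y)
      = fromCols ((completion hk G Y').toCols₁ + reducedColumns hk G * Y)
          (reducedColumns hk G) := by
  simp only [completion, toCols₁_fromCols]
  congr 1
  rw [add_assoc, ← Matrix.mul_add, add_assoc]

/-- Two completions differ by a symmetric matrix. -/
theorem exists_shear {n k : ℕ} {S T : Matrix (Fin n ⊕ Fin n) (Fin n ⊕ Fin n) (ZMod 2)}
    (hS : S ∈ symplectics n) (hT : T ∈ symplectics n) (h₂ : T.toCols₂ = S.toCols₂)
    (h₁ : T.toCols₁ * padMatrix n k = S.toCols₁ * padMatrix n k) :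
    ∃ Y : Matrix (Fin n) (Fin n) (ZMod 2), IsShear k Y ∧ T.toCols₁ = S.toCols₁ + S.toCols₂ * Y := by
  obtain ⟨s1, s2, s3, s4⟩ := toCols_of_mem_symplectics hS
  obtain ⟨t1, t2, t3, t4⟩ := toCols_of_mem_symplectics hT
  -- The coordinates of the difference in the basis given by `S`. Isotropy of the `X` columns of `T`
  -- makes `Y + Yᵀ` vanish; the common last columns make `Y` annihilate `[0; I]`.
  set Y := S.toCols₁ᵀ * symJ n * T.toCols₁ with hY
  have e1 : T.toCols₁ = S.toCols₁ + S.toCols₂ * Y := by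
    have h := (symplectics_inverse hS).1
    -- Columns that pair to zero with the whole symplectic basis are zero, so the identity may be
    -- checked after pairing with `S`.
    have hinj : ∀ D : Matrix (Fin n ⊕ Fin n) (Fin n) (ZMod 2), Sᵀ * symJ n * D = 0 → D = 0 := by
      intro D hD
      have h' := (symplectics_inverse hS).2
      have : S * (symJ n * Sᵀ * symJ n) * D = S * symJ n * (Sᵀ * symJ n * D) := by
        simp only [Matrix.mul_assoc]
      rwa [h', hD, Matrix.one_mul, Matrix.mul_zero] at this
    apply eq_of_matrix_add_eq_zero
    apply hinj
    rw [← fromCols_toCols S, transpose_fromCols, fromRows_mul, fromRows_mul, fromCols_toCols]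
    simp only [Matrix.mul_add, ← Matrix.mul_assoc, s1, s2, s3, s4, Matrix.one_mul,
      Matrix.zero_mul, zero_add, add_zero]
    rw [← hY, matrix_add_self, ← h₂, t2, matrix_add_self]
    ext (i | i) j <;> rfl
  refine ⟨Y, ⟨?_, ?_⟩, e1⟩
  · have e2 : T.toCols₁ᵀ * symJ n * T.toCols₁ = Y + Yᵀ := by
      conv_lhs => rw [e1]
      calc (S.toCols₁ + S.toCols₂ * Y)ᵀ * symJ n * (S.toCols₁ + S.toCols₂ * Y)
          = S.toCols₁ᵀ * symJ n * S.toCols₁ + (S.toCols₁ᵀ * symJ n * S.toCols₂) * Y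
            + Yᵀ * (S.toCols₂ᵀ * symJ n * S.toCols₁)
            + Yᵀ * (S.toCols₂ᵀ * symJ n * S.toCols₂) * Y := by
            simp only [transpose_add, transpose_mul, Matrix.add_mul, Matrix.mul_add,
              Matrix.mul_assoc]
            abel
        _ = Y + Yᵀ := by
            rw [s1, s2, s3, s4, Matrix.one_mul, Matrix.mul_one, Matrix.mul_zero, Matrix.zero_mul,
              add_zero, zero_add]
    rw [t1] at e2
    exact (eq_of_matrix_add_eq_zero e2.symm).symm
  · rw [hY, Matrix.mul_assoc, h₁, ← Matrix.mul_assoc, s1, Matrix.zero_mul]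

theorem mul_mem_encoders {n k : ℕ} {T : Matrix (Fin n ⊕ Fin n) (Fin n ⊕ Fin n) (ZMod 2)}
    (hT : T ∈ symplectics n) {A : Matrix (Fin n ⊕ Fin n) (Fin n) (ZMod 2)}
    {B : Matrix (Fin n ⊕ Fin n) (Fin k) (ZMod 2)} (h : fromCols A B ∈ encoders n k)
    {R : Matrix (Fin n) (Fin n) (ZMod 2)} (hR : IsUnit R) :
    fromCols (T * A * R) (T * B) ∈ encoders n k := by
  obtain ⟨h1, h2, h3⟩ := fromCols_mem_encoders.mp h
  have hT' := mem_symplectics.mp hT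
  refine fromCols_mem_encoders.mpr ⟨?_, ?_, ?_⟩
  · calc (T * A * R)ᵀ * symJ n * (T * A * R) = Rᵀ * (Aᵀ * (Tᵀ * symJ n * T) * A) * R := by
          simp only [transpose_mul, Matrix.mul_assoc]
      _ = 0 := by rw [hT', h1]; simp
  · calc (T * B)ᵀ * symJ n * (T * B) = Bᵀ * (Tᵀ * symJ n * T) * B := by
          simp only [transpose_mul, Matrix.mul_assoc]
      _ = 0 := by rw [hT', h2]
  · rw [← coe_mulVecLin, injective_iff_map_eq_zero] at h3 ⊢
    intro w hw
    rw [mulVecLin_apply, fromCols_mulVec, ← mulVec_mulVec, ← mulVec_mulVec, ← mulVec_mulVec,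
      ← mulVec_add] at hw
    have h4 := congrArg (symJ n * Tᵀ * symJ n).mulVec hw
    rw [mulVec_mulVec, (symplectics_inverse hT).1, one_mulVec, mulVec_zero] at h4
    have h5 := h3 (Sum.elim (R.mulVec (w ∘ Sum.inl)) (w ∘ Sum.inr)) (by
      rw [mulVecLin_apply, fromCols_mulVec]
      exact h4)
    have h6 : R.mulVec (w ∘ Sum.inl) = R.mulVec 0 := by
      ext i
      rw [mulVec_zero]
      exact congrFun h5 (Sum.inl i)
    have h7 := mulVec_injective_iff_isUnit.mpr hR h6
    ext g
    rcases g with i | l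
    · exact congrFun h7 i
    · exact congrFun h5 (Sum.inr l)

/-- The action of symplectic and invertible matrices on encoders preserves averages. -/
theorem expect_encoders_act {n k : ℕ} {T : Matrix (Fin n ⊕ Fin n) (Fin n ⊕ Fin n) (ZMod 2)}
    (hT : T ∈ symplectics n) {R : Matrix (Fin n) (Fin n) (ZMod 2)} (hR : IsUnit R)
    (f : Matrix (Fin n ⊕ Fin n) (Fin n ⊕ Fin k) (ZMod 2) → ℝ) :
    𝔼 G ∈ encoders n k, f (fromCols (T * G.toCols₁ * R) (T * G.toCols₂))
      = 𝔼 G ∈ encoders n k, f G := by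
  have hR' := (isUnit_iff_isUnit_det _).mp hR
  refine Finset.expect_nbij' (fun G => fromCols (T * G.toCols₁ * R) (T * G.toCols₂))
    (fun G => fromCols (symJ n * Tᵀ * symJ n * G.toCols₁ * R⁻¹) (symJ n * Tᵀ * symJ n * G.toCols₂))
    ?_ ?_ ?_ ?_ fun _ _ => rfl
  · intro G hG
    exact mul_mem_encoders hT (by rwa [fromCols_toCols]) hR
  · intro G hG
    exact mul_mem_encoders (inverse_mem_symplectics hT) (by rwa [fromCols_toCols])
      (isUnit_nonsing_inv_iff.mpr hR)
  · intro G _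
    simp only [toCols₁_fromCols, toCols₂_fromCols]
    conv_rhs => rw [← fromCols_toCols G]
    congr 1
    · rw [← Matrix.mul_assoc, ← Matrix.mul_assoc, (symplectics_inverse hT).1, Matrix.one_mul,
        mul_nonsing_inv_cancel_right _ _ hR']
    · rw [← Matrix.mul_assoc, (symplectics_inverse hT).1, Matrix.one_mul]
  · intro G _
    simp only [toCols₁_fromCols, toCols₂_fromCols]
    conv_rhs => rw [← fromCols_toCols G]
    congr 1
    · rw [← Matrix.mul_assoc, ← Matrix.mul_assoc, (symplectics_inverse hT).2, Matrix.one_mul,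
        nonsing_inv_mul_cancel_right _ _ hR']
    · rw [← Matrix.mul_assoc, (symplectics_inverse hT).2, Matrix.one_mul]

theorem symplectics_nonempty (n : ℕ) : (symplectics n).Nonempty := ⟨1, one_mem_symplectics n⟩

theorem one_mem_glFixing (n j : ℕ) : 1 ∈ glFixing n j :=
  mem_glFixing.mpr ⟨isUnit_one, fun _ _ => one_mulVec _⟩

theorem encoders_nonempty {n k : ℕ} (hk : k ≤ n) : (encoders n k).Nonempty :=
  ⟨encoderOf k 1 1, encoderOf_mem hk (one_mem_symplectics n) isUnit_one⟩

/-- The encoder of a random symplectic matrix and a random invertible matrix is uniformly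
distributed. -/
theorem expect_encoderOf {n k : ℕ} (hk : k ≤ n)
    (f : Matrix (Fin n ⊕ Fin n) (Fin n ⊕ Fin k) (ZMod 2) → ℝ) :
    𝔼 S ∈ symplectics n, 𝔼 P ∈ glFixing n 0, f (encoderOf k S P) = 𝔼 G ∈ encoders n k, f G := by
  have hS := symplectics_nonempty n
  have hP : (glFixing n 0).Nonempty := ⟨1, one_mem_glFixing n 0⟩
  have hunit : ∀ {P}, P ∈ glFixing n 0 → IsUnit P := fun h => (mem_glFixing.mp h).1
  calc 𝔼 S ∈ symplectics n, 𝔼 P ∈ glFixing n 0, f (encoderOf k S P)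
      = 𝔼 G ∈ encoders n k, 𝔼 T ∈ symplectics n, 𝔼 R ∈ glFixing n 0,
          f (fromCols (T * G.toCols₁ * R) (T * G.toCols₂)) := by
        -- A dummy average over encoders is introduced: for each single `G`, the left side equals
        -- the average over the images of `G` under the group. Averaging over `G` and exchanging the
        -- averages then gives the uniform distribution, because every group element permutes the
        -- encoders.
        rw [← Finset.expect_const (encoders_nonempty hk)
          (𝔼 S ∈ symplectics n, 𝔼 P ∈ glFixing n 0, f (encoderOf k S P))]
        refine Finset.expect_congr rfl fun G hG => ?_
        obtain ⟨c1, c2, -, -, P, hP, c4⟩ := completion_spec hk hG isShear_zero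
        set S := completion hk G 0
        rw [← expect_symplectics_mul_right c1]
        refine Finset.expect_congr rfl fun T _ => ?_
        -- Once the symplectic variable has been translated by a completion of `G`, the invertible
        -- variable has to be translated by the factor `P` that separates the columns of `G` from
        -- the reduced ones.
        refine Finset.expect_nbij' (fun R => P⁻¹ * R) (fun R => P * R) ?_ ?_ ?_ ?_ ?_
        · exact fun R hR => mem_glFixing.mpr
            ⟨(isUnit_nonsing_inv_iff.mpr hP).mul (hunit hR), fun i hi => absurd hi (by omega)⟩
        · exact fun R hR => mem_glFixing.mpr
            ⟨hP.mul (hunit hR), fun i hi => absurd hi (by omega)⟩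
        · exact fun R _ => mul_nonsing_inv_cancel_left _ _ ((isUnit_iff_isUnit_det _).mp hP)
        · exact fun R _ => nonsing_inv_mul_cancel_left _ _ ((isUnit_iff_isUnit_det _).mp hP)
        · intro R _
          have e1 : (T * S).toCols₁ = T * S.toCols₁ := rfl
          have e2 : (T * S).toCols₂ = T * S.toCols₂ := rfl
          rw [encoderOf, e1, e2, completion_toCols₂, c4, Matrix.mul_assoc, Matrix.mul_assoc, c2,
            Matrix.mul_assoc T, Matrix.mul_assoc (reducedColumns hk G),
            mul_nonsing_inv_cancel_left _ _ ((isUnit_iff_isUnit_det _).mp hP)]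
    _ = 𝔼 T ∈ symplectics n, 𝔼 R ∈ glFixing n 0, 𝔼 G ∈ encoders n k,
          f (fromCols (T * G.toCols₁ * R) (T * G.toCols₂)) := by
        rw [Finset.expect_comm]
        exact Finset.expect_congr rfl fun T _ => Finset.expect_comm _ _ _
    _ = 𝔼 T ∈ symplectics n, 𝔼 R ∈ glFixing n 0, 𝔼 G ∈ encoders n k, f G :=
        Finset.expect_congr rfl fun T hT => Finset.expect_congr rfl fun R hR =>
          expect_encoders_act hT (hunit hR) f
    _ = 𝔼 G ∈ encoders n k, f G := by
        rw [Finset.expect_const hS, Finset.expect_const hP]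

/-- The random symmetric matrix that is described by coins. -/
def coinMatrix {n : ℕ} (k : ℕ) (r : Fin n → Bits n) : Matrix (Fin n) (Fin n) (ZMod 2) :=
  of fun i j => (bit (i.1 < n - k) * bit (j.1 < n - k)) *
    (bit (i.1 < j.1 + 1) * r i j + bit (j.1 < i.1) * r j i)

theorem isShear_coinMatrix {n k : ℕ} (r : Fin n → Bits n) : IsShear k (coinMatrix k r) := by
  refine ⟨?_, ?_⟩
  · ext i j
    simp only [coinMatrix, transpose_apply, of_apply, bit]
    rcases lt_trichotomy i j with h | rfl | h
    · have h' : i.1 < j.1 := h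
      rw [if_pos (show i.1 < j.1 + 1 by omega), if_neg (show ¬ j.1 < i.1 by omega),
        if_neg (show ¬ j.1 < i.1 + 1 by omega), if_pos h']
      ring
    · rfl
    · have h' : j.1 < i.1 := h
      rw [if_neg (show ¬ i.1 < j.1 + 1 by omega), if_pos h',
        if_pos (show j.1 < i.1 + 1 by omega), if_neg (show ¬ i.1 < j.1 by omega)]
      ring
  · ext i l
    rw [Matrix.mul_apply, Matrix.zero_apply]
    refine Finset.sum_eq_zero fun j _ => ?_
    simp only [coinMatrix, of_apply, padMatrix, bit]
    by_cases hj : j.1 < n - k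
    · rw [if_neg (c := j.1 = n - k + l.1) (by omega), mul_zero]
    · simp [hj]

/-- The construction from coins is linear and reproduces every admissible symmetric matrix from its
own entries. Translating the coins thus translates the matrix, which gives the invariance needed
below without counting symmetric matrices. -/
theorem coinMatrix_add {n k : ℕ} {Y : Matrix (Fin n) (Fin n) (ZMod 2)} (hk : k ≤ n)
    (hY : IsShear k Y) (r : Fin n → Bits n) : 
    coinMatrix k ((fun i j => Y i j) + r) = Y + coinMatrix k r := by
  have hsym : ∀ i j, Y j i = Y i j := fun i j => congrFun (congrFun hY.1 i) j
  have hzero : ∀ i j : Fin n, ¬ j.1 < n - k → Y i j = 0 := by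
    intro i j hj
    have hj2 := j.2
    have := congrFun (congrFun hY.2 i) ⟨j.1 - (n - k), by omega⟩
    rw [Matrix.mul_apply, Finset.sum_eq_single j] at this
    · have h8 : j.1 = n - k + (j.1 - (n - k)) := by omega
      simpa [padMatrix, bit, ← h8] using this
    · intro q _ hq
      rw [padMatrix, of_apply, bit, if_neg, mul_zero]
      intro hc
      exact hq (Fin.ext (by dsimp only at hc; omega))
    · simp
  ext i j
  simp only [coinMatrix, of_apply, Matrix.add_apply, Pi.add_apply]
  have e : (bit (i.1 < n - k) * bit (j.1 < n - k)) *
      (bit (i.1 < j.1 + 1) * Y i j + bit (j.1 < i.1) * Y j i) = Y i j := by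
    rw [hsym i j, ← add_mul]
    have h1 : (bit (i.1 < j.1 + 1) : ZMod 2) + bit (j.1 < i.1) = 1 := by
      simp only [bit]
      rcases lt_or_ge j.1 i.1 with h | h
      · rw [if_neg (by omega), if_pos h, zero_add]
      · rw [if_pos (by omega), if_neg (by omega), add_zero]
    rw [h1, one_mul]
    by_cases hi : i.1 < n - k
    · by_cases hj : j.1 < n - k
      · simp [bit, hi, hj]
      · rw [hzero i j hj, mul_zero]
    · rw [← hsym i j, hzero j i hi, mul_zero]
  conv_rhs => rw [← e]
  ring

/-- The random completion of a random encoder is a uniformly distributed symplectic matrix. -/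
theorem expect_completion {n k : ℕ} (hk : k ≤ n)
    (f : Matrix (Fin n ⊕ Fin n) (Fin n ⊕ Fin n) (ZMod 2) → ℝ) :
    𝔼 G ∈ encoders n k, 𝔼 r : Fin n → Bits n, f (completion hk G (coinMatrix k r))
      = 𝔼 S ∈ symplectics n, f S := by
  have hS := symplectics_nonempty n
  -- The chosen completion need not commute with the action of `T`, but the completion of the
  -- transformed encoder and the transformed completion share their `Z` columns and their last `X`
  -- columns. They differ by a symmetric matrix, which uniform coins absorb.
  have key : ∀ T ∈ symplectics n, ∀ G ∈ encoders n k,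
      𝔼 r : Fin n → Bits n, f (T * completion hk G (coinMatrix k r))
        = 𝔼 r : Fin n → Bits n, f (completion hk (fromCols (T * G.toCols₁ * (1 : Matrix (Fin n) (Fin n) (ZMod 2))) (T * G.toCols₂))
            (coinMatrix k r)) := by
    intro T hT G hG
    set G' := fromCols (T * G.toCols₁ * (1 : Matrix (Fin n) (Fin n) (ZMod 2))) (T * G.toCols₂) with hG'
    have hG'm : G' ∈ encoders n k := mul_mem_encoders hT (by rwa [fromCols_toCols]) isUnit_one
    -- The elimination depends only on the pairings between the two halves of the encoder, and `T`
    -- preserves these.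
    have hred : reducedColumns hk G' = T * reducedColumns hk G := by
      have h1 : G'.toCols₁ = T * G.toCols₁ := by simp [hG']
      have h2 : G'.toCols₂ = T * G.toCols₂ := by simp [hG']
      have h3 : G'.toCols₁ᵀ * symJ n * G'.toCols₂ = G.toCols₁ᵀ * symJ n * G.toCols₂ := by
        rw [h1, h2, transpose_mul]
        calc G.toCols₁ᵀ * Tᵀ * symJ n * (T * G.toCols₂)
            = G.toCols₁ᵀ * (Tᵀ * symJ n * T) * G.toCols₂ := by simp only [Matrix.mul_assoc]
          _ = _ := by rw [mem_symplectics.mp hT]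
      rw [reducedColumns, h3, h1, reducedColumns, Matrix.mul_assoc]
    obtain ⟨c1, c2, -⟩ := completion_spec hk hG isShear_zero
    obtain ⟨d1, d2, -⟩ := completion_spec hk hG'm isShear_zero
    have t1 : (T * completion hk G 0).toCols₁ = T * (completion hk G 0).toCols₁ := rfl
    have t2 : (T * completion hk G 0).toCols₂ = T * (completion hk G 0).toCols₂ := rfl
    obtain ⟨Y, hY, hYe⟩ := exists_shear (k := k) d1 (mul_mem_symplectics hT c1) (by
      rw [t2, completion_toCols₂, completion_toCols₂, hred]) (by
      rw [t1, Matrix.mul_assoc, c2, d2, hG', toCols₂_fromCols])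
    refine Fintype.expect_equiv (Equiv.addLeft fun i j => Y i j) _ _ fun r => ?_
    congr 1
    have e1 := completion_add hk G (coinMatrix k r) 0
    have e2 := completion_add hk G' (Y + coinMatrix k r) 0
    rw [zero_add] at e1 e2
    rw [Equiv.coe_addLeft, coinMatrix_add hk hY, e1, e2, mul_fromCols, hred]
    congr 1
    rw [Matrix.mul_add, ← t1, hYe, completion_toCols₂, hred, Matrix.mul_add, add_assoc]
    simp only [Matrix.mul_assoc]
  calc 𝔼 G ∈ encoders n k, 𝔼 r : Fin n → Bits n, f (completion hk G (coinMatrix k r))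
      = 𝔼 T ∈ symplectics n, 𝔼 G ∈ encoders n k, 𝔼 r : Fin n → Bits n,
          f (T * completion hk G (coinMatrix k r)) := by
        rw [← Finset.expect_const hS
          (𝔼 G ∈ encoders n k, 𝔼 r : Fin n → Bits n, f (completion hk G (coinMatrix k r)))]
        refine Finset.expect_congr rfl fun T hT => ?_
        rw [Finset.expect_congr rfl (key T hT)]
        exact (expect_encoders_act hT isUnit_one
          fun G => 𝔼 r : Fin n → Bits n, f (completion hk G (coinMatrix k r))).symm
    _ = 𝔼 G ∈ encoders n k, 𝔼 r : Fin n → Bits n, 𝔼 T ∈ symplectics n,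
          f (T * completion hk G (coinMatrix k r)) := by
        rw [Finset.expect_comm]
        exact Finset.expect_congr rfl fun G _ => Finset.expect_comm _ _ _
    _ = 𝔼 G ∈ encoders n k, 𝔼 r : Fin n → Bits n, 𝔼 T ∈ symplectics n, f T :=
        Finset.expect_congr rfl fun G hG => Finset.expect_congr rfl fun r _ =>
          expect_symplectics_mul_right (completion_spec hk hG (isShear_coinMatrix r)).1 f
    _ = 𝔼 S ∈ symplectics n, f S := by
        rw [Finset.expect_const (encoders_nonempty hk), Finset.expect_const Finset.univ_nonempty]

end LSN

namespace LSN

open Matrix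

/-! ## Signs -/

/-- The sign `(-1)^a`. -/
noncomputable def sign (a : ZMod 2) : ℂ := if a = 0 then 1 else -1

theorem zmod2_cases (a : ZMod 2) : a = 0 ∨ a = 1 := by
  revert a; decide

theorem sign_zero : sign 0 = 1 := by simp [sign]

theorem sign_one : sign 1 = -1 := by simp [sign]

theorem sign_add (a b : ZMod 2) : sign (a + b) = sign a * sign b := by
  have h : (1 : ZMod 2) + 1 = 0 := by decide
  rcases zmod2_cases a with rfl | rfl <;> rcases zmod2_cases b with rfl | rfl <;>
    simp [sign, h]

theorem sign_mul_self (a : ZMod 2) : sign a * sign a = 1 := by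
  rw [← sign_add, zmod2_add_self, sign_zero]

theorem sign_injective : Function.Injective sign := by
  intro a b h
  have h2 : (-1 : ℂ) ≠ 1 := by norm_num
  rcases zmod2_cases a with rfl | rfl <;> rcases zmod2_cases b with rfl | rfl <;>
    simp_all [sign, eq_comm]

theorem sign_sum {ι : Type*} (s : Finset ι) (f : ι → ZMod 2) :
    sign (∑ i ∈ s, f i) = ∏ i ∈ s, sign (f i) := by
  classical
  induction s using Finset.induction_on with
  | empty => simp [sign]
  | insert i s hi ih => rw [Finset.sum_insert hi, Finset.prod_insert hi, sign_add, ih]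

theorem star_sign (a : ZMod 2) : star (sign a) = sign a := by
  rcases zmod2_cases a with rfl | rfl <;> simp [sign]

/-! ## Tensor products of one-qubit matrices -/

/-- The tensor product of one-qubit matrices. -/
def tensor {n : ℕ} (K : Fin n → Matrix (ZMod 2) (ZMod 2) ℂ) : Matrix (Bits n) (Bits n) ℂ :=
  Matrix.of fun s t => ∏ j, K j (s j) (t j)

theorem tensor_mul {n : ℕ} (K L : Fin n → Matrix (ZMod 2) (ZMod 2) ℂ) :
    tensor K * tensor L = tensor fun j => K j * L j := by
  ext s t
  simp only [tensor, Matrix.mul_apply, Matrix.of_apply, ← Finset.prod_mul_distrib]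
  rw [Finset.prod_univ_sum, Fintype.piFinset_univ]

theorem tensor_one {n : ℕ} : tensor (fun _ : Fin n => 1) = 1 := by
  ext s t
  simp only [tensor, Matrix.of_apply, Matrix.one_apply]
  rw [Finset.prod_ite_zero]
  simp [funext_iff]

theorem tensor_smul {n : ℕ} (c : Fin n → ℂ) (K : Fin n → Matrix (ZMod 2) (ZMod 2) ℂ) :
    tensor (fun j => c j • K j) = (∏ j, c j) • tensor K := by
  ext s t
  simp [tensor, Finset.prod_mul_distrib]

theorem tensor_conjTranspose {n : ℕ} (K : Fin n → Matrix (ZMod 2) (ZMod 2) ℂ) :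
    (tensor K)ᴴ = tensor fun j => (K j)ᴴ := by
  ext s t
  simp [tensor, Matrix.conjTranspose_apply]

/-! ## Pauli operators -/

theorem pauli_eq_tensor {n : ℕ} (v : PVec n) :
    pauli v = tensor fun j => pauli1 (v (Sum.inl j)) (v (Sum.inr j)) := rfl

theorem zmod2_univ : (Finset.univ : Finset (ZMod 2)) = {0, 1} := by decide

theorem sum_zmod2 {M : Type*} [AddCommMonoid M] (f : ZMod 2 → M) : ∑ a, f a = f 0 + f 1 := by
  rw [zmod2_univ, Finset.sum_pair (by decide)]

theorem pauli1_entries : (pauli1 0 0 = 1) ∧ (∀ s t, pauli1 0 1 s t = if s = t then sign s else 0) ∧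
    (∀ s t, pauli1 1 0 s t = if s = t then 0 else 1) ∧
    (∀ s t, pauli1 1 1 s t = if s = t then 0 else -Complex.I * sign s) := by
  refine ⟨by simp [pauli1], fun s t => ?_, fun s t => ?_, fun s t => ?_⟩ <;>
  rcases zmod2_cases s with rfl | rfl <;> rcases zmod2_cases t with rfl | rfl <;>
    simp [pauli1, sign]

theorem pauli1_conjTranspose (a b : ZMod 2) : (pauli1 a b)ᴴ = pauli1 a b := by
  ext s t
  rcases zmod2_cases a with rfl | rfl <;> rcases zmod2_cases b with rfl | rfl <;>
  rcases zmod2_cases s with rfl | rfl <;> rcases zmod2_cases t with rfl | rfl <;>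
    simp [pauli1]

theorem pauli1_mul_self (a b : ZMod 2) : pauli1 a b * pauli1 a b = 1 := by
  ext s t
  rw [Matrix.mul_apply, sum_zmod2]
  rcases zmod2_cases a with rfl | rfl <;> rcases zmod2_cases b with rfl | rfl <;>
  rcases zmod2_cases s with rfl | rfl <;> rcases zmod2_cases t with rfl | rfl <;>
    simp [pauli1]

theorem pauli1_mul_comm (a b c d : ZMod 2) :
    pauli1 a b * pauli1 c d = sign (a * d + b * c) • (pauli1 c d * pauli1 a b) := by
  ext s t
  rw [Matrix.smul_apply, Matrix.mul_apply, Matrix.mul_apply, sum_zmod2, sum_zmod2]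
  rcases zmod2_cases a with rfl | rfl <;> rcases zmod2_cases b with rfl | rfl <;>
  rcases zmod2_cases c with rfl | rfl <;> rcases zmod2_cases d with rfl | rfl <;>
  rcases zmod2_cases s with rfl | rfl <;> rcases zmod2_cases t with rfl | rfl <;>
    simp [pauli1, sign, zmod2_add_self]

theorem exists_pauli1_mul (a b c d : ZMod 2) : ∃ z : ℂ, z ^ 4 = 1 ∧
    pauli1 a b * pauli1 c d = z • pauli1 (a + c) (b + d) := by
  have h : (1 : ZMod 2) + 1 = 0 := by decide
  rcases zmod2_cases a with rfl | rfl <;> rcases zmod2_cases b with rfl | rfl <;>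
  rcases zmod2_cases c with rfl | rfl <;> rcases zmod2_cases d with rfl | rfl <;>
  simp only [zero_add, add_zero, h]
  all_goals first
    | refine ⟨1, by norm_num, ?_⟩
      ext s t
      rw [Matrix.smul_apply, Matrix.mul_apply, sum_zmod2]
      rcases zmod2_cases s with rfl | rfl <;> rcases zmod2_cases t with rfl | rfl <;>
        simp [pauli1] <;> done
    | refine ⟨Complex.I, by simp, ?_⟩
      ext s t
      rw [Matrix.smul_apply, Matrix.mul_apply, sum_zmod2]
      rcases zmod2_cases s with rfl | rfl <;> rcases zmod2_cases t with rfl | rfl <;>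
        simp [pauli1] <;> done
    | refine ⟨-Complex.I, by rw [Even.neg_pow (by decide), Complex.I_pow_four], ?_⟩
      ext s t
      rw [Matrix.smul_apply, Matrix.mul_apply, sum_zmod2]
      rcases zmod2_cases s with rfl | rfl <;> rcases zmod2_cases t with rfl | rfl <;>
        simp [pauli1]

theorem pauli_conjTranspose {n : ℕ} (v : PVec n) : (pauli v)ᴴ = pauli v := by
  simp only [pauli_eq_tensor, tensor_conjTranspose, pauli1_conjTranspose]

theorem pauli_mul_self {n : ℕ} (v : PVec n) : pauli v * pauli v = 1 := by
  simp only [pauli_eq_tensor, tensor_mul, pauli1_mul_self, tensor_one]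

theorem pauli_mul_comm {n : ℕ} (v w : PVec n) :
    pauli v * pauli w = sign (sympInner v w) • (pauli w * pauli v) := by
  simp only [pauli_eq_tensor, tensor_mul]
  rw [sympInner_eq, Fintype.sum_sum_type, ← Finset.sum_add_distrib, sign_sum, ← tensor_smul]
  congr 1
  funext j
  exact pauli1_mul_comm _ _ _ _

theorem exists_pauli_mul {n : ℕ} (v w : PVec n) : ∃ z : ℂ, z ^ 4 = 1 ∧
    pauli v * pauli w = z • pauli (v + w) := by
  choose z hz hzm using fun j => exists_pauli1_mul (v (Sum.inl j)) (v (Sum.inr j)) (w (Sum.inl j))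
    (w (Sum.inr j))
  refine ⟨∏ j, z j, ?_, ?_⟩
  · rw [← Finset.prod_pow]
    exact Finset.prod_eq_one fun j _ => hz j
  · simp only [pauli_eq_tensor, tensor_mul, hzm, tensor_smul, Pi.add_apply]

theorem pauli_zero {n : ℕ} : pauli (0 : PVec n) = 1 := by
  rw [pauli_eq_tensor]
  simp only [Pi.zero_apply, pauli1_entries.1, tensor_one]

theorem mem_phases {z : ℂ} (h : z ^ 4 = 1) :
    z ∈ ({1, -1, Complex.I, -Complex.I} : Set ℂ) := by
  have : (z - 1) * ((z + 1) * ((z - Complex.I) * (z + Complex.I))) = 0 := by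
    ring_nf
    simp [h]
  simp only [mul_eq_zero, sub_eq_zero, add_eq_zero_iff_eq_neg] at this
  simpa using this

/-! ## Clifford operators -/

/-- The symplectic matrix whose columns are the images of the generators. -/
def tableauMatrix {n : ℕ} (τ : Tableau n) : Matrix (Fin n ⊕ Fin n) (Fin n ⊕ Fin n) (ZMod 2) :=
  Matrix.of fun h g => (τ g).2 h

theorem tableauMatrix_gram {n : ℕ} (τ : Tableau n) (g h : Fin n ⊕ Fin n) :
    ((tableauMatrix τ)ᵀ * symJ n * tableauMatrix τ) g h = sympInner (τ g).2 (τ h).2 :=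
  transpose_mul_symJ_mul_apply _ _ _ _

theorem sympInner_single {n : ℕ} (g h : Fin n ⊕ Fin n) :
    sympInner (Pi.single g 1 : PVec n) (Pi.single h 1) = symJ n g h := by
  rw [← Matrix.one_mul (symJ n), ← Matrix.mul_one (1 * symJ n)]
  nth_rewrite 1 [← transpose_one]
  rw [transpose_mul_symJ_mul_apply]
  congr 1 <;> ext i <;> simp [Matrix.one_apply, Pi.single_apply]

/-- Conjugation by a unitary preserves whether two Pauli operators commute or anticommute, and for
Pauli operators this sign is the symplectic inner product. -/
theorem tableauMatrix_mem_symplectics {n : ℕ} {τ : Tableau n}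
    {U : Matrix.unitaryGroup (Bits n) ℂ} (hU : HasTableau U τ) :
    tableauMatrix τ ∈ symplectics n := by
  have hUU : U.1ᴴ * U.1 = 1 := Matrix.mem_unitaryGroup_iff'.mp U.2
  have hUU' : U.1 * U.1ᴴ = 1 := Matrix.mem_unitaryGroup_iff.mp U.2
  have hp : ∀ g, pauli (τ g).2 = sign (τ g).1 • (U.1 * pauli (Pi.single g 1) * U.1ᴴ) := by
    intro g
    rw [hU g, smul_smul]
    change _ = (sign _ * sign _) • _
    rw [sign_mul_self, one_smul]
  have hmul : ∀ g h, pauli (τ g).2 * pauli (τ h).2 = (sign (τ g).1 * sign (τ h).1) •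
      (U.1 * (pauli (Pi.single g 1) * pauli (Pi.single h 1)) * U.1ᴴ) := by
    intro g h
    rw [hp g, hp h, Matrix.smul_mul, Matrix.mul_smul, smul_smul]
    congr 1
    calc U.1 * pauli (Pi.single g 1) * U.1ᴴ * (U.1 * pauli (Pi.single h 1) * U.1ᴴ)
        = U.1 * pauli (Pi.single g 1) * (U.1ᴴ * U.1) * pauli (Pi.single h 1) * U.1ᴴ := by
          simp only [Matrix.mul_assoc]
      _ = _ := by rw [hUU, Matrix.mul_one]; simp only [Matrix.mul_assoc]
  rw [mem_symplectics]
  ext g h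
  rw [tableauMatrix_gram, ← sympInner_single]
  apply sign_injective
  have h1 := pauli_mul_comm (τ g).2 (τ h).2
  have h2 : pauli (τ g).2 * pauli (τ h).2 = sign (sympInner (Pi.single g 1 : PVec n)
      (Pi.single h 1)) • (pauli (τ h).2 * pauli (τ g).2) := by
    rw [hmul, hmul, pauli_mul_comm (Pi.single g 1), Matrix.mul_smul, Matrix.smul_mul,
      smul_comm, mul_comm (sign (τ g).1)]
  have h3 := h1.symm.trans h2
  -- Cancelling the product of the two Pauli operators leaves an equality of scalar matrices, from
  -- which the signs are read off at one diagonal entry.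
  have h4 : (pauli (τ h).2 * pauli (τ g).2) * (pauli (τ g).2 * pauli (τ h).2) = 1 := by
    rw [Matrix.mul_assoc, ← Matrix.mul_assoc (pauli (τ g).2), pauli_mul_self, Matrix.one_mul,
      pauli_mul_self]
  have h5 := congrArg (· * (pauli (τ g).2 * pauli (τ h).2)) h3
  simp only [Matrix.smul_mul, h4] at h5
  have h6 := congrFun (congrFun h5 0) 0
  simpa using h6

end LSN

/-! ### Constructing Clifford unitaries from symplectic matrices; code states and errors -/

namespace LSN

open Matrix

theorem bits_induction {ι : Type*} [Fintype ι] [DecidableEq ι] {p : (ι → ZMod 2) → Prop}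
    (h0 : p 0) (hs : ∀ z j, p z → p (z + Pi.single j 1)) (z : ι → ZMod 2) : p z := by
  have key : ∀ T : Finset ι, p (∑ j ∈ T, Pi.single j 1) := by
    intro T
    induction T using Finset.induction_on with
    | empty => simpa using h0
    | insert j T hj ih => rw [Finset.sum_insert hj, add_comm]; exact hs _ _ ih
  have hz : z = ∑ j ∈ Finset.univ.filter (fun j => z j ≠ 0), Pi.single j 1 := by
    ext i
    rw [Finset.sum_apply, Finset.sum_filter, Finset.sum_eq_single i]
    · rcases zmod2_cases (z i) with h | h <;> simp [h]
    · intro b _ hb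
      simp [hb.symm]
    · simp
  rw [hz]
  exact key _

/-- The signed Pauli operator that a tableau assigns to a generator. -/
noncomputable def tableauPauli {n : ℕ} (τ : Tableau n) (g : Fin n ⊕ Fin n) :
    Matrix (Bits n) (Bits n) ℂ :=
  sign (τ g).1 • pauli (τ g).2

theorem tableauPauli_mul_self {n : ℕ} (τ : Tableau n) (g : Fin n ⊕ Fin n) :
    tableauPauli τ g * tableauPauli τ g = 1 := by
  rw [tableauPauli, Matrix.smul_mul, Matrix.mul_smul, smul_smul, pauli_mul_self, sign_mul_self,
    one_smul]

theorem tableauPauli_conjTranspose {n : ℕ} (τ : Tableau n) (g : Fin n ⊕ Fin n) :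
    (tableauPauli τ g)ᴴ = tableauPauli τ g := by
  rw [tableauPauli, conjTranspose_smul, pauli_conjTranspose, star_sign]

theorem tableauPauli_mul_comm {n : ℕ} {τ : Tableau n} (hτ : tableauMatrix τ ∈ symplectics n)
    (g h : Fin n ⊕ Fin n) : tableauPauli τ g * tableauPauli τ h
      = sign (symJ n g h) • (tableauPauli τ h * tableauPauli τ g) := by
  have h1 : sympInner (τ g).2 (τ h).2 = symJ n g h := by
    rw [← tableauMatrix_gram, mem_symplectics.mp hτ]
  simp only [tableauPauli, Matrix.smul_mul, Matrix.mul_smul, smul_smul]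
  rw [pauli_mul_comm, h1, smul_smul]
  congr 1
  ring

/-- Extend the set of fixed stabilizers one at a time. If `ψ` is fixed by the earlier ones, then `ψ`
plus its image under the next one is fixed by all of them, unless it is zero. In that case the next
stabilizer has eigenvalue `-1` on `ψ`, and its partner among the images of the `X` generators flips
this sign while commuting with the others. -/
theorem exists_stabilizerState {n : ℕ} {τ : Tableau n} (hτ : tableauMatrix τ ∈ symplectics n) :
    ∃ ψ : Bits n → ℂ, ψ ≠ 0 ∧ ∀ j, (tableauPauli τ (Sum.inr j)).mulVec ψ = ψ := by
  have hsw : ∀ g h (ψ : Bits n → ℂ), (tableauPauli τ g).mulVec ((tableauPauli τ h).mulVec ψ)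
      = sign (symJ n g h) • (tableauPauli τ h).mulVec ((tableauPauli τ g).mulVec ψ) := by
    intro g h ψ
    rw [mulVec_mulVec, tableauPauli_mul_comm hτ, smul_mulVec, mulVec_mulVec]
  have hsq : ∀ g (ψ : Bits n → ℂ), (tableauPauli τ g).mulVec ((tableauPauli τ g).mulVec ψ) = ψ := by
    intro g ψ
    rw [mulVec_mulVec, tableauPauli_mul_self, one_mulVec]
  suffices H : ∀ t ≤ n, ∃ ψ : Bits n → ℂ, ψ ≠ 0 ∧
      ∀ j : Fin n, j.1 < t → (tableauPauli τ (Sum.inr j)).mulVec ψ = ψ by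
    obtain ⟨ψ, h1, h2⟩ := H n le_rfl
    exact ⟨ψ, h1, fun j => h2 j j.2⟩
  intro t
  induction t with
  | zero => exact fun _ => ⟨Pi.single 0 1, by simp, fun j hj => absurd hj (by omega)⟩
  | succ t ih =>
    intro ht
    obtain ⟨ψ, hψ, hfix⟩ := ih (by omega)
    set j₀ : Fin n := ⟨t, by omega⟩ with hj₀
    by_cases hφ : ψ + (tableauPauli τ (Sum.inr j₀)).mulVec ψ = 0
    · have hneg : (tableauPauli τ (Sum.inr j₀)).mulVec ψ = -ψ := (neg_eq_of_add_eq_zero_right hφ).symm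
      refine ⟨(tableauPauli τ (Sum.inl j₀)).mulVec ψ, ?_, ?_⟩
      · intro h
        apply hψ
        rw [← hsq (Sum.inl j₀) ψ, h, mulVec_zero]
      · intro j hj
        rw [hsw]
        by_cases hjt : j = j₀
        · subst hjt
          rw [hneg]
          simp [symJ, sign, mulVec_neg]
        · rw [hfix j (by
            have : j.1 ≠ t := fun h => hjt (Fin.ext h)
            omega)]
          simp [symJ, sign, hjt]
    · refine ⟨_, hφ, ?_⟩
      intro j hj
      rw [mulVec_add]
      by_cases hjt : j = j₀
      · subst hjt
        rw [hsq, add_comm]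
      · rw [hsw, hfix j (by
            have : j.1 ≠ t := fun h => hjt (Fin.ext h)
            omega)]
        simp [symJ, sign]

/-- The images of the `X` generators are commuting involutions, so their products define a
representation of the additive group of bit strings. It is assembled from one homomorphism per
generator. -/
theorem exists_shiftOperators {n : ℕ} {τ : Tableau n} (hτ : tableauMatrix τ ∈ symplectics n) :
    ∃ W : Bits n → Matrix (Bits n) (Bits n) ℂ, W 0 = 1 ∧ (∀ z w, W (z + w) = W z * W w) ∧
      ∀ j, W (Pi.single j 1) = tableauPauli τ (Sum.inl j) := by
  let ϕ : Fin n → Multiplicative (ZMod 2) →* Matrix (Bits n) (Bits n) ℂ := fun j =>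
    { toFun := fun a => if a.toAdd = 0 then 1 else tableauPauli τ (Sum.inl j)
      map_one' := by simp
      map_mul' := by
        intro a b
        have h : (1 : ZMod 2) + 1 = 0 := by decide
        rw [toAdd_mul]
        rcases zmod2_cases a.toAdd with ha | ha <;> rcases zmod2_cases b.toAdd with hb | hb <;>
          simp [ha, hb, h, tableauPauli_mul_self] }
  have hcomm : Pairwise fun i j => ∀ x y, Commute (ϕ i x) (ϕ j y) := by
    intro i j _ x y
    have h : Commute (tableauPauli τ (Sum.inl i)) (tableauPauli τ (Sum.inl j)) := by
      rw [commute_iff_eq, tableauPauli_mul_comm hτ]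
      simp [symJ, sign]
    change Commute (if x.toAdd = 0 then _ else _) (if y.toAdd = 0 then _ else _)
    split_ifs
    · exact Commute.one_left _
    · exact Commute.one_left _
    · exact Commute.one_right _
    · exact h
  let Φ := MonoidHom.noncommPiCoprod ϕ hcomm
  refine ⟨fun z => Φ fun j => Multiplicative.ofAdd (z j), ?_, ?_, ?_⟩
  · exact map_one Φ
  · intro z w
    exact map_mul Φ _ _
  · intro j
    have h1 : (fun i => Multiplicative.ofAdd ((Pi.single j 1 : Bits n) i))
        = Pi.mulSingle j (Multiplicative.ofAdd 1) := by
      funext i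
      by_cases h : i = j
      · subst h; simp
      · simp [h]
    change Φ _ = _
    rw [h1, MonoidHom.noncommPiCoprod_mulSingle]
    change (if (1 : ZMod 2) = 0 then (1 : Matrix (Bits n) (Bits n) ℂ) else
      tableauPauli τ (Sum.inl j)) = _
    rw [if_neg (by decide)]

/-- Every Pauli operator is, up to a phase, a product of generators, so conjugation is controlled by
induction on its support. The condition `c ^ 4 = 1` replaces membership in the list of four phases
because it is evidently closed under products and inverses. -/
theorem isClifford_of_hasTableau {n : ℕ} {U : Matrix.unitaryGroup (Bits n) ℂ} {τ : Tableau n}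
    (hU : HasTableau U τ) : IsClifford U := by
  have hUU : U.1ᴴ * U.1 = 1 := Matrix.mem_unitaryGroup_iff'.mp U.2
  have hUU' : U.1 * U.1ᴴ = 1 := Matrix.mem_unitaryGroup_iff.mp U.2
  suffices H : ∀ v : PVec n, ∃ w : PVec n, ∃ c : ℂ, c ^ 4 = 1 ∧
      U.1 * pauli v * U.1ᴴ = c • pauli w by
    intro v
    obtain ⟨w, c, hc, h⟩ := H v
    exact ⟨w, c, mem_phases hc, h⟩
  refine bits_induction ⟨0, 1, by norm_num, ?_⟩ ?_
  · rw [pauli_zero, Matrix.mul_one, hUU', one_smul]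
  · rintro v g ⟨w, c, hc, h⟩
    obtain ⟨z, hz, hvz⟩ := exists_pauli_mul v (Pi.single g 1)
    obtain ⟨z', hz', hwz⟩ := exists_pauli_mul w (τ g).2
    have hz0 : z ≠ 0 := by rintro rfl; norm_num at hz
    refine ⟨w + (τ g).2, z⁻¹ * (c * sign (τ g).1 * z'), ?_, ?_⟩
    · have hs : sign (τ g).1 ^ 4 = 1 := by
        rw [show sign (τ g).1 ^ 4 = (sign (τ g).1 * sign (τ g).1) * (sign (τ g).1 * sign (τ g).1) by
          ring, sign_mul_self, one_mul]
      rw [mul_pow, mul_pow, mul_pow, inv_pow, hz, hc, hs, hz']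
      norm_num
    · have e1 : pauli (v + Pi.single g 1) = z⁻¹ • (pauli v * pauli (Pi.single g 1)) := by
        rw [hvz, smul_smul, inv_mul_cancel₀ hz0, one_smul]
      have e2 : U.1 * (pauli v * pauli (Pi.single g 1)) * U.1ᴴ
          = (U.1 * pauli v * U.1ᴴ) * (U.1 * pauli (Pi.single g 1) * U.1ᴴ) := by
        calc _ = U.1 * pauli v * (1 : Matrix (Bits n) (Bits n) ℂ) * (pauli (Pi.single g 1) * U.1ᴴ) := by
              rw [Matrix.mul_one]; simp only [Matrix.mul_assoc]
          _ = _ := by rw [← hUU]; simp only [Matrix.mul_assoc]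
      have e3 : U.1 * pauli (Pi.single g 1) * U.1ᴴ = sign (τ g).1 • pauli (τ g).2 := hU g
      rw [e1, Matrix.mul_smul, Matrix.smul_mul, e2, h, e3, Matrix.smul_mul, Matrix.mul_smul, hwz,
        smul_smul, smul_smul, smul_smul]
      congr 1
      ring

/-- Shifting a joint `+1` eigenvector of the prescribed `Z` images by the prescribed `X` images
gives vectors labelled by bit strings, on which the prescribed operators act as `X` and `Z` act on
the computational basis. The matrix with these columns is the required unitary. -/
theorem exists_hasTableau {n : ℕ} {τ : Tableau n} (hτ : tableauMatrix τ ∈ symplectics n) :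
    ∃ U, HasTableau U τ := by
  obtain ⟨ψ₀, hψ₀, hfix₀⟩ := exists_stabilizerState hτ
  obtain ⟨W, hW0, hWadd, hW1⟩ := exists_shiftOperators hτ
  -- normalize the stabilizer state
  obtain ⟨ψ, hnorm, hfix⟩ : ∃ ψ : Bits n → ℂ, star ψ ⬝ᵥ ψ = 1 ∧
      ∀ j, (tableauPauli τ (Sum.inr j)).mulVec ψ = ψ := by
    have hpos : 0 < ∑ s, ‖ψ₀ s‖ ^ 2 := by
      obtain ⟨s, hs⟩ := Function.ne_iff.mp hψ₀
      refine Finset.sum_pos' (fun _ _ => by positivity) ⟨s, Finset.mem_univ s, ?_⟩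
      have : ‖ψ₀ s‖ ≠ 0 := norm_ne_zero_iff.mpr hs
      positivity
    set r := ∑ s, ‖ψ₀ s‖ ^ 2 with hr
    have hdot : star ψ₀ ⬝ᵥ ψ₀ = (r : ℂ) := by
      simp only [dotProduct, Pi.star_apply, hr, Complex.ofReal_sum]
      refine Finset.sum_congr rfl fun s _ => ?_
      rw [Complex.star_def, ← Complex.normSq_eq_conj_mul_self, Complex.normSq_eq_norm_sq]
    refine ⟨((1 / √r : ℝ) : ℂ) • ψ₀, ?_, fun j => by rw [mulVec_smul, hfix₀]⟩
    rw [star_smul, smul_dotProduct, dotProduct_smul, hdot, Complex.star_def, Complex.conj_ofReal,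
      smul_eq_mul, smul_eq_mul, ← Complex.ofReal_mul, ← Complex.ofReal_mul]
    have : 1 / √r * (1 / √r * r) = 1 := by
      have h := Real.mul_self_sqrt hpos.le
      have h' : √r ≠ 0 := by positivity
      field_simp
      nlinarith
    rw [this, Complex.ofReal_one]
  -- A shift by `z` anticommutes with stabilizer `j` exactly when `z j = 1`, so `z` is the
  -- eigenvalue pattern of the shifted state.
  have hWZ : ∀ z j, tableauPauli τ (Sum.inr j) * W z
      = sign (z j) • (W z * tableauPauli τ (Sum.inr j)) := by
    intro z j
    induction z using bits_induction with
    | h0 => simp [hW0, sign]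
    | hs z i ih =>
      rw [hWadd, hW1, ← Matrix.mul_assoc, ih, Matrix.smul_mul, Matrix.mul_assoc,
        tableauPauli_mul_comm hτ, Matrix.mul_smul, smul_smul, Pi.add_apply, sign_add,
        Matrix.mul_assoc]
      congr 3
      by_cases h : j = i
      · subst h; simp [symJ]
      · simp [symJ, h]
  have hWU : ∀ z, (W z)ᴴ * W z = 1 := by
    intro z
    induction z using bits_induction with
    | h0 => simp [hW0]
    | hs z i ih =>
      rw [hWadd, conjTranspose_mul, Matrix.mul_assoc, ← Matrix.mul_assoc _ (W z), ih,
        Matrix.one_mul, hW1, tableauPauli_conjTranspose, tableauPauli_mul_self]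
  let V : Matrix (Bits n) (Bits n) ℂ := Matrix.of fun s z => (W z).mulVec ψ s
  have hVZ : ∀ j z, (tableauPauli τ (Sum.inr j)).mulVec ((W z).mulVec ψ)
      = sign (z j) • (W z).mulVec ψ := by
    intro j z
    rw [mulVec_mulVec, hWZ, smul_mulVec, ← mulVec_mulVec, hfix]
  -- Two different labels differ in some bit `j`. The corresponding columns are eigenvectors of the
  -- Hermitian stabilizer `j` for different eigenvalues, hence orthogonal.
  have hVU : Vᴴ * V = 1 := by
    ext z z'
    have e : (Vᴴ * V) z z' = star ((W z).mulVec ψ) ⬝ᵥ (W z').mulVec ψ := rfl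
    rw [e]
    by_cases h : z = z'
    · subst h
      rw [star_mulVec, ← dotProduct_mulVec, mulVec_mulVec, hWU, one_mulVec, hnorm]
      simp
    · obtain ⟨j, hj⟩ := Function.ne_iff.mp h
      rw [Matrix.one_apply_ne h]
      have h1 : star ((W z).mulVec ψ) ⬝ᵥ (tableauPauli τ (Sum.inr j)).mulVec ((W z').mulVec ψ)
          = sign (z' j) * (star ((W z).mulVec ψ) ⬝ᵥ (W z').mulVec ψ) := by
        rw [hVZ, dotProduct_smul, smul_eq_mul]
      have h2 : star ((W z).mulVec ψ) ⬝ᵥ (tableauPauli τ (Sum.inr j)).mulVec ((W z').mulVec ψ)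
          = sign (z j) * (star ((W z).mulVec ψ) ⬝ᵥ (W z').mulVec ψ) := by
        rw [dotProduct_mulVec]
        nth_rewrite 1 [← tableauPauli_conjTranspose]
        rw [← star_mulVec, hVZ, star_smul, smul_dotProduct, star_sign, smul_eq_mul]
      have h3 : (sign (z j) - sign (z' j)) * (star ((W z).mulVec ψ) ⬝ᵥ (W z').mulVec ψ) = 0 := by
        rw [sub_mul, ← h1, ← h2, sub_self]
      exact (mul_eq_zero.mp h3).resolve_left (sub_ne_zero.mpr fun hc => hj (sign_injective hc))
  have hVU' : V * Vᴴ = 1 := mul_eq_one_comm.mp hVU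
  refine ⟨⟨V, Matrix.mem_unitaryGroup_iff'.mpr hVU⟩, ?_⟩
  have key : ∀ g, V * pauli (Pi.single g 1) = tableauPauli τ g * V := by
    intro g
    ext s z
    have e : (tableauPauli τ g * V) s z = (tableauPauli τ g).mulVec ((W z).mulVec ψ) s := rfl
    rw [e]
    rcases g with j | j
    · rw [Matrix.mul_apply, Finset.sum_eq_single (z + Pi.single j 1)]
      · rw [pauli_single_inl, if_pos rfl, mul_one, mulVec_mulVec, ← hW1, ← hWadd, add_comm]
        rfl
      · intro t _ ht
        rw [pauli_single_inl, if_neg ht, mul_zero]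
      · simp
    · rw [pauli_single_inr, Matrix.mul_diagonal, hVZ, mul_comm]
      rfl
  intro g
  change V * pauli (Pi.single g 1) * Vᴴ = tableauPauli τ g
  rw [key, Matrix.mul_assoc, hVU', Matrix.mul_one]

/-- The analytic definition becomes pure linear algebra. In particular there is no constraint on
signs, so a uniform Clifford operator has independent uniform signs. -/
theorem mem_cliffords {n : ℕ} {τ : Tableau n} :
    τ ∈ cliffords n ↔ tableauMatrix τ ∈ symplectics n := by
  simp only [cliffords, Finset.mem_filter, Finset.mem_univ, true_and]
  constructor
  · rintro ⟨U, -, hU⟩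
    exact tableauMatrix_mem_symplectics hU
  · intro h
    obtain ⟨U, hU⟩ := exists_hasTableau h
    exact ⟨U, isClifford_of_hasTableau hU, hU⟩

theorem hasTableau_cliffordOf {n : ℕ} {τ : Tableau n} (hτ : τ ∈ cliffords n) :
    HasTableau (cliffordOf τ) τ := by
  simp only [cliffords, Finset.mem_filter, Finset.mem_univ, true_and] at hτ
  rw [cliffordOf, dif_pos hτ]
  exact hτ.choose_spec.2

/-- The basis state `|z⟩`, transformed by the Clifford operator with tableau `τ`. -/
noncomputable def codeState {n : ℕ} (τ : Tableau n) (z : Bits n) : Bits n → ℂ :=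
  (cliffordOf τ).1.mulVec (Pi.single z 1)

theorem codeState_apply {n : ℕ} (τ : Tableau n) (z s : Bits n) :
    codeState τ z s = (cliffordOf τ).1 s z := by
  simp [codeState]

theorem tableauPauli_mulVec_codeState {n : ℕ} {τ : Tableau n} (hτ : τ ∈ cliffords n) (j : Fin n)
    (z : Bits n) : (tableauPauli τ (Sum.inr j)).mulVec (codeState τ z)
      = sign (z j) • codeState τ z := by
  have h := hasTableau_cliffordOf hτ (Sum.inr j)
  have hUU : (cliffordOf τ).1ᴴ * (cliffordOf τ).1 = 1 :=
    Matrix.mem_unitaryGroup_iff'.mp (cliffordOf τ).2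
  change _ = tableauPauli τ (Sum.inr j) at h
  rw [← h, codeState, mulVec_mulVec, Matrix.mul_assoc, hUU, Matrix.mul_one, ← mulVec_mulVec,
    ← mulVec_smul, pauli_single_inr]
  congr 1
  ext s
  rw [mulVec_diagonal, Pi.smul_apply, smul_eq_mul]
  by_cases hs : s = z
  · subst hs; rfl
  · simp [hs]

theorem pauli_mulVec_codeState {n : ℕ} {τ : Tableau n} (hτ : τ ∈ cliffords n) (j : Fin n)
    (z : Bits n) : (pauli (τ (Sum.inr j)).2).mulVec (codeState τ z)
      = sign (z j + (τ (Sum.inr j)).1) • codeState τ z := by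
  have h := tableauPauli_mulVec_codeState hτ j z
  rw [tableauPauli, smul_mulVec] at h
  rw [sign_add, mul_comm, ← smul_smul, ← h, smul_smul, sign_mul_self, one_smul]

/-- A joint eigenvector of the stabilizers is a code state up to a factor. -/
theorem eq_smul_codeState {n : ℕ} {τ : Tableau n} (hτ : τ ∈ cliffords n) {φ : Bits n → ℂ}
    {b : Bits n} (h : ∀ j, (pauli (τ (Sum.inr j)).2).mulVec φ = sign (b j) • φ) :
    ∃ c : ℂ, φ = c • codeState τ (fun j => b j + (τ (Sum.inr j)).1) := by
  have hUU : (cliffordOf τ).1ᴴ * (cliffordOf τ).1 = 1 :=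
    Matrix.mem_unitaryGroup_iff'.mp (cliffordOf τ).2
  have hUU' : (cliffordOf τ).1 * (cliffordOf τ).1ᴴ = 1 :=
    Matrix.mem_unitaryGroup_iff.mp (cliffordOf τ).2
  set z : Bits n := fun j => b j + (τ (Sum.inr j)).1 with hz
  have h1 : ∀ j, (tableauPauli τ (Sum.inr j)).mulVec φ = sign (z j) • φ := by
    intro j
    rw [tableauPauli, smul_mulVec, h, smul_smul, hz, sign_add, mul_comm]
  set χ := (cliffordOf τ).1ᴴ.mulVec φ with hχ
  have hφ : φ = (cliffordOf τ).1.mulVec χ := by rw [hχ, mulVec_mulVec, hUU', one_mulVec]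
  have h2 : ∀ j, (pauli (Pi.single (Sum.inr j) 1 : PVec n)).mulVec χ = sign (z j) • χ := by
    intro j
    have ht := hasTableau_cliffordOf hτ (Sum.inr j)
    change _ = tableauPauli τ (Sum.inr j) at ht
    have h3 := congrArg (cliffordOf τ).1ᴴ.mulVec (h1 j)
    rw [mulVec_smul, ← hχ] at h3
    rw [← h3, ← ht, hφ, mulVec_mulVec, mulVec_mulVec]
    congr 1
    simp only [← Matrix.mul_assoc, hUU, Matrix.one_mul]
  refine ⟨χ z, ?_⟩
  -- Pulled back through the Clifford operator, the state is a joint eigenvector of the diagonal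
  -- operators `Z_j`, whose sign patterns separate the basis states.
  have h4 : χ = χ z • Pi.single z 1 := by
    ext s
    by_cases hs : s = z
    · subst hs; simp
    · obtain ⟨j, hj⟩ := Function.ne_iff.mp hs
      have h5 := congrFun (h2 j) s
      rw [pauli_single_inr, mulVec_diagonal, Pi.smul_apply, smul_eq_mul] at h5
      have h6 : (sign (s j) - sign (z j)) * χ s = 0 := by
        rw [sub_mul, ← h5]
        exact sub_self _
      have := (mul_eq_zero.mp h6).resolve_left (sub_ne_zero.mpr fun hc => hj (sign_injective hc))
      simp [hs, this]
  rw [codeState, ← mulVec_smul, ← h4, hφ]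

theorem star_codeState_dotProduct {n : ℕ} (τ : Tableau n) (z z' : Bits n) :
    star (codeState τ z) ⬝ᵥ codeState τ z' = if z = z' then 1 else 0 := by
  have hUU : (cliffordOf τ).1ᴴ * (cliffordOf τ).1 = 1 :=
    Matrix.mem_unitaryGroup_iff'.mp (cliffordOf τ).2
  have := congrFun (congrFun hUU z) z'
  rw [Matrix.one_apply] at this
  rw [← this, Matrix.mul_apply]
  refine Finset.sum_congr rfl fun s _ => ?_
  rw [Pi.star_apply, codeState_apply, codeState_apply, conjTranspose_apply]

theorem norm_eq_one_of_smul {n : ℕ} {φ ψ : Bits n → ℂ} {c : ℂ} (hφ : star φ ⬝ᵥ φ = 1)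
    (hψ : star ψ ⬝ᵥ ψ = 1) (h : φ = c • ψ) : ‖c‖ = 1 := by
  rw [h, star_smul, smul_dotProduct, dotProduct_smul, hψ, smul_eq_mul, smul_eq_mul, mul_one,
    Complex.star_def, ← Complex.normSq_eq_conj_mul_self, Complex.normSq_eq_norm_sq] at hφ
  have h2 : ‖c‖ ^ 2 = 1 := by exact_mod_cast hφ
  exact (pow_eq_one_iff_of_nonneg (norm_nonneg _) two_ne_zero).mp h2

/-- The syndrome of a Pauli error. -/
def syndrome {n : ℕ} (τ : Tableau n) (e : PVec n) : Bits n :=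
  fun j => sympInner (τ (Sum.inr j)).2 e

/-- The error commutes or anticommutes with each stabilizer according to the syndrome, so the noisy
codeword is a joint eigenvector with shifted eigenvalues. The joint eigenspaces are one-dimensional;
this fixes it up to a factor, which has modulus one because both vectors are normalized. -/
theorem noisyCodeword_eq {n k : ℕ} {τ : Tableau n} (hτ : τ ∈ cliffords n) (e : PVec n)
    (x : Bits k) : ∃ c : ℂ, ‖c‖ = 1 ∧
      noisyCodeword τ e x = c • codeState τ (pad n x + syndrome τ e) := by
  have h1 : ∀ j, (pauli (τ (Sum.inr j)).2).mulVec (noisyCodeword τ e x)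
      = sign (pad n x j + syndrome τ e j + (τ (Sum.inr j)).1) • noisyCodeword τ e x := by
    intro j
    have := pauli_mulVec_codeState hτ j (pad n x)
    rw [noisyCodeword, mulVec_mulVec, pauli_mul_comm, smul_mulVec, ← mulVec_mulVec]
    change _ • (pauli e).mulVec ((pauli (τ (Sum.inr j)).2).mulVec (codeState τ (pad n x))) = _
    rw [this, mulVec_smul, smul_smul, syndrome, ← sign_add]
    congr 2
    ring
  obtain ⟨c, hc⟩ := eq_smul_codeState hτ (b := fun j => pad n x j + syndrome τ e j +
    (τ (Sum.inr j)).1) h1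
  have h2 : (fun j => pad n x j + syndrome τ e j + (τ (Sum.inr j)).1 + (τ (Sum.inr j)).1)
      = pad n x + syndrome τ e := by
    funext j
    rw [add_assoc, zmod2_add_self, add_zero]
    rfl
  rw [h2] at hc
  refine ⟨c, norm_eq_one_of_smul ?_ ?_ hc, hc⟩
  · rw [noisyCodeword, star_mulVec, ← dotProduct_mulVec, mulVec_mulVec, pauli_conjTranspose,
      pauli_mul_self, one_mulVec]
    change star (codeState τ (pad n x)) ⬝ᵥ codeState τ (pad n x) = 1
    rw [star_codeState_dotProduct, if_pos rfl]
  · rw [star_codeState_dotProduct, if_pos rfl]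

/-- Two Clifford operators with the same stabilizers up to signs have the same code states up to
phases. -/
theorem codeState_eq_smul {n : ℕ} {τ τ' : Tableau n} (hτ : τ ∈ cliffords n)
    (hτ' : τ' ∈ cliffords n) (h : ∀ j, (τ (Sum.inr j)).2 = (τ' (Sum.inr j)).2) (z : Bits n) :
    ∃ c : ℂ, ‖c‖ = 1 ∧ codeState τ z
      = c • codeState τ' (fun j => z j + (τ (Sum.inr j)).1 + (τ' (Sum.inr j)).1) := by
  obtain ⟨c, hc⟩ := eq_smul_codeState hτ' (φ := codeState τ z)
    (b := fun j => z j + (τ (Sum.inr j)).1) fun j => by rw [← h]; exact pauli_mulVec_codeState hτ j z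
  exact ⟨c, norm_eq_one_of_smul (by rw [star_codeState_dotProduct, if_pos rfl])
    (by rw [star_codeState_dotProduct, if_pos rfl]) hc, hc⟩

end LSN

namespace LSN

open Matrix

/-! ## Loaded states

The registers are in a pure state, and a set `b` of further qubits is in state `1`. -/

section

variable {m n : ℕ}

/-- The state with register content `φ` in which the other qubits in state `1` form the set `b`. -/
noncomputable def load (φ : (Fin m → Bits n) → ℂ) (b : Finset (ℕ × ℕ)) : QMem :=
  ∑ s, φ s • Finsupp.single (ones s ∪ b) (1 : ℂ)

theorem loadState_eq (φ : (Fin m → Bits n) → ℂ) : loadState φ = load φ ∅ := by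
  simp [loadState, load]

theorem load_add (φ χ : (Fin m → Bits n) → ℂ) (b : Finset (ℕ × ℕ)) :
    load (φ + χ) b = load φ b + load χ b := by
  simp [load, add_smul, Finset.sum_add_distrib]

theorem load_smul (c : ℂ) (φ : (Fin m → Bits n) → ℂ) (b : Finset (ℕ × ℕ)) :
    load (c • φ) b = c • load φ b := by
  simp only [load, Finset.smul_sum, smul_smul, Pi.smul_apply, smul_eq_mul]

/-- Replace bit `l` of register `i`. -/
def setBit (s : Fin m → Bits n) (i : Fin m) (l : Fin n) (c : ZMod 2) : Fin m → Bits n :=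
  Function.update s i (Function.update (s i) l c)

theorem setBit_apply (s : Fin m → Bits n) (i : Fin m) (l : Fin n) (c : ZMod 2) (i' : Fin m)
    (l' : Fin n) : setBit s i l c i' l' = if i' = i ∧ l' = l then c else s i' l' := by
  unfold setBit
  by_cases h : i' = i
  · subst h
    by_cases h' : l' = l
    · subst h'; simp
    · simp [h']
  · simp [h]

theorem setBit_self (s : Fin m → Bits n) (i : Fin m) (l : Fin n) : setBit s i l (s i l) = s := by
  funext i' l'
  rw [setBit_apply]
  split_ifs with h
  · rw [h.1, h.2]
  · rfl

theorem setBit_setBit (s : Fin m → Bits n) (i : Fin m) (l : Fin n) (c d : ZMod 2) :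
    setBit (setBit s i l c) i l d = setBit s i l d := by
  funext i' l'
  simp only [setBit_apply]
  split_ifs <;> rfl

theorem mem_ones {s : Fin m → Bits n} {q : ℕ × ℕ} :
    q ∈ ones s ↔ ∃ (i : Fin m) (l : Fin n), s i l = 1 ∧ q = (i.1, l.1) := by
  simp [ones, eq_comm]

theorem mem_ones_mk {s : Fin m → Bits n} {i : Fin m} {l : Fin n} :
    (i.1, l.1) ∈ ones s ↔ s i l = 1 := by
  rw [mem_ones]
  constructor
  · rintro ⟨i', l', h, h'⟩
    obtain ⟨h1, h2⟩ := Prod.mk.inj h'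
    rwa [Fin.ext h1, Fin.ext h2]
  · exact fun h => ⟨i, l, h, rfl⟩

/-- The ancilla qubit. -/
abbrev ancilla (m : ℕ) : ℕ × ℕ := (m, 0)

/-- Registers occupy the rows `0, …, m - 1` of qubit addresses; row `m` is the first free one. -/
theorem ancilla_notMem_ones {s : Fin m → Bits n} : ancilla m ∉ ones s := by
  rw [mem_ones]
  rintro ⟨i, l, -, h⟩
  have := (Prod.mk.inj h).1
  omega

/-- Sets of qubits outside the registers. -/
def Outside (m n : ℕ) (b : Finset (ℕ × ℕ)) : Prop :=
  ∀ (i : Fin m) (l : Fin n), (i.1, l.1) ∉ b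

theorem outside_empty : Outside m n ∅ := fun _ _ => Finset.notMem_empty _

theorem outside_ancilla : Outside m n {ancilla m} := by
  intro i l h
  have := (Prod.mk.inj (Finset.mem_singleton.mp h)).1
  omega

theorem erase_ones {s : Fin m → Bits n} {b : Finset (ℕ × ℕ)} (hb : Outside m n b) (i : Fin m)
    (l : Fin n) : (ones s ∪ b).erase (i.1, l.1) = ones (setBit s i l 0) ∪ b := by
  ext q
  simp only [Finset.mem_erase, Finset.mem_union, mem_ones, setBit_apply]
  constructor
  · rintro ⟨h, ⟨i', l', h1, rfl⟩ | h1⟩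
    · refine Or.inl ⟨i', l', ?_, rfl⟩
      rw [if_neg, h1]
      rintro ⟨rfl, rfl⟩
      exact h rfl
    · exact Or.inr h1
  · rintro (⟨i', l', h1, rfl⟩ | h1)
    · split_ifs at h1 with h2
      · exact absurd h1 (by decide)
      · refine ⟨fun hc => h2 ?_, Or.inl ⟨i', l', h1, rfl⟩⟩
        obtain ⟨h3, h4⟩ := Prod.mk.inj hc
        exact ⟨Fin.ext h3, Fin.ext h4⟩
    · refine ⟨?_, Or.inr h1⟩
      rintro rfl
      exact hb i l h1

theorem insert_ones {s : Fin m → Bits n} {b : Finset (ℕ × ℕ)} (i : Fin m)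
    (l : Fin n) : insert (i.1, l.1) (ones s ∪ b) = ones (setBit s i l 1) ∪ b := by
  ext q
  simp only [Finset.mem_insert, Finset.mem_union, mem_ones, setBit_apply]
  constructor
  · rintro (rfl | ⟨i', l', h1, rfl⟩ | h1)
    · exact Or.inl ⟨i, l, by simp, rfl⟩
    · refine Or.inl ⟨i', l', ?_, rfl⟩
      split_ifs
      · rfl
      · exact h1
    · exact Or.inr h1
  · rintro (⟨i', l', h1, rfl⟩ | h1)
    · split_ifs at h1 with h2
      · left
        rw [h2.1, h2.2]
      · exact Or.inr (Or.inl ⟨i', l', h1, rfl⟩)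
    · exact Or.inr (Or.inr h1)

theorem mem_ones_union {s : Fin m → Bits n} {b : Finset (ℕ × ℕ)} (hb : Outside m n b) {i : Fin m}
    {l : Fin n} : (i.1, l.1) ∈ ones s ∪ b ↔ s i l = 1 := by
  rw [Finset.mem_union, mem_ones_mk]
  exact or_iff_left (hb i l)

/-! ## One-qubit gates on a register -/

/-- The action of a one-qubit matrix on qubit `l` of register `i`. -/
noncomputable def bitAct (K : Matrix (ZMod 2) (ZMod 2) ℂ) (i : Fin m) (l : Fin n)
    (φ : (Fin m → Bits n) → ℂ) : (Fin m → Bits n) → ℂ :=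
  fun s => ∑ c, K (s i l) c * φ (setBit s i l c)

/-- Reduces a gate on a register qubit to its action on basis states. The double sum is reindexed by
exchanging the old and the new value of the bit, which also explains why `K` occurs with transposed
arguments in the hypothesis. -/
theorem map_load {T : QMem →ₗ[ℂ] QMem} {K : Matrix (ZMod 2) (ZMod 2) ℂ} {i : Fin m} {l : Fin n}
    {b : Finset (ℕ × ℕ)} (hT : ∀ s : Fin m → Bits n, T (Finsupp.single (ones s ∪ b) 1)
      = ∑ c, K c (s i l) • Finsupp.single (ones (setBit s i l c) ∪ b) (1 : ℂ))
    (φ : (Fin m → Bits n) → ℂ) : T (load φ b) = load (bitAct K i l φ) b := by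
  simp only [load, map_sum, map_smul, hT, bitAct, Finset.sum_smul, Finset.smul_sum, smul_smul]
  rw [← Finset.sum_product', ← Finset.sum_product']
  refine Finset.sum_nbij' (fun p => (setBit p.1 i l p.2, p.1 i l))
    (fun p => (setBit p.1 i l p.2, p.1 i l)) (by simp) (by simp) ?_ ?_ ?_
  · rintro ⟨s, c⟩ -
    simp [setBit_setBit, setBit_self, setBit_apply]
  · rintro ⟨s, c⟩ -
    simp [setBit_setBit, setBit_self, setBit_apply]
  · rintro ⟨s, c⟩ -
    simp only [setBit_apply, and_self, if_true, setBit_setBit, setBit_self]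
    rw [mul_comm]

theorem bitAct_bitAct (K L : Matrix (ZMod 2) (ZMod 2) ℂ) (i : Fin m) (l : Fin n)
    (φ : (Fin m → Bits n) → ℂ) : bitAct K i l (bitAct L i l φ) = bitAct (K * L) i l φ := by
  funext s
  simp only [bitAct, setBit_apply, and_self, if_true, setBit_setBit, Matrix.mul_apply,
    sum_zmod2]
  ring

theorem bitAct_one (i : Fin m) (l : Fin n) (φ : (Fin m → Bits n) → ℂ) : bitAct 1 i l φ = φ := by
  funext s
  simp [bitAct, Matrix.one_apply, setBit_self]

theorem bitAct_smul (K : Matrix (ZMod 2) (ZMod 2) ℂ) (c : ℂ) (i : Fin m) (l : Fin n)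
    (φ : (Fin m → Bits n) → ℂ) : bitAct K i l (c • φ) = c • bitAct K i l φ := by
  funext s
  simp only [bitAct, Pi.smul_apply, smul_eq_mul, Finset.mul_sum]
  exact Finset.sum_congr rfl fun _ _ => by ring

/-- The Hadamard matrix. -/
noncomputable def hadamard : Matrix (ZMod 2) (ZMod 2) ℂ :=
  Matrix.of fun s t => (1 / (√2 : ℂ)) * sign (s * t)

theorem applyH_single (q : ℕ × ℕ) (b : Finset (ℕ × ℕ)) :
    applyH q (Finsupp.single b 1) = (1 / (√2 : ℂ)) • (Finsupp.single (b.erase q) (1 : ℂ)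
      + (if q ∈ b then (-1 : ℂ) else 1) • Finsupp.single (insert q b) (1 : ℂ)) := by
  rw [applyH, Finsupp.linearCombination_single, one_smul]

theorem applyPhase_single (ω : ℂ) (q : ℕ × ℕ) (b : Finset (ℕ × ℕ)) :
    applyPhase ω q (Finsupp.single b 1) = Finsupp.single b (if q ∈ b then ω else 1) := by
  rw [applyPhase, Finsupp.linearCombination_single, one_smul]

theorem applyCX_single (q q' : ℕ × ℕ) (b : Finset (ℕ × ℕ)) :
    applyCX q q' (Finsupp.single b 1)
      = Finsupp.single (if q ∈ b ∧ q ≠ q' then symmDiff b {q'} else b) (1 : ℂ) := by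
  rw [applyCX, Finsupp.linearCombination_single, one_smul]

theorem applyH_load {b : Finset (ℕ × ℕ)} (hb : Outside m n b) (i : Fin m) (l : Fin n)
    (φ : (Fin m → Bits n) → ℂ) :
    applyH (i.1, l.1) (load φ b) = load (bitAct hadamard i l φ) b := by
  refine map_load (fun s => ?_) φ
  rw [applyH_single, erase_ones hb, insert_ones, sum_zmod2]
  simp only [mem_ones_union hb]
  rcases zmod2_cases (s i l) with h | h <;> simp [h, hadamard, sign]

theorem applyS_load {b : Finset (ℕ × ℕ)} (hb : Outside m n b) (i : Fin m) (l : Fin n)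
    (φ : (Fin m → Bits n) → ℂ) : applyPhase Complex.I (i.1, l.1) (load φ b)
      = load (bitAct (diagonal fun c => if c = 1 then Complex.I else 1) i l φ) b := by
  refine map_load (fun s => ?_) φ
  rw [applyPhase_single, sum_zmod2]
  simp only [mem_ones_union hb]
  have h0 := setBit_self s i l
  rcases zmod2_cases (s i l) with h | h <;> rw [h] at h0 <;>
    simp [h, h0]

theorem applyCX_load_of_mem {b : Finset (ℕ × ℕ)} (hb : Outside m n b) {q : ℕ × ℕ} (hq : q ∈ b)
    (i : Fin m) (l : Fin n) (φ : (Fin m → Bits n) → ℂ) :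
    applyCX q (i.1, l.1) (load φ b) = load (bitAct (pauli1 1 0) i l φ) b := by
  refine map_load (fun s => ?_) φ
  have hne : q ≠ (i.1, l.1) := fun h => hb i l (h ▸ hq)
  rw [applyCX_single, if_pos ⟨Finset.mem_union_right _ hq, hne⟩, sum_zmod2]
  rcases zmod2_cases (s i l) with h | h
  · have h1 : (i.1, l.1) ∉ ones s ∪ b := by rw [mem_ones_union hb, h]; decide
    have h2 : symmDiff (ones s ∪ b) {(i.1, l.1)} = insert (i.1, l.1) (ones s ∪ b) := by
      ext x
      simp only [Finset.mem_symmDiff, Finset.mem_singleton, Finset.mem_insert]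
      by_cases hx : x = (i.1, l.1)
      · subst hx; simp [h1]
      · simp [hx]
    rw [h2, insert_ones]
    simp [h, pauli1]
  · have h1 : (i.1, l.1) ∈ ones s ∪ b := by rw [mem_ones_union hb, h]
    have h2 : symmDiff (ones s ∪ b) {(i.1, l.1)} = (ones s ∪ b).erase (i.1, l.1) := by
      ext x
      simp only [Finset.mem_symmDiff, Finset.mem_singleton, Finset.mem_erase]
      by_cases hx : x = (i.1, l.1)
      · subst hx; simp [h1]
      · simp [hx]
    rw [h2, erase_ones hb]
    simp [h, pauli1]

theorem applyCX_load_of_notMem {b : Finset (ℕ × ℕ)} {q : ℕ × ℕ} (hq : q ∉ b)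
    (hq' : ∀ (i : Fin m) (l : Fin n), q ≠ (i.1, l.1)) (q' : ℕ × ℕ)
    (φ : (Fin m → Bits n) → ℂ) : applyCX q q' (load φ b) = load φ b := by
  simp only [load, map_sum, map_smul]
  refine Finset.sum_congr rfl fun s _ => ?_
  rw [applyCX_single, if_neg]
  rintro ⟨h, -⟩
  rcases Finset.mem_union.mp h with h | h
  · obtain ⟨i, l, -, h'⟩ := mem_ones.mp h
    exact hq' i l h'
  · exact hq h

theorem ancilla_ne (i : Fin m) (l : Fin n) : ancilla m ≠ (i.1, l.1) := by
  intro h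
  have := (Prod.mk.inj h).1
  omega

/-! ## Gates on the ancilla -/

theorem union_ancilla_erase (s : Fin m → Bits n) :
    (ones s ∪ {ancilla m}).erase (ancilla m) = ones s ∪ ∅ := by
  rw [Finset.union_comm, ← Finset.insert_eq, Finset.erase_insert ancilla_notMem_ones,
    Finset.union_empty]

theorem applyH_ancilla_load_empty (φ : (Fin m → Bits n) → ℂ) :
    applyH (ancilla m) (load φ ∅) = (1 / (√2 : ℂ)) • (load φ ∅ + load φ {ancilla m}) := by
  simp only [load, map_sum, map_smul, ← Finset.sum_add_distrib, Finset.smul_sum]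
  refine Finset.sum_congr rfl fun s _ => ?_
  rw [applyH_single, Finset.union_empty, if_neg ancilla_notMem_ones,
    Finset.erase_eq_of_notMem ancilla_notMem_ones, one_smul, Finset.insert_eq, Finset.union_comm,
    ← smul_add, smul_comm]

theorem applyH_ancilla_load_ancilla (φ : (Fin m → Bits n) → ℂ) :
    applyH (ancilla m) (load φ {ancilla m})
      = (1 / (√2 : ℂ)) • (load φ ∅ - load φ {ancilla m}) := by
  simp only [load, map_sum, map_smul, ← Finset.sum_sub_distrib, Finset.smul_sum]
  refine Finset.sum_congr rfl fun s _ => ?_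
  have h : ancilla m ∈ ones s ∪ {ancilla m} := by simp
  rw [applyH_single, union_ancilla_erase, if_pos h, Finset.insert_eq_of_mem h, neg_one_smul,
    ← sub_eq_add_neg, ← smul_sub, smul_comm]

theorem applyS_ancilla_load_empty (φ : (Fin m → Bits n) → ℂ) :
    applyPhase Complex.I (ancilla m) (load φ ∅) = load φ ∅ := by
  simp only [load, map_sum, map_smul]
  refine Finset.sum_congr rfl fun s _ => ?_
  rw [applyPhase_single, Finset.union_empty, if_neg ancilla_notMem_ones]

theorem applyS_ancilla_load_ancilla (φ : (Fin m → Bits n) → ℂ) :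
    applyPhase Complex.I (ancilla m) (load φ {ancilla m})
      = Complex.I • load φ {ancilla m} := by
  simp only [load, map_sum, map_smul, Finset.smul_sum]
  refine Finset.sum_congr rfl fun s _ => ?_
  have h : ancilla m ∈ ones s ∪ {ancilla m} := by simp
  rw [applyPhase_single, if_pos h]
  simp [mul_comm]

theorem filter_load {p : Finset (ℕ × ℕ) → Prop} [DecidablePred p] {b : Finset (ℕ × ℕ)} (P : Prop)
    [Decidable P] (h : ∀ s : Fin m → Bits n, p (ones s ∪ b) ↔ P) (φ : (Fin m → Bits n) → ℂ) :
    (load φ b).filter p = if P then load φ b else 0 := by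
  split_ifs with hP
  · rw [load, Finsupp.filter_sum]
    refine Finset.sum_congr rfl fun s _ => ?_
    rw [Finsupp.filter_smul, Finsupp.filter_single_of_pos _ ((h s).mpr hP)]
  · rw [load, Finsupp.filter_sum]
    refine Finset.sum_eq_zero fun s _ => ?_
    rw [Finsupp.filter_smul, Finsupp.filter_single_of_neg _ (fun hc => hP ((h s).mp hc)), smul_zero]

/-! ## Pauli operators on a register -/

/-- The action of a matrix on register `i`. -/
noncomputable def regAct (i : Fin m) (K : Matrix (Bits n) (Bits n) ℂ)
    (φ : (Fin m → Bits n) → ℂ) : (Fin m → Bits n) → ℂ :=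
  fun s => ∑ r, K (s i) r * φ (Function.update s i r)

theorem regAct_one (i : Fin m) (φ : (Fin m → Bits n) → ℂ) : regAct i 1 φ = φ := by
  funext s
  simp [regAct, Matrix.one_apply]

theorem regAct_regAct (i : Fin m) (K L : Matrix (Bits n) (Bits n) ℂ)
    (φ : (Fin m → Bits n) → ℂ) : regAct i K (regAct i L φ) = regAct i (K * L) φ := by
  funext s
  simp only [regAct, Function.update_self, Function.update_idem, Matrix.mul_apply, Finset.sum_mul,
    Finset.mul_sum]
  rw [Finset.sum_comm]
  exact Finset.sum_congr rfl fun r _ => Finset.sum_congr rfl fun t _ => by ring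

/-- In the sum over register contents only strings that agree with `s i` away from `l` survive,
because the other tensor factors are identities. -/
theorem bitAct_eq_regAct (K : Matrix (ZMod 2) (ZMod 2) ℂ) (i : Fin m) (l : Fin n)
    (φ : (Fin m → Bits n) → ℂ) :
    bitAct K i l φ = regAct i (tensor (Function.update (fun _ => 1) l K)) φ := by
  funext s
  simp only [bitAct, regAct]
  have hinj : Function.Injective fun c : ZMod 2 => Function.update (s i) l c := by
    intro c d h
    simpa using congrFun h l
  rw [← Finset.sum_subset (Finset.subset_univ (Finset.univ.image
    fun c : ZMod 2 => Function.update (s i) l c)), Finset.sum_image fun _ _ _ _ h => hinj h]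
  · refine Finset.sum_congr rfl fun c _ => ?_
    rw [← setBit]
    congr 1
    simp only [tensor, Matrix.of_apply]
    rw [Finset.prod_eq_single l]
    · simp
    · intro j _ hj
      simp [hj]
    · simp
  · intro r _ hr
    have : ∃ j, j ≠ l ∧ s i j ≠ r j := by
      by_contra! hc
      apply hr
      refine Finset.mem_image.mpr ⟨r l, Finset.mem_univ _, ?_⟩
      funext j
      by_cases hj : j = l
      · subst hj; simp
      · simp [hj, hc j hj]
    obtain ⟨j, hj, hne⟩ := this
    simp only [tensor, Matrix.of_apply]
    rw [Finset.prod_eq_zero (Finset.mem_univ j), zero_mul]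
    simp [hj, hne]

/-- The part of a Pauli operator on the first `t` qubits. -/
noncomputable def pauliPrefix (v : PVec n) (t : ℕ) : Matrix (Bits n) (Bits n) ℂ :=
  tensor fun j => if j.1 < t then pauli1 (v (Sum.inl j)) (v (Sum.inr j)) else 1

theorem pauliPrefix_zero (v : PVec n) : pauliPrefix v 0 = 1 := by
  simp [pauliPrefix, tensor_one]

theorem pauliPrefix_self (v : PVec n) : pauliPrefix v n = pauli v := by
  simp [pauliPrefix, pauli_eq_tensor]

theorem pauliPrefix_succ (v : PVec n) (l : Fin n) :
    tensor (Function.update (fun _ => 1) l (pauli1 (v (Sum.inl l)) (v (Sum.inr l))))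
      * pauliPrefix v l = pauliPrefix v (l + 1) := by
  rw [pauliPrefix, tensor_mul, pauliPrefix]
  congr 1
  funext j
  by_cases h : j = l
  · subst h; simp
  · have h' : j.1 ≠ l.1 := fun hc => h (Fin.ext hc)
    have h'' : (j.1 < l.1) ↔ j.1 < l.1 + 1 := by omega
    simp [h, h'']

end

end LSN

namespace LSN

open Matrix

/-! ## Measuring a Pauli operator -/

/-- The parameter `n`, from the input. -/
abbrev Expr.n : Expr := .get 0 (.lit 0) (.lit 0) (.lit 0)

/-- The parameter `k`, from the input. -/
abbrev Expr.k : Expr := .get 0 (.lit 1) (.lit 0) (.lit 0)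

/-- The parameter `m`, from the input. -/
abbrev Expr.m : Expr := .get 0 (.lit 2) (.lit 0) (.lit 0)

/-- A Pauli operator on qubit `22` of register `20`, controlled by the ancilla. The operator is
read from row `n + 21` of array `a`. -/
def Cmd.controlledPauli (a : ℕ) : Cmd :=
  let cx : Cmd := .gateCX .m (.lit 0) (.var 20) (.var 22)
  let h : Cmd := .gateH (.var 20) (.var 22)
  let s : Cmd := .gateS (.var 20) (.var 22)
  let x : Expr := .mod (.get a (.var 20) (.add .n (.var 21)) (.var 22)) (.lit 2)
  let z : Expr := .mod (.get a (.var 20) (.add .n (.var 21)) (.add .n (.var 22))) (.lit 2)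
  .ite z (.ite x (.seq s (.seq s (.seq s (.seq cx s)))) (.seq h (.seq cx h)))
    (.ite x cx .skip)

/-- Measure on register `20` the Pauli operator in row `n + 21` of array `a`. The result is stored
in array `11`. -/
def Cmd.measurePauli (a : ℕ) : Cmd :=
  let h : Cmd := .gateH .m (.lit 0)
  let s : Cmd := .gateS .m (.lit 0)
  .seq h <| .seq (.for_ 22 .n (.controlledPauli a)) <| .seq h <|
    .seq (.measure 11 (.var 20) (.var 21) (.lit 0) .m (.lit 0))
      (.ite (.get 11 (.var 20) (.var 21) (.lit 0)) (.seq h (.seq s (.seq s h))) .skip)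

section

variable {m n : ℕ}

theorem natCast_zmod2_mod {N : ℕ} {c : ZMod 2} (h : (N : ZMod 2) = c) : N % 2 = c.val := by
  rw [← h, ZMod.val_natCast]

theorem bitAct_pauli1 (v : PVec n) (i : Fin m) (l : Fin n) (φ : (Fin m → Bits n) → ℂ) :
    bitAct (pauli1 (v (Sum.inl l)) (v (Sum.inr l))) i l (regAct i (pauliPrefix v l) φ)
      = regAct i (pauliPrefix v (l + 1)) φ := by
  rw [bitAct_eq_regAct, regAct_regAct, pauliPrefix_succ]

theorem sqrt_two_inv_mul_self : (1 / (√2 : ℂ)) * (1 / (√2 : ℂ)) = 1 / 2 := by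
  have h : ((√2 : ℝ) : ℂ) * (√2 : ℝ) = 2 := by
    rw [← Complex.ofReal_mul, Real.mul_self_sqrt (by norm_num)]
    norm_num
  rw [div_mul_div_comm, one_mul, h]

theorem hadamard_mul_hadamard : hadamard * hadamard = 1 := by
  ext s t
  rw [Matrix.mul_apply, sum_zmod2]
  simp only [hadamard, Matrix.of_apply]
  have h : ∀ x y : ℂ, 1 / (√2 : ℂ) * x * (1 / (√2 : ℂ) * y) = 1 / 2 * (x * y) := by
    intro x y
    rw [← sqrt_two_inv_mul_self]
    ring
  rw [h, h]
  rcases zmod2_cases s with rfl | rfl <;> rcases zmod2_cases t with rfl | rfl <;>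
    norm_num [sign]

theorem hadamard_mul_pauli1 : hadamard * (pauli1 1 0 * hadamard) = pauli1 0 1 := by
  ext s t
  simp only [Matrix.mul_apply, sum_zmod2, hadamard, Matrix.of_apply]
  have h : ∀ x y z : ℂ, 1 / (√2 : ℂ) * x * (z * (1 / (√2 : ℂ) * y)) = 1 / 2 * (x * z * y) := by
    intro x y z
    rw [← sqrt_two_inv_mul_self]
    ring
  simp only [mul_add, h]
  rcases zmod2_cases s with rfl | rfl <;> rcases zmod2_cases t with rfl | rfl <;>
    norm_num [sign, pauli1]

theorem phase_mul_pauli1 : (diagonal fun c : ZMod 2 => if c = 1 then Complex.I else 1) *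
    (pauli1 1 0 * ((diagonal fun c : ZMod 2 => if c = 1 then Complex.I else 1) *
    ((diagonal fun c : ZMod 2 => if c = 1 then Complex.I else 1) *
    (diagonal fun c : ZMod 2 => if c = 1 then Complex.I else 1)))) = pauli1 1 1 := by
  rw [diagonal_mul_diagonal, diagonal_mul_diagonal]
  ext s t
  rw [diagonal_mul, mul_diagonal]
  rcases zmod2_cases s with rfl | rfl <;> rcases zmod2_cases t with rfl | rfl <;>
    simp [pauli1]

theorem phase_pow_four : (diagonal fun c : ZMod 2 => if c = 1 then Complex.I else 1) *
    ((diagonal fun c : ZMod 2 => if c = 1 then Complex.I else 1) *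
    ((diagonal fun c : ZMod 2 => if c = 1 then Complex.I else 1) *
    (diagonal fun c : ZMod 2 => if c = 1 then Complex.I else 1))) = 1 := by
  rw [diagonal_mul_diagonal, diagonal_mul_diagonal, diagonal_mul_diagonal, ← diagonal_one]
  congr 1
  funext c
  rcases zmod2_cases c with rfl | rfl <;> simp

/-- Only the `CX` gate is truly controlled. It is conjugated to a controlled `Z` by `H` and to a
controlled `Y` by `S`, with `S³` as the inverse of `S`. In the branch where the ancilla is `0` the
uncontrolled gates cancel through `H² = 1` and `S⁴ = 1`. -/
theorem wp_controlledPauli {a : ℕ} {μ : Mem} {i : Fin m} {l : Fin n} {v : PVec n}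
    (hn : μ 0 0 0 0 = n) (hm : μ 0 2 0 0 = m) (hi : μ 20 0 0 0 = i) (hl : μ 22 0 0 0 = l)
    (hx : (μ a i (n + μ 21 0 0 0) l : ZMod 2) = v (Sum.inl l))
    (hz : (μ a i (n + μ 21 0 0 0) (n + l) : ZMod 2) = v (Sum.inr l))
    (F : Mem → QMem → ℝ) (φ χ : (Fin m → Bits n) → ℂ) :
    wp (.controlledPauli a) F μ (load φ ∅ + load χ {ancilla m})
      = F μ (load φ ∅ + load (bitAct (pauli1 (v (Sum.inl l)) (v (Sum.inr l))) i l χ)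
          {ancilla m}) := by
  have hx' := natCast_zmod2_mod hx
  have hz' := natCast_zmod2_mod hz
  simp only [Cmd.controlledPauli, wp, Expr.eval, hn, hm, hi, hl, hx', hz']
  have hcx : ∀ φ χ : (Fin m → Bits n) → ℂ, applyCX (m, 0) (i.1, l.1)
      (load φ ∅ + load χ {ancilla m}) = load φ ∅ + load (bitAct (pauli1 1 0) i l χ) {ancilla m} := by
    intro φ χ
    rw [map_add, applyCX_load_of_notMem (Finset.notMem_empty _) ancilla_ne,
      applyCX_load_of_mem outside_ancilla (Finset.mem_singleton_self _)]
  have hh : ∀ φ χ : (Fin m → Bits n) → ℂ, applyH (i.1, l.1)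
      (load φ ∅ + load χ {ancilla m})
        = load (bitAct hadamard i l φ) ∅ + load (bitAct hadamard i l χ) {ancilla m} := by
    intro φ χ
    rw [map_add, applyH_load outside_empty, applyH_load outside_ancilla]
  have hs : ∀ φ χ : (Fin m → Bits n) → ℂ, applyPhase Complex.I (i.1, l.1)
      (load φ ∅ + load χ {ancilla m})
        = load (bitAct (diagonal fun c => if c = 1 then Complex.I else 1) i l φ) ∅ +
          load (bitAct (diagonal fun c => if c = 1 then Complex.I else 1) i l χ) {ancilla m} := by
    intro φ χ
    rw [map_add, applyS_load outside_empty, applyS_load outside_ancilla]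
  rcases zmod2_cases (v (Sum.inl l)) with h | h <;> rcases zmod2_cases (v (Sum.inr l)) with h' | h'
  · simp [h, h', pauli1_entries.1, bitAct_one]
  · simp only [h, h', ZMod.val_zero, ZMod.val_one, ne_eq, one_ne_zero, not_true, not_false_iff,
      if_true, if_false, hh, hcx, bitAct_bitAct, hadamard_mul_hadamard, hadamard_mul_pauli1,
      bitAct_one]
  · simp only [h, h', ZMod.val_zero, ZMod.val_one, ne_eq, one_ne_zero, not_true, not_false_iff,
      if_true, if_false, hcx]
  · simp only [h, h', ZMod.val_one, ne_eq, one_ne_zero, not_false_iff,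
      if_true, hs, hcx, bitAct_bitAct, phase_mul_pauli1, phase_pow_four, bitAct_one]

theorem applyH_ancilla_add (φ χ : (Fin m → Bits n) → ℂ) :
    applyH (ancilla m) ((1 / (√2 : ℂ)) • (load φ ∅ + load χ {ancilla m}))
      = load ((1 / 2 : ℂ) • (φ + χ)) ∅ + load ((1 / 2 : ℂ) • (φ - χ)) {ancilla m} := by
  rw [map_smul, map_add, applyH_ancilla_load_empty, applyH_ancilla_load_ancilla, ← smul_add,
    smul_smul, sqrt_two_inv_mul_self, load_smul, load_smul, load_add,
    show φ - χ = φ + (-1 : ℂ) • χ by rw [neg_one_smul, sub_eq_add_neg], load_add, load_smul]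
  module

/-- `S² = Z` and `H Z H = X`: the gate sequence flips the ancilla back to `0`. -/
theorem applyX_ancilla (φ : (Fin m → Bits n) → ℂ) :
    applyH (ancilla m) (applyPhase Complex.I (ancilla m) (applyPhase Complex.I (ancilla m)
      (applyH (ancilla m) (load φ {ancilla m})))) = load φ ∅ := by
  have hs : applyPhase Complex.I (ancilla m) (applyPhase Complex.I (ancilla m)
      (load φ ∅ - load φ {ancilla m})) = load φ ∅ + load φ {ancilla m} := by
    simp only [map_sub, map_smul, applyS_ancilla_load_empty, applyS_ancilla_load_ancilla,
      smul_smul, Complex.I_mul_I, neg_one_smul, sub_neg_eq_add]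
  rw [applyH_ancilla_load_ancilla, map_smul, map_smul, hs, applyH_ancilla_add, sub_self, smul_zero]
  have h : load (0 : (Fin m → Bits n) → ℂ) {ancilla m} = 0 := by simp [load]
  rw [h, add_zero, ← two_smul ℂ φ, smul_smul]
  norm_num

/-- The state of the registers after result `w` of a measurement of the Pauli operator `v` on
register `i`. -/
noncomputable def postMeasure (i : Fin m) (v : PVec n) (w : ZMod 2) (φ : (Fin m → Bits n) → ℂ) :
    (Fin m → Bits n) → ℂ :=
  (1 / 2 : ℂ) • (φ + sign w • regAct i (pauli v) φ)

/-- The Hadamard test: after the second `H` the ancilla values `0` and `1` carry the two spectral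
projections of the state, and measuring the ancilla selects one. Resetting the ancilla after result
`1` leaves the memory in the same form in both branches, so that measurements can be iterated. Array
`22` is excluded for the operator because it is the loop counter. -/
theorem wp_measurePauli {a : ℕ} (ha : a ≠ 22) {μ : Mem} {i : Fin m} {j : ℕ} {v : PVec n}
    (hn : μ 0 0 0 0 = n) (hm : μ 0 2 0 0 = m) (hi : μ 20 0 0 0 = i) (hj : μ 21 0 0 0 = j)
    (hl : μ 22 0 0 0 = 0) (hx : ∀ l : Fin n, (μ a i (n + j) l : ZMod 2) = v (Sum.inl l))
    (hz : ∀ l : Fin n, (μ a i (n + j) (n + l) : ZMod 2) = v (Sum.inr l))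
    (F : Mem → QMem → ℝ) (φ : (Fin m → Bits n) → ℂ) :
    wp (.measurePauli a) F μ (load φ ∅) = ∑ w : ZMod 2,
      F (store μ 11 i j 0 w.val) (load (postMeasure i v w φ) ∅) := by
  have hloop : ∀ G : Mem → QMem → ℝ, wp (.for_ 22 .n (.controlledPauli a)) G μ
      ((1 / (√2 : ℂ)) • (load φ ∅ + load φ {ancilla m}))
        = G μ ((1 / (√2 : ℂ)) • (load φ ∅ + load (regAct i (pauli v) φ) {ancilla m})) := by
    intro G
    have := wp_for_unitary (x := 22) (N := n) (e := .n) (c := .controlledPauli a) (μ := μ)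
      (fun t => load ((1 / (√2 : ℂ)) • φ) ∅ +
        load ((1 / (√2 : ℂ)) • regAct i (pauliPrefix v t) φ) {ancilla m}) hl
      (by simp [Expr.eval, hn]) G ?_
    · simpa only [pauliPrefix_zero, pauliPrefix_self, regAct_one, load_smul, ← smul_add] using this
    · intro t ht G
      have e : ∀ b, b ≠ 22 → setVar μ 22 t b = μ b := fun b hb => store_of_ne hb
      have := wp_controlledPauli (a := a) (μ := setVar μ 22 t) (i := i) (l := ⟨t, ht⟩) (v := v)
        (by rw [e _ (by norm_num), hn]) (by rw [e _ (by norm_num), hm])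
        (by rw [e _ (by norm_num), hi]) store_apply_self
        (by rw [e _ ha, e _ (by norm_num), hj]; exact hx ⟨t, ht⟩)
        (by rw [e _ ha, e _ (by norm_num), hj]; exact hz ⟨t, ht⟩) G
        ((1 / (√2 : ℂ)) • φ) ((1 / (√2 : ℂ)) • regAct i (pauliPrefix v t) φ)
      rw [this, bitAct_smul]
      have h2 := bitAct_pauli1 v i ⟨t, ht⟩ φ
      dsimp only at h2 ⊢
      rw [h2]
  have hmem : ∀ s : Fin m → Bits n, ancilla m ∈ ones s ∪ {ancilla m} := fun s => by simp
  have hnot : ∀ s : Fin m → Bits n, ancilla m ∉ ones s ∪ ∅ := fun s => by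
    rw [Finset.union_empty]; exact ancilla_notMem_ones
  have f1 : ∀ χ : (Fin m → Bits n) → ℂ,
      (load χ ∅).filter (fun b => ancilla m ∉ b) = load χ ∅ := fun χ => by
    rw [filter_load True (fun s => by simpa using ancilla_notMem_ones), if_pos trivial]
  have f2 : ∀ χ : (Fin m → Bits n) → ℂ,
      (load χ {ancilla m}).filter (fun b => ancilla m ∉ b) = 0 := fun χ => by
    rw [filter_load False (fun s => by simp), if_neg (by simp)]
  have f3 : ∀ χ : (Fin m → Bits n) → ℂ,
      (load χ ∅).filter (fun b => ancilla m ∈ b) = 0 := fun χ => by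
    rw [filter_load False (fun s => by simpa using ancilla_notMem_ones), if_neg (by simp)]
  have f4 : ∀ χ : (Fin m → Bits n) → ℂ,
      (load χ {ancilla m}).filter (fun b => ancilla m ∈ b) = load χ {ancilla m} := fun χ => by
    rw [filter_load True (fun s => by simp), if_pos trivial]
  have e0 : ∀ b w, b ≠ 11 → store μ 11 i j 0 w b = μ b := fun b w hb => store_of_ne hb
  have p0 : postMeasure i v 0 φ = (1 / 2 : ℂ) • (φ + regAct i (pauli v) φ) := by
    rw [postMeasure, sign_zero, one_smul]
  have p1 : postMeasure i v 1 φ = (1 / 2 : ℂ) • (φ - regAct i (pauli v) φ) := by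
    rw [postMeasure, sign_one, neg_one_smul, sub_eq_add_neg]
  simp only [Cmd.measurePauli]
  rw [wp, wp]
  simp only [Expr.eval, hm]
  rw [applyH_ancilla_load_empty, wp, hloop]
  simp only [wp, Expr.eval, hm, applyH_ancilla_add, hi, hj, Finsupp.filter_add, f1, f2, f3, f4,
    add_zero, zero_add, e0 20 _ (by norm_num), e0 21 _ (by norm_num), e0 0 _ (by norm_num),
    store_apply_self, applyX_ancilla, ne_eq, one_ne_zero, not_true, not_false_iff, if_true,
    if_false]
  rw [sum_zmod2, p0, p1]
  rfl

end

end LSN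

namespace LSN

open Matrix

/-! ## Nested loops that fill an array -/

section

variable {β : ℕ → Type}

/-- The memory after the cells `j < t` of row `i` of array `a` have been filled. -/
def fillRow (μ : Mem) (a i : ℕ) (enc : ∀ j, β j → ℕ) {t : ℕ} (g : ∀ j : Fin t, β j) : Mem :=
  fun a' i' j' l' => if h : (a' = a ∧ i' = i ∧ l' = 0) ∧ j' < t then enc j' (g ⟨j', h.2⟩)
    else μ a' i' j' l'

/-- The memory after `t` rows of array `a` have been filled. -/
def fill (μ : Mem) (a : ℕ) (enc : ∀ j, β j → ℕ) {t n : ℕ} (f : Fin t → ∀ j : Fin n, β j) : Mem :=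
  fun a' i' j' l' => if h : (a' = a ∧ l' = 0) ∧ i' < t ∧ j' < n then
    enc j' (f ⟨i', h.2.1⟩ ⟨j', h.2.2⟩) else μ a' i' j' l'

theorem fillRow_zero (μ : Mem) (a i : ℕ) (enc : ∀ j, β j → ℕ) (g : ∀ j : Fin 0, β j) :
    fillRow μ a i enc g = μ := by
  funext a' i' j' l'
  simp [fillRow]

theorem fill_zero (μ : Mem) (a : ℕ) (enc : ∀ j, β j → ℕ) {n : ℕ}
    (f : Fin 0 → ∀ j : Fin n, β j) : fill μ a enc f = μ := by
  funext a' i' j' l'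
  simp [fill]

theorem fillRow_snoc (μ : Mem) (a i : ℕ) (enc : ∀ j, β j → ℕ) {t : ℕ} (g : ∀ j : Fin t, β j)
    (v : β t) : fillRow μ a i enc (Fin.snoc (α := fun j : Fin (t + 1) => β j) g v)
      = store (fillRow μ a i enc g) a i t 0 (enc t v) := by
  funext a' i' j' l'
  simp only [fillRow, store]
  by_cases h : a' = a ∧ i' = i ∧ l' = 0
  · obtain ⟨rfl, rfl, rfl⟩ := h
    rcases lt_trichotomy j' t with hj | rfl | hj
    · have h1 : j' < t + 1 := by omega
      have h2 : j' ≠ t := by omega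
      simp [hj, h1, h2, Fin.snoc]
    · simp [Fin.snoc]
    · have h1 : ¬ j' < t + 1 := by omega
      have h2 : j' ≠ t := by omega
      have h3 : ¬ j' < t := by omega
      simp [h1, h2, h3]
  · have h4 : ¬ (a' = a ∧ i' = i ∧ j' = t ∧ l' = 0) := by tauto
    rw [dif_neg (by tauto), dif_neg (by tauto), if_neg h4]

theorem fill_snoc (μ : Mem) (a : ℕ) (enc : ∀ j, β j → ℕ) {t n : ℕ}
    (f : Fin t → ∀ j : Fin n, β j) (g : ∀ j : Fin n, β j) :
    fill μ a enc (Fin.snoc (α := fun _ : Fin (t + 1) => ∀ j : Fin n, β j) f g)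
      = fillRow (fill μ a enc f) a t enc g := by
  funext a' i' j' l'
  simp only [fillRow, fill]
  by_cases h : (a' = a ∧ l' = 0) ∧ j' < n
  · obtain ⟨⟨rfl, rfl⟩, hj⟩ := h
    rcases lt_trichotomy i' t with hi | rfl | hi
    · have h1 : i' < t + 1 := by omega
      have h2 : i' ≠ t := by omega
      simp [hi, h1, h2, hj, Fin.snoc]
    · simp [hj, Fin.snoc]
    · have h1 : ¬ i' < t + 1 := by omega
      have h2 : i' ≠ t := by omega
      have h3 : ¬ i' < t := by omega
      simp [h1, h2, h3]
  · rw [dif_neg (by tauto), dif_neg (by tauto), dif_neg (by tauto)]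

theorem fill_of_ne {μ : Mem} {a b : ℕ} (h : b ≠ a) (enc : ∀ j, β j → ℕ) {t n : ℕ}
    (f : Fin t → ∀ j : Fin n, β j) : fill μ a enc f b = μ b := by
  funext i j l
  simp [fill, h]

theorem fillRow_of_ne {μ : Mem} {a b i : ℕ} (h : b ≠ a) (enc : ∀ j, β j → ℕ) {t : ℕ}
    (g : ∀ j : Fin t, β j) : fillRow μ a i enc g b = μ b := by
  funext i j l
  simp [fillRow, h]

theorem fill_apply {μ : Mem} {a : ℕ} (enc : ∀ j, β j → ℕ) {t n : ℕ}
    (f : Fin t → ∀ j : Fin n, β j) (i : Fin t) (j : Fin n) :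
    fill μ a enc f a i j 0 = enc j (f i j) := by
  simp [fill]

theorem store_setVar {μ : Mem} {a b i j l v w : ℕ} (h : a ≠ b) :
    store (setVar μ b w) a i j l v = setVar (store μ a i j l v) b w := by
  funext a' i' j' l'
  simp only [store]
  split_ifs <;> first | rfl | omega

/-- Two applications of `wp_for`. `Ψ i f j g` is the state when the rows in `f` are complete and the
cells in `g` of row `i` have been processed; by `hΨ` the end of a row is the start of the next. The
body sees nothing about array `a` itself, and the weight may depend on the column only. -/
theorem wp_fill [∀ j, Fintype (β j)] {a m n : ℕ} (enc : ∀ j, β j → ℕ) (h0 : a ≠ 0) (h20 : a ≠ 20)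
    (h21 : a ≠ 21) {c : Cmd} {μ : Mem} (hn : μ 0 0 0 0 = n) (hm : μ 0 2 0 0 = m)
    (hi : μ 20 0 0 0 = 0) (hj : μ 21 0 0 0 = 0) (κ : ℕ → ℝ)
    (Ψ : ∀ i, (Fin i → ∀ j : Fin n, β j) → ∀ j, (∀ j' : Fin j, β j') → QMem)
    (hΨ : ∀ i f (g : ∀ j : Fin n, β j) g₀,
      Ψ (i + 1) (Fin.snoc (α := fun _ : Fin (i + 1) => ∀ j : Fin n, β j) f g) 0 g₀ = Ψ i f n g)
    (hbody : ∀ i < m, ∀ f, ∀ j < n, ∀ (g : ∀ j' : Fin j, β j') (F : Mem → QMem → ℝ),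
      Homogeneous F → ∀ ν : Mem, (∀ b, b ≠ a → b ≠ 20 → b ≠ 21 → ν b = μ b) →
      ν 20 0 0 0 = i → ν 21 0 0 0 = j → wp c F ν (Ψ i f j g) = κ j * ∑ v : β j,
        F (store ν a i j 0 (enc j v))
          (Ψ i f (j + 1) (Fin.snoc (α := fun j' : Fin (j + 1) => β j') g v)))
    {F : Mem → QMem → ℝ} (hF : Homogeneous F) (f₀ : Fin 0 → ∀ j : Fin n, β j)
    (g₀ : ∀ j : Fin 0, β j) :
    wp (.for_ 20 .m (.for_ 21 .n c)) F μ (Ψ 0 f₀ 0 g₀)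
      = (∏ j ∈ Finset.range n, κ j) ^ m *
        ∑ f : Fin m → ∀ j : Fin n, β j, F (fill μ a enc f) (Ψ m f 0 g₀) := by
  have hinner : ∀ i < m, ∀ (f : Fin i → ∀ j : Fin n, β j) (G : Mem → QMem → ℝ), Homogeneous G →
      wp (.for_ 21 .n c) G (setVar (fill μ a enc f) 20 i) (Ψ i f 0 g₀)
        = (∏ j ∈ Finset.range n, κ j) * ∑ g : ∀ j : Fin n, β j,
          G (setVar (fillRow (fill μ a enc f) a i enc g) 20 i) (Ψ i f n g) := by
    intro i hi f G hG
    have e : ∀ (t : ℕ) (g : ∀ j : Fin t, β j) b, b ≠ a → b ≠ 20 →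
        setVar (fillRow (fill μ a enc f) a i enc g) 20 i b = μ b := by
      intro t g b hb hb'
      rw [setVar, store_of_ne hb', fillRow_of_ne hb, fill_of_ne hb]
    have := wp_for (x := 21) (N := n) (e := .n) (c := c) (α := β)
      (fun j g => setVar (fillRow (fill μ a enc f) a i enc g) 20 i) (fun j g => Ψ i f j g) κ
      (fun t g => by rw [e _ _ _ h21.symm (by norm_num), hj])
      (fun g => by rw [Expr.eval, e _ _ _ h0.symm (by norm_num)]; exact hn) ?_ hG g₀
    · simpa only [fillRow_zero] using this
    · intro j hj' g H hH
      rw [hbody i hi f j hj' g H hH]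
      · congr 1
        refine Finset.sum_congr rfl fun v _ => ?_
        rw [fillRow_snoc, store_setVar h21, store_setVar h20]
      · intro b h1 h2 h3
        rw [setVar, store_of_ne h3, e _ _ _ h1 h2]
      · rw [setVar, store_of_ne (by norm_num)]
        exact store_apply_self
      · exact store_apply_self
  have := wp_for (x := 20) (N := m) (e := .m) (c := .for_ 21 .n c)
    (α := fun _ => ∀ j : Fin n, β j) (fun i f => fill μ a enc f) (fun i f => Ψ i f 0 g₀)
    (fun _ => ∏ j ∈ Finset.range n, κ j)
    (fun t f => by rw [fill_of_ne h20.symm, hi])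
    (fun f => by rw [Expr.eval, fill_of_ne h0.symm]; exact hm) ?_ hF f₀
  · simpa only [fill_zero, Finset.prod_const, Finset.card_range] using this
  · intro i hi' f H hH
    rw [hinner i hi' f H hH]
    congr 1
    refine Finset.sum_congr rfl fun g _ => ?_
    rw [fill_snoc, hΨ]

end

/-- Random numbers below `N j` in the cells `i, j` of array `a`. -/
theorem wp_fill_rand {a m n : ℕ} (N : ℕ → ℕ) (hN : ∀ j < n, 0 < N j) (h0 : a ≠ 0) (h20 : a ≠ 20)
    (h21 : a ≠ 21) {e : Expr} {μ : Mem} (hn : μ 0 0 0 0 = n) (hm : μ 0 2 0 0 = m)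
    (hi : μ 20 0 0 0 = 0) (hj : μ 21 0 0 0 = 0)
    (he : ∀ ν : Mem, (∀ b, b ≠ a → b ≠ 20 → b ≠ 21 → ν b = μ b) → ∀ j < n, ν 21 0 0 0 = j →
      e.eval ν = N j - 1)
    {F : Mem → QMem → ℝ} (hF : Homogeneous F) (ψ : QMem) :
    wp (.for_ 20 .m (.for_ 21 .n (.rand a (.var 20) (.var 21) (.lit 0) e))) F μ ψ
      = 𝔼 f : Fin m → ∀ j : Fin n, Fin (N j),
        F (fill μ a (β := fun j => Fin (N j)) (fun _ v => v.1) f) ψ := by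
  have := wp_fill (β := fun j => Fin (N j)) (a := a) (m := m) (n := n) (fun _ v => v.1) h0 h20 h21
    (c := .rand a (.var 20) (.var 21) (.lit 0) e) hn hm hi hj (fun j => 1 / (N j : ℝ))
    (fun _ _ _ _ => ψ) (fun _ _ _ _ => rfl) ?_ hF (fun i => i.elim0) (fun i => i.elim0)
  · rw [this, Fintype.expect_eq_sum_div_card, div_eq_inv_mul]
    congr 1
    simp [Fintype.card_pi, Finset.prod_range]
  · intro i _ f j hj' g G hG ν hν hνi hνj
    rw [wp_rand hG, he ν hν j hj' hνj]
    -- `rand` includes its upper bound, hence the expression is `N j - 1`; positivity of `N j` keeps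
    -- the truncated subtraction honest.
    have h2 : N j - 1 + 1 = N j := by have := hN j hj'; omega
    have h3 : ((N j - 1 : ℕ) : ℝ) + 1 = N j := by exact_mod_cast h2
    rw [h2, h3, Finset.sum_range]
    simp only [Expr.eval, hνi, hνj]

/-! ## Joint measurements -/

section

variable {m n : ℕ}

theorem regAct_productState (i : Fin m) (K : Matrix (Bits n) (Bits n) ℂ) (ψ : Fin m → Bits n → ℂ) :
    regAct i K (productState ψ) = productState (Function.update ψ i (K.mulVec (ψ i))) := by
  funext s
  simp only [regAct, productState]
  rw [← Finset.mul_prod_erase _ _ (Finset.mem_univ i)]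
  have h1 : ∀ j ∈ Finset.univ.erase i, Function.update ψ i (K.mulVec (ψ i)) j (s j)
      = ψ j (s j) := fun j hj => by rw [Function.update_of_ne (Finset.ne_of_mem_erase hj)]
  rw [Function.update_self, Finset.prod_congr rfl h1, mulVec, dotProduct, Finset.sum_mul]
  refine Finset.sum_congr rfl fun r _ => ?_
  rw [← Finset.mul_prod_erase _ _ (Finset.mem_univ i), Function.update_self, mul_assoc]
  congr 2
  refine Finset.prod_congr rfl fun j hj => ?_
  rw [Function.update_of_ne (Finset.ne_of_mem_erase hj)]

theorem productState_update_smul (i : Fin m) (c : ℂ) (ψ : Fin m → Bits n → ℂ) :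
    productState (Function.update ψ i (c • ψ i)) = c • productState ψ := by
  funext s
  simp only [productState, Pi.smul_apply, smul_eq_mul]
  rw [← Finset.mul_prod_erase _ _ (Finset.mem_univ i),
    ← Finset.mul_prod_erase _ (fun j => ψ j (s j)) (Finset.mem_univ i), Function.update_self,
    Pi.smul_apply, smul_eq_mul, mul_assoc]
  congr 2
  refine Finset.prod_congr rfl fun j hj => ?_
  rw [Function.update_of_ne (Finset.ne_of_mem_erase hj)]

theorem productState_smul (c : Fin m → ℂ) (ψ : Fin m → Bits n → ℂ) :
    productState (fun i => c i • ψ i) = (∏ i, c i) • productState ψ := by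
  funext s
  simp [productState, Finset.prod_mul_distrib]

/-- The product of the code states. -/
noncomputable def jointState (τ : Fin m → Tableau n) (z : Fin m → Bits n) :
    (Fin m → Bits n) → ℂ :=
  productState fun i => codeState (τ i) (z i)

theorem regAct_jointState {τ : Fin m → Tableau n} (hτ : ∀ i, τ i ∈ cliffords n) (i : Fin m)
    (j : Fin n) (z : Fin m → Bits n) : regAct i (pauli (τ i (Sum.inr j)).2) (jointState τ z)
      = sign (z i j + (τ i (Sum.inr j)).1) • jointState τ z := by
  rw [jointState, regAct_productState, pauli_mulVec_codeState (hτ i)]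
  exact productState_update_smul i _ fun i => codeState (τ i) (z i)

theorem star_jointState_dotProduct (τ : Fin m → Tableau n) (z z' : Fin m → Bits n) :
    star (jointState τ z) ⬝ᵥ jointState τ z' = if z = z' then 1 else 0 := by
  have h1 : star (jointState τ z) ⬝ᵥ jointState τ z'
      = ∏ i, star (codeState (τ i) (z i)) ⬝ᵥ codeState (τ i) (z' i) := by
    simp only [dotProduct]
    rw [Finset.prod_univ_sum, Fintype.piFinset_univ]
    refine Finset.sum_congr rfl fun s _ => ?_
    simp [jointState, productState, Finset.prod_mul_distrib]
  rw [h1]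
  simp only [star_codeState_dotProduct]
  rw [Finset.prod_ite_zero]
  simp [funext_iff]

/-- The unitary whose columns are the joint code states. -/
noncomputable def jointMatrix (τ : Fin m → Tableau n) :
    Matrix (Fin m → Bits n) (Fin m → Bits n) ℂ :=
  Matrix.of fun s z => jointState τ z s

theorem jointMatrix_unitary (τ : Fin m → Tableau n) :
    (jointMatrix τ)ᴴ * jointMatrix τ = 1 ∧ jointMatrix τ * (jointMatrix τ)ᴴ = 1 := by
  have h : (jointMatrix τ)ᴴ * jointMatrix τ = 1 := by
    ext z z'
    rw [Matrix.one_apply, ← star_jointState_dotProduct τ]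
    rfl
  exact ⟨h, mul_eq_one_comm.mp h⟩

/-- The amplitudes with respect to the joint code states. -/
noncomputable def amplitude (τ : Fin m → Tableau n) (φ : (Fin m → Bits n) → ℂ)
    (z : Fin m → Bits n) : ℂ :=
  star (jointState τ z) ⬝ᵥ φ

theorem sum_amplitude (τ : Fin m → Tableau n) (φ : (Fin m → Bits n) → ℂ) :
    ∑ z, amplitude τ φ z • jointState τ z = φ := by
  have h : (jointMatrix τ).mulVec ((jointMatrix τ)ᴴ.mulVec φ) = φ := by
    rw [mulVec_mulVec, (jointMatrix_unitary τ).2, one_mulVec]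
  nth_rewrite 2 [← h]
  funext s
  rw [Finset.sum_apply]
  refine Finset.sum_congr rfl fun z _ => ?_
  rw [Pi.smul_apply, smul_eq_mul, mul_comm]
  rfl

open Classical in
/-- The projection of `φ` to the code states with property `A`. -/
noncomputable def codeFilter (τ : Fin m → Tableau n) (φ : (Fin m → Bits n) → ℂ)
    (A : (Fin m → Bits n) → Prop) : (Fin m → Bits n) → ℂ :=
  ∑ z, if A z then amplitude τ φ z • jointState τ z else 0

theorem regAct_sum_smul {ι : Type*} (S : Finset ι) (i : Fin m) (K : Matrix (Bits n) (Bits n) ℂ)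
    (f : ι → (Fin m → Bits n) → ℂ) : regAct i K (∑ x ∈ S, f x) = ∑ x ∈ S, regAct i K (f x) := by
  funext s
  simp only [regAct, Finset.sum_apply, Finset.mul_sum]
  exact Finset.sum_comm

theorem regAct_smul (c : ℂ) (i : Fin m) (K : Matrix (Bits n) (Bits n) ℂ)
    (φ : (Fin m → Bits n) → ℂ) : regAct i K (c • φ) = c • regAct i K φ := by
  funext s
  simp only [regAct, Pi.smul_apply, smul_eq_mul, Finset.mul_sum]
  exact Finset.sum_congr rfl fun _ _ => by ring

/-- On a code state the measured operator is the scalar `±1`, so the projection for result `w`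
either keeps or annihilates it. The sign in the tableau accounts for the offset between result and
label. -/
theorem postMeasure_codeFilter {τ : Fin m → Tableau n} (hτ : ∀ i, τ i ∈ cliffords n) (i : Fin m)
    (j : Fin n) (w : ZMod 2) (φ : (Fin m → Bits n) → ℂ) (A : (Fin m → Bits n) → Prop) :
    postMeasure i (τ i (Sum.inr j)).2 w (codeFilter τ φ A)
      = codeFilter τ φ fun z => A z ∧ z i j + (τ i (Sum.inr j)).1 = w := by
  classical
  rw [postMeasure, codeFilter, codeFilter, regAct_sum_smul, Finset.smul_sum,
    ← Finset.sum_add_distrib, Finset.smul_sum]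
  refine Finset.sum_congr rfl fun z _ => ?_
  by_cases hA : A z
  · rw [if_pos hA, regAct_smul, regAct_jointState hτ, smul_comm _ (sign _), smul_smul,
      ← sign_add]
    by_cases hw : z i j + (τ i (Sum.inr j)).1 = w
    · rw [if_pos ⟨hA, hw⟩, hw, zmod2_add_self, sign_zero, one_smul]
      module
    · rw [if_neg fun h => hw h.2]
      have : w + (z i j + (τ i (Sum.inr j)).1) = 1 := by
        revert hw
        generalize z i j + (τ i (Sum.inr j)).1 = x
        revert x w
        decide
      rw [this, sign_one]
      module
  · rw [if_neg hA, if_neg fun h => hA h.1]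
    have : regAct i (pauli (τ i (Sum.inr j)).2) (0 : (Fin m → Bits n) → ℂ) = 0 := by
      funext s
      simp [regAct]
    rw [this, smul_zero, add_zero, smul_zero]

/-- After part of the measurements, the state is the projection to the code states compatible with
the results so far. When all results are known, exactly one label is left, namely the results
corrected by the signs of the tableau. -/
theorem wp_fill_measurePauli {a : ℕ} (h0 : a ≠ 11) (h20 : a ≠ 20) (h21 : a ≠ 21) (h22 : a ≠ 22)
    {μ : Mem} (hn : μ 0 0 0 0 = n) (hm : μ 0 2 0 0 = m) (hi : μ 20 0 0 0 = 0)
    (hj : μ 21 0 0 0 = 0) (hl : μ 22 0 0 0 = 0) {τ : Fin m → Tableau n}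
    (hτ : ∀ i, τ i ∈ cliffords n)
    (hx : ∀ (i : Fin m) (j l : Fin n), (μ a i (n + j) l : ZMod 2) = (τ i (Sum.inr j)).2 (Sum.inl l))
    (hz : ∀ (i : Fin m) (j l : Fin n), (μ a i (n + j) (n + l) : ZMod 2) = (τ i (Sum.inr j)).2 (Sum.inr l))
    {F : Mem → QMem → ℝ} (hF : Homogeneous F) (φ : (Fin m → Bits n) → ℂ) :
    wp (.for_ 20 .m (.for_ 21 .n (.measurePauli a))) F μ (load φ ∅)
      = ∑ w : Fin m → Bits n, F (fill μ 11 (β := fun _ => ZMod 2) (fun _ v => v.val) w)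
        (load (amplitude τ φ (fun i j => w i j + (τ i (Sum.inr j)).1) •
          jointState τ (fun i j => w i j + (τ i (Sum.inr j)).1)) ∅) := by
  classical
  have := wp_fill (β := fun _ => ZMod 2) (a := 11) (m := m) (n := n) (fun _ v => v.val)
    (by norm_num) (by norm_num) (by norm_num) (c := .measurePauli a) hn hm hi hj (fun _ => 1)
    (fun i f j g => load (codeFilter τ φ fun z =>
      (∀ (i' : Fin m) (h : i'.1 < i) (j' : Fin n),
        z i' j' + (τ i' (Sum.inr j')).1 = f ⟨i', h⟩ j') ∧
      ∀ (i' : Fin m) (j' : Fin n), i'.1 = i → ∀ h : j'.1 < j,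
        z i' j' + (τ i' (Sum.inr j')).1 = g ⟨j', h⟩) ∅) ?_ ?_ hF (fun i => i.elim0)
      (fun i => i.elim0)
  · have hstart : codeFilter τ φ (fun z =>
        (∀ (i' : Fin m) (h : i'.1 < 0) (j' : Fin n),
          z i' j' + (τ i' (Sum.inr j')).1 = (Fin.elim0 ⟨i', h⟩ : Bits n) j') ∧
        ∀ (i' : Fin m) (j' : Fin n), i'.1 = 0 → ∀ h : j'.1 < 0,
          z i' j' + (τ i' (Sum.inr j')).1 = Fin.elim0 ⟨j', h⟩) = φ := by
      rw [codeFilter]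
      conv_rhs => rw [← sum_amplitude τ φ]
      refine Finset.sum_congr rfl fun z _ => if_pos ⟨?_, ?_⟩
      · intro _ h
        exact absurd h (by omega)
      · intro _ _ _ h
        exact absurd h (by omega)
    rw [hstart] at this
    rw [this, Finset.prod_const_one, one_pow, one_mul]
    refine Finset.sum_congr rfl fun w _ => ?_
    congr 2
    rw [codeFilter, Finset.sum_eq_single fun i j => w i j + (τ i (Sum.inr j)).1]
    · rw [if_pos]
      refine ⟨fun i' h j' => ?_, fun i' j' h h' => absurd h' (by omega)⟩
      rw [add_assoc, zmod2_add_self, add_zero]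
    · intro z _ hz
      rw [if_neg]
      rintro ⟨h, -⟩
      apply hz
      funext i j
      have := h i i.2 j
      rw [← this, add_assoc, zmod2_add_self, add_zero]
    · simp
  · intro i f g g₀
    congr 2
    funext z
    apply propext
    constructor
    · rintro ⟨h1, -⟩
      refine ⟨fun i' h j' => ?_, fun i' j' h h' => ?_⟩
      · have := h1 i' (by omega) j'
        simpa [Fin.snoc, h] using this
      · have := h1 i' (by omega) j'
        simpa [Fin.snoc, h] using this
    · rintro ⟨h1, h2⟩
      refine ⟨fun i' h j' => ?_, fun _ _ _ h => absurd h (by omega)⟩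
      by_cases h' : i'.1 < i
      · simpa [Fin.snoc, h'] using h1 i' h' j'
      · simpa [Fin.snoc, h'] using h2 i' j' (by omega) j'.2
  · intro i hi' f j hj' g G hG ν hν hνi hνj
    rw [wp_measurePauli h22 (i := ⟨i, hi'⟩) (j := j) (v := (τ ⟨i, hi'⟩ (Sum.inr ⟨j, hj'⟩)).2)
      (by rw [hν 0 (by norm_num) (by norm_num) (by norm_num), hn])
      (by rw [hν 0 (by norm_num) (by norm_num) (by norm_num), hm]) hνi hνj
      (by rw [hν 22 (by norm_num) (by norm_num) (by norm_num), hl])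
      (by rw [hν a h0 h20 h21]; exact fun l => hx ⟨i, hi'⟩ ⟨j, hj'⟩ l)
      (by rw [hν a h0 h20 h21]; exact fun l => hz ⟨i, hi'⟩ ⟨j, hj'⟩ l), one_mul]
    refine Finset.sum_congr rfl fun w _ => ?_
    congr 2
    rw [postMeasure_codeFilter hτ]
    congr 1
    funext z
    apply propext
    constructor
    · rintro ⟨⟨h1, h2⟩, h3⟩
      refine ⟨h1, fun i' j' h h' => ?_⟩
      by_cases hjj : j'.1 < j
      · simpa [Fin.snoc, hjj] using h2 i' j' h hjj
      · have e1 : i' = ⟨i, hi'⟩ := Fin.ext h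
        have e2 : j' = ⟨j, hj'⟩ := Fin.ext (by dsimp only; omega)
        subst e1 e2
        simpa [Fin.snoc] using h3
    · rintro ⟨h1, h2⟩
      refine ⟨⟨h1, fun i' j' h h' => ?_⟩, ?_⟩
      · have := h2 i' j' h (by omega)
        simp only [Fin.snoc, h', dif_pos] at this
        exact this
      · simpa [Fin.snoc] using h2 ⟨i, hi'⟩ ⟨j, hj'⟩ rfl (by dsimp only; omega)

/-- A random basis state. -/
theorem wp_fill_coin {a : ℕ} (h0 : a ≠ 0) (h20 : a ≠ 20) (h21 : a ≠ 21) {μ : Mem}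
    (hn : μ 0 0 0 0 = n) (hm : μ 0 2 0 0 = m) (hi : μ 20 0 0 0 = 0) (hj : μ 21 0 0 0 = 0)
    {F : Mem → QMem → ℝ} (hF : Homogeneous F) :
    wp (.for_ 20 .m (.for_ 21 .n (.seq (.gateH (.var 20) (.var 21))
        (.measure a (.var 20) (.var 21) (.lit 0) (.var 20) (.var 21))))) F μ (Finsupp.single ∅ 1)
      = 𝔼 s : Fin m → Bits n, F (fill μ a (β := fun _ => ZMod 2) (fun _ v => v.val) s)
          (load (Pi.single s 1) ∅) := by
  classical
  have hload : ∀ s : Fin m → Bits n, load (Pi.single s 1) ∅ = Finsupp.single (ones s) (1 : ℂ) := by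
    intro s
    rw [load, Finset.sum_eq_single s]
    · simp
    · intro t _ ht
      simp [ht]
    · simp
  -- The basis state reached so far: measured bits have their results, all later qubits are still
  -- `0`. Hence each Hadamard gate acts on `|0⟩` and each result has weight one half.
  let st : ∀ i, (Fin i → Bits n) → ∀ j, (Fin j → ZMod 2) → Fin m → Bits n :=
    fun i f j g i' j' => if h : i'.1 < i then f ⟨i', h⟩ j' else
      if h : i'.1 = i ∧ j'.1 < j then g ⟨j', h.2⟩ else 0
  have := wp_fill (β := fun _ => ZMod 2) (a := a) (m := m) (n := n) (fun _ v => v.val)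
    h0 h20 h21 (c := (.seq (.gateH (.var 20) (.var 21))
        (.measure a (.var 20) (.var 21) (.lit 0) (.var 20) (.var 21)))) hn hm hi hj (fun _ => 2⁻¹)
    (fun i f j g => load (Pi.single (st i f j g) 1) ∅) ?_ ?_ hF (fun i => i.elim0)
      (fun i => i.elim0)
  · have hstart : load (Pi.single (st 0 (fun i => i.elim0) 0 (fun i => i.elim0)) 1) ∅
        = Finsupp.single ∅ (1 : ℂ) := by
      rw [hload]
      congr 1
      ext q
      simp [mem_ones, st]
    rw [hstart] at this
    have hend : ∀ s : Fin m → Bits n, st m s 0 (fun i => i.elim0) = s := by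
      intro s
      funext i j
      exact dif_pos i.2
    have hcard : (∏ j ∈ Finset.range n, (2⁻¹ : ℝ)) ^ m
        = ((Fintype.card (Fin m → Bits n) : ℕ) : ℝ)⁻¹ := by
      simp [Fintype.card_pi, ZMod.card]
    rw [this, Fintype.expect_eq_sum_div_card, div_eq_inv_mul, hcard]
    simp only [hend]
  · intro i f g g₀
    congr 2
    funext i' j'
    simp only [st]
    rcases lt_trichotomy i'.1 i with h | h | h
    · have h1 : i'.1 < i + 1 := by omega
      simp [h, h1, Fin.snoc]
    · simp [h, Fin.snoc]
    · have h1 : ¬ i'.1 < i + 1 := by omega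
      have h2 : ¬ i'.1 < i := by omega
      have h3 : i'.1 ≠ i := by omega
      simp [h1, h2, h3]
  · intro i hi' f j hj' g G hG ν hν hνi hνj
    set s := st i f j g with hs
    have hsij : s ⟨i, hi'⟩ ⟨j, hj'⟩ = 0 := by simp [hs, st]
    have hnext : ∀ v : ZMod 2, st i f (j + 1) (Fin.snoc (α := fun _ => ZMod 2) g v)
        = setBit s ⟨i, hi'⟩ ⟨j, hj'⟩ v := by
      intro v
      funext i' j'
      rw [setBit_apply]
      simp only [hs, st, Fin.ext_iff]
      rcases lt_trichotomy i'.1 i with h | h | h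
      · have h3 : i'.1 ≠ i := by omega
        simp [h, h3]
      · rcases lt_trichotomy j'.1 j with h4 | h4 | h4
        · have h5 : j'.1 < j + 1 := by omega
          have h6 : j'.1 ≠ j := by omega
          simp [h, h4, h5, h6, Fin.snoc]
        · simp [h, h4, Fin.snoc]
        · have h5 : ¬ j'.1 < j + 1 := by omega
          have h6 : j'.1 ≠ j := by omega
          have h7 : ¬ j'.1 < j := by omega
          simp [h, h5, h6, h7]
      · have h2 : ¬ i'.1 < i := by omega
        have h3 : i'.1 ≠ i := by omega
        simp [h2, h3]
    have hmem : ∀ v : ZMod 2, (i, j) ∈ ones (setBit s ⟨i, hi'⟩ ⟨j, hj'⟩ v) ↔ v = 1 := by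
      intro v
      have := mem_ones_mk (s := setBit s ⟨i, hi'⟩ ⟨j, hj'⟩ v) (i := ⟨i, hi'⟩) (l := ⟨j, hj'⟩)
      rw [setBit_apply] at this
      simpa using this
    have hH : applyH (i, j) (load (Pi.single s 1) ∅) = (1 / (√2 : ℂ)) •
        (load (Pi.single (setBit s ⟨i, hi'⟩ ⟨j, hj'⟩ 0) 1) ∅ +
          load (Pi.single (setBit s ⟨i, hi'⟩ ⟨j, hj'⟩ 1) 1) ∅) := by
      have h1 : (i, j) ∉ ones s := by
        have := hmem 0
        rw [← hsij, setBit_self, hsij] at this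
        simpa using this
      have h2 := erase_ones (s := s) outside_empty ⟨i, hi'⟩ ⟨j, hj'⟩
      have h3 := insert_ones (s := s) (b := ∅) ⟨i, hi'⟩ ⟨j, hj'⟩
      simp only [Finset.union_empty] at h2 h3
      rw [hload, hload, hload, applyH_single, if_neg h1, one_smul, h2, h3]
    simp only [wp, Expr.eval, hνi, hνj, hH, Finsupp.filter_smul, Finsupp.filter_add]
    simp only [hload]
    have n0 : (i, j) ∉ ones (setBit s ⟨i, hi'⟩ ⟨j, hj'⟩ 0) := by rw [hmem]; decide
    have n1 : (i, j) ∈ ones (setBit s ⟨i, hi'⟩ ⟨j, hj'⟩ 1) := by rw [hmem]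
    rw [Finsupp.filter_single_of_pos (fun b => (i, j) ∉ b) n0,
      Finsupp.filter_single_of_neg (fun b => (i, j) ∉ b) (not_not.mpr n1),
      Finsupp.filter_single_of_neg (fun b => (i, j) ∈ b) n0,
      Finsupp.filter_single_of_pos (fun b => (i, j) ∈ b) n1, add_zero, zero_add,
      hG, hG, sum_zmod2, hnext, hnext, mul_add]
    have h5 : ‖(1 / (√2 : ℂ))‖ ^ 2 = 2⁻¹ := by
      rw [norm_div, norm_one, Complex.norm_real, div_pow, one_pow, Real.norm_eq_abs, sq_abs,
        Real.sq_sqrt (by norm_num), one_div]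
    rw [h5]
    rfl

end

end LSN

namespace LSN

open Matrix

/-! ## Deterministic subroutines -/

theorem exec_tabulate_fin {R : Type*} [Semiring R] {a : ℕ} (ha : a < 30) (ha0 : a ≠ 0)
    {e₁ e₂ e₃ e₄ E : Expr} {μ : Mem} {N₁ N₂ N₃ N₄ : ℕ}
    (val : Fin N₁ → Fin N₂ → Fin N₃ → Fin N₄ → R)
    (h₁ : ∀ ν : Mem, ν 0 = μ 0 → e₁.eval ν = N₁) (h₂ : ∀ ν : Mem, ν 0 = μ 0 → e₂.eval ν = N₂)
    (h₃ : ∀ ν : Mem, ν 0 = μ 0 → e₃.eval ν = N₃) (h₄ : ∀ ν : Mem, ν 0 = μ 0 → e₄.eval ν = N₄)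
    (hE : ∀ (ν : Mem) (i : Fin N₁) (j : Fin N₂) (l : Fin N₃) (q : Fin N₄),
      (∀ b < 30, b ≠ a → ν b = μ b) → ν 30 0 0 0 = i → ν 31 0 0 0 = j → ν 32 0 0 0 = l →
      ν 33 0 0 0 = q → (E.eval ν : R) = val i j l q)
    (i : Fin N₁) (j : Fin N₂) (l : Fin N₃) :
    (exec (.tabulate a e₁ e₂ e₃ e₄ E) μ a i j l : R) = ∑ q, val i j l q := by
  rw [exec_tabulate ha ha0 (fun i j l q => if h : (i < N₁ ∧ j < N₂) ∧ l < N₃ ∧ q < N₄ then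
    val ⟨i, h.1.1⟩ ⟨j, h.1.2⟩ ⟨l, h.2.1⟩ ⟨q, h.2.2⟩ else 0) h₁ h₂ h₃ h₄ ?_ i.2 j.2 l.2,
    Finset.sum_range]
  · refine Finset.sum_congr rfl fun q _ => ?_
    rw [dif_pos ⟨⟨i.2, j.2⟩, l.2, q.2⟩]
  · intro ν i j l q hi hj hl hq hν h30 h31 h32 h33
    rw [dif_pos ⟨⟨hi, hj⟩, hl, hq⟩]
    exact hE ν ⟨i, hi⟩ ⟨j, hj⟩ ⟨l, hl⟩ ⟨q, hq⟩ hν h30 h31 h32 h33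

theorem Expr.eval_and (e f : Expr) (μ : Mem) :
    (Expr.and e f).eval μ = e.eval μ % 2 * (f.eval μ % 2) := by
  simp only [Expr.and, Expr.eval]
  have h1 := Nat.mod_lt (e.eval μ) (by norm_num : 2 > 0)
  have h2 := Nat.mod_lt (f.eval μ) (by norm_num : 2 > 0)
  interval_cases e.eval μ % 2 <;> interval_cases f.eval μ % 2 <;> simp

theorem natCast_zmod2_eq_zero {N : ℕ} : (N : ZMod 2) = 0 ↔ N % 2 = 0 := by
  rw [ZMod.natCast_eq_zero_iff]
  omega

/-- `dst[i][j] := lastOne src[i][j]`, with auxiliary array `cnt`. -/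
def Cmd.lastOne (src cnt dst : ℕ) (e₁ e₂ e₃ : Expr) : Cmd :=
  .seq (.tabulate cnt e₁ e₂ e₃ e₃ (.and (.lt (.var 32) (.var 33)) (.get src (.var 30) (.var 31) (.var 33))))
    (.tabulate dst e₁ e₂ e₃ (.lit 1) (.and (.cell src) (.eq (.cell cnt) (.lit 0))))

theorem exec_lastOne_of_ne {src cnt dst b : ℕ} (hb : b < 30) (h1 : b ≠ cnt) (h2 : b ≠ dst)
    {e₁ e₂ e₃ : Expr} (μ : Mem) : exec (.lastOne src cnt dst e₁ e₂ e₃) μ b = μ b := by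
  rw [Cmd.lastOne, exec, exec_tabulate_of_ne hb h2, exec_tabulate_of_ne hb h1]

/-- The auxiliary array counts the odd entries behind each position. The count is taken over `ℕ`,
since the test is whether there are none; a parity would not tell. -/
theorem exec_lastOne {src cnt dst : ℕ} (h1 : src < 30) (h2 : cnt < 30) (h3 : dst < 30)
    (c0 : cnt ≠ 0) (d0 : dst ≠ 0) (h12 : src ≠ cnt) (h13 : src ≠ dst) (h23 : cnt ≠ dst)
    {e₁ e₂ e₃ : Expr} {μ : Mem} {N₁ N₂ N₃ : ℕ} (M : Fin N₁ → Fin N₂ → Fin N₃ → ZMod 2)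
    (he₁ : ∀ ν : Mem, ν 0 = μ 0 → e₁.eval ν = N₁) (he₂ : ∀ ν : Mem, ν 0 = μ 0 → e₂.eval ν = N₂)
    (he₃ : ∀ ν : Mem, ν 0 = μ 0 → e₃.eval ν = N₃)
    (hM : ∀ i j l, (μ src (i : Fin N₁) (j : Fin N₂) (l : Fin N₃) : ZMod 2) = M i j l)
    (i : Fin N₁) (j : Fin N₂) (l : Fin N₃) :
    (exec (.lastOne src cnt dst e₁ e₂ e₃) μ dst i j l : ZMod 2) = LSN.lastOne (M i j) l := by
  rw [Cmd.lastOne, exec]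
  set μ₁ := exec (.tabulate cnt e₁ e₂ e₃ e₃ (.and (.lt (.var 32) (.var 33))
    (.get src (.var 30) (.var 31) (.var 33)))) μ with hμ₁
  have f₁ : ∀ b < 30, b ≠ cnt → μ₁ b = μ b := fun b hb hb' => exec_tabulate_of_ne hb hb' μ
  have hcnt : ∀ i j l, (μ₁ cnt (i : Fin N₁) (j : Fin N₂) (l : Fin N₃) : ℕ)
      = ∑ q : Fin N₃, (if l < q then 1 else 0) * (μ src i j q % 2) := by
    intro i j l
    have := exec_tabulate_fin (R := ℕ) h2 c0 (e₁ := e₁) (e₂ := e₂) (e₃ := e₃) (e₄ := e₃)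
      (E := .and (.lt (.var 32) (.var 33)) (.get src (.var 30) (.var 31) (.var 33))) (μ := μ)
      (fun (i : Fin N₁) (j : Fin N₂) (l : Fin N₃) (q : Fin N₃) =>
        (if l < q then 1 else 0) * (μ src i j q % 2)) he₁ he₂ he₃ he₃ ?_ i j l
    · simpa using this
    · intro ν i j l q hν h30 h31 h32 h33
      rw [Expr.eval_and]
      simp only [Expr.eval, h30, h31, h32, h33, hν src h1 h12, Fin.lt_def]
      split_ifs <;> simp
  rw [exec_tabulate_fin (R := ZMod 2) h3 d0 (N₄ := 1) (fun i j l _ => LSN.lastOne (M i j) l)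
    (fun ν hν => he₁ ν (hν.trans (f₁ 0 (by norm_num) c0.symm)))
    (fun ν hν => he₂ ν (hν.trans (f₁ 0 (by norm_num) c0.symm)))
    (fun ν hν => he₃ ν (hν.trans (f₁ 0 (by norm_num) c0.symm))) (fun ν _ => rfl) ?_ i j l]
  · simp
  · intro ν i j l q hν h30 h31 h32 h33
    rw [Expr.cast_eval_and, Expr.cast_eval_eq]
    simp only [Expr.eval, h30, h31, h32, hν src h1 h13, hν cnt h2 h23, f₁ src h1 h12, hM,
      hcnt, LSN.lastOne]
    congr 1
    simp only [bit]
    congr 1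
    rw [Finset.sum_eq_zero_iff]
    apply propext
    constructor
    · intro h q hq
      have := h q (Finset.mem_univ q)
      rw [if_pos hq, one_mul, ← natCast_zmod2_eq_zero, hM] at this
      exact this
    · intro h q _
      split_ifs with hq
      · rw [one_mul, ← natCast_zmod2_eq_zero, hM]
        exact h q hq
      · rw [zero_mul]

/-- The powers of two up to `2 ^ n`, in array `10`. -/
def Cmd.powers : Cmd :=
  .seq (.set 10 (.lit 0) (.lit 0) (.lit 0) (.lit 1))
    (.for_ 23 .n (.set 10 (.add (.var 23) (.lit 1)) (.lit 0) (.lit 0)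
      (.add (.get 10 (.var 23) (.lit 0) (.lit 0)) (.get 10 (.var 23) (.lit 0) (.lit 0)))))

theorem exec_powers {n : ℕ} {μ : Mem} (hn : μ 0 0 0 0 = n) :
    ∀ j ≤ n, exec .powers μ 10 j 0 0 = 2 ^ j := by
  rw [Cmd.powers, exec]
  refine exec_for (fun t ν => ∀ j ≤ t, ν 10 j 0 0 = 2 ^ j) (by simp [Cmd.writes]) (N := n) ?_ ?_ ?_ ?_
  · simp [Expr.eval, exec, store_of_ne, hn]
  · intro j ν v h j' hj'
    rw [setVar, store_of_ne (by norm_num)]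
    exact h j' hj'
  · intro j hj
    have : j = 0 := by omega
    subst this
    simp [exec, Expr.eval, store_apply_self]
  · intro j _ ν _ hj h j' hj'
    simp only [exec, Expr.eval, hj, store_apply]
    split_ifs with h'
    · rw [h j le_rfl, h'.1, pow_succ]
      ring
    · exact h j' (by
        have : j' ≠ j + 1 := fun e => h' (by simp [e])
        omega)

theorem exec_powers_of_ne {b : ℕ} (h1 : b ≠ 10) (h2 : b ≠ 23) (μ : Mem) :
    exec .powers μ b = μ b :=
  exec_of_notMem (by simp [Cmd.powers, Cmd.writes, Cmd.writes_for, h1, h2]) μ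

/-! ## The output of a reduction -/

/-- Copy the answer of the oracle to the output. -/
def Cmd.copyAnswer : Cmd :=
  .for_ 22 (.add .n (.lit 1)) (.set 6 (.var 22) (.lit 0) (.lit 0)
    (.get 5 (.var 22) (.lit 0) (.lit 0)))

/-- Answers have length `k ≤ n` or `1`, so copying `n + 1` cells serves both problems with one
program. -/
theorem outputWeight_copyAnswer {n ℓ : ℕ} (hℓ : ℓ ≤ n + 1) {s : Config}
    (hn : s.mem 0 0 0 0 = n) (ans out : Bits ℓ) (μ : Mem) (hs : s.mem = writeAnswer μ ans) :
    outputWeight .copyAnswer s out = if ans = out then normSq s.qmem else 0 := by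
  have hout : output ℓ (exec .copyAnswer s.mem) = ans := by
    have : ∀ i < n + 1, exec .copyAnswer s.mem 6 i 0 0 = s.mem 5 i 0 0 := by
      rw [Cmd.copyAnswer]
      refine exec_for (fun t ν => ∀ i < t, ν 6 i 0 0 = s.mem 5 i 0 0) (by simp [Cmd.writes])
        (N := n + 1) ?_ ?_ ?_ ?_
      · simp [Expr.eval, store_of_ne, hn]
      · intro j ν v h j' hj'
        rw [setVar, store_of_ne (by norm_num)]
        exact h j' hj'
      · intro i hi
        omega
      · intro j _ ν hν hj h j' hj'
        simp only [exec, Expr.eval, hj, store_apply, hν 5 (by norm_num) (by simp [Cmd.writes])]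
        split_ifs with h'
        · rw [h'.1]
        · exact h j' (by
            have : j' ≠ j := fun e => h' (by simp [e])
            omega)
    funext i
    have hi := i.2
    rw [output, this i (by omega), hs]
    simp [writeAnswer, hi]
  rw [outputWeight, sum_map_run .copyAnswer
    (fun μ ψ => if output ℓ μ = out then normSq ψ else 0) s, wp_of_isDet (by decide), hout]

theorem normSq_single : normSq (Finsupp.single ∅ 1) = 1 := by
  simp [normSq]

/-- Since the answer is passed on unchanged, only the branch in which the oracle answers `out`
contributes, and the behaviour of the algorithm becomes one preexpectation of its first part. -/
theorem withClassical_eq {pre : Cmd} (hpre : pre.hasParamLoops) {n k m ℓ : ℕ} (hk : k ≤ n)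
    (hℓ : ℓ ≤ n + 1) (O : ClassicalOracle n k m ℓ) (τ : Fin m → Tableau n)
    (φ : (Fin m → Bits n) → ℂ) (out : Bits ℓ) :
    (OneCallAlgorithm.mk pre .copyAnswer).withClassical O τ φ out
      = wp pre (fun μ ψ => O.solver (classicalQuery n k m μ) out * normSq ψ) (quantumInput k τ)
        (load φ ∅) := by
  rw [← loadState_eq]
  have h := sum_map_run pre (fun μ ψ => O.solver (classicalQuery n k m μ) out * normSq ψ)
    (startQuantum k τ φ)
  change _ = wp pre _ (startQuantum k τ φ).mem (startQuantum k τ φ).qmem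
  rw [← h, OneCallAlgorithm.withClassical]
  congr 1
  refine List.map_congr_left fun s hs => ?_
  have hb : ∀ i j l, (startQuantum k τ φ).mem 0 i j l ≤ n + m := by
    intro i j l
    simp only [startQuantum, quantumInput]
    exact initMem_zero_le hk _ _ i j l
  have h0 := (Cmd.time_le hpre hb s hs).2
  have hn : (s.mem 0 0 0 0) = n := by rw [h0]; simp [startQuantum, quantumInput, initMem]
  rw [Finset.sum_eq_single out]
  · rw [outputWeight_copyAnswer (n := n) hℓ _ out out s.mem rfl, if_pos rfl]
    · rfl
    · simpa [Config.afterClassical, writeAnswer] using hn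
  · intro ans _ hne
    rw [outputWeight_copyAnswer (n := n) hℓ _ ans out s.mem rfl, if_neg hne, mul_zero]
    simpa [Config.afterClassical, writeAnswer] using hn
  · simp

theorem withQuantum_eq {pre : Cmd} (hpre : pre.hasParamLoops) {n k m ℓ : ℕ} (hk : k ≤ n)
    (hℓ : ℓ ≤ n + 1) (O : QuantumOracle n m ℓ) (inst : Fin m → ClassicalSample n k)
    (out : Bits ℓ) : (OneCallAlgorithm.mk pre .copyAnswer).withQuantum k O inst out
      = wp pre (fun μ ψ => answerWeight O (quantumQuery n m μ) out ψ) (classicalInput inst)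
        (Finsupp.single ∅ 1) := by
  have h := sum_map_run pre (fun μ ψ => answerWeight O (quantumQuery n m μ) out ψ)
    (startClassical inst)
  change _ = wp pre _ (startClassical inst).mem (startClassical inst).qmem
  rw [← h, OneCallAlgorithm.withQuantum]
  congr 1
  refine List.map_congr_left fun s hs => ?_
  have hb : ∀ i j l, (startClassical inst).mem 0 i j l ≤ n + m := by
    intro i j l
    simp only [startClassical, classicalInput]
    exact initMem_zero_le hk _ _ i j l
  have h0 := (Cmd.time_le hpre hb s hs).2
  have hn : (s.mem 0 0 0 0) = n := by rw [h0]; simp [startClassical, classicalInput, initMem]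
  rw [Finset.sum_eq_single out]
  · rw [outputWeight_copyAnswer (n := n) hℓ _ out out s.mem rfl, if_pos rfl]
    · simp [Config.afterQuantum, normSq_single]
    · simpa [Config.afterQuantum, writeAnswer] using hn
  · intro ans _ hne
    rw [outputWeight_copyAnswer (n := n) hℓ _ ans out s.mem rfl, if_neg hne, mul_zero]
    simpa [Config.afterQuantum, writeAnswer] using hn
  · simp

theorem normSq_smul (z : ℂ) (ψ : QMem) : normSq (z • ψ) = ‖z‖ ^ 2 * normSq ψ := by
  by_cases hz : z = 0
  · simp [hz, normSq]
  · rw [normSq, Finsupp.sum_smul_index (by simp), normSq, Finsupp.sum, Finsupp.sum,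
      Finset.mul_sum]
    exact Finset.sum_congr rfl fun b _ => by rw [norm_mul, mul_pow]

theorem ones_injective {m n : ℕ} : Function.Injective (ones : (Fin m → Bits n) → Finset (ℕ × ℕ)) := by
  intro s t h
  funext i l
  have h1 := mem_ones_mk (s := s) (i := i) (l := l)
  rw [h, mem_ones_mk] at h1
  rcases zmod2_cases (s i l) with h2 | h2 <;> rcases zmod2_cases (t i l) with h3 | h3 <;>
    simp_all

theorem load_apply {m n : ℕ} (φ : (Fin m → Bits n) → ℂ) (s : Fin m → Bits n) :
    load φ ∅ (ones s) = φ s := by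
  rw [load, Finsupp.finsetSum_apply, Finset.sum_eq_single s]
  · simp
  · intro t _ ht
    simp [ones_injective.ne ht]
  · simp

theorem support_load {m n : ℕ} (φ : (Fin m → Bits n) → ℂ) {b : Finset (ℕ × ℕ)}
    (hb : b ∈ (load φ ∅).support) : ∃ s : Fin m → Bits n, b = ones s := by
  by_contra! hc
  rw [Finsupp.mem_support_iff, load, Finsupp.finsetSum_apply] at hb
  apply hb
  refine Finset.sum_eq_zero fun s _ => ?_
  simp [(hc s).symm]

theorem normSq_load {m n : ℕ} (φ : (Fin m → Bits n) → ℂ) :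
    normSq (load φ ∅) = ∑ s, ‖φ s‖ ^ 2 := by
  have h : normSq (load φ ∅) = ∑ b ∈ Finset.univ.image (ones : (Fin m → Bits n) → _),
      ‖load φ ∅ b‖ ^ 2 := by
    rw [normSq, Finsupp.sum]
    refine Finset.sum_subset ?_ ?_
    · intro b hb
      obtain ⟨s, rfl⟩ := support_load φ hb
      simp
    · intro b _ hb
      rw [Finsupp.notMem_support_iff.mp hb]
      simp
  rw [h, Finset.sum_image fun _ _ _ _ h => ones_injective h]
  simp only [load_apply]

theorem ones_subset {m n : ℕ} (s : Fin m → Bits n) : ones s ⊆ Finset.range m ×ˢ Finset.range n := by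
  intro q hq
  obtain ⟨i, l, -, rfl⟩ := mem_ones.mp hq
  simp

theorem QuantumOracle.solver_smul {n m ℓ : ℕ} (O : QuantumOracle n m ℓ) (τ : Fin m → Tableau n)
    (z : ℂ) (φ : (Fin m → Bits n) → ℂ) (out : Bits ℓ) :
    O.solver τ (z • φ) out = ‖z‖ ^ 2 * O.solver τ φ out := by
  simp only [QuantumOracle.solver]
  rw [mulVec_smul, star_smul, smul_dotProduct, dotProduct_smul, smul_smul, Complex.star_def,
    ← Complex.normSq_eq_conj_mul_self, Complex.normSq_eq_norm_sq, smul_eq_mul,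
    Complex.re_ofReal_mul]

/-- With all qubits outside the registers in state `0`, only the empty set occurs in the sum over
outside configurations. The zero state is treated separately because its support, and hence the sum,
is empty. -/
theorem answerWeight_load {n m ℓ : ℕ} (O : QuantumOracle n m ℓ) (τ : Fin m → Tableau n)
    (ans : Bits ℓ) (φ : (Fin m → Bits n) → ℂ) :
    answerWeight O τ ans (load φ ∅) = O.solver τ φ ans := by
  by_cases hφ : load φ ∅ = 0
  · have : φ = 0 := by
      funext s
      rw [← load_apply φ s, hφ]
      rfl
    subst this
    simp [answerWeight, hφ, QuantumOracle.solver]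
  · have himg : ((load φ ∅).support.image fun b => b \ (Finset.range m ×ˢ Finset.range n)) = {∅} := by
      ext b
      simp only [Finset.mem_image, Finset.mem_singleton]
      constructor
      · rintro ⟨c, hc, rfl⟩
        obtain ⟨s, rfl⟩ := support_load φ hc
        exact Finset.sdiff_eq_empty_iff_subset.mpr (ones_subset s)
      · rintro rfl
        obtain ⟨c, hc⟩ := Finsupp.support_nonempty_iff.mpr hφ
        obtain ⟨s, rfl⟩ := support_load φ hc
        exact ⟨_, hc, Finset.sdiff_eq_empty_iff_subset.mpr (ones_subset s)⟩
    rw [answerWeight, himg, Finset.sum_singleton]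
    simp only [Finset.union_empty, load_apply]

theorem homogeneous_classical {n k m ℓ : ℕ} (O : ClassicalOracle n k m ℓ) (out : Bits ℓ) :
    Homogeneous fun μ ψ => O.solver (classicalQuery n k m μ) out * normSq ψ := by
  intro μ z ψ
  dsimp only
  rw [normSq_smul]
  ring

theorem homogeneous_quantum {n m ℓ : ℕ} (O : QuantumOracle n m ℓ) (out : Bits ℓ) :
    Homogeneous fun μ ψ => answerWeight O (quantumQuery n m μ) out ψ := by
  intro μ z ψ
  by_cases hz : z = 0
  · simp [hz, answerWeight]
  · simp only [answerWeight]
    rw [Finsupp.support_smul_eq hz, Finset.mul_sum]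
    refine Finset.sum_congr rfl fun b _ => ?_
    exact O.solver_smul _ z (fun s => ψ (ones s ∪ b)) out

end LSN

namespace LSN

open Matrix

/-! ## The query of the reduction from the quantum problem -/

/-- `16 := 15 * colMatrix`, for column `22`. -/
def Cmd.multiplyColMatrix : Cmd :=
  .tabulate 16 .m .n (.add .n .n) .n <| .and
    (.add (.and (.eq (.var 31) (.var 22)) (.get 12 (.var 30) (.var 22) (.var 33)))
      (.and (.add (.lit 1) (.eq (.var 31) (.var 22)))
        (.add (.and (.get 14 (.var 30) (.var 22) (.var 31)) (.eq (.var 33) (.var 22)))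
          (.and (.add (.lit 1) (.get 14 (.var 30) (.var 22) (.var 31)))
            (.eq (.var 33) (.var 31))))))
    (.get 15 (.var 30) (.var 33) (.var 32))

/-- The column products, applied to the `Z` columns of the tableaus, in array `15`. -/
def Cmd.scrambleColumns : Cmd :=
  .seq (.tabulate 12 .m .n .n (.lit 1) (.div (.add (.get 8 (.var 30) (.var 31) (.lit 0))
      (.get 10 (.var 31) (.lit 0) (.lit 0))) (.get 10 (.var 32) (.lit 0) (.lit 0)))) <|
  .seq (.lastOne 12 13 14 .m .n .n) <|
  .seq (.tabulate 15 .m .n (.add .n .n) (.lit 1) (.get 1 (.var 30) (.add .n (.var 31)) (.var 32))) <|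
    .for_ 22 .n (.seq .multiplyColMatrix (.tabulate 15 .m .n (.add .n .n) (.lit 1) (.cell 16)))

/-- Compute the query to the oracle for the classical problem. -/
def Cmd.classicalQuery : Cmd :=
  .seq .scrambleColumns <|
  .seq (.tabulate 3 .m (.add .n .n) (.add .n .k) (.lit 1)
    (.add (.and (.lt (.var 32) .n) (.get 15 (.var 30) (.var 32) (.var 31)))
      (.and (.add (.lit 1) (.lt (.var 32) .n)) (.get 1 (.var 30) (.sub (.var 32) .k) (.var 31))))) <|
  .tabulate 4 .m (.add .n .n) (.lit 1) .n
    (.add (.and (.add (.get 11 (.var 30) (.var 33) (.lit 0))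
        (.get 2 (.var 30) (.add .n (.var 33)) (.lit 0))) (.get 1 (.var 30) (.var 33) (.var 31)))
      (.and (.get 9 (.var 30) (.var 33) (.lit 0)) (.get 1 (.var 30) (.add .n (.var 33)) (.var 31))))

theorem mul_padMatrix_apply {n k : ℕ} (hk : k ≤ n) {α : Type*} (A : Matrix α (Fin n) (ZMod 2))
    (g : α) (l : Fin k) : (A * padMatrix n k) g l = A g ⟨n - k + l, by omega⟩ := by
  rw [Matrix.mul_apply, Finset.sum_eq_single ⟨n - k + l, by omega⟩]
  · simp [padMatrix, bit]
  · intro i _ hi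
    have : i.1 ≠ n - k + l := fun h => hi (Fin.ext h)
    simp [padMatrix, bit, this]
  · simp

section

variable {n k m : ℕ}

/-- The expression is the defining formula of the column matrix, with `1 + x` for the negation of a
bit. Arrays hold the matrices transposed: the first index after the sample is the column. -/
theorem exec_multiplyColMatrix {μ : Mem} (hn : μ 0 0 0 0 = n) (hm : μ 0 2 0 0 = m) {t : Fin n}
    (ht : μ 22 0 0 0 = t) (V : Fin m → Fin n → Bits n)
    (h12 : ∀ (i : Fin m) (j q : Fin n), (μ 12 i j q : ZMod 2) = V i j q)
    (h14 : ∀ (i : Fin m) (j q : Fin n), (μ 14 i j q : ZMod 2) = lastOne (V i j) q)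
    (A : Fin m → Matrix (Fin n ⊕ Fin n) (Fin n) (ZMod 2))
    (h15 : ∀ (i : Fin m) (q : Fin n) (g : Fin n ⊕ Fin n),
      (μ 15 i q (finSumFinEquiv g) : ZMod 2) = A i g q)
    (i : Fin m) (q : Fin n) (g : Fin n ⊕ Fin n) :
    (exec .multiplyColMatrix μ 16 i q (finSumFinEquiv g) : ZMod 2)
      = (A i * colMatrix t (V i t)) g q := by
  rw [Cmd.multiplyColMatrix, exec_tabulate_fin (by norm_num) (by norm_num)
    (fun (i : Fin m) (q : Fin n) (g : Fin (n + n)) (q' : Fin n) =>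
      A i (finSumFinEquiv.symm g) q' * colMatrix t (V i t) q' q)
    (fun ν h => by simp [Expr.eval, h, hm]) (fun ν h => by simp [Expr.eval, h, hn])
    (fun ν h => by simp [Expr.eval, h, hn]) (fun ν h => by simp [Expr.eval, h, hn])]
  · rw [Matrix.mul_apply]
    simp
  · intro ν i q g q' hν h30 h31 h32 h33
    have e15 : (ν 15 i q' g : ZMod 2) = A i (finSumFinEquiv.symm g) q' := by
      rw [hν 15 (by norm_num) (by norm_num), ← h15, Equiv.apply_symm_apply]
    have e12 : ∀ j q, (ν 12 i (j : Fin n) (q : Fin n) : ZMod 2) = V i j q := fun j q => by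
      rw [hν 12 (by norm_num) (by norm_num), h12]
    have e14 : ∀ j q, (ν 14 i (j : Fin n) (q : Fin n) : ZMod 2) = lastOne (V i j) q := fun j q => by
      rw [hν 14 (by norm_num) (by norm_num), h14]
    have h22 : ν 22 0 0 0 = t := by rw [hν 22 (by norm_num) (by norm_num), ht]
    simp only [Expr.cast_eval_and, Expr.cast_eval_add, Expr.cast_eval_eq]
    simp only [Expr.eval, h30, h31, h32, h33, h22, e15, e12, e14, Nat.cast_one, ← Fin.ext_iff]
    rw [mul_comm, colMatrix, Matrix.of_apply]
    congr 1
    by_cases h : q = t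
    · rw [if_pos h, bit, if_pos h, zmod2_add_self, one_mul, zero_mul, add_zero]
    · rw [if_neg h]
      simp only [bit, h, if_false, zero_mul, zero_add, add_zero, one_mul]

theorem exec_scrambleColumns_of_ne {b : ℕ} (hb : b < 12) (μ : Mem) :
    exec .scrambleColumns μ b = μ b := by
  rw [Cmd.scrambleColumns, exec, exec, exec]
  rw [exec_of_notMem, exec_tabulate_of_ne (by omega) (by omega),
    exec_lastOne_of_ne (by omega) (by omega) (by omega), exec_tabulate_of_ne (by omega) (by omega)]
  refine Cmd.notMem_writes_for (by omega) ?_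
  rw [Cmd.writes, List.mem_append, not_or]
  exact ⟨Cmd.notMem_writes_tabulate (by omega) (by omega),
    Cmd.notMem_writes_tabulate (by omega) (by omega)⟩

/-- The vectors are binary expansions: dividing by a power of two and reducing modulo two extracts a
digit. Multiplying by one column matrix after the other replaces an inversion or a rejection step.
-/
theorem exec_scrambleColumns {μ : Mem} (hn : μ 0 0 0 0 = n) (hm : μ 0 2 0 0 = m)
    (V : Fin m → Fin n → Bits n)
    (hV : ∀ (i : Fin m) (j q : Fin n),
      (((μ 8 i j 0 + μ 10 j 0 0) / μ 10 q 0 0 : ℕ) : ZMod 2) = V i j q)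
    (S : Fin m → Matrix (Fin n ⊕ Fin n) (Fin n ⊕ Fin n) (ZMod 2))
    (hS : ∀ (i : Fin m) (h g : Fin n ⊕ Fin n),
      (μ 1 i (finSumFinEquiv h) (finSumFinEquiv g) : ZMod 2) = S i g h)
    (i : Fin m) (q : Fin n) (g : Fin n ⊕ Fin n) :
    (exec .scrambleColumns μ 15 i q (finSumFinEquiv g) : ZMod 2)
      = ((S i).toCols₂ * colProduct (V i) n) g q := by
  rw [Cmd.scrambleColumns, exec, exec, exec]
  set μ₁ := exec (.tabulate 12 .m .n .n (.lit 1) (.div (.add (.get 8 (.var 30) (.var 31) (.lit 0))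
      (.get 10 (.var 31) (.lit 0) (.lit 0))) (.get 10 (.var 32) (.lit 0) (.lit 0)))) μ with hμ₁
  have f₁ : ∀ b < 30, b ≠ 12 → μ₁ b = μ b := fun b hb hb' => exec_tabulate_of_ne hb hb' μ
  have v₁ : ∀ (i : Fin m) (j q : Fin n), (μ₁ 12 i j q : ZMod 2) = V i j q := by
    intro i j q
    rw [hμ₁, exec_tabulate_fin (by norm_num) (by norm_num) (N₄ := 1)
      (fun (i : Fin m) (j q : Fin n) _ => V i j q)
      (fun ν h => by simp [Expr.eval, h, hm]) (fun ν h => by simp [Expr.eval, h, hn])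
      (fun ν h => by simp [Expr.eval, h, hn]) (fun ν h => rfl)]
    · simp
    · intro ν i j q _ hν h30 h31 h32 h33
      simp only [Expr.eval, h30, h31, h32, hν 8 (by norm_num) (by norm_num),
        hν 10 (by norm_num) (by norm_num), hV]
  set μ₂ := exec (.lastOne 12 13 14 .m .n .n) μ₁ with hμ₂
  have f₂ : ∀ b < 30, b ≠ 13 → b ≠ 14 → μ₂ b = μ₁ b := fun b hb h h' =>
    exec_lastOne_of_ne hb h h' μ₁
  have p₁ : μ₁ 0 = μ 0 := f₁ 0 (by norm_num) (by norm_num)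
  have v₂ : ∀ (i : Fin m) (j q : Fin n), (μ₂ 14 i j q : ZMod 2) = lastOne (V i j) q :=
    exec_lastOne (by norm_num) (by norm_num) (by norm_num) (by norm_num) (by norm_num)
      (by norm_num) (by norm_num) (by norm_num) V
      (fun ν h => by simp [Expr.eval, h, p₁, hm]) (fun ν h => by simp [Expr.eval, h, p₁, hn])
      (fun ν h => by simp [Expr.eval, h, p₁, hn]) v₁
  have p₂ : μ₂ 0 = μ 0 := (f₂ 0 (by norm_num) (by norm_num) (by norm_num)).trans p₁
  set μ₃ := exec (.tabulate 15 .m .n (.add .n .n) (.lit 1)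
    (.get 1 (.var 30) (.add .n (.var 31)) (.var 32))) μ₂ with hμ₃
  have f₃ : ∀ b < 30, b ≠ 15 → μ₃ b = μ₂ b := fun b hb hb' => exec_tabulate_of_ne hb hb' μ₂
  have p₃ : μ₃ 0 = μ 0 := (f₃ 0 (by norm_num) (by norm_num)).trans p₂
  have v₃ : ∀ (i : Fin m) (q : Fin n) (g : Fin n ⊕ Fin n),
      (μ₃ 15 i q (finSumFinEquiv g) : ZMod 2) = (S i).toCols₂ g q := by
    intro i q g
    rw [hμ₃, exec_tabulate_fin (by norm_num) (by norm_num) (N₄ := 1)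
      (fun (i : Fin m) (q : Fin n) (g : Fin (n + n)) _ =>
        (S i).toCols₂ (finSumFinEquiv.symm g) q)
      (fun ν h => by simp [Expr.eval, h, p₂, hm]) (fun ν h => by simp [Expr.eval, h, p₂, hn])
      (fun ν h => by simp [Expr.eval, h, p₂, hn]) (fun ν h => rfl)]
    · simp
    · intro ν i q g _ hν h30 h31 h32 h33
      have := hS i (Sum.inr q) (finSumFinEquiv.symm g)
      rw [Equiv.apply_symm_apply, finSumFinEquiv_apply_right, Fin.val_natAdd] at this
      simp only [Expr.eval, h30, h31, h32, hν 1 (by norm_num) (by norm_num),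
        hν 0 (by norm_num) (by norm_num), p₂, hn, f₂ 1 (by norm_num) (by norm_num) (by norm_num),
        f₁ 1 (by norm_num) (by norm_num), this]
      rfl
  have := exec_for (x := 22) (N := n) (e := .n) (μ := μ₃)
    (c := .seq .multiplyColMatrix (.tabulate 15 .m .n (.add .n .n) (.lit 1) (.cell 16)))
    (fun t ν => ∀ (i : Fin m) (q : Fin n) (g : Fin n ⊕ Fin n),
      (ν 15 i q (finSumFinEquiv g) : ZMod 2) = ((S i).toCols₂ * colProduct (V i) t) g q)
    ?_ ?_ ?_ ?_ ?_
  · exact this i q g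
  · rw [Cmd.writes, List.mem_append, not_or]
    exact ⟨Cmd.notMem_writes_tabulate (by omega) (by omega),
      Cmd.notMem_writes_tabulate (by omega) (by omega)⟩
  · rw [Expr.eval, setVar, store_of_ne (by norm_num), p₃]
    exact hn
  · intro t ν v h i q g
    rw [setVar, store_of_ne (by norm_num)]
    exact h i q g
  · intro i q g
    rw [colProduct, Matrix.mul_one]
    exact v₃ i q g
  · intro t ht ν hν h22 hI i q g
    have hw : ∀ b < 30, b ≠ 15 → b ≠ 16 →
        b ∉ (Cmd.seq .multiplyColMatrix (.tabulate 15 .m .n (.add .n .n) (.lit 1) (.cell 16))).writes := by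
      intro b hb h h'
      rw [Cmd.writes, List.mem_append, not_or]
      exact ⟨Cmd.notMem_writes_tabulate hb h', Cmd.notMem_writes_tabulate hb h⟩
    have g0 : ∀ b < 30, b ≠ 15 → b ≠ 16 → b ≠ 22 → ν b = μ₃ b := fun b hb h h' h'' =>
      hν b h'' (hw b hb h h')
    have q₀ : ν 0 = μ 0 := (g0 0 (by norm_num) (by norm_num) (by norm_num) (by norm_num)).trans p₃
    have h16 := exec_multiplyColMatrix (n := n) (m := m) (μ := ν) (t := ⟨t, ht⟩) (by rw [q₀, hn])
      (by rw [q₀, hm]) h22 V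
      (fun i j q => by
        rw [g0 12 (by norm_num) (by norm_num) (by norm_num) (by norm_num),
          f₃ 12 (by norm_num) (by norm_num), f₂ 12 (by norm_num) (by norm_num) (by norm_num), v₁])
      (fun i j q => by
        rw [g0 14 (by norm_num) (by norm_num) (by norm_num) (by norm_num),
          f₃ 14 (by norm_num) (by norm_num), v₂])
      (fun i => (S i).toCols₂ * colProduct (V i) t) hI
    have q₁ : exec .multiplyColMatrix ν 0 = μ 0 :=
      (exec_tabulate_of_ne (by norm_num) (by norm_num) ν).trans q₀
    rw [exec, exec_tabulate_fin (by norm_num) (by norm_num) (N₄ := 1)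
      (fun (i : Fin m) (q : Fin n) (g : Fin (n + n)) _ =>
        ((S i).toCols₂ * colProduct (V i) (t + 1)) (finSumFinEquiv.symm g) q)
      (fun ν h => by simp [Expr.eval, h, q₁, hm]) (fun ν h => by simp [Expr.eval, h, q₁, hn])
      (fun ν h => by simp [Expr.eval, h, q₁, hn]) (fun ν h => rfl)]
    · simp
    · intro ρ i q g _ hρ h30 h31 h32 h33
      have := h16 i q (finSumFinEquiv.symm g)
      rw [Equiv.apply_symm_apply] at this
      simp only [Expr.eval, h30, h31, h32, hρ 16 (by norm_num) (by norm_num), this]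
      rw [colProduct, dif_pos ht, Matrix.mul_assoc]

theorem exec_classicalQuery (hk : k ≤ n) {μ : Mem} (hn : μ 0 0 0 0 = n) (hk' : μ 0 1 0 0 = k)
    (hm : μ 0 2 0 0 = m) (V : Fin m → Fin n → Bits n)
    (hV : ∀ (i : Fin m) (j q : Fin n),
      (((μ 8 i j 0 + μ 10 j 0 0) / μ 10 q 0 0 : ℕ) : ZMod 2) = V i j q)
    (S : Fin m → Matrix (Fin n ⊕ Fin n) (Fin n ⊕ Fin n) (ZMod 2))
    (hS : ∀ (i : Fin m) (h g : Fin n ⊕ Fin n),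
      (μ 1 i (finSumFinEquiv h) (finSumFinEquiv g) : ZMod 2) = S i g h)
    (z r : Fin m → Bits n)
    (hz : ∀ (i : Fin m) (q : Fin n), (μ 11 i q 0 + μ 2 i (n + q) 0 : ZMod 2) = z i q)
    (hr : ∀ (i : Fin m) (q : Fin n), (μ 9 i q 0 : ZMod 2) = r i q) :
    classicalQuery n k m (exec .classicalQuery μ) = fun i =>
      (encoderOf k (S i) (colProduct (V i) n),
        (S i).toCols₁.mulVec (z i) + (S i).toCols₂.mulVec (r i)) := by
  rw [Cmd.classicalQuery, exec, exec]
  have h15 := exec_scrambleColumns hn hm V hV S hS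
  set μ₁ := exec .scrambleColumns μ with hμ₁
  have f₁ : ∀ b < 12, μ₁ b = μ b := fun b hb => exec_scrambleColumns_of_ne hb μ
  set μ₂ := exec (.tabulate 3 .m (.add .n .n) (.add .n .k) (.lit 1)
    (.add (.and (.lt (.var 32) .n) (.get 15 (.var 30) (.var 32) (.var 31)))
      (.and (.add (.lit 1) (.lt (.var 32) .n))
        (.get 1 (.var 30) (.sub (.var 32) .k) (.var 31))))) μ₁ with hμ₂
  have f₂ : ∀ b < 30, b ≠ 3 → μ₂ b = μ₁ b := fun b hb hb' => exec_tabulate_of_ne hb hb' μ₁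
  have p₁ : μ₁ 0 = μ 0 := f₁ 0 (by norm_num)
  have p₂ : μ₂ 0 = μ 0 := (f₂ 0 (by norm_num) (by norm_num)).trans p₁
  have v₂ : ∀ (i : Fin m) (g : Fin n ⊕ Fin n) (h : Fin n ⊕ Fin k),
      (μ₂ 3 i (finSumFinEquiv g) (finSumFinEquiv h) : ZMod 2)
        = encoderOf k (S i) (colProduct (V i) n) g h := by
    intro i g h
    rw [hμ₂, exec_tabulate_fin (by norm_num) (by norm_num) (N₄ := 1)
      (fun (i : Fin m) (g : Fin (n + n)) (h : Fin (n + k)) _ =>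
        encoderOf k (S i) (colProduct (V i) n) (finSumFinEquiv.symm g) (finSumFinEquiv.symm h))
      (fun ν h => by simp [Expr.eval, h, p₁, hm]) (fun ν h => by simp [Expr.eval, h, p₁, hn])
      (fun ν h => by simp [Expr.eval, h, p₁, hn, hk']) (fun ν h => rfl)]
    · simp
    · intro ν i g h _ hν h30 h31 h32 h33
      have e0 : ν 0 = μ 0 := (hν 0 (by norm_num) (by norm_num)).trans p₁
      simp only [Expr.cast_eval_and, Expr.cast_eval_add, Expr.cast_eval_lt]
      simp only [Expr.eval, h30, h31, h32, e0, hn, hk', hν 15 (by norm_num) (by norm_num),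
        hν 1 (by norm_num) (by norm_num), f₁ 1 (by norm_num)]
      obtain ⟨h, rfl⟩ := finSumFinEquiv.surjective h
      obtain ⟨g, rfl⟩ := finSumFinEquiv.surjective g
      rcases h with q | l
      · have h1 : ((finSumFinEquiv (Sum.inl q : Fin n ⊕ Fin k) : Fin (n + k)) : ℕ) = q := by simp
        rw [h1, h15, bit, if_pos q.2]
        simp [encoderOf, zmod2_add_self]
      · have h1 : ((finSumFinEquiv (Sum.inr l : Fin n ⊕ Fin k) : Fin (n + k)) : ℕ) = n + l := by
          simp
        have h2 := hS i (Sum.inl ⟨n - k + l, by omega⟩) g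
        rw [finSumFinEquiv_apply_left, Fin.val_castAdd] at h2
        -- Column `n + l` of the query comes from the image of the generator `X` with index `n - k +
        -- l`, which is `n + l - k` because `k ≤ n`.
        rw [h1, bit, if_neg (by omega), show n + l.1 - k = n - k + l by omega, h2]
        simp only [zero_mul, zero_add, Nat.cast_one, add_zero, one_mul, Equiv.symm_apply_apply,
          encoderOf, fromCols_apply_inr, mul_padMatrix_apply hk]
        rfl
  funext i
  rw [LSN.classicalQuery]
  congr 1
  · ext g h
    rw [Matrix.of_apply, exec_tabulate_of_ne (by norm_num) (by norm_num), v₂]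
  · funext g
    have := exec_tabulate_fin (R := ZMod 2) (a := 4) (by norm_num) (by norm_num) (N₃ := 1) (N₄ := n)
      (e₁ := .m) (e₂ := .add .n .n) (e₃ := .lit 1) (e₄ := .n) (μ := μ₂)
      (E := .add (.and (.add (.get 11 (.var 30) (.var 33) (.lit 0))
          (.get 2 (.var 30) (.add .n (.var 33)) (.lit 0))) (.get 1 (.var 30) (.var 33) (.var 31)))
        (.and (.get 9 (.var 30) (.var 33) (.lit 0))
          (.get 1 (.var 30) (.add .n (.var 33)) (.var 31))))
      (fun (i : Fin m) (g : Fin (n + n)) _ (q : Fin n) =>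
        z i q * (S i).toCols₁ (finSumFinEquiv.symm g) q +
          r i q * (S i).toCols₂ (finSumFinEquiv.symm g) q)
      (fun ν h => by simp [Expr.eval, h, p₂, hm]) (fun ν h => by simp [Expr.eval, h, p₂, hn])
      (fun ν h => rfl) (fun ν h => by simp [Expr.eval, h, p₂, hn]) ?_ i (finSumFinEquiv g) 0
    · rw [Fin.val_zero] at this
      rw [this, Pi.add_apply, mulVec, mulVec, dotProduct, dotProduct, ← Finset.sum_add_distrib]
      refine Finset.sum_congr rfl fun q _ => ?_
      rw [Equiv.symm_apply_apply]
      ring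
    · intro ν i g _ q hν h30 h31 h32 h33
      have e : ∀ b < 12, b ≠ 3 → b ≠ 4 → ν b = μ b := fun b hb h h' =>
        (hν b (by omega) h').trans ((f₂ b (by omega) h).trans (f₁ b hb))
      have h1 := hS i (Sum.inl q) (finSumFinEquiv.symm g)
      have h2 := hS i (Sum.inr q) (finSumFinEquiv.symm g)
      rw [Equiv.apply_symm_apply, finSumFinEquiv_apply_left, Fin.val_castAdd] at h1
      rw [Equiv.apply_symm_apply, finSumFinEquiv_apply_right, Fin.val_natAdd] at h2
      simp only [Expr.cast_eval_and, Expr.cast_eval_add]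
      simp only [Expr.eval, h30, h31, h33, e 0 (by norm_num) (by norm_num) (by norm_num), hn,
        e 1 (by norm_num) (by norm_num) (by norm_num),
        e 2 (by norm_num) (by norm_num) (by norm_num),
        e 9 (by norm_num) (by norm_num) (by norm_num),
        e 11 (by norm_num) (by norm_num) (by norm_num), hz, hr, h1, h2]
      rfl

end

end LSN

namespace LSN

open Matrix

/-! ## Averages over independent samples -/

theorem expect_prod_eval {ι : Type*} [Fintype ι] [DecidableEq ι] {α : ι → Type*}
    [∀ i, DecidableEq (α i)] (s : ∀ i, Finset (α i)) (g : ∀ i, α i → ℝ) :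
    𝔼 a ∈ Fintype.piFinset s, ∏ i, g i (a i) = ∏ i, 𝔼 x ∈ s i, g i x := by
  simp only [Finset.expect_eq_sum_div_card, Finset.prod_div_distrib, Finset.prod_univ_sum,
    Fintype.card_piFinset, Nat.cast_prod]

/-- Averages over independent samples depend only on the distributions of the samples. -/
theorem expect_piFinset_congr {ι : Type*} [Fintype ι] [DecidableEq ι] {α β γ : ι → Type*}
    [∀ i, Fintype (γ i)] (s : ∀ i, Finset (α i)) (t : ∀ i, Finset (β i)) (φ : ∀ i, α i → γ i)
    (ψ : ∀ i, β i → γ i)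
    (h : ∀ i (f : γ i → ℝ), 𝔼 a ∈ s i, f (φ i a) = 𝔼 b ∈ t i, f (ψ i b)) (F : (∀ i, γ i) → ℝ) :
    𝔼 a ∈ Fintype.piFinset s, F (fun i => φ i (a i))
      = 𝔼 b ∈ Fintype.piFinset t, F (fun i => ψ i (b i)) := by
  classical
  -- Every function on a finite product is a combination of indicators of points. Such an indicator
  -- is a product over the coordinates, and its average over independent samples factors.
  have key : ∀ x : ∀ i, γ i, F x = ∑ c : ∀ i, γ i, F c * ∏ i, if x i = c i then (1 : ℝ) else 0 := by
    intro x
    rw [Finset.sum_eq_single x]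
    · simp
    · intro c _ hc
      obtain ⟨i, hi⟩ := Function.ne_iff.mp hc
      rw [Finset.prod_eq_zero (Finset.mem_univ i) (if_neg fun h => hi h.symm), mul_zero]
    · simp
  have e1 : ∀ a : ∀ i, α i, F (fun i => φ i (a i))
      = ∑ c : ∀ i, γ i, F c * ∏ i, if φ i (a i) = c i then (1 : ℝ) else 0 := fun a => key _
  have e2 : ∀ b : ∀ i, β i, F (fun i => ψ i (b i))
      = ∑ c : ∀ i, γ i, F c * ∏ i, if ψ i (b i) = c i then (1 : ℝ) else 0 := fun a => key _
  simp only [e1, e2]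
  rw [Finset.expect_sum_comm, Finset.expect_sum_comm]
  refine Finset.sum_congr rfl fun c _ => ?_
  rw [← Finset.mul_expect, ← Finset.mul_expect,
    expect_prod_eval s fun i x => if φ i x = c i then (1 : ℝ) else 0,
    expect_prod_eval t fun i x => if ψ i x = c i then (1 : ℝ) else 0]
  congr 1
  exact Finset.prod_congr rfl fun i _ => h i fun y => if y = c i then (1 : ℝ) else 0

theorem expect_piFinset_product {ι : Type*} [Fintype ι] [DecidableEq ι] {α β : Type*}
    (s : Finset α) (t : Finset β) (F : (ι → α) → (ι → β) → ℝ) :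
    𝔼 a ∈ Fintype.piFinset (fun _ : ι => s), 𝔼 b ∈ Fintype.piFinset (fun _ : ι => t), F a b
      = 𝔼 c ∈ Fintype.piFinset (fun _ : ι => s ×ˢ t), F (fun i => (c i).1) (fun i => (c i).2) := by
  rw [← Finset.expect_product']
  refine Finset.expect_nbij' (fun p i => (p.1 i, p.2 i)) (fun c => (fun i => (c i).1, fun i => (c i).2))
    ?_ ?_ ?_ ?_ ?_
  · rintro ⟨a, b⟩ h
    simp only [Finset.mem_product, Fintype.mem_piFinset] at h ⊢
    exact fun i => ⟨h.1 i, h.2 i⟩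
  · intro c h
    simp only [Finset.mem_product, Fintype.mem_piFinset] at h ⊢
    exact ⟨fun i => (h i).1, fun i => (h i).2⟩
  · intro _ _; rfl
  · intro _ _; rfl
  · intro _ _; rfl

/-! ## Binary expansions -/

/-- The first `n` binary digits of a number. -/
def digits (n a : ℕ) : Bits n := fun q => ((a / 2 ^ q.1 : ℕ) : ZMod 2)

theorem digits_eq_zero {n a : ℕ} {q : Fin n} : digits n a q = 0 ↔ a.testBit q = false := by
  rw [digits, natCast_zmod2_eq_zero, Nat.testBit_eq_decide_div_mod_eq, decide_eq_false_iff_not]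
  omega

theorem digits_injective {n a b : ℕ} (ha : a < 2 ^ n) (hb : b < 2 ^ n)
    (h : digits n a = digits n b) : a = b := by
  refine Nat.eq_of_testBit_eq fun q => ?_
  by_cases hq : q < n
  · have h1 := digits_eq_zero (a := a) (q := ⟨q, hq⟩)
    have h2 := digits_eq_zero (a := b) (q := ⟨q, hq⟩)
    rw [h] at h1
    have := h1.symm.trans h2
    cases h3 : a.testBit q <;> cases h4 : b.testBit q <;> simp_all
  · have h2 : 2 ^ n ≤ 2 ^ q := Nat.pow_le_pow_right (by norm_num) (by omega)
    rw [Nat.testBit_lt_two_pow (by omega), Nat.testBit_lt_two_pow (by omega)]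

theorem digits_bijective (n : ℕ) : Function.Bijective fun a : Fin (2 ^ n) => digits n a := by
  rw [Fintype.bijective_iff_injective_and_card]
  refine ⟨fun a b h => Fin.ext (digits_injective a.2 b.2 h), ?_⟩
  simp [ZMod.card]

/-- A number below `2 ^ n` has a nonzero digit at some position from `j` on exactly when it is not
equal to its remainder modulo `2 ^ j`. -/
theorem digits_mem_freshVectors {n a : ℕ} {j : ℕ} (ha : a < 2 ^ n) :
    digits n a ∈ freshVectors n j ↔ 2 ^ j ≤ a := by
  simp only [freshVectors, Finset.mem_filter, Finset.mem_univ, true_and]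
  constructor
  · rintro ⟨q, hq, h⟩
    by_contra! hc
    apply h
    have h2 : 2 ^ j ≤ 2 ^ q.1 := Nat.pow_le_pow_right (by norm_num) hq
    rw [digits_eq_zero, Nat.testBit_lt_two_pow (by omega)]
  · intro h
    by_contra! hc
    have h1 : a % 2 ^ j < 2 ^ j := Nat.mod_lt _ (by positivity)
    have h2 : a % 2 ^ j = a := by
      refine digits_injective ((Nat.mod_le _ _).trans_lt ha) ha ?_
      funext q
      by_cases hq : j ≤ q.1
      · rw [hc q hq, digits_eq_zero, Nat.testBit_mod_two_pow]
        simp [hq]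
      · have h3 := digits_eq_zero (a := a % 2 ^ j) (q := q)
        rw [Nat.testBit_mod_two_pow] at h3
        simp only [not_le.mp hq, decide_true, Bool.true_and, ← digits_eq_zero] at h3
        rcases zmod2_cases (digits n (a % 2 ^ j) q) with h4 | h4 <;>
          rcases zmod2_cases (digits n a q) with h5 | h5 <;> simp_all
    omega

/-- The fresh vectors are the expansions of an interval of numbers, so a uniform number shifted by
`2 ^ j` samples them exactly, with no rejection. -/
theorem expect_freshVectors {n : ℕ} (j : ℕ) (f : Bits n → ℝ) :
    𝔼 u : Fin (2 ^ n - 2 ^ j), f (digits n (u + 2 ^ j)) = 𝔼 v ∈ freshVectors n j, f v := by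
  refine Finset.expect_nbij (fun u => digits n (u + 2 ^ j)) ?_ (fun _ _ => rfl) ?_ ?_
  · intro u _
    have := u.2
    rw [digits_mem_freshVectors (by omega)]
    omega
  · intro u _ v _ h
    have h1 := u.2
    have h2 := v.2
    have := digits_injective (by omega) (by omega) h
    exact Fin.ext (by omega)
  · intro v hv
    obtain ⟨⟨a, h2⟩, h⟩ := (digits_bijective n).2 v
    dsimp only at h
    subst h
    have h1 : 2 ^ j ≤ a := (digits_mem_freshVectors h2).mp hv
    have h3 : a - 2 ^ j < 2 ^ n - 2 ^ j := Nat.sub_lt_sub_right h1 h2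
    have h4 : digits n (a - 2 ^ j + 2 ^ j) = digits n a := by rw [Nat.sub_add_cancel h1]
    exact ⟨⟨a - 2 ^ j, h3⟩, by simp, h4⟩

theorem expect_colProduct_digits {n : ℕ} (f : Matrix (Fin n) (Fin n) (ZMod 2) → ℝ) :
    𝔼 u : ∀ j : Fin n, Fin (2 ^ n - 2 ^ j.1),
      f (colProduct (fun j => digits n (u j + 2 ^ j.1)) n) = 𝔼 P ∈ glFixing n 0, f P := by
  rw [← expect_colProduct, ← Fintype.piFinset_univ]
  have h : ∀ (j : Fin n) (f : Bits n → ℝ),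
      𝔼 u ∈ (Finset.univ : Finset (Fin (2 ^ n - 2 ^ j.1))), f (digits n (u + 2 ^ j.1))
        = 𝔼 v ∈ freshVectors n j, f v := fun j f => expect_freshVectors j.1 f
  exact expect_piFinset_congr (α := fun j : Fin n => Fin (2 ^ n - 2 ^ j.1)) (γ := fun _ => Bits n)
    _ (fun j : Fin n => freshVectors n j) (fun j u => digits n (u + 2 ^ j.1)) (fun _ v => v) h
    fun v => f (colProduct v n)

/-! ## Random tableaus -/

/-- The tableau with given symplectic matrix and signs. -/
def tableauOf {n : ℕ} (S : Matrix (Fin n ⊕ Fin n) (Fin n ⊕ Fin n) (ZMod 2)) (s : PVec n) :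
    Tableau n := fun g => (s g, fun h => S h g)

/-- The description of Clifford operators by a symplectic matrix and free signs, read as a product
of uniform distributions. -/
theorem expect_cliffords {n : ℕ} (f : Tableau n → ℝ) :
    𝔼 τ ∈ cliffords n, f τ = 𝔼 S ∈ symplectics n, 𝔼 s : PVec n, f (tableauOf S s) := by
  rw [← Finset.expect_product']
  refine Finset.expect_nbij' (fun τ => (tableauMatrix τ, fun g => (τ g).1))
    (fun p => tableauOf p.1 p.2) ?_ ?_ ?_ ?_ ?_
  · intro τ hτ
    simpa using mem_cliffords.mp hτ
  · rintro ⟨S, s⟩ h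
    exact mem_cliffords.mpr (Finset.mem_product.mp h).1
  · intro _ _; rfl
  · intro _ _; rfl
  · intro _ _; rfl

theorem expect_bits_affine {n : ℕ} {P : Matrix (Fin n) (Fin n) (ZMod 2)} (hP : IsUnit P)
    (c : Bits n) (f : Bits n → ℝ) : 𝔼 r : Bits n, f r = 𝔼 r : Bits n, f (P.mulVec r + c) := by
  refine (Fintype.expect_bijective (fun r => P.mulVec r + c) ?_ _ _ fun _ => rfl).symm
  rw [← Finite.injective_iff_bijective]
  intro r r' h
  exact mulVec_injective_iff_isUnit.mpr hP (add_right_cancel h)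

/-- The right inverse identity `S J Sᵀ J = 1`, written out in the two column blocks: every vector is
expanded by its pairings with the dual columns. -/
theorem symplectic_completeness {n : ℕ} {S : Matrix (Fin n ⊕ Fin n) (Fin n ⊕ Fin n) (ZMod 2)}
    (hS : S ∈ symplectics n) (v : PVec n) :
    S.toCols₁.mulVec ((S.toCols₂ᵀ * symJ n).mulVec v) +
      S.toCols₂.mulVec ((S.toCols₁ᵀ * symJ n).mulVec v) = v := by
  have h := (symplectics_inverse hS).2
  rw [← fromCols_toCols S, transpose_fromCols, symJ, ← Matrix.mul_assoc, ← Matrix.mul_assoc,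
    fromCols_mul_fromBlocks, fromCols_mul_fromRows] at h
  simp only [Matrix.mul_zero, Matrix.mul_one, zero_add, add_zero] at h
  rw [mulVec_mulVec, mulVec_mulVec, ← add_mulVec, ← Matrix.mul_assoc, ← Matrix.mul_assoc,
    ← Matrix.add_mul, add_comm, symJ, h, one_mulVec]

theorem syndrome_eq {n : ℕ} (τ : Tableau n) (e : PVec n) :
    syndrome τ e = ((tableauMatrix τ).toCols₂ᵀ * symJ n).mulVec e := by
  rw [← mulVec_mulVec]
  rfl

/-- The error splits into an `X` part, whose coordinates are the syndrome and have been measured,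
and a `Z` part. The missing `Z` part lies in the span of the columns of the first encoder half and
is hidden by the uniform `r`. The signs of the tableau play no role, so their average is trivial. -/
theorem expect_sample {n k : ℕ} (hk : k ≤ n) (e : PVec n) (x : Bits k)
    (f : ClassicalSample n k → ℝ) :
    𝔼 τ ∈ cliffords n, 𝔼 P ∈ glFixing n 0, 𝔼 r : Bits n,
      f (encoderOf k (tableauMatrix τ) P,
        (tableauMatrix τ).toCols₁.mulVec (pad n x + syndrome τ e) +
          (tableauMatrix τ).toCols₂.mulVec r)
      = 𝔼 G ∈ encoders n k, 𝔼 r : Bits n, f (G, G.mulVec (Sum.elim r x) + e) := by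
  rw [← expect_encoderOf hk fun G => 𝔼 r : Bits n, f (G, G.mulVec (Sum.elim r x) + e),
    expect_cliffords]
  refine Finset.expect_congr rfl fun S hS => ?_
  have hu : (Finset.univ : Finset (PVec n)).Nonempty := Finset.univ_nonempty
  conv_rhs => rw [← Finset.expect_const hu (𝔼 P ∈ glFixing n 0, 𝔼 r : Bits n,
    f (encoderOf k S P, (encoderOf k S P).mulVec (Sum.elim r x) + e))]
  refine Finset.expect_congr rfl fun s _ => Finset.expect_congr rfl fun P hP => ?_
  have hm : tableauMatrix (tableauOf S s) = S := rfl
  -- The substitution for `r`: multiplication by `P` passes to the scrambled columns, and the shift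
  -- is the vector of `Z` coordinates of the error.
  rw [expect_bits_affine (mem_glFixing.mp hP).1 ((S.toCols₁ᵀ * symJ n).mulVec e)]
  refine Finset.expect_congr rfl fun r _ => ?_
  rw [syndrome_eq, hm, mulVec_add, mulVec_add]
  congr 2
  conv_rhs => rw [← symplectic_completeness hS e]
  rw [encoderOf, fromCols_mulVec, Sum.elim_comp_inl, Sum.elim_comp_inr, ← mulVec_mulVec r,
    ← mulVec_mulVec x, padMatrix_mulVec]
  abel

/-- The columns of a symplectic matrix form a basis: pairing with the dual columns recovers both
coordinate vectors, and the cardinalities agree. -/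
theorem expect_symplectic_mulVec {n : ℕ} {S : Matrix (Fin n ⊕ Fin n) (Fin n ⊕ Fin n) (ZMod 2)}
    (hS : S ∈ symplectics n) (f : PVec n → ℝ) :
    𝔼 r : Bits n, 𝔼 z : Bits n, f (S.toCols₁.mulVec z + S.toCols₂.mulVec r) = 𝔼 u, f u := by
  rw [← Finset.expect_product']
  refine Fintype.expect_bijective (fun p : Bits n × Bits n =>
    S.toCols₁.mulVec p.2 + S.toCols₂.mulVec p.1) ?_ _ _ fun _ => rfl
  rw [Fintype.bijective_iff_injective_and_card]
  constructor
  · rintro ⟨r, z⟩ ⟨r', z'⟩ h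
    obtain ⟨h1, h2, h3, h4⟩ := toCols_of_mem_symplectics hS
    have e1 := congrArg (S.toCols₁ᵀ * symJ n).mulVec h
    have e2 := congrArg (S.toCols₂ᵀ * symJ n).mulVec h
    simp only [mulVec_add, mulVec_mulVec, h1, h4, zero_mulVec, one_mulVec, zero_add] at e1
    simp only [mulVec_add, mulVec_mulVec, h2, h3, zero_mulVec, one_mulVec, add_zero] at e2
    rw [e1, e2]
  · simp only [Fintype.card_prod, Fintype.card_fun, ZMod.card, Fintype.card_fin, Fintype.card_sum,
      pow_add]

theorem expect_sample_unstructured {n k : ℕ} (hk : k ≤ n) (f : ClassicalSample n k → ℝ) :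
    𝔼 τ ∈ cliffords n, 𝔼 P ∈ glFixing n 0, 𝔼 r : Bits n, 𝔼 z : Bits n,
      f (encoderOf k (tableauMatrix τ) P,
        (tableauMatrix τ).toCols₁.mulVec z + (tableauMatrix τ).toCols₂.mulVec r)
      = 𝔼 G ∈ encoders n k, 𝔼 u : PVec n, f (G, u) := by
  rw [← expect_encoderOf hk fun G => 𝔼 u : PVec n, f (G, u), expect_cliffords]
  refine Finset.expect_congr rfl fun S hS => ?_
  have hu : (Finset.univ : Finset (PVec n)).Nonempty := Finset.univ_nonempty
  rw [← Finset.expect_const hu (𝔼 P ∈ glFixing n 0, 𝔼 u : PVec n, f (encoderOf k S P, u))]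
  exact Finset.expect_congr rfl fun s _ => Finset.expect_congr rfl fun P hP =>
    expect_symplectic_mulVec hS fun u => f (encoderOf k S P, u)

end LSN

namespace LSN

open Matrix

/-! ## The reduction from the quantum problem to its classical representation -/

theorem expect_pi_pair {m : ℕ} {α β : Type*} [Fintype β] (s : Finset α)
    (F : (Fin m → α) → (Fin m → β) → ℝ) :
    𝔼 a ∈ Fintype.piFinset (fun _ : Fin m => s), 𝔼 b : Fin m → β, F a b
      = 𝔼 c ∈ Fintype.piFinset (fun _ : Fin m => s ×ˢ (Finset.univ : Finset β)),
        F (fun i => (c i).1) (fun i => (c i).2) := by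
  rw [← Fintype.piFinset_univ]
  exact expect_piFinset_product _ _ F

theorem expect_product_univ {α β : Type*} [Fintype β] (s : Finset α) (f : α × β → ℝ) :
    𝔼 c ∈ s ×ˢ (Finset.univ : Finset β), f c = 𝔼 a ∈ s, 𝔼 b, f (a, b) :=
  Finset.expect_product _ _ _

/-- The procedure that solves the quantum problem with one call of an oracle for the classical
problem, up to the call. -/
def Cmd.toClassical : Cmd :=
  .seq .powers <|
  .seq (.for_ 20 .m (.for_ 21 .n (.rand 8 (.var 20) (.var 21) (.lit 0)
    (.sub (.sub (.get 10 .n (.lit 0) (.lit 0)) (.get 10 (.var 21) (.lit 0) (.lit 0))) (.lit 1))))) <|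
  .seq (.for_ 20 .m (.for_ 21 .n (.rand 9 (.var 20) (.var 21) (.lit 0) (.lit 1)))) <|
  .seq (.for_ 20 .m (.for_ 21 .n (.measurePauli 1))) .classicalQuery

/-- The reduction of the quantum problem to the classical one: `Cmd.toClassical`, then the answer of
the oracle. -/
def toClassical : OneCallAlgorithm := ⟨.toClassical, .copyAnswer⟩

theorem Cmd.toClassical_hasParamLoops : Cmd.toClassical.hasParamLoops := by decide

theorem tensorEntry_apply {m r c : ℕ} (M : Fin m → Fin r → Fin c → ZMod 2) (i : Fin m) (j : Fin r)
    (l : Fin c) : (tensorEntry M i j l : ZMod 2) = M i j l := by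
  simp [tensorEntry]

section

variable {n k m ℓ : ℕ}

/-- The classical sample that belongs to a tableau and random choices. -/
def classicalSample (k : ℕ) (τ : Tableau n) (P : Matrix (Fin n) (Fin n) (ZMod 2))
    (r z : Bits n) : ClassicalSample n k :=
  (encoderOf k (tableauMatrix τ) P,
    (tableauMatrix τ).toCols₁.mulVec z + (tableauMatrix τ).toCols₂.mulVec r)

theorem expect_pi_colProduct_digits
    (f : (Fin m → Matrix (Fin n) (Fin n) (ZMod 2)) → ℝ) :
    𝔼 u : Fin m → ∀ j : Fin n, Fin (2 ^ n - 2 ^ j.1),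
      f (fun i => colProduct (fun j => digits n (u i j + 2 ^ j.1)) n)
    = 𝔼 P ∈ Fintype.piFinset (fun _ : Fin m => glFixing n 0), f P := by
  rw [← Fintype.piFinset_univ]
  exact expect_piFinset_congr (α := fun _ : Fin m => ∀ j : Fin n, Fin (2 ^ n - 2 ^ j.1))
    (γ := fun _ => Matrix (Fin n) (Fin n) (ZMod 2)) _ (fun _ => glFixing n 0)
    (fun _ u => colProduct (fun j => digits n (u j + 2 ^ j.1)) n) (fun _ P => P)
    (fun _ f => expect_colProduct_digits f) f

/-- The whole program in closed form: invertible matrices and masks are uniform, and the label `z`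
is obtained with the Born probability of the corresponding code state. The proof pushes the
preexpectation through the stages, recording which arrays each stage leaves alone. -/
theorem withClassical_toClassical (hk : k ≤ n) (hℓ : ℓ ≤ n + 1) (O : ClassicalOracle n k m ℓ)
    {τ : Fin m → Tableau n} (hτ : ∀ i, τ i ∈ cliffords n) (φ : (Fin m → Bits n) → ℂ)
    (out : Bits ℓ) :
    toClassical.withClassical O τ φ out
      = 𝔼 P ∈ Fintype.piFinset (fun _ : Fin m => glFixing n 0), 𝔼 r : Fin m → Bits n,
        ∑ z : Fin m → Bits n, O.solver (fun i => classicalSample k (τ i) (P i) (r i) (z i)) out *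
          ‖amplitude τ φ z‖ ^ 2 := by
  have hF := homogeneous_classical O out
  rw [toClassical, withClassical_eq Cmd.toClassical_hasParamLoops hk hℓ, Cmd.toClassical, wp, wp,
    wp, wp, wp_of_isDet (c := .powers) (by decide)]
  set μ₀ := exec .powers (quantumInput k τ) with hμ₀
  have f₀ : ∀ b, b ≠ 10 → b ≠ 23 → μ₀ b = quantumInput k τ b := fun b h h' =>
    exec_powers_of_ne h h' _
  have hn₀ : quantumInput k τ 0 0 0 0 = n := by simp [quantumInput, initMem]
  have hk₀ : quantumInput k τ 0 1 0 0 = k := by simp [quantumInput, initMem]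
  have hm₀ : quantumInput k τ 0 2 0 0 = m := by simp [quantumInput, initMem]
  have hz₀ : ∀ b i j l, 2 < b → quantumInput k τ b i j l = 0 := by
    intro b i j l hb
    simp [quantumInput, initMem, show b ≠ 0 by omega, show b ≠ 1 by omega, show b ≠ 2 by omega]
  have hpow : ∀ j ≤ n, μ₀ 10 j 0 0 = 2 ^ j := exec_powers hn₀
  -- The number of admissible columns in step `j`; it is positive since `j < n`.
  rw [wp_fill_rand (n := n) (m := m) (fun j => 2 ^ n - 2 ^ j)
    (fun j hj => Nat.sub_pos_of_lt (Nat.pow_lt_pow_right (by norm_num) hj))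
    (by norm_num) (by norm_num) (by norm_num) (by rw [f₀ _ (by norm_num) (by norm_num), hn₀])
    (by rw [f₀ _ (by norm_num) (by norm_num), hm₀])
    (by rw [f₀ _ (by norm_num) (by norm_num), hz₀ _ _ _ _ (by norm_num)])
    (by rw [f₀ _ (by norm_num) (by norm_num), hz₀ _ _ _ _ (by norm_num)]) ?_ hF.wp.wp.wp]
  swap
  · intro ν hν j hj h21
    simp only [Expr.eval, h21, hν 10 (by norm_num) (by norm_num) (by norm_num),
      hν 0 (by norm_num) (by norm_num) (by norm_num), f₀ 0 (by norm_num) (by norm_num), hn₀,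
      hpow n le_rfl, hpow j hj.le]
  rw [← expect_pi_colProduct_digits fun P => 𝔼 r : Fin m → Bits n,
        ∑ z : Fin m → Bits n, O.solver (fun i => classicalSample k (τ i) (P i) (r i) (z i)) out *
          ‖amplitude τ φ z‖ ^ 2]
  refine Finset.expect_congr rfl fun u _ => ?_
  set μ₁ := fill μ₀ 8 (β := fun j => Fin (2 ^ n - 2 ^ j)) (fun _ v => v.1) u with hμ₁
  have f₁ : ∀ b, b ≠ 8 → μ₁ b = μ₀ b := fun b h => fill_of_ne h _ _
  have f₁' : ∀ b, b ≠ 8 → b ≠ 10 → b ≠ 23 → μ₁ b = quantumInput k τ b := fun b h h' h'' =>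
    (f₁ b h).trans (f₀ b h' h'')
  rw [wp_fill_rand (n := n) (m := m) (fun _ => 2) (fun _ _ => by norm_num) (by norm_num)
    (by norm_num) (by norm_num) (by rw [f₁' _ (by norm_num) (by norm_num) (by norm_num), hn₀])
    (by rw [f₁' _ (by norm_num) (by norm_num) (by norm_num), hm₀])
    (by rw [f₁' _ (by norm_num) (by norm_num) (by norm_num), hz₀ _ _ _ _ (by norm_num)])
    (by rw [f₁' _ (by norm_num) (by norm_num) (by norm_num), hz₀ _ _ _ _ (by norm_num)])
    (fun _ _ _ _ _ => rfl) hF.wp.wp]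
  change (𝔼 r : Fin m → Bits n, wp (.for_ 20 .m (.for_ 21 .n (.measurePauli 1)))
    (wp .classicalQuery _) (fill μ₁ 9 (β := fun _ => ZMod 2) (fun _ v => v.val) r) _) = _
  refine Finset.expect_congr rfl fun r _ => ?_
  set μ₂ := fill μ₁ 9 (β := fun _ => ZMod 2) (fun _ v => v.val) r with hμ₂
  have f₂ : ∀ b, b ≠ 9 → μ₂ b = μ₁ b := fun b h => fill_of_ne h _ _
  have f₂' : ∀ b, b ≠ 9 → b ≠ 8 → b ≠ 10 → b ≠ 23 → μ₂ b = quantumInput k τ b :=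
    fun b h h' h'' h3 => (f₂ b h).trans (f₁' b h' h'' h3)
  have hS : ∀ (i : Fin m) (h g : Fin n ⊕ Fin n),
      (quantumInput k τ 1 i (finSumFinEquiv h) (finSumFinEquiv g) : ZMod 2) = (τ i h).2 g := by
    intro i h g
    rw [quantumInput, initMem, if_neg (by norm_num), if_pos rfl, tensorEntry_apply,
      Equiv.symm_apply_apply, Equiv.symm_apply_apply]
  have hsgn : ∀ (i : Fin m) (q : Fin n),
      (quantumInput k τ 2 i (n + q) 0 : ZMod 2) = (τ i (Sum.inr q)).1 := by
    intro i q
    have := tensorEntry_apply (fun (i : Fin m) (j : Fin (n + n)) (_ : Fin 1) =>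
      (τ i (finSumFinEquiv.symm j)).1) i (finSumFinEquiv (Sum.inr q)) 0
    rw [Equiv.symm_apply_apply, finSumFinEquiv_apply_right, Fin.val_natAdd, Fin.val_zero] at this
    rw [quantumInput, initMem, if_neg (by norm_num), if_neg (by norm_num), if_pos rfl, this]
  rw [wp_fill_measurePauli (n := n) (m := m) (by norm_num) (by norm_num) (by norm_num)
    (by norm_num) (by rw [f₂' _ (by norm_num) (by norm_num) (by norm_num) (by norm_num), hn₀])
    (by rw [f₂' _ (by norm_num) (by norm_num) (by norm_num) (by norm_num), hm₀])
    (by rw [f₂' _ (by norm_num) (by norm_num) (by norm_num) (by norm_num),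
      hz₀ _ _ _ _ (by norm_num)])
    (by rw [f₂' _ (by norm_num) (by norm_num) (by norm_num) (by norm_num),
      hz₀ _ _ _ _ (by norm_num)])
    (by rw [f₂' _ (by norm_num) (by norm_num) (by norm_num) (by norm_num),
      hz₀ _ _ _ _ (by norm_num)]) hτ
    (fun i j l => by
      have := hS i (Sum.inr j) (Sum.inl l)
      rw [finSumFinEquiv_apply_right, finSumFinEquiv_apply_left, Fin.val_natAdd,
        Fin.val_castAdd] at this
      rw [f₂' _ (by norm_num) (by norm_num) (by norm_num) (by norm_num), this])
    (fun i j l => by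
      have := hS i (Sum.inr j) (Sum.inr l)
      rw [finSumFinEquiv_apply_right, finSumFinEquiv_apply_right, Fin.val_natAdd,
        Fin.val_natAdd] at this
      rw [f₂' _ (by norm_num) (by norm_num) (by norm_num) (by norm_num), this]) hF.wp]
  -- The measurement results are eigenvalues of unsigned Pauli operators. Adding the signs of the
  -- tableau converts them to labels of code states.
  refine Fintype.sum_equiv (Equiv.addRight fun i j => (τ i (Sum.inr j)).1) _ _ fun w => ?_
  set μ₃ := fill μ₂ 11 (β := fun _ => ZMod 2) (fun _ v => v.val) w with hμ₃
  have f₃ : ∀ b, b ≠ 11 → μ₃ b = μ₂ b := fun b h => fill_of_ne h _ _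
  have f₃' : ∀ b, b ≠ 11 → b ≠ 9 → b ≠ 8 → b ≠ 10 → b ≠ 23 → μ₃ b = quantumInput k τ b :=
    fun b h h' h'' h3 h4 => (f₃ b h).trans (f₂' b h' h'' h3 h4)
  have h0 : μ₃ 0 = quantumInput k τ 0 :=
    f₃' 0 (by norm_num) (by norm_num) (by norm_num) (by norm_num) (by norm_num)
  have hnorm : ∀ z : Fin m → Bits n, normSq (load (jointState τ z) ∅) = 1 := by
    intro z
    have h1 := star_jointState_dotProduct τ z z
    rw [if_pos rfl] at h1
    rw [normSq_load]
    have h2 : ((∑ s, ‖jointState τ z s‖ ^ 2 : ℝ) : ℂ) = 1 := by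
      rw [← h1, dotProduct, Complex.ofReal_sum]
      refine Finset.sum_congr rfl fun s _ => ?_
      rw [Pi.star_apply, Complex.star_def, ← Complex.normSq_eq_conj_mul_self,
        Complex.normSq_eq_norm_sq]
    exact_mod_cast h2
  rw [wp_of_isDet (by decide), load_smul, normSq_smul, hnorm, mul_one]
  rw [exec_classicalQuery hk (by rw [h0, hn₀]) (by rw [h0, hk₀]) (by rw [h0, hm₀])
    (fun i j => digits n (u i j + 2 ^ j.1)) ?_ (fun i => tableauMatrix (τ i)) ?_
    (fun i j => w i j + (τ i (Sum.inr j)).1) r ?_ ?_]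
  · rfl
  · intro i j q
    rw [f₃ 8 (by norm_num), f₂ 8 (by norm_num), hμ₁, fill_apply, f₃ 10 (by norm_num),
      f₂ 10 (by norm_num), f₁ 10 (by norm_num), hpow _ j.2.le, hpow _ q.2.le]
    rfl
  · intro i h g
    rw [f₃' 1 (by norm_num) (by norm_num) (by norm_num) (by norm_num) (by norm_num), hS]
    rfl
  · intro i q
    rw [f₃' 2 (by norm_num) (by norm_num) (by norm_num) (by norm_num) (by norm_num), hsgn, hμ₃,
      fill_apply, ZMod.natCast_zmod_val]
  · intro i q
    rw [f₃ 9 (by norm_num), hμ₂, fill_apply, ZMod.natCast_zmod_val]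

/-- A noisy codeword is one code state up to phase, so its measurement is deterministic. -/
theorem norm_amplitude_noisyCodeword {τ : Fin m → Tableau n} (hτ : ∀ i, τ i ∈ cliffords n)
    (e : Fin m → PVec n) (x : Bits k) (z : Fin m → Bits n) :
    ‖amplitude τ (productState fun i => noisyCodeword (τ i) (e i) x) z‖ ^ 2
      = if z = (fun i => pad n x + syndrome (τ i) (e i)) then 1 else 0 := by
  choose c hc hcw using fun i => noisyCodeword_eq (hτ i) (e i) x
  have h1 : (productState fun i => noisyCodeword (τ i) (e i) x)
      = (∏ i, c i) • jointState τ fun i => pad n x + syndrome (τ i) (e i) := by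
    rw [jointState, ← productState_smul]
    exact congrArg productState (funext hcw)
  rw [h1, amplitude, dotProduct_smul, star_jointState_dotProduct, smul_eq_mul, norm_mul, norm_prod,
    Finset.prod_eq_one fun i _ => hc i, one_mul]
  split_ifs <;> simp

/-- Summing the squared overlaps with all basis states gives the squared norm of the code state.
Hence measuring a maximally mixed register, or a random basis state, yields a uniform label. -/
theorem expect_norm_amplitude_basis (τ : Fin m → Tableau n) (z : Fin m → Bits n) :
    𝔼 s : Fin m → Bits n, ‖amplitude τ (Pi.single s 1) z‖ ^ 2
      = ((Fintype.card (Fin m → Bits n) : ℕ) : ℝ)⁻¹ := by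
  have h1 := star_jointState_dotProduct τ z z
  rw [if_pos rfl] at h1
  have h2 : ((∑ s, ‖amplitude τ (Pi.single s 1) z‖ ^ 2 : ℝ) : ℂ) = 1 := by
    refine Eq.trans ?_ h1
    rw [dotProduct, Complex.ofReal_sum]
    refine Finset.sum_congr rfl fun s _ => ?_
    rw [amplitude, dotProduct_single, mul_one, Pi.star_apply, norm_star, Complex.star_def,
      ← Complex.normSq_eq_conj_mul_self, Complex.normSq_eq_norm_sq]
  rw [Fintype.expect_eq_sum_div_card]
  have h3 : (∑ s, ‖amplitude τ (Pi.single s 1) z‖ ^ 2 : ℝ) = 1 := by exact_mod_cast h2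
  rw [h3, one_div]

/-- For a fixed error pattern the samples are independent and `expect_sample` matches their
distributions one by one; the common secret is just a parameter. The work consists in regrouping
averages over tuples into tuples of samples. Summation against the error weights comes last, so no
property of these weights is needed. -/
theorem quantumStructured_toClassical (hk : k ≤ n) (hℓ : ℓ ≤ n + 1) (p : ℝ)
    (O : ClassicalOracle n k m ℓ) (x : Bits k) (out : Bits ℓ) :
    quantumStructured p (toClassical.withClassical O) x out = classicalStructured p O.solver x out := by
  have key : ∀ e : Fin m → PVec n,
      𝔼 τ ∈ Fintype.piFinset (fun _ : Fin m => cliffords n),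
        toClassical.withClassical O τ (productState fun i => noisyCodeword (τ i) (e i) x) out
      = 𝔼 G ∈ Fintype.piFinset (fun _ : Fin m => encoders n k), 𝔼 r : Fin m → Bits n,
        O.solver (fun i => (G i, (G i).mulVec (Sum.elim (r i) x) + e i)) out := by
    intro e
    have h1 : ∀ τ ∈ Fintype.piFinset (fun _ : Fin m => cliffords n),
        toClassical.withClassical O τ (productState fun i => noisyCodeword (τ i) (e i) x) out
        = 𝔼 P ∈ Fintype.piFinset (fun _ : Fin m => glFixing n 0), 𝔼 r : Fin m → Bits n,
          O.solver (fun i => classicalSample k (τ i) (P i) (r i)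
            (pad n x + syndrome (τ i) (e i))) out := by
      intro τ hτ
      rw [withClassical_toClassical hk hℓ O (Fintype.mem_piFinset.mp hτ)]
      refine Finset.expect_congr rfl fun P _ => Finset.expect_congr rfl fun r _ => ?_
      simp only [norm_amplitude_noisyCodeword (Fintype.mem_piFinset.mp hτ), mul_ite, mul_one,
        mul_zero, Finset.sum_ite_eq', Finset.mem_univ, if_true]
    rw [Finset.expect_congr rfl h1]
    calc _ = 𝔼 τ ∈ Fintype.piFinset (fun _ : Fin m => cliffords n),
          𝔼 c ∈ Fintype.piFinset (fun _ : Fin m => glFixing n 0 ×ˢ (Finset.univ : Finset (Bits n))),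
            O.solver (fun i => classicalSample k (τ i) (c i).1 (c i).2
              (pad n x + syndrome (τ i) (e i))) out :=
          Finset.expect_congr rfl fun τ _ => expect_pi_pair (glFixing n 0) fun P r =>
            O.solver (fun i => classicalSample k (τ i) (P i) (r i)
              (pad n x + syndrome (τ i) (e i))) out
      _ = 𝔼 d ∈ Fintype.piFinset (fun _ : Fin m =>
            cliffords n ×ˢ (glFixing n 0 ×ˢ (Finset.univ : Finset (Bits n)))),
            O.solver (fun i => classicalSample k (d i).1 (d i).2.1 (d i).2.2
              (pad n x + syndrome (d i).1 (e i))) out :=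
          expect_piFinset_product (cliffords n) (glFixing n 0 ×ˢ (Finset.univ : Finset (Bits n)))
            fun τ c => O.solver (fun i => classicalSample k (τ i) (c i).1 (c i).2
              (pad n x + syndrome (τ i) (e i))) out
      _ = 𝔼 d ∈ Fintype.piFinset (fun _ : Fin m =>
            encoders n k ×ˢ (Finset.univ : Finset (Bits n))),
            O.solver (fun i => ((d i).1, (d i).1.mulVec (Sum.elim (d i).2 x) + e i)) out := by
          refine expect_piFinset_congr (γ := fun _ => ClassicalSample n k) _ _
            (fun i (d : Tableau n × Matrix (Fin n) (Fin n) (ZMod 2) × Bits n) =>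
              classicalSample k d.1 d.2.1 d.2.2 (pad n x + syndrome d.1 (e i)))
            (fun i (d : Matrix (Fin n ⊕ Fin n) (Fin n ⊕ Fin k) (ZMod 2) × Bits n) =>
              (d.1, d.1.mulVec (Sum.elim d.2 x) + e i)) (fun i f => ?_) fun s => O.solver s out
          rw [Finset.expect_product, expect_product_univ, ← expect_sample hk (e i) x f]
          refine Finset.expect_congr rfl fun τ _ => ?_
          rw [expect_product_univ]
          rfl
      _ = _ := (expect_pi_pair (encoders n k) fun G r =>
            O.solver (fun i => (G i, (G i).mulVec (Sum.elim (r i) x) + e i)) out).symm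
  rw [quantumStructured, classicalStructured, Finset.expect_sum_comm]
  simp only [Finset.expect_sum_comm, ← Finset.mul_expect, key]

theorem expect_withClassical_toClassical (hk : k ≤ n) (hℓ : ℓ ≤ n + 1)
    (O : ClassicalOracle n k m ℓ) (out : Bits ℓ) {τ : Fin m → Tableau n}
    (hτ : ∀ i, τ i ∈ cliffords n) :
    𝔼 s : Fin m → Bits n, toClassical.withClassical O τ (Pi.single s 1) out
      = 𝔼 P ∈ Fintype.piFinset (fun _ : Fin m => glFixing n 0), 𝔼 r : Fin m → Bits n,
        𝔼 z : Fin m → Bits n,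
          O.solver (fun i => classicalSample k (τ i) (P i) (r i) (z i)) out := by
  rw [Finset.expect_congr rfl fun s _ => withClassical_toClassical hk hℓ O hτ (Pi.single s 1) out,
    Finset.expect_comm]
  refine Finset.expect_congr rfl fun P _ => ?_
  rw [Finset.expect_comm]
  refine Finset.expect_congr rfl fun r _ => ?_
  rw [Finset.expect_sum_comm, Fintype.expect_eq_sum_div_card, div_eq_mul_inv, Finset.sum_mul]
  refine Finset.sum_congr rfl fun z _ => ?_
  rw [← Finset.mul_expect, expect_norm_amplitude_basis]

theorem expect_pi_sample_unstructured (hk : k ≤ n) (f : (Fin m → ClassicalSample n k) → ℝ) :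
    𝔼 τ ∈ Fintype.piFinset (fun _ : Fin m => cliffords n),
      𝔼 P ∈ Fintype.piFinset (fun _ : Fin m => glFixing n 0), 𝔼 r : Fin m → Bits n,
        𝔼 z : Fin m → Bits n, f (fun i => classicalSample k (τ i) (P i) (r i) (z i))
      = 𝔼 G ∈ Fintype.piFinset (fun _ : Fin m => encoders n k), 𝔼 u : Fin m → PVec n,
        f (fun i => (G i, u i)) := by
  calc _ = 𝔼 τ ∈ Fintype.piFinset (fun _ : Fin m => cliffords n),
        𝔼 c ∈ Fintype.piFinset (fun _ : Fin m => glFixing n 0 ×ˢ (Finset.univ : Finset (Bits n))),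
          𝔼 z : Fin m → Bits n, f (fun i => classicalSample k (τ i) (c i).1 (c i).2 (z i)) :=
        Finset.expect_congr rfl fun τ _ => expect_pi_pair (glFixing n 0) fun P r =>
          𝔼 z : Fin m → Bits n, f (fun i => classicalSample k (τ i) (P i) (r i) (z i))
    _ = 𝔼 τ ∈ Fintype.piFinset (fun _ : Fin m => cliffords n),
        𝔼 c ∈ Fintype.piFinset (fun _ : Fin m =>
          (glFixing n 0 ×ˢ (Finset.univ : Finset (Bits n))) ×ˢ (Finset.univ : Finset (Bits n))),
            f (fun i => classicalSample k (τ i) (c i).1.1 (c i).1.2 (c i).2) :=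
        Finset.expect_congr rfl fun τ _ =>
          expect_pi_pair (glFixing n 0 ×ˢ (Finset.univ : Finset (Bits n))) fun c z =>
            f (fun i => classicalSample k (τ i) (c i).1 (c i).2 (z i))
    _ = 𝔼 d ∈ Fintype.piFinset (fun _ : Fin m => cliffords n ×ˢ
          ((glFixing n 0 ×ˢ (Finset.univ : Finset (Bits n))) ×ˢ (Finset.univ : Finset (Bits n)))),
          f (fun i => classicalSample k (d i).1 (d i).2.1.1 (d i).2.1.2 (d i).2.2) :=
        expect_piFinset_product (cliffords n)
          ((glFixing n 0 ×ˢ (Finset.univ : Finset (Bits n))) ×ˢ (Finset.univ : Finset (Bits n)))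
          fun τ c => f (fun i => classicalSample k (τ i) (c i).1.1 (c i).1.2 (c i).2)
    _ = 𝔼 d ∈ Fintype.piFinset (fun _ : Fin m =>
          encoders n k ×ˢ (Finset.univ : Finset (PVec n))), f d := by
        refine expect_piFinset_congr (γ := fun _ => ClassicalSample n k) _ _
          (fun i (d : Tableau n × (Matrix (Fin n) (Fin n) (ZMod 2) × Bits n) × Bits n) =>
            classicalSample k d.1 d.2.1.1 d.2.1.2 d.2.2)
          (fun i d => d) (fun i f => ?_) f
        rw [Finset.expect_product, expect_product_univ, ← expect_sample_unstructured hk f]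
        refine Finset.expect_congr rfl fun τ _ => ?_
        rw [expect_product_univ, expect_product_univ]
        rfl
    _ = _ := (expect_pi_pair (encoders n k) fun G u => f (fun i => (G i, u i))).symm

theorem quantumUnstructured_toClassical (hk : k ≤ n) (hℓ : ℓ ≤ n + 1)
    (O : ClassicalOracle n k m ℓ) (out : Bits ℓ) :
    quantumUnstructured (toClassical.withClassical O) out = classicalUnstructured O.solver out := by
  rw [quantumUnstructured, classicalUnstructured,
    ← expect_pi_sample_unstructured hk fun d => O.solver d out]
  exact Finset.expect_congr rfl fun τ hτ =>
    expect_withClassical_toClassical hk hℓ O out (Fintype.mem_piFinset.mp hτ)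

end

end LSN

namespace LSN

open Matrix

/-! ## Computing a completion of an encoder -/

theorem exec_tabulate_equiv {ι₂ ι₃ ι₄ : Type*} [Fintype ι₄] {a : ℕ} (ha : a < 30) (ha0 : a ≠ 0)
    {e₁ e₂ e₃ e₄ E : Expr} {μ : Mem} {N₁ N₂ N₃ N₄ : ℕ} (ε₂ : ι₂ ≃ Fin N₂) (ε₃ : ι₃ ≃ Fin N₃)
    (ε₄ : ι₄ ≃ Fin N₄) (val : Fin N₁ → ι₂ → ι₃ → ι₄ → ZMod 2)
    (h₁ : ∀ ν : Mem, ν 0 = μ 0 → e₁.eval ν = N₁) (h₂ : ∀ ν : Mem, ν 0 = μ 0 → e₂.eval ν = N₂)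
    (h₃ : ∀ ν : Mem, ν 0 = μ 0 → e₃.eval ν = N₃) (h₄ : ∀ ν : Mem, ν 0 = μ 0 → e₄.eval ν = N₄)
    (hE : ∀ (ν : Mem) (i : Fin N₁) (j : ι₂) (l : ι₃) (q : ι₄),
      (∀ b < 30, b ≠ a → ν b = μ b) → ν 30 0 0 0 = i → ν 31 0 0 0 = ε₂ j → ν 32 0 0 0 = ε₃ l →
      ν 33 0 0 0 = ε₄ q → (E.eval ν : ZMod 2) = val i j l q)
    (i : Fin N₁) (j : ι₂) (l : ι₃) :
    (exec (.tabulate a e₁ e₂ e₃ e₄ E) μ a i (ε₂ j) (ε₃ l) : ZMod 2) = ∑ q, val i j l q := by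
  rw [exec_tabulate_fin ha ha0 (fun i j l q => val i (ε₂.symm j) (ε₃.symm l) (ε₄.symm q)) h₁ h₂ h₃
    h₄ (fun ν i j l q hν h30 h31 h32 h33 => hE ν i _ _ _ hν h30 (by simpa using h31)
      (by simpa using h32) (by simpa using h33)), Equiv.symm_apply_apply, Equiv.symm_apply_apply]
  exact ε₄.symm.sum_comp _

theorem exec_copy {a b : ℕ} (ha : a < 30) (ha0 : a ≠ 0) (hb : b < 30) (hab : b ≠ a)
    {e₁ e₂ e₃ : Expr} {μ : Mem} {N₁ N₂ N₃ : ℕ}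
    (h₁ : ∀ ν : Mem, ν 0 = μ 0 → e₁.eval ν = N₁) (h₂ : ∀ ν : Mem, ν 0 = μ 0 → e₂.eval ν = N₂)
    (h₃ : ∀ ν : Mem, ν 0 = μ 0 → e₃.eval ν = N₃) (i : Fin N₁) (j : Fin N₂) (l : Fin N₃) :
    exec (.tabulate a e₁ e₂ e₃ (.lit 1) (.cell b)) μ a i j l = μ b i j l := by
  have := exec_tabulate_fin (R := ℕ) (N₄ := 1) ha ha0 (fun i j l _ => μ b i j l) h₁ h₂ h₃
    (e₄ := .lit 1) (fun ν _ => rfl) (E := .cell b) (fun ν i j l _ hν h30 h31 h32 _ => by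
      simp only [Expr.eval, h30, h31, h32, hν b hb hab, Nat.cast_id]) i j l
  simpa using this

theorem bit_congr {P Q : Prop} [Decidable P] [Decidable Q] (h : P ↔ Q) : bit P = bit Q := by
  simp only [bit, h]

theorem one_add_bit {P : Prop} [Decidable P] : 1 + bit P = bit ¬ P := by
  simp only [bit]
  split_ifs <;> rfl

/-- The partner of a row in the symplectic pairing. -/
def Expr.swap (e : Expr) : Expr := .mod (.add e .n) (.add .n .n)

/-- Adding `n` modulo `n + n` exchanges the two halves of the coordinates. -/
theorem Expr.eval_swap {n : ℕ} {μ : Mem} (hn : μ 0 0 0 0 = n) {e : Expr} {g : Fin n ⊕ Fin n}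
    (he : e.eval μ = finSumFinEquiv g) : (Expr.swap e).eval μ = finSumFinEquiv g.swap := by
  simp only [Expr.swap, Expr.eval, hn, he]
  rcases g with q | q
  · have := q.2
    simp only [Sum.swap_inl, finSumFinEquiv_apply_left, finSumFinEquiv_apply_right, Fin.val_natAdd,
      Fin.val_castAdd]
    rw [Nat.mod_eq_of_lt (by omega), add_comm]
  · have := q.2
    simp only [Sum.swap_inr, finSumFinEquiv_apply_left, finSumFinEquiv_apply_right, Fin.val_natAdd,
      Fin.val_castAdd]
    rw [show n + q.1 + n = q.1 + (n + n) by omega, Nat.add_mod_right, Nat.mod_eq_of_lt (by omega)]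

theorem transpose_mul_symJ_mul {n : ℕ} {α β : Type*} (M : Matrix (Fin n ⊕ Fin n) α (ZMod 2))
    (M' : Matrix (Fin n ⊕ Fin n) β (ZMod 2)) (a : α) (b : β) :
    (Mᵀ * symJ n * M') a b = ∑ g, M g a * M' g.swap b := by
  rw [transpose_mul_symJ_mul_apply, sympInner_eq]
  rfl

/-- One elimination step for the columns in array `15`. -/
def Cmd.elimStep : Cmd :=
  let y (e : Expr) : Expr := .get 12 (.var 30) (.lit 0) e
  let u (e : Expr) : Expr := .get 14 (.var 30) (.lit 0) e
  let isT (e : Expr) : Expr := .eq (.add e (.add (.var 22) (.lit 1))) .n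
  .seq (.tabulate 12 .m (.lit 1) .n (.add .n .n)
    (.and (.get 15 (.var 30) (.var 32) (.var 33))
      (.get 1 (.var 30) (.swap (.var 33)) (.add .n (.sub (.sub .k (.lit 1)) (.var 22)))))) <|
  .seq (.tabulate 13 .m (.lit 1) .n (.lit 1)
    (.and (y (.var 32)) (.lt (.add (.var 32) (.var 22)) .n))) <|
  .seq (.lastOne 13 17 14 .m (.lit 1) .n) <|
  .seq (.tabulate 16 .m .n (.add .n .n) .n
    (.and (.get 15 (.var 30) (.var 33) (.var 32))
      (.add (.and (isT (.var 31)) (u (.var 33)))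
        (.and (.add (.lit 1) (isT (.var 31)))
          (.add (.and (u (.var 31)) (.add (isT (.var 33))
              (.and (y (.sub (.sub .n (.lit 1)) (.var 22))) (u (.var 33)))))
            (.and (.add (.lit 1) (u (.var 31))) (.add (.eq (.var 33) (.var 31))
              (.and (y (.var 31)) (u (.var 33)))))))))) <|
  .tabulate 15 .m .n (.add .n .n) (.lit 1) (.cell 16)

theorem Cmd.elimStep_writes {b : ℕ} (hb : b ∈ Cmd.elimStep.writes) (h : b < 30) :
    b ∈ [12, 13, 14, 15, 16, 17] := by
  simp [Cmd.elimStep, Cmd.lastOne, Cmd.tabulate, Cmd.writes_for, Cmd.writes] at hb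
  simp
  omega

section

variable {n k m : ℕ}

/-- The vector to be eliminated is computed from the current columns and the encoder, so the
accumulated product of column operations is never stored. The new columns go to array `16` first
because the product reads the array that it replaces. -/
theorem exec_elimStep (hk : k ≤ n) {μ : Mem} (hn : μ 0 0 0 0 = n) (hk' : μ 0 1 0 0 = k)
    (hm : μ 0 2 0 0 = m) {t : ℕ} (ht : t < k) (h22 : μ 22 0 0 0 = t)
    (G : Fin m → Matrix (Fin n ⊕ Fin n) (Fin n ⊕ Fin k) (ZMod 2))
    (hG : ∀ (i : Fin m) (g : Fin n ⊕ Fin n) (h : Fin n ⊕ Fin k),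
      (μ 1 i (finSumFinEquiv g) (finSumFinEquiv h) : ZMod 2) = G i g h)
    (A : Fin m → Matrix (Fin n ⊕ Fin n) (Fin n) (ZMod 2))
    (hA : ∀ (i : Fin m) (q : Fin n) (g : Fin n ⊕ Fin n),
      (μ 15 i q (finSumFinEquiv g) : ZMod 2) = A i g q)
    (i : Fin m) (q : Fin n) (g : Fin n ⊕ Fin n) :
    (exec .elimStep μ 15 i q (finSumFinEquiv g) : ZMod 2)
      = (A i * elimMatrix ⟨n - 1 - t, by omega⟩ fun q =>
          ((A i)ᵀ * symJ n * (G i).toCols₂) q ⟨k - 1 - t, by omega⟩) g q := by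
  set T : Fin n := ⟨n - 1 - t, by omega⟩ with hT
  set y : Fin m → Fin n → ZMod 2 := fun i q =>
    ((A i)ᵀ * symJ n * (G i).toCols₂) q ⟨k - 1 - t, by omega⟩ with hy
  rw [Cmd.elimStep, exec]
  set μ₁ := exec (.tabulate 12 .m (.lit 1) .n (.add .n .n)
    (.and (.get 15 (.var 30) (.var 32) (.var 33))
      (.get 1 (.var 30) (.swap (.var 33)) (.add .n (.sub (.sub .k (.lit 1)) (.var 22)))))) μ with hμ₁
  have f₁ : ∀ b < 30, b ≠ 12 → μ₁ b = μ b := fun b hb hb' => exec_tabulate_of_ne hb hb' μ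
  have p₁ : μ₁ 0 = μ 0 := f₁ 0 (by norm_num) (by norm_num)
  have v₁ : ∀ (i : Fin m) (q : Fin n), (μ₁ 12 i 0 q : ZMod 2) = y i q := by
    intro i q
    have := exec_tabulate_equiv (a := 12) (by norm_num) (by norm_num) (Equiv.refl (Fin 1))
      (Equiv.refl (Fin n)) (finSumFinEquiv (m := n) (n := n)) (e₁ := .m) (e₂ := .lit 1) (e₃ := .n)
      (e₄ := .add .n .n) (E := .and (.get 15 (.var 30) (.var 32) (.var 33))
        (.get 1 (.var 30) (.swap (.var 33)) (.add .n (.sub (.sub .k (.lit 1)) (.var 22)))))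
      (μ := μ) (fun i _ q g => A i g q * G i g.swap (Sum.inr ⟨k - 1 - t, by omega⟩))
      (fun ν h => by simp [Expr.eval, h, hm]) (fun ν h => rfl)
      (fun ν h => by simp [Expr.eval, h, hn]) (fun ν h => by simp [Expr.eval, h, hn]) ?_ i 0 q
    · exact this.trans (transpose_mul_symJ_mul (A i) (G i).toCols₂ q _).symm
    · intro ν i _ q g hν h30 _ h32 h33
      have e0 : ν 0 = μ 0 := hν 0 (by norm_num) (by norm_num)
      have es : (Expr.swap (.var 33)).eval ν = finSumFinEquiv g.swap :=
        Expr.eval_swap (by rw [e0, hn]) (by simpa [Expr.eval] using h33)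
      have hl := hG i g.swap (Sum.inr ⟨k - 1 - t, by omega⟩)
      rw [finSumFinEquiv_apply_right, Fin.val_natAdd] at hl
      rw [Equiv.refl_apply] at h32
      rw [Expr.cast_eval_and]
      simp only [Expr.eval, es, h30, h32, h33, e0, hn, hk', hν 15 (by norm_num) (by norm_num), hA,
        hν 1 (by norm_num) (by norm_num), hν 22 (by norm_num) (by norm_num), h22, hl]
  rw [exec]
  set μ₂ := exec (.tabulate 13 .m (.lit 1) .n (.lit 1)
    (.and (.get 12 (.var 30) (.lit 0) (.var 32)) (.lt (.add (.var 32) (.var 22)) .n))) μ₁ with hμ₂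
  have f₂ : ∀ b < 30, b ≠ 13 → μ₂ b = μ₁ b := fun b hb hb' => exec_tabulate_of_ne hb hb' μ₁
  have p₂ : μ₂ 0 = μ 0 := (f₂ 0 (by norm_num) (by norm_num)).trans p₁
  have v₂ : ∀ (i : Fin m) (j : Fin 1) (q : Fin n),
      (μ₂ 13 i j q : ZMod 2) = y i q * bit (q ≤ T) := by
    intro i j q
    rw [hμ₂, exec_tabulate_fin (by norm_num) (by norm_num) (N₄ := 1)
      (fun (i : Fin m) (_ : Fin 1) (q : Fin n) _ => y i q * bit (q ≤ T))
      (fun ν h => by simp [Expr.eval, h, p₁, hm]) (fun ν h => rfl)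
      (fun ν h => by simp [Expr.eval, h, p₁, hn]) (fun ν h => rfl)]
    · simp
    · intro ν i _ q _ hν h30 _ h32 _
      rw [Expr.cast_eval_and, Expr.cast_eval_lt]
      simp only [Expr.eval, h30, h32, hν 0 (by norm_num) (by norm_num), p₁, hn,
        hν 12 (by norm_num) (by norm_num), v₁, hν 22 (by norm_num) (by norm_num),
        f₁ 22 (by norm_num) (by norm_num), h22]
      congr 1
      refine bit_congr ?_
      rw [Fin.le_def, hT]
      dsimp only
      omega
  rw [exec]
  set μ₃ := exec (.lastOne 13 17 14 .m (.lit 1) .n) μ₂ with hμ₃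
  have f₃ : ∀ b < 30, b ≠ 17 → b ≠ 14 → μ₃ b = μ₂ b := fun b hb h h' =>
    exec_lastOne_of_ne hb h h' μ₂
  have p₃ : μ₃ 0 = μ 0 := (f₃ 0 (by norm_num) (by norm_num) (by norm_num)).trans p₂
  have v₃ : ∀ (i : Fin m) (q : Fin n),
      (μ₃ 14 i 0 q : ZMod 2) = lastOne (fun q => y i q * bit (q ≤ T)) q := fun i q =>
    exec_lastOne (by norm_num) (by norm_num) (by norm_num) (by norm_num) (by norm_num)
      (by norm_num) (by norm_num) (by norm_num) (fun i (_ : Fin 1) q => y i q * bit (q ≤ T))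
      (fun ν h => by simp [Expr.eval, h, p₂, hm]) (fun ν h => rfl)
      (fun ν h => by simp [Expr.eval, h, p₂, hn]) v₂ i 0 q
  have p₄ : ∀ {e₁ e₂ e₃ e₄ E : Expr} {ν : Mem},
      ν 0 = exec (.tabulate 16 e₁ e₂ e₃ e₄ E) μ₃ 0 → ν 0 = μ 0 := fun h =>
    h.trans ((exec_tabulate_of_ne (by norm_num) (by norm_num) _).trans p₃)
  rw [exec, exec_copy (by norm_num) (by norm_num) (by norm_num) (by norm_num)
    (fun ν h => by simp [Expr.eval, p₄ h, hm]) (fun ν h => by simp [Expr.eval, p₄ h, hn])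
    (fun ν h => by simp [Expr.eval, p₄ h, hn]), Matrix.mul_apply]
  refine exec_tabulate_equiv (by norm_num) (by norm_num) (Equiv.refl (Fin n))
    (finSumFinEquiv (m := n) (n := n)) (Equiv.refl (Fin n))
    (fun i q g q' => A i g q' * elimMatrix T (y i) q' q)
    (fun ν h => by simp [Expr.eval, h, p₃, hm]) (fun ν h => by simp [Expr.eval, h, p₃, hn])
    (fun ν h => by simp [Expr.eval, h, p₃, hn]) (fun ν h => by simp [Expr.eval, h, p₃, hn])
    ?_ i q g
  intro ν i q g q' hν h30 h31 h32 h33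
  rw [Equiv.refl_apply] at h31 h33
  have e0 : ν 0 = μ 0 := (hν 0 (by norm_num) (by norm_num)).trans p₃
  have e22 : ν 22 0 0 0 = t := by
    rw [hν 22 (by norm_num) (by norm_num), f₃ 22 (by norm_num) (by norm_num) (by norm_num),
      f₂ 22 (by norm_num) (by norm_num), f₁ 22 (by norm_num) (by norm_num), h22]
  have e12 : ∀ (i : Fin m) (q : Fin n), (ν 12 i 0 q : ZMod 2) = y i q := fun i q => by
    rw [hν 12 (by norm_num) (by norm_num), f₃ 12 (by norm_num) (by norm_num) (by norm_num),
      f₂ 12 (by norm_num) (by norm_num), v₁]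
  have e15 : (ν 15 i q' (finSumFinEquiv g) : ZMod 2) = A i g q' := by
    rw [hν 15 (by norm_num) (by norm_num), f₃ 15 (by norm_num) (by norm_num) (by norm_num),
      f₂ 15 (by norm_num) (by norm_num), f₁ 15 (by norm_num) (by norm_num), hA]
  -- The program tests `q = n - 1 - t` in additive form.
  have eT : ∀ q : Fin n, bit (q.1 + (t + 1) = n) = bit (q = T) := fun q => bit_congr (by
    rw [Fin.ext_iff, hT]
    dsimp only
    omega)
  have e12T : (ν 12 i 0 (n - 1 - t) : ZMod 2) = y i T := e12 i T
  simp only [Expr.cast_eval_and, Expr.cast_eval_add, Expr.cast_eval_eq]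
  simp only [Expr.eval, h30, h31, h32, h33, e0, e22, hn, e12, e12T, e15,
    hν 14 (by norm_num) (by norm_num), v₃, eT, Nat.cast_one, ← Fin.ext_iff]
  congr 1
  rw [elimMatrix, Matrix.of_apply]
  by_cases h : q = T
  · simp [h, bit, zmod2_add_self]
  · simp only [h, bit, if_false, zero_mul, zero_add, add_zero, one_mul]

/-- The columns `A` of the encoder, reduced such that `Aᵀ J B` is in normal form, in array `15`. -/
def Cmd.reducedColumns : Cmd :=
  .seq (.tabulate 15 .m .n (.add .n .n) (.lit 1) (.get 1 (.var 30) (.var 32) (.var 31)))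
    (.for_ 22 .k .elimStep)

theorem exec_reducedColumns_of_ne {b : ℕ} (hb : b < 30) (hb' : b ∉ [12, 13, 14, 15, 16, 17, 22])
    (μ : Mem) : exec .reducedColumns μ b = μ b := by
  simp only [List.mem_cons, List.not_mem_nil, or_false, not_or] at hb'
  rw [Cmd.reducedColumns, exec, exec_of_notMem, exec_tabulate_of_ne hb (by omega)]
  refine Cmd.notMem_writes_for (by omega) fun h => ?_
  have := Cmd.elimStep_writes h hb
  simp only [List.mem_cons, List.not_mem_nil, or_false] at this
  omega

theorem exec_reducedColumns (hk : k ≤ n) {μ : Mem} (hn : μ 0 0 0 0 = n) (hk' : μ 0 1 0 0 = k)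
    (hm : μ 0 2 0 0 = m)
    (G : Fin m → Matrix (Fin n ⊕ Fin n) (Fin n ⊕ Fin k) (ZMod 2))
    (hG : ∀ (i : Fin m) (g : Fin n ⊕ Fin n) (h : Fin n ⊕ Fin k),
      (μ 1 i (finSumFinEquiv g) (finSumFinEquiv h) : ZMod 2) = G i g h)
    (i : Fin m) (q : Fin n) (g : Fin n ⊕ Fin n) :
    (exec .reducedColumns μ 15 i q (finSumFinEquiv g) : ZMod 2)
      = LSN.reducedColumns hk (G i) g q := by
  rw [Cmd.reducedColumns, exec]
  set μ₁ := exec (.tabulate 15 .m .n (.add .n .n) (.lit 1)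
    (.get 1 (.var 30) (.var 32) (.var 31))) μ with hμ₁
  have f₁ : ∀ b < 30, b ≠ 15 → μ₁ b = μ b := fun b hb hb' => exec_tabulate_of_ne hb hb' μ
  have p₁ : μ₁ 0 = μ 0 := f₁ 0 (by norm_num) (by norm_num)
  have hw : ∀ b < 30, b ∉ [12, 13, 14, 15, 16, 17] → b ∉ Cmd.elimStep.writes := fun b hb h h' =>
    h (Cmd.elimStep_writes h' hb)
  have := exec_for (x := 22) (N := k) (e := .k) (μ := μ₁) (c := .elimStep)
    (fun t ν => ∀ (i : Fin m) (q : Fin n) (g : Fin n ⊕ Fin n),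
      (ν 15 i q (finSumFinEquiv g) : ZMod 2)
        = ((G i).toCols₁ * elimProduct hk ((G i).toCols₁ᵀ * symJ n * (G i).toCols₂) t) g q)
    (hw 22 (by norm_num) (by norm_num)) ?_ ?_ ?_ ?_
  · exact this i q g
  · rw [Expr.eval, setVar, store_of_ne (by norm_num), p₁]
    exact hk'
  · intro t ν v h i q g
    rw [setVar, store_of_ne (by norm_num)]
    exact h i q g
  · intro i q g
    rw [elimProduct, Matrix.mul_one, hμ₁]
    have := exec_tabulate_equiv (by norm_num) (by norm_num) (Equiv.refl (Fin n))
      (finSumFinEquiv (m := n) (n := n)) (Equiv.refl (Fin 1)) (a := 15) (μ := μ)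
      (E := .get 1 (.var 30) (.var 32) (.var 31)) (fun i q g _ => (G i).toCols₁ g q) (e₁ := .m)
      (e₂ := .n) (e₃ := .add .n .n) (e₄ := .lit 1)
      (fun ν h => by simp [Expr.eval, h, hm]) (fun ν h => by simp [Expr.eval, h, hn])
      (fun ν h => by simp [Expr.eval, h, hn]) (fun ν h => rfl) ?_ i q g
    · rw [Finset.univ_unique, Finset.sum_singleton] at this
      exact this
    · intro ν i q g _ hν h30 h31 h32 _
      have := hG i g (Sum.inl q)
      rw [finSumFinEquiv_apply_left, Fin.val_castAdd] at this
      rw [Equiv.refl_apply] at h31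
      simp only [Expr.eval, h30, h31, h32, hν 1 (by norm_num) (by norm_num), this]
      rfl
  · intro t ht ν hν h22 hI i q g
    have g0 : ∀ b < 30, b ∉ [12, 13, 14, 15, 16, 17] → b ≠ 22 → ν b = μ₁ b := fun b hb h h' =>
      hν b h' (hw b hb h)
    have q₀ : ν 0 = μ 0 := (g0 0 (by norm_num) (by norm_num) (by norm_num)).trans p₁
    have h := exec_elimStep hk (by rw [q₀, hn]) (by rw [q₀, hk']) (by rw [q₀, hm]) ht h22 G
      (fun i g h => by
        rw [g0 1 (by norm_num) (by norm_num) (by norm_num), f₁ 1 (by norm_num) (by norm_num), hG])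
      (fun i => (G i).toCols₁ * elimProduct hk ((G i).toCols₁ᵀ * symJ n * (G i).toCols₂) t)
      hI i q g
    refine h.trans ?_
    -- Pairing the current columns `A Q` with `B` is the same as applying `Qᵀ` to the original
    -- pairing matrix, on which the elimination is defined.
    rw [elimProduct, dif_pos ht, ← Matrix.mul_assoc]
    simp only [transpose_mul, Matrix.mul_assoc]

end

end LSN

/-! ### Computing a left inverse on the machine -/

namespace LSN

open Matrix

/-- One step of the computation of a left inverse (in array `18`) of the columns in array `15`. -/
def Cmd.leftInvStep : Cmd :=
  .seq (.tabulate 12 .m (.lit 1) .n (.add .n .n)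
    (.and (.get 18 (.var 30) (.var 32) (.var 33)) (.get 15 (.var 30) (.var 22) (.var 33)))) <|
  .seq (.tabulate 13 .m (.lit 1) (.add .n .n) .n
    (.and (.add (.get 12 (.var 30) (.lit 0) (.var 33)) (.eq (.var 33) (.var 22)))
      (.get 15 (.var 30) (.var 33) (.var 32)))) <|
  .seq (.lastOne 13 17 14 .m (.lit 1) (.add .n .n)) <|
  .seq (.tabulate 19 .m (.lit 1) .n (.add .n .n)
    (.and (.get 14 (.var 30) (.lit 0) (.var 33)) (.get 15 (.var 30) (.var 32) (.var 33)))) <|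
  .seq (.tabulate 24 .m (.lit 1) (.add .n .n) .n
    (.add (.and (.get 19 (.var 30) (.lit 0) (.var 33)) (.get 18 (.var 30) (.var 33) (.var 32)))
      (.and (.eq (.var 33) (.var 22)) (.get 14 (.var 30) (.lit 0) (.var 32))))) <|
  .seq (.tabulate 16 .m .n (.add .n .n) (.lit 1)
    (.add (.cell 18) (.and (.add (.get 12 (.var 30) (.lit 0) (.var 31)) (.eq (.var 31) (.var 22)))
      (.get 24 (.var 30) (.lit 0) (.var 32))))) <|
  .tabulate 18 .m .n (.add .n .n) (.lit 1) (.cell 16)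

theorem Cmd.leftInvStep_writes {b : ℕ} (hb : b ∈ Cmd.leftInvStep.writes) (h : b < 30) :
    b ∈ [12, 13, 14, 16, 17, 18, 19, 24] := by
  simp [Cmd.leftInvStep, Cmd.lastOne, Cmd.tabulate, Cmd.writes_for, Cmd.writes] at hb
  simp
  omega

section

variable {n k m : ℕ}

/-- Each stage tabulates one of the intermediate vectors in the definition of the step: `y`, the
residual, its pivot indicator, the row selected by the pivot, the functional `f`. The rank-one
update is written to array `16` and copied back. -/
theorem exec_leftInvStep {μ : Mem} (hn : μ 0 0 0 0 = n) (hm : μ 0 2 0 0 = m) (j : Fin n)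
    (h22 : μ 22 0 0 0 = j) (A : Fin m → Matrix (Fin (n + n)) (Fin n) (ZMod 2))
    (hA : ∀ (i : Fin m) (q : Fin n) (h : Fin (n + n)), (μ 15 i q h : ZMod 2) = A i h q)
    (F : Fin m → Matrix (Fin n) (Fin (n + n)) (ZMod 2))
    (hF : ∀ (i : Fin m) (q : Fin n) (h : Fin (n + n)), (μ 18 i q h : ZMod 2) = F i q h)
    (i : Fin m) (q : Fin n) (h : Fin (n + n)) :
    (exec .leftInvStep μ 18 i q h : ZMod 2) = LSN.leftInvStep (A i) (F i) j q h := by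
  set y : Fin m → Fin n → ZMod 2 := fun i q => ∑ h, F i q h * A i h j with hy
  set v : Fin m → Fin (n + n) → ZMod 2 := fun i h => ∑ q, (y i q + bit (q = j)) * A i h q with hv
  set s : Fin m → Fin n → ZMod 2 := fun i q => ∑ h, lastOne (v i) h * A i h q with hs
  set f : Fin m → Fin (n + n) → ZMod 2 := fun i h =>
    ∑ q, (s i q * F i q h + bit (q = j) * lastOne (v i) h) with hf
  have hgoal : LSN.leftInvStep (A i) (F i) j q h = F i q h + (y i q + bit (q = j)) * f i h := rfl
  rw [hgoal, Cmd.leftInvStep, exec]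
  set μ₁ := exec (.tabulate 12 .m (.lit 1) .n (.add .n .n)
    (.and (.get 18 (.var 30) (.var 32) (.var 33))
      (.get 15 (.var 30) (.var 22) (.var 33)))) μ with hμ₁
  have f₁ : ∀ b < 30, b ≠ 12 → μ₁ b = μ b := fun b hb hb' => exec_tabulate_of_ne hb hb' μ
  have p₁ : μ₁ 0 = μ 0 := f₁ 0 (by norm_num) (by norm_num)
  have v₁ : ∀ (i : Fin m) (q : Fin n), (μ₁ 12 i 0 q : ZMod 2) = y i q := by
    intro i q
    refine exec_tabulate_fin (by norm_num) (by norm_num) (fun i (_ : Fin 1) q h =>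
      F i q h * A i h j) (fun ν h => by simp [Expr.eval, h, hm]) (fun ν h => rfl)
      (fun ν h => by simp [Expr.eval, h, hn]) (fun ν h => by simp [Expr.eval, h, hn]) ?_ i 0 q
    intro ν i _ q h hν h30 _ h32 h33
    rw [Expr.cast_eval_and]
    simp only [Expr.eval, h30, h32, h33, hν 15 (by norm_num) (by norm_num),
      hν 18 (by norm_num) (by norm_num), hν 22 (by norm_num) (by norm_num), h22, hA, hF]
  rw [exec]
  set μ₂ := exec (.tabulate 13 .m (.lit 1) (.add .n .n) .n
    (.and (.add (.get 12 (.var 30) (.lit 0) (.var 33)) (.eq (.var 33) (.var 22)))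
      (.get 15 (.var 30) (.var 33) (.var 32)))) μ₁ with hμ₂
  have f₂ : ∀ b < 30, b ≠ 12 → b ≠ 13 → μ₂ b = μ b := fun b hb h h' =>
    (exec_tabulate_of_ne hb h' μ₁).trans (f₁ b hb h)
  have p₂ : μ₂ 0 = μ 0 := f₂ 0 (by norm_num) (by norm_num) (by norm_num)
  have v₂ : ∀ (i : Fin m) (o : Fin 1) (h : Fin (n + n)), (μ₂ 13 i o h : ZMod 2) = v i h := by
    refine exec_tabulate_fin (by norm_num) (by norm_num) (fun i (_ : Fin 1) h q =>
      (y i q + bit (q = j)) * A i h q) (fun ν h => by simp [Expr.eval, h, p₁, hm]) (fun ν h => rfl)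
      (fun ν h => by simp [Expr.eval, h, p₁, hn]) (fun ν h => by simp [Expr.eval, h, p₁, hn]) ?_
    intro ν i _ h q hν h30 _ h32 h33
    rw [Expr.cast_eval_and, Expr.cast_eval_add, Expr.cast_eval_eq]
    simp only [Expr.eval, h30, h32, h33, hν 15 (by norm_num) (by norm_num),
      hν 12 (by norm_num) (by norm_num), hν 22 (by norm_num) (by norm_num),
      f₁ 15 (by norm_num) (by norm_num), f₁ 22 (by norm_num) (by norm_num), h22, hA, v₁,
      ← Fin.ext_iff]
  have w₂ : ∀ b < 30, b ≠ 13 → μ₂ b = μ₁ b := fun b hb h => exec_tabulate_of_ne hb h μ₁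
  rw [exec]
  set μ₃ := exec (.lastOne 13 17 14 .m (.lit 1) (.add .n .n)) μ₂ with hμ₃
  have w₃ : ∀ b < 30, b ≠ 17 → b ≠ 14 → μ₃ b = μ₂ b := fun b hb h h' =>
    exec_lastOne_of_ne hb h h' μ₂
  have p₃ : μ₃ 0 = μ 0 := (w₃ 0 (by norm_num) (by norm_num) (by norm_num)).trans p₂
  have v₃ : ∀ (i : Fin m) (h : Fin (n + n)), (μ₃ 14 i 0 h : ZMod 2) = lastOne (v i) h := fun i h =>
    exec_lastOne (by norm_num) (by norm_num) (by norm_num) (by norm_num) (by norm_num)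
      (by norm_num) (by norm_num) (by norm_num) (fun i (_ : Fin 1) => v i)
      (fun ν h => by simp [Expr.eval, h, p₂, hm]) (fun ν h => rfl)
      (fun ν h => by simp [Expr.eval, h, p₂, hn]) v₂ i 0 h
  have e₃ : ∀ b < 30, b ∉ [12, 13, 14, 17] → μ₃ b = μ b := by
    intro b hb h
    simp only [List.mem_cons, List.not_mem_nil, or_false, not_or] at h
    rw [w₃ b hb (by tauto) (by tauto), f₂ b hb (by tauto) (by tauto)]
  rw [exec]
  set μ₄ := exec (.tabulate 19 .m (.lit 1) .n (.add .n .n)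
    (.and (.get 14 (.var 30) (.lit 0) (.var 33)) (.get 15 (.var 30) (.var 32) (.var 33)))) μ₃
    with hμ₄
  have w₄ : ∀ b < 30, b ≠ 19 → μ₄ b = μ₃ b := fun b hb h => exec_tabulate_of_ne hb h μ₃
  have p₄ : μ₄ 0 = μ 0 := (w₄ 0 (by norm_num) (by norm_num)).trans p₃
  have v₄ : ∀ (i : Fin m) (q : Fin n), (μ₄ 19 i 0 q : ZMod 2) = s i q := by
    intro i q
    refine exec_tabulate_fin (by norm_num) (by norm_num) (fun i (_ : Fin 1) q h =>
      lastOne (v i) h * A i h q) (fun ν h => by simp [Expr.eval, h, p₃, hm]) (fun ν h => rfl)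
      (fun ν h => by simp [Expr.eval, h, p₃, hn]) (fun ν h => by simp [Expr.eval, h, p₃, hn])
      ?_ i 0 q
    intro ν i _ q h hν h30 _ h32 h33
    rw [Expr.cast_eval_and]
    simp only [Expr.eval, h30, h32, h33, hν 15 (by norm_num) (by norm_num),
      hν 14 (by norm_num) (by norm_num), e₃ 15 (by norm_num) (by norm_num), hA, v₃]
  rw [exec]
  set μ₅ := exec (.tabulate 24 .m (.lit 1) (.add .n .n) .n
    (.add (.and (.get 19 (.var 30) (.lit 0) (.var 33)) (.get 18 (.var 30) (.var 33) (.var 32)))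
      (.and (.eq (.var 33) (.var 22)) (.get 14 (.var 30) (.lit 0) (.var 32))))) μ₄ with hμ₅
  have w₅ : ∀ b < 30, b ≠ 24 → μ₅ b = μ₄ b := fun b hb h => exec_tabulate_of_ne hb h μ₄
  have p₅ : μ₅ 0 = μ 0 := (w₅ 0 (by norm_num) (by norm_num)).trans p₄
  have e₄ : ∀ b < 30, b ∉ [12, 13, 14, 17, 19] → μ₄ b = μ b := by
    intro b hb h
    simp only [List.mem_cons, List.not_mem_nil, or_false, not_or] at h
    rw [w₄ b hb (by tauto), e₃ b hb (by simp; tauto)]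
  have v₅ : ∀ (i : Fin m) (h : Fin (n + n)), (μ₅ 24 i 0 h : ZMod 2) = f i h := by
    intro i h
    refine exec_tabulate_fin (by norm_num) (by norm_num) (fun i (_ : Fin 1) h q =>
      s i q * F i q h + bit (q = j) * lastOne (v i) h)
      (fun ν h => by simp [Expr.eval, h, p₄, hm]) (fun ν h => rfl)
      (fun ν h => by simp [Expr.eval, h, p₄, hn]) (fun ν h => by simp [Expr.eval, h, p₄, hn])
      ?_ i 0 h
    intro ν i _ h q hν h30 _ h32 h33
    simp only [Expr.cast_eval_add, Expr.cast_eval_and, Expr.cast_eval_eq]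
    simp only [Expr.eval, h30, h32, h33, hν 19 (by norm_num) (by norm_num), v₄,
      hν 14 (by norm_num) (by norm_num), w₄ 14 (by norm_num) (by norm_num), v₃,
      hν 18 (by norm_num) (by norm_num), e₄ 18 (by norm_num) (by norm_num), hF,
      hν 22 (by norm_num) (by norm_num), e₄ 22 (by norm_num) (by norm_num), h22, ← Fin.ext_iff]
  have p₆ : ∀ {e₁ e₂ e₃ e₄ E : Expr} {ν : Mem},
      ν 0 = exec (.tabulate 16 e₁ e₂ e₃ e₄ E) μ₅ 0 → ν 0 = μ 0 := fun h =>
    h.trans ((exec_tabulate_of_ne (by norm_num) (by norm_num) _).trans p₅)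
  rw [exec, exec_copy (by norm_num) (by norm_num) (by norm_num) (by norm_num)
    (fun ν h => by simp [Expr.eval, p₆ h, hm]) (fun ν h => by simp [Expr.eval, p₆ h, hn])
    (fun ν h => by simp [Expr.eval, p₆ h, hn]),
    exec_tabulate_fin (N₄ := 1) (by norm_num) (by norm_num) (fun (i : Fin m) (q : Fin n) h _ =>
      F i q h + (y i q + bit (q = j)) * f i h) (fun ν h => by simp [Expr.eval, h, p₅, hm])
      (fun ν h => by simp [Expr.eval, h, p₅, hn]) (fun ν h => by simp [Expr.eval, h, p₅, hn])
      (fun ν h => rfl), Finset.univ_unique, Finset.sum_singleton]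
  intro ν i q h _ hν h30 h31 h32 _
  simp only [Expr.cast_eval_add, Expr.cast_eval_and, Expr.cast_eval_eq]
  have e12 : ν 12 = μ₁ 12 := by
    rw [hν 12 (by norm_num) (by norm_num), w₅ 12 (by norm_num) (by norm_num),
      w₄ 12 (by norm_num) (by norm_num), w₃ 12 (by norm_num) (by norm_num) (by norm_num),
      w₂ 12 (by norm_num) (by norm_num)]
  simp only [Expr.eval, h30, h31, h32, e12, v₁,
    hν 24 (by norm_num) (by norm_num), v₅,
    hν 18 (by norm_num) (by norm_num), w₅ 18 (by norm_num) (by norm_num),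
    e₄ 18 (by norm_num) (by norm_num), hF, hν 22 (by norm_num) (by norm_num),
    w₅ 22 (by norm_num) (by norm_num), e₄ 22 (by norm_num) (by norm_num), h22, ← Fin.ext_iff]

/-- A left inverse, in array `18`, of the columns in array `15`. -/
def Cmd.leftInv : Cmd := .for_ 22 .n .leftInvStep

theorem exec_leftInv_of_ne {b : ℕ} (hb : b < 30)
    (hb' : b ∉ [12, 13, 14, 16, 17, 18, 19, 22, 24]) (μ : Mem) : exec .leftInv μ b = μ b := by
  simp only [List.mem_cons, List.not_mem_nil, or_false, not_or] at hb'
  rw [Cmd.leftInv, exec_of_notMem]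
  refine Cmd.notMem_writes_for (by omega) fun h => ?_
  have := Cmd.leftInvStep_writes h hb
  simp only [List.mem_cons, List.not_mem_nil, or_false] at this
  omega

/-- The recursion starts from the zero matrix, which is supplied by an array that has not been used
before; hence `h18`. -/
theorem exec_leftInv {μ : Mem} (hn : μ 0 0 0 0 = n) (hm : μ 0 2 0 0 = m)
    (A : Fin m → Matrix (Fin (n + n)) (Fin n) (ZMod 2))
    (hA : ∀ (i : Fin m) (q : Fin n) (h : Fin (n + n)), (μ 15 i q h : ZMod 2) = A i h q)
    (h18 : ∀ i q h, μ 18 i q h = 0) (i : Fin m) (q : Fin n) (h : Fin (n + n)) :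
    (exec .leftInv μ 18 i q h : ZMod 2) = LSN.leftInv (A i) n q h := by
  rw [Cmd.leftInv]
  have hw : ∀ b < 30, b ∉ [12, 13, 14, 16, 17, 18, 19, 24] → b ∉ Cmd.leftInvStep.writes :=
    fun b hb h h' => h (Cmd.leftInvStep_writes h' hb)
  have := exec_for (x := 22) (N := n) (e := .n) (μ := μ) (c := .leftInvStep)
    (fun t ν => ∀ (i : Fin m) (q : Fin n) (h : Fin (n + n)),
      (ν 18 i q h : ZMod 2) = LSN.leftInv (A i) t q h)
    (hw 22 (by norm_num) (by norm_num)) ?_ ?_ ?_ ?_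
  · exact this i q h
  · rw [Expr.eval, setVar, store_of_ne (by norm_num)]
    exact hn
  · intro t ν v h i q g
    rw [setVar, store_of_ne (by norm_num)]
    exact h i q g
  · intro i q h
    rw [h18, LSN.leftInv, Nat.cast_zero, Matrix.zero_apply]
  · intro t ht ν hν h22 hI i q h
    have g0 : ∀ b < 30, b ∉ [12, 13, 14, 16, 17, 18, 19, 24] → b ≠ 22 → ν b = μ b :=
      fun b hb h h' => hν b h' (hw b hb h)
    have q₀ : ν 0 = μ 0 := g0 0 (by norm_num) (by norm_num) (by norm_num)
    have h := exec_leftInvStep (by rw [q₀, hn]) (by rw [q₀, hm]) ⟨t, ht⟩ h22 A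
      (fun i q h => by rw [g0 15 (by norm_num) (by norm_num) (by norm_num), hA])
      (fun i => LSN.leftInv (A i) t) hI i q h
    rw [h, LSN.leftInv, dif_pos ht]

end

end LSN

/-! ### Computing the completed tableaus and their signs -/

namespace LSN

open Matrix

/-- The tableaus (without signs) that complete the encoders, in array `3`. -/
def Cmd.completion : Cmd :=
  let inner (e : Expr) : Expr := .lt e (.sub .n .k)
  let coin (e f : Expr) : Expr := .div (.get 8 (.var 30) e (.lit 0)) (.get 10 f (.lit 0) (.lit 0))
  .seq .reducedColumns <| .seq .leftInv <|
  .seq (.tabulate 25 .m .n (.add .n .n) (.lit 1)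
    (.add (.and (inner (.var 31)) (.get 18 (.var 30) (.var 31) (.swap (.var 32))))
      (.and (.add (.lit 1) (inner (.var 31))) (.get 1 (.var 30) (.var 32) (.add (.var 31) .k))))) <|
  .seq (.tabulate 26 .m .n .n (.add .n .n)
    (.and (.get 25 (.var 30) (.var 31) (.var 33)) (.get 25 (.var 30) (.var 32) (.swap (.var 33))))) <|
  .seq (.tabulate 27 .m .n .n (.lit 1)
    (.add (.and (.lt (.var 32) (.var 31)) (.cell 26))
      (.and (.and (inner (.var 31)) (inner (.var 32)))
        (.add (.and (.lt (.var 31) (.add (.var 32) (.lit 1))) (coin (.var 31) (.var 32)))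
          (.and (.lt (.var 32) (.var 31)) (coin (.var 32) (.var 31))))))) <|
  .tabulate 3 .m (.add .n .n) (.add .n .n) .n
    (.add (.and (.lt (.var 31) .n)
        (.add (.and (.get 15 (.var 30) (.var 33) (.var 32)) (.get 27 (.var 30) (.var 33) (.var 31)))
          (.and (.eq (.var 33) (.var 31)) (.get 25 (.var 30) (.var 33) (.var 32)))))
      (.and (.eq (.add .n (.var 33)) (.var 31)) (.get 15 (.var 30) (.var 33) (.var 32))))

/-- The signs of the tableaus, in array `4`. -/
def Cmd.signs : Cmd :=
  .tabulate 4 .m (.add .n .n) (.lit 1) (.add .n .n)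
    (.add (.and (.eq (.var 33) (.var 31))
        (.add (.and (.lt (.var 31) .n) (.get 9 (.var 30) (.var 31) (.lit 0)))
          (.and (.add (.lit 1) (.lt (.var 31) .n))
            (.get 11 (.var 30) (.sub (.var 31) .n) (.lit 0)))))
      (.and (.add (.lit 1) (.lt (.var 31) .n))
        (.and (.get 3 (.var 30) (.var 31) (.var 33)) (.get 2 (.var 30) (.swap (.var 33)) (.lit 0)))))

section

variable {n k m : ℕ}

theorem exec_for_counter (x : ℕ) (e : Expr) (c : Cmd) (μ : Mem) :
    exec (.for_ x e c) μ x 0 0 0 = 0 := store_apply_self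

theorem exec_completion_of_ne {b : ℕ} (hb : b < 30)
    (hb' : b ∉ [3, 12, 13, 14, 15, 16, 17, 18, 19, 22, 24, 25, 26, 27]) (μ : Mem) :
    exec .completion μ b = μ b := by
  simp only [List.mem_cons, List.not_mem_nil, or_false, not_or] at hb'
  rw [Cmd.completion, exec, exec, exec, exec, exec, exec_tabulate_of_ne hb (by omega),
    exec_tabulate_of_ne hb (by omega), exec_tabulate_of_ne hb (by omega),
    exec_tabulate_of_ne hb (by omega), exec_leftInv_of_ne hb (by simp; omega),
    exec_reducedColumns_of_ne hb (by simp; omega)]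

theorem exec_completion_counter (μ : Mem) : exec .completion μ 22 0 0 0 = 0 := by
  rw [Cmd.completion, exec, exec, exec, exec, exec, exec_tabulate_of_ne (by norm_num) (by norm_num),
    exec_tabulate_of_ne (by norm_num) (by norm_num),
    exec_tabulate_of_ne (by norm_num) (by norm_num),
    exec_tabulate_of_ne (by norm_num) (by norm_num)]
  exact exec_for_counter _ _ _ _

/-- Arrays `25`, `26` and `27` hold the dual columns, their Gram matrix and the correction, the last
one including the coins. One random number per row supplies all the coins of that row through its
binary digits. Since a tableau lists the images of the generators as rows, the result appears
transposed. -/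
theorem exec_completion (hk : k ≤ n) {μ : Mem} (hn : μ 0 0 0 0 = n) (hk' : μ 0 1 0 0 = k)
    (hm : μ 0 2 0 0 = m) (G : Fin m → Matrix (Fin n ⊕ Fin n) (Fin n ⊕ Fin k) (ZMod 2))
    (hG : ∀ (i : Fin m) (g : Fin n ⊕ Fin n) (h : Fin n ⊕ Fin k),
      (μ 1 i (finSumFinEquiv g) (finSumFinEquiv h) : ZMod 2) = G i g h)
    (h18 : ∀ i q h, μ 18 i q h = 0) (r : Fin m → Fin n → Bits n)
    (hr : ∀ (i : Fin m) (a b : Fin n), ((μ 8 i a 0 / μ 10 b 0 0 : ℕ) : ZMod 2) = r i a b)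
    (i : Fin m) (g h : Fin n ⊕ Fin n) :
    (exec .completion μ 3 i (finSumFinEquiv g) (finSumFinEquiv h) : ZMod 2)
      = LSN.completion hk (G i) (coinMatrix k (r i)) h g := by
  set A : Fin m → Matrix (Fin n ⊕ Fin n) (Fin n) (ZMod 2) :=
    fun i => LSN.reducedColumns hk (G i) with hA
  set X : Fin m → Matrix (Fin n ⊕ Fin n) (Fin n) (ZMod 2) :=
    fun i => dualColumns (A i) (G i).toCols₂ with hX
  set N : Fin m → Matrix (Fin n) (Fin n) (ZMod 2) := fun i => (X i)ᵀ * symJ n * X i with hN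
  set V : Fin m → Matrix (Fin n) (Fin n) (ZMod 2) :=
    fun i => lowerPart (N i) + coinMatrix k (r i) with hV
  have hgoal : LSN.completion hk (G i) (coinMatrix k (r i)) = fromCols (X i + A i * V i) (A i) :=
    rfl
  rw [hgoal, Cmd.completion, exec]
  have v₁ := exec_reducedColumns hk hn hk' hm G hG
  set μ₁ := exec .reducedColumns μ with hμ₁
  have f₁ : ∀ b < 30, b ∉ [12, 13, 14, 15, 16, 17, 22] → μ₁ b = μ b := fun b hb h =>
    exec_reducedColumns_of_ne hb h μ
  have p₁ : μ₁ 0 = μ 0 := f₁ 0 (by norm_num) (by norm_num)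
  rw [exec]
  have v₂ := exec_leftInv (μ := μ₁) (by rw [p₁, hn]) (by rw [p₁, hm])
    (fun i => (A i).submatrix finSumFinEquiv.symm id)
    (fun i q h => by
      have := v₁ i q (finSumFinEquiv.symm h)
      rw [Equiv.apply_symm_apply] at this
      exact this)
    (fun i q h => by rw [f₁ 18 (by norm_num) (by norm_num), h18])
  set μ₂ := exec .leftInv μ₁ with hμ₂
  have f₂ : ∀ b < 30, b ∉ [12, 13, 14, 15, 16, 17, 18, 19, 22, 24] → μ₂ b = μ b := by
    intro b hb h
    simp only [List.mem_cons, List.not_mem_nil, or_false, not_or] at h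
    rw [hμ₂, exec_leftInv_of_ne hb (by simp; omega), f₁ b hb (by simp; omega)]
  have p₂ : μ₂ 0 = μ 0 := f₂ 0 (by norm_num) (by norm_num)
  have e₂ : μ₂ 15 = μ₁ 15 := exec_leftInv_of_ne (by norm_num) (by norm_num) _
  rw [exec]
  set μ₃ := exec (.tabulate 25 .m .n (.add .n .n) (.lit 1)
    (.add (.and (.lt (.var 31) (.sub .n .k)) (.get 18 (.var 30) (.var 31) (.swap (.var 32))))
      (.and (.add (.lit 1) (.lt (.var 31) (.sub .n .k)))
        (.get 1 (.var 30) (.var 32) (.add (.var 31) .k))))) μ₂ with hμ₃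
  have f₃ : ∀ b < 30, b ≠ 25 → μ₃ b = μ₂ b := fun b hb h => exec_tabulate_of_ne hb h μ₂
  have p₃ : μ₃ 0 = μ 0 := (f₃ 0 (by norm_num) (by norm_num)).trans p₂
  have v₃ : ∀ (i : Fin m) (q : Fin n) (g : Fin n ⊕ Fin n),
      (μ₃ 25 i q (finSumFinEquiv g) : ZMod 2) = X i g q := by
    intro i q g
    have := exec_tabulate_equiv (a := 25) (μ := μ₂) (by norm_num) (by norm_num)
      (Equiv.refl (Fin n)) (finSumFinEquiv (m := n) (n := n)) (Equiv.refl (Fin 1)) (e₁ := .m)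
      (e₂ := .n) (e₃ := .add .n .n) (e₄ := .lit 1)
      (E := .add (.and (.lt (.var 31) (.sub .n .k)) (.get 18 (.var 30) (.var 31) (.swap (.var 32))))
        (.and (.add (.lit 1) (.lt (.var 31) (.sub .n .k)))
          (.get 1 (.var 30) (.var 32) (.add (.var 31) .k)))) (fun i q g _ => X i g q)
      (fun ν h => by simp [Expr.eval, h, p₂, hm]) (fun ν h => by simp [Expr.eval, h, p₂, hn])
      (fun ν h => by simp [Expr.eval, h, p₂, hn]) (fun ν h => rfl) ?_ i q g
    · rw [Finset.univ_unique, Finset.sum_singleton] at this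
      exact this
    · intro ν i q g _ hν h30 h31 h32 _
      rw [Equiv.refl_apply] at h31
      have e0 : ν 0 = μ 0 := (hν 0 (by norm_num) (by norm_num)).trans p₂
      have es : (Expr.swap (.var 32)).eval ν = finSumFinEquiv g.swap :=
        Expr.eval_swap (by rw [e0, hn]) (by simpa [Expr.eval] using h32)
      simp only [Expr.cast_eval_add, Expr.cast_eval_and, Expr.cast_eval_lt]
      simp only [Expr.eval, es, h30, h31, h32, e0, hn, hk', hν 18 (by norm_num) (by norm_num), v₂,
        hν 1 (by norm_num) (by norm_num), f₂ 1 (by norm_num) (by norm_num), Nat.cast_one]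
      rw [one_add_bit, hX]
      simp only [dualColumns, Matrix.of_apply]
      -- In the last `k` columns the dual matrix copies the second half of the encoder; its column
      -- `q - (n - k)` is column `q + k` of the whole encoder.
      by_cases h : n - k ≤ q.1
      · have hq := q.2
        have := hG i g (Sum.inr ⟨q.1 - (n - k), by omega⟩)
        rw [finSumFinEquiv_apply_right, Fin.val_natAdd,
          show n + (q.1 - (n - k)) = q.1 + k by omega] at this
        rw [dif_pos h, this, bit, if_neg (by omega), bit, if_pos (by omega), zero_mul, zero_add,
          one_mul]
        rfl
      · rw [dif_neg h, bit, if_pos (by omega), bit, if_neg (by omega), zero_mul, one_mul,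
          add_zero]
  rw [exec]
  set μ₄ := exec (.tabulate 26 .m .n .n (.add .n .n)
    (.and (.get 25 (.var 30) (.var 31) (.var 33))
      (.get 25 (.var 30) (.var 32) (.swap (.var 33))))) μ₃ with hμ₄
  have f₄ : ∀ b < 30, b ≠ 26 → μ₄ b = μ₃ b := fun b hb h => exec_tabulate_of_ne hb h μ₃
  have p₄ : μ₄ 0 = μ 0 := (f₄ 0 (by norm_num) (by norm_num)).trans p₃
  have v₄ : ∀ (i : Fin m) (a b : Fin n), (μ₄ 26 i a b : ZMod 2) = N i a b := by
    intro i a b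
    have := exec_tabulate_equiv (a := 26) (μ := μ₃) (by norm_num) (by norm_num)
      (Equiv.refl (Fin n)) (Equiv.refl (Fin n)) (finSumFinEquiv (m := n) (n := n)) (e₁ := .m)
      (e₂ := .n) (e₃ := .n) (e₄ := .add .n .n)
      (E := .and (.get 25 (.var 30) (.var 31) (.var 33))
        (.get 25 (.var 30) (.var 32) (.swap (.var 33)))) (fun i a b g => X i g a * X i g.swap b)
      (fun ν h => by simp [Expr.eval, h, p₃, hm]) (fun ν h => by simp [Expr.eval, h, p₃, hn])
      (fun ν h => by simp [Expr.eval, h, p₃, hn]) (fun ν h => by simp [Expr.eval, h, p₃, hn])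
      ?_ i a b
    · exact this.trans (transpose_mul_symJ_mul (X i) (X i) a b).symm
    · intro ν i a b g hν h30 h31 h32 h33
      rw [Equiv.refl_apply] at h31 h32
      have e0 : ν 0 = μ 0 := (hν 0 (by norm_num) (by norm_num)).trans p₃
      have es : (Expr.swap (.var 33)).eval ν = finSumFinEquiv g.swap :=
        Expr.eval_swap (by rw [e0, hn]) (by simpa [Expr.eval] using h33)
      rw [Expr.cast_eval_and]
      simp only [Expr.eval, es, h30, h31, h32, h33, hν 25 (by norm_num) (by norm_num), v₃]
  rw [exec]
  set μ₅ := exec (.tabulate 27 .m .n .n (.lit 1)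
    (.add (.and (.lt (.var 32) (.var 31)) (.cell 26))
      (.and (.and (.lt (.var 31) (.sub .n .k)) (.lt (.var 32) (.sub .n .k)))
        (.add (.and (.lt (.var 31) (.add (.var 32) (.lit 1)))
          (.div (.get 8 (.var 30) (.var 31) (.lit 0)) (.get 10 (.var 32) (.lit 0) (.lit 0))))
          (.and (.lt (.var 32) (.var 31))
            (.div (.get 8 (.var 30) (.var 32) (.lit 0))
              (.get 10 (.var 31) (.lit 0) (.lit 0)))))))) μ₄ with hμ₅
  have f₅ : ∀ b < 30, b ≠ 27 → μ₅ b = μ₄ b := fun b hb h => exec_tabulate_of_ne hb h μ₄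
  have p₅ : μ₅ 0 = μ 0 := (f₅ 0 (by norm_num) (by norm_num)).trans p₄
  have g₄ : ∀ b < 30, b ∉ [12, 13, 14, 15, 16, 17, 18, 19, 22, 24, 25, 26] → μ₄ b = μ b := by
    intro b hb h
    simp only [List.mem_cons, List.not_mem_nil, or_false, not_or] at h
    rw [f₄ b hb (by omega), f₃ b hb (by omega), f₂ b hb (by simp; omega)]
  have v₅ : ∀ (i : Fin m) (a b : Fin n), (μ₅ 27 i a b : ZMod 2) = V i a b := by
    intro i a b
    rw [hμ₅, exec_tabulate_fin (by norm_num) (by norm_num) (N₄ := 1)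
      (fun (i : Fin m) (a b : Fin n) _ => V i a b)
      (fun ν h => by simp [Expr.eval, h, p₄, hm]) (fun ν h => by simp [Expr.eval, h, p₄, hn])
      (fun ν h => by simp [Expr.eval, h, p₄, hn]) (fun ν h => rfl), Finset.univ_unique,
      Finset.sum_singleton]
    intro ν i a b _ hν h30 h31 h32 _
    simp only [Expr.cast_eval_add, Expr.cast_eval_and, Expr.cast_eval_lt]
    simp only [Expr.eval, h30, h31, h32, hν 0 (by norm_num) (by norm_num), p₄, hn, hk',
      hν 26 (by norm_num) (by norm_num), v₄, hν 8 (by norm_num) (by norm_num),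
      hν 10 (by norm_num) (by norm_num), g₄ 8 (by norm_num) (by norm_num),
      g₄ 10 (by norm_num) (by norm_num), hr]
    rfl
  have e₅ : μ₅ 15 = μ₁ 15 := by
    rw [f₅ 15 (by norm_num) (by norm_num), f₄ 15 (by norm_num) (by norm_num),
      f₃ 15 (by norm_num) (by norm_num), e₂]
  have hlast := exec_tabulate_equiv (a := 3) (μ := μ₅) (by norm_num) (by norm_num)
    (finSumFinEquiv (m := n) (n := n)) (finSumFinEquiv (m := n) (n := n)) (Equiv.refl (Fin n))
    (e₁ := .m) (e₂ := .add .n .n) (e₃ := .add .n .n) (e₄ := .n)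
    (E := .add (.and (.lt (.var 31) .n)
        (.add (.and (.get 15 (.var 30) (.var 33) (.var 32)) (.get 27 (.var 30) (.var 33) (.var 31)))
          (.and (.eq (.var 33) (.var 31)) (.get 25 (.var 30) (.var 33) (.var 32)))))
      (.and (.eq (.add .n (.var 33)) (.var 31)) (.get 15 (.var 30) (.var 33) (.var 32))))
    (fun (i : Fin m) (g h : Fin n ⊕ Fin n) (q : Fin n) =>
      Sum.elim (fun a => A i h q * V i q a + bit (q = a) * X i h q)
        (fun a => bit (q = a) * A i h q) g)
    (fun ν h => by simp [Expr.eval, h, p₅, hm]) (fun ν h => by simp [Expr.eval, h, p₅, hn])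
    (fun ν h => by simp [Expr.eval, h, p₅, hn]) (fun ν h => by simp [Expr.eval, h, p₅, hn])
    ?_ i g h
  · refine hlast.trans ?_
    rcases g with a | a
    · simp only [Sum.elim_inl, fromCols_apply_inl, Matrix.add_apply, Matrix.mul_apply,
        Finset.sum_add_distrib, sum_bit_mul]
      exact add_comm _ _
    · simp only [Sum.elim_inr, fromCols_apply_inr, sum_bit_mul]
  · intro ν i g h q hν h30 h31 h32 h33
    rw [Equiv.refl_apply] at h33
    have e15 : ν 15 = μ₁ 15 := (hν 15 (by norm_num) (by norm_num)).trans e₅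
    have e25 : ν 25 = μ₃ 25 := by
      rw [hν 25 (by norm_num) (by norm_num), f₅ 25 (by norm_num) (by norm_num),
        f₄ 25 (by norm_num) (by norm_num)]
    have e27 : ν 27 = μ₅ 27 := hν 27 (by norm_num) (by norm_num)
    have e0 : ν 0 = μ 0 := (hν 0 (by norm_num) (by norm_num)).trans p₅
    simp only [Expr.cast_eval_add, Expr.cast_eval_and, Expr.cast_eval_lt, Expr.cast_eval_eq]
    have hq := q.2
    rcases g with a | a
    · have ha := a.2
      rw [finSumFinEquiv_apply_left, Fin.val_castAdd] at h31
      simp only [Expr.eval, h30, h31, h32, h33, e15, v₁, e25, v₃, e27, v₅, e0, hn, ← Fin.ext_iff,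
        Sum.elim_inl]
      rw [bit, if_pos ha, one_mul, bit, bit, if_neg (show ¬ n + q.1 = a.1 by omega), zero_mul,
        add_zero]
    · have ha := a.2
      rw [finSumFinEquiv_apply_right, Fin.val_natAdd] at h31
      simp only [Expr.eval, h30, h31, h32, h33, e15, v₁, e25, v₃, e0, hn, Sum.elim_inr]
      rw [bit, if_neg (by omega), zero_mul, zero_add]
      congr 1
      exact bit_congr (by rw [Fin.ext_iff]; omega)

/-- The signs of the `X` generators are plain coins. Those of the `Z` generators combine the
measurement results with the pairing of the given vector with the `Z` columns, which is the label
that the prepared state is to have. -/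
theorem exec_signs {μ : Mem} (hn : μ 0 0 0 0 = n) (hm : μ 0 2 0 0 = m)
    (S : Fin m → Matrix (Fin n ⊕ Fin n) (Fin n ⊕ Fin n) (ZMod 2))
    (hS : ∀ (i : Fin m) (g h : Fin n ⊕ Fin n),
      (μ 3 i (finSumFinEquiv g) (finSumFinEquiv h) : ZMod 2) = S i h g)
    (s w : Fin m → Bits n) (T : Fin m → PVec n)
    (hs : ∀ (i : Fin m) (q : Fin n), (μ 9 i q 0 : ZMod 2) = s i q)
    (hw : ∀ (i : Fin m) (q : Fin n), (μ 11 i q 0 : ZMod 2) = w i q)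
    (hT : ∀ (i : Fin m) (g : Fin n ⊕ Fin n), (μ 2 i (finSumFinEquiv g) 0 : ZMod 2) = T i g) :
    quantumQuery n m (exec .signs μ) = fun i => tableauOf (S i)
      (Sum.elim (s i) (w i + ((S i).toCols₂ᵀ * symJ n).mulVec (T i))) := by
  funext i g
  rw [quantumQuery, tableauOf, Cmd.signs]
  refine Prod.ext ?_ ?_
  · have := exec_tabulate_equiv (a := 4) (μ := μ) (by norm_num) (by norm_num)
      (finSumFinEquiv (m := n) (n := n)) (Equiv.refl (Fin 1)) (finSumFinEquiv (m := n) (n := n))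
      (e₁ := .m) (e₂ := .add .n .n) (e₃ := .lit 1) (e₄ := .add .n .n)
      (E := .add (.and (.eq (.var 33) (.var 31))
        (.add (.and (.lt (.var 31) .n) (.get 9 (.var 30) (.var 31) (.lit 0)))
          (.and (.add (.lit 1) (.lt (.var 31) .n))
            (.get 11 (.var 30) (.sub (.var 31) .n) (.lit 0)))))
        (.and (.add (.lit 1) (.lt (.var 31) .n))
          (.and (.get 3 (.var 30) (.var 31) (.var 33))
            (.get 2 (.var 30) (.swap (.var 33)) (.lit 0)))))
      (fun (i : Fin m) (g : Fin n ⊕ Fin n) _ (h : Fin n ⊕ Fin n) =>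
        bit (h = g) * Sum.elim (s i) (w i) g +
          Sum.elim (fun _ => 0) (fun q => S i h (Sum.inr q) * T i h.swap) g)
      (fun ν h => by simp [Expr.eval, h, hm]) (fun ν h => by simp [Expr.eval, h, hn])
      (fun ν h => rfl) (fun ν h => by simp [Expr.eval, h, hn]) ?_ i g 0
    · refine this.trans ?_
      rw [Finset.sum_add_distrib, sum_bit_mul]
      rcases g with q | q
      · simp
      · simp only [Sum.elim_inr, Pi.add_apply]
        congr 1
        rw [← mulVec_mulVec, mulVec, dotProduct]
        refine Finset.sum_congr rfl fun h _ => ?_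
        rw [symJ_mulVec]
        rfl
    · intro ν i g _ h hν h30 h31 _ h33
      have e0 : ν 0 = μ 0 := hν 0 (by norm_num) (by norm_num)
      have es : (Expr.swap (.var 33)).eval ν = finSumFinEquiv h.swap :=
        Expr.eval_swap (by rw [e0, hn]) (by simpa [Expr.eval] using h33)
      simp only [Expr.cast_eval_add, Expr.cast_eval_and, Expr.cast_eval_lt, Expr.cast_eval_eq]
      simp only [Expr.eval, es, h30, h31, h33, e0, hn, hν 3 (by norm_num) (by norm_num), hS,
        hν 2 (by norm_num) (by norm_num), hT, hν 9 (by norm_num) (by norm_num),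
        hν 11 (by norm_num) (by norm_num), Nat.cast_one, ← Fin.ext_iff,
        EmbeddingLike.apply_eq_iff_eq]
      rcases g with q | q
      · have hq := q.2
        rw [finSumFinEquiv_apply_left, Fin.val_castAdd, hs]
        have h1 : bit (q.1 < n) = 1 := if_pos hq
        rw [h1, zmod2_add_self, one_mul, zero_mul, zero_mul]
        simp only [add_zero, Sum.elim_inl]
      · have hq := q.2
        rw [finSumFinEquiv_apply_right, Fin.val_natAdd, Nat.add_sub_cancel_left, hw]
        have h1 : bit (n + q.1 < n) = 0 := if_neg (by omega)
        rw [h1, zero_mul, zero_add, add_zero, one_mul, one_mul]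
        rfl
  · funext h
    dsimp only
    rw [exec_tabulate_of_ne (by norm_num) (by norm_num), hS]

end

end LSN

namespace LSN

open Matrix

/-! ## The reduction from the classical representation to the quantum problem -/

/-- The procedure that solves the classical problem with one call of an oracle for the quantum
problem, up to the call. -/
def Cmd.toQuantum : Cmd :=
  .seq .powers <|
  .seq (.for_ 20 .m (.for_ 21 .n (.rand 8 (.var 20) (.var 21) (.lit 0)
    (.sub (.get 10 .n (.lit 0) (.lit 0)) (.lit 1))))) <|
  .seq (.for_ 20 .m (.for_ 21 .n (.rand 9 (.var 20) (.var 21) (.lit 0) (.lit 1)))) <|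
  .seq (.for_ 20 .m (.for_ 21 .n (.seq (.gateH (.var 20) (.var 21))
    (.measure 7 (.var 20) (.var 21) (.lit 0) (.var 20) (.var 21))))) <|
  .seq .completion <|
  .seq (.for_ 20 .m (.for_ 21 .n (.measurePauli 3))) .signs

/-- The reduction of the classical problem to the quantum one: `Cmd.toQuantum`, then the answer of
the oracle. -/
def toQuantum : OneCallAlgorithm := ⟨.toQuantum, .copyAnswer⟩

theorem Cmd.toQuantum_hasParamLoops : Cmd.toQuantum.hasParamLoops := by decide

section

variable {n k m ℓ : ℕ}

/-- Tableaus that differ only in signs have the same code states up to phase, with labels shifted by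
the difference of the `Z` signs, and no measurement sees a global phase. -/
theorem solver_jointState (O : QuantumOracle n m ℓ) (σ : Fin m → Tableau n) {τ τ' : Fin m → Tableau n}
    (hτ : ∀ i, τ i ∈ cliffords n) (hτ' : ∀ i, τ' i ∈ cliffords n)
    (h : ∀ i j, (τ i (Sum.inr j)).2 = (τ' i (Sum.inr j)).2) (z : Fin m → Bits n) (out : Bits ℓ) :
    O.solver σ (jointState τ z) out = O.solver σ (jointState τ' fun i j =>
      z i j + (τ i (Sum.inr j)).1 + (τ' i (Sum.inr j)).1) out := by
  choose c hc hcw using fun i => codeState_eq_smul (hτ i) (hτ' i) (h i) (z i)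
  have h1 : jointState τ z = (∏ i, c i) • jointState τ' fun i j =>
      z i j + (τ i (Sum.inr j)).1 + (τ' i (Sum.inr j)).1 := by
    rw [jointState, jointState, ← productState_smul]
    exact congrArg productState (funext hcw)
  rw [h1, O.solver_smul, norm_prod, Finset.prod_eq_one fun i _ => hc i, one_pow, one_mul]

/-- Pauli corrections of a random code state. -/
theorem expect_signs (O : QuantumOracle n m ℓ) (out : Bits ℓ)
    {S : Fin m → Matrix (Fin n ⊕ Fin n) (Fin n ⊕ Fin n) (ZMod 2)} (hS : ∀ i, S i ∈ symplectics n)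
    (z : Fin m → Bits n) :
    𝔼 s : Fin m → Bits n, 𝔼 w : Fin m → Bits n,
      O.solver (fun i => tableauOf (S i) (Sum.elim (s i) (w i + z i)))
        (jointState (fun i => tableauOf (S i) 0) w) out
      = 𝔼 s : Fin m → PVec n, O.solver (fun i => tableauOf (S i) (s i))
          (jointState (fun i => tableauOf (S i) (s i)) z) out := by
  rw [← Finset.expect_product']
  have hmem : ∀ (s : Fin m → PVec n) i, tableauOf (S i) (s i) ∈ cliffords n :=
    fun s i => mem_cliffords.mpr (hS i)
  refine Fintype.expect_bijective
    (fun (p : (Fin m → Bits n) × (Fin m → Bits n)) i => Sum.elim (p.1 i) (p.2 i + z i)) ?_ _ _ ?_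
  · rw [Fintype.bijective_iff_injective_and_card]
    constructor
    · rintro ⟨s, w⟩ ⟨s', w'⟩ h
      refine Prod.ext (funext fun i => ?_) (funext fun i => ?_)
      · exact congrArg (fun f => f ∘ Sum.inl) (congrFun h i)
      · exact add_right_cancel (congrArg (fun f => f ∘ Sum.inr) (congrFun h i))
    · simp only [Fintype.card_prod, Fintype.card_fun, ZMod.card, Fintype.card_fin,
        Fintype.card_sum, pow_add, mul_pow]
  · rintro ⟨s, w⟩
    dsimp only
    -- Passing from zero signs to the signs `w + z` turns label `w` into `w + (w + z) = z`: the
    -- choice of signs does the work of a Pauli correction.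
    rw [solver_jointState O _ (hmem fun _ => 0) (hmem fun i => Sum.elim (s i) (w i + z i)) fun _ _ => rfl]
    congr 2
    funext i j
    simp only [tableauOf, Sum.elim_inr, Pi.zero_apply, Pi.add_apply, add_zero]
    rw [← add_assoc, zmod2_add_self, zero_add]

/-- The whole program in closed form: the oracle receives a random completion with uniform signs and
the code state labelled by the pairing of the given vector with the reduced columns. This holds for
every second component of the samples, structured or not. -/
theorem withQuantum_toQuantum (hk : k ≤ n) (hℓ : ℓ ≤ n + 1) (O : QuantumOracle n m ℓ)
    {inst : Fin m → ClassicalSample n k} (hinst : ∀ i, (inst i).1 ∈ encoders n k) (out : Bits ℓ) :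
    toQuantum.withQuantum k O inst out
      = 𝔼 r : Fin m → Fin n → Bits n, 𝔼 s : Fin m → PVec n,
        O.solver (fun i => tableauOf (completion hk (inst i).1 (coinMatrix k (r i))) (s i))
          (jointState (fun i => tableauOf (completion hk (inst i).1 (coinMatrix k (r i))) (s i))
            fun i => ((reducedColumns hk (inst i).1)ᵀ * symJ n).mulVec (inst i).2) out := by
  have hF := homogeneous_quantum O out
  rw [toQuantum, withQuantum_eq Cmd.toQuantum_hasParamLoops hk hℓ, Cmd.toQuantum, wp, wp, wp, wp,
    wp, wp, wp_of_isDet (c := .powers) (by decide)]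
  set μ₀ := exec .powers (classicalInput inst) with hμ₀
  have f₀ : ∀ b, b ≠ 10 → b ≠ 23 → μ₀ b = classicalInput inst b := fun b h h' =>
    exec_powers_of_ne h h' _
  have hn₀ : classicalInput inst 0 0 0 0 = n := by simp [classicalInput, initMem]
  have hk₀ : classicalInput inst 0 1 0 0 = k := by simp [classicalInput, initMem]
  have hm₀ : classicalInput inst 0 2 0 0 = m := by simp [classicalInput, initMem]
  have hz₀ : ∀ b i j l, 2 < b → classicalInput inst b i j l = 0 := by
    intro b i j l hb
    simp [classicalInput, initMem, show b ≠ 0 by omega, show b ≠ 1 by omega, show b ≠ 2 by omega]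
  have hG : ∀ (i : Fin m) (g : Fin n ⊕ Fin n) (h : Fin n ⊕ Fin k),
      (classicalInput inst 1 i (finSumFinEquiv g) (finSumFinEquiv h) : ZMod 2)
        = (inst i).1 g h := by
    intro i g h
    rw [classicalInput, initMem, if_neg (by norm_num), if_pos rfl, tensorEntry_apply,
      Equiv.symm_apply_apply, Equiv.symm_apply_apply]
  have hT : ∀ (i : Fin m) (g : Fin n ⊕ Fin n),
      (classicalInput inst 2 i (finSumFinEquiv g) 0 : ZMod 2) = (inst i).2 g := by
    intro i g
    have := tensorEntry_apply (fun (i : Fin m) (j : Fin (n + n)) (_ : Fin 1) =>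
      (inst i).2 (finSumFinEquiv.symm j)) i (finSumFinEquiv g) 0
    rw [Equiv.symm_apply_apply, Fin.val_zero] at this
    rw [classicalInput, initMem, if_neg (by norm_num), if_neg (by norm_num), if_pos rfl, this]
  have hpow : ∀ j ≤ n, μ₀ 10 j 0 0 = 2 ^ j := exec_powers hn₀
  rw [wp_fill_rand (n := n) (m := m) (fun _ => 2 ^ n) (fun _ _ => by positivity)
    (by norm_num) (by norm_num) (by norm_num) (by rw [f₀ _ (by norm_num) (by norm_num), hn₀])
    (by rw [f₀ _ (by norm_num) (by norm_num), hm₀])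
    (by rw [f₀ _ (by norm_num) (by norm_num), hz₀ _ _ _ _ (by norm_num)])
    (by rw [f₀ _ (by norm_num) (by norm_num), hz₀ _ _ _ _ (by norm_num)]) ?_ hF.wp.wp.wp.wp.wp]
  swap
  · intro ν hν j hj h21
    simp only [Expr.eval, hν 10 (by norm_num) (by norm_num) (by norm_num),
      hν 0 (by norm_num) (by norm_num) (by norm_num), f₀ 0 (by norm_num) (by norm_num), hn₀,
      hpow n le_rfl]
  -- Uniform numbers below `2 ^ n` are the same as uniform rows of coins.
  have hdig : Function.Bijective fun (u : Fin m → Fin n → Fin (2 ^ n)) i j => digits n (u i j) :=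
    Function.Bijective.piMap fun _ => Function.Bijective.piMap fun _ => digits_bijective n
  refine Fintype.expect_bijective _ hdig _ _ fun u => ?_
  set r : Fin m → Fin n → Bits n := fun i j => digits n (u i j) with hr
  set S : Fin m → Matrix (Fin n ⊕ Fin n) (Fin n ⊕ Fin n) (ZMod 2) :=
    fun i => completion hk (inst i).1 (coinMatrix k (r i)) with hSdef
  have hS : ∀ i, S i ∈ symplectics n := fun i =>
    (completion_spec hk (hinst i) (isShear_coinMatrix (r i))).1
  have hS₂ : ∀ i, (S i).toCols₂ = reducedColumns hk (inst i).1 := fun i =>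
    completion_toCols₂ hk _ _
  set μ₁ := fill μ₀ 8 (β := fun _ => Fin (2 ^ n)) (fun _ v => v.1) u with hμ₁
  have f₁ : ∀ b, b ≠ 8 → μ₁ b = μ₀ b := fun b h => fill_of_ne h _ _
  have f₁' : ∀ b, b ∉ [8, 10, 23] → μ₁ b = classicalInput inst b := by
    intro b h
    simp only [List.mem_cons, List.not_mem_nil, or_false, not_or] at h
    exact (f₁ b h.1).trans (f₀ b h.2.1 h.2.2)
  rw [wp_fill_rand (n := n) (m := m) (fun _ => 2) (fun _ _ => by norm_num) (by norm_num)
    (by norm_num) (by norm_num) (by rw [f₁' _ (by norm_num), hn₀])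
    (by rw [f₁' _ (by norm_num), hm₀])
    (by rw [f₁' _ (by norm_num), hz₀ _ _ _ _ (by norm_num)])
    (by rw [f₁' _ (by norm_num), hz₀ _ _ _ _ (by norm_num)])
    (fun _ _ _ _ _ => rfl) hF.wp.wp.wp.wp]
  rw [← expect_signs O out hS fun i => ((reducedColumns hk (inst i).1)ᵀ * symJ n).mulVec (inst i).2]
  change (𝔼 s : Fin m → Bits n, wp _ _
    (fill μ₁ 9 (β := fun _ => ZMod 2) (fun _ v => v.val) s) _) = _
  refine Finset.expect_congr rfl fun s _ => ?_
  set μ₂ := fill μ₁ 9 (β := fun _ => ZMod 2) (fun _ v => v.val) s with hμ₂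
  have f₂ : ∀ b, b ≠ 9 → μ₂ b = μ₁ b := fun b h => fill_of_ne h _ _
  have f₂' : ∀ b, b ∉ [8, 9, 10, 23] → μ₂ b = classicalInput inst b := by
    intro b h
    simp only [List.mem_cons, List.not_mem_nil, or_false, not_or] at h
    rw [f₂ b (by tauto), f₁' b (by simp; tauto)]
  rw [wp_fill_coin (n := n) (m := m) (by norm_num) (by norm_num) (by norm_num)
    (by rw [f₂' _ (by norm_num), hn₀]) (by rw [f₂' _ (by norm_num), hm₀])
    (by rw [f₂' _ (by norm_num), hz₀ _ _ _ _ (by norm_num)])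
    (by rw [f₂' _ (by norm_num), hz₀ _ _ _ _ (by norm_num)]) hF.wp.wp.wp]
  set τ₀ : Fin m → Tableau n := fun i => tableauOf (S i) 0 with hτ₀
  have hmem : ∀ i, τ₀ i ∈ cliffords n := fun i => mem_cliffords.mpr (hS i)
  have key : ∀ b : Fin m → Bits n, wp .completion
      (wp (.for_ 20 .m (.for_ 21 .n (.measurePauli 3)))
        (wp .signs fun μ ψ => answerWeight O (quantumQuery n m μ) out ψ))
      (fill μ₂ 7 (β := fun _ => ZMod 2) (fun _ v => v.val) b) (load (Pi.single b 1) ∅)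
      = ∑ w : Fin m → Bits n, ‖amplitude τ₀ (Pi.single b 1) w‖ ^ 2 *
        O.solver (fun i => tableauOf (S i) (Sum.elim (s i)
          (w i + ((reducedColumns hk (inst i).1)ᵀ * symJ n).mulVec (inst i).2)))
          (jointState τ₀ w) out := by
    intro b
    rw [wp_of_isDet (c := .completion) (by decide)]
    set μ₃ := fill μ₂ 7 (β := fun _ => ZMod 2) (fun _ v => v.val) b with hμ₃
    have f₃ : ∀ b, b ≠ 7 → μ₃ b = μ₂ b := fun b h => fill_of_ne h _ _
    have f₃' : ∀ b, b ∉ [7, 8, 9, 10, 23] → μ₃ b = classicalInput inst b := by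
      intro b h
      simp only [List.mem_cons, List.not_mem_nil, or_false, not_or] at h
      rw [f₃ b (by tauto), f₂' b (by simp; tauto)]
    have h3 := exec_completion hk (μ := μ₃) (by rw [f₃' _ (by norm_num), hn₀])
      (by rw [f₃' _ (by norm_num), hk₀]) (by rw [f₃' _ (by norm_num), hm₀]) (fun i => (inst i).1)
      (fun i g h => by rw [f₃' _ (by norm_num), hG])
      (fun i q h => by rw [f₃' _ (by norm_num), hz₀ _ _ _ _ (by norm_num)]) r
      (fun i a b => by
        rw [f₃ 8 (by norm_num), f₂ 8 (by norm_num), hμ₁, fill_apply, f₃ 10 (by norm_num),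
          f₂ 10 (by norm_num), f₁ 10 (by norm_num), hpow _ b.2.le]
        rfl)
    set μ₄ := exec .completion μ₃ with hμ₄
    have f₄ : ∀ b < 30, b ∉ [3, 12, 13, 14, 15, 16, 17, 18, 19, 22, 24, 25, 26, 27] →
      μ₄ b = μ₃ b := fun b hb h => exec_completion_of_ne hb h _
    have f₄' : ∀ b ∈ [0, 1, 2, 20, 21], μ₄ b = classicalInput inst b := by
      intro b hb
      simp only [List.mem_cons, List.not_mem_nil, or_false] at hb
      rw [f₄ b (by omega) (by simp; omega), f₃' b (by simp; omega)]
    change wp _ _ μ₄ _ = _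
    rw [wp_fill_measurePauli (n := n) (m := m) (μ := μ₄) (by norm_num) (by norm_num) (by norm_num)
      (by norm_num) (by rw [f₄' _ (by norm_num), hn₀]) (by rw [f₄' _ (by norm_num), hm₀])
      (by rw [f₄' _ (by norm_num), hz₀ _ _ _ _ (by norm_num)])
      (by rw [f₄' _ (by norm_num), hz₀ _ _ _ _ (by norm_num)])
      (exec_completion_counter _) hmem
      (fun i j l => by
        have := h3 i (Sum.inr j) (Sum.inl l)
        rwa [finSumFinEquiv_apply_right, finSumFinEquiv_apply_left, Fin.val_natAdd,
          Fin.val_castAdd] at this)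
      (fun i j l => by
        have := h3 i (Sum.inr j) (Sum.inr l)
        rwa [finSumFinEquiv_apply_right, finSumFinEquiv_apply_right, Fin.val_natAdd,
          Fin.val_natAdd] at this) hF.wp]
    refine Finset.sum_congr rfl fun w _ => ?_
    set μ₅ := fill μ₄ 11 (β := fun _ => ZMod 2) (fun _ v => v.val) w with hμ₅
    have f₅ : ∀ b, b ≠ 11 → μ₅ b = μ₄ b := fun b h => fill_of_ne h _ _
    have hw : (fun i j => w i j + (τ₀ i (Sum.inr j)).1) = w := by
      funext i j
      exact add_zero _
    rw [wp_of_isDet (by decide), hw, exec_signs (n := n) (m := m)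
      (by rw [f₅ _ (by norm_num), f₄' _ (by norm_num), hn₀])
      (by rw [f₅ _ (by norm_num), f₄' _ (by norm_num), hm₀]) S
      (fun i g h => by rw [f₅ _ (by norm_num), h3]) s w (fun i => (inst i).2)
      (fun i q => by
        rw [f₅ _ (by norm_num), f₄ _ (by norm_num) (by norm_num), f₃ _ (by norm_num), hμ₂,
          fill_apply, ZMod.natCast_zmod_val])
      (fun i q => by rw [hμ₅, fill_apply, ZMod.natCast_zmod_val])
      (fun i g => by rw [f₅ _ (by norm_num), f₄' _ (by norm_num), hT]), answerWeight_load,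
      O.solver_smul]
    simp only [hS₂]
  -- Averaged over the random initial basis state, all measurement results `w` become equally
  -- likely, as `expect_signs` requires.
  rw [Finset.expect_congr rfl fun b _ => key b, Finset.expect_sum_comm,
    Fintype.expect_eq_sum_div_card, div_eq_mul_inv, Finset.sum_mul]
  refine Finset.sum_congr rfl fun w _ => ?_
  rw [← Finset.expect_mul, expect_norm_amplitude_basis, mul_comm]

end

end LSN

/-! ### Distribution of the oracle's instance in the reduction to the quantum problem -/

namespace LSN

open Matrix

section

variable {n k m ℓ : ℕ}

/-- The randomly completed and randomly signed tableaus are exactly independent uniform Clifford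
operators; this combines `expect_completion` and `expect_cliffords` sample by sample. -/
theorem expect_pi_completion (hk : k ≤ n) (H : (Fin m → Tableau n) → ℝ) :
    𝔼 G ∈ Fintype.piFinset (fun _ : Fin m => encoders n k), 𝔼 r : Fin m → Fin n → Bits n,
      𝔼 s : Fin m → PVec n, H (fun i => tableauOf (completion hk (G i) (coinMatrix k (r i))) (s i))
      = 𝔼 τ ∈ Fintype.piFinset (fun _ : Fin m => cliffords n), H τ := by
  calc _ = 𝔼 c ∈ Fintype.piFinset (fun _ : Fin m =>
          encoders n k ×ˢ (Finset.univ : Finset (Fin n → Bits n))), 𝔼 s : Fin m → PVec n,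
          H (fun i => tableauOf (completion hk (c i).1 (coinMatrix k (c i).2)) (s i)) :=
        expect_pi_pair (encoders n k) fun G r => 𝔼 s : Fin m → PVec n,
          H (fun i => tableauOf (completion hk (G i) (coinMatrix k (r i))) (s i))
    _ = 𝔼 d ∈ Fintype.piFinset (fun _ : Fin m =>
          (encoders n k ×ˢ (Finset.univ : Finset (Fin n → Bits n))) ×ˢ
            (Finset.univ : Finset (PVec n))),
          H (fun i => tableauOf (completion hk (d i).1.1 (coinMatrix k (d i).1.2)) (d i).2) :=
        expect_pi_pair (encoders n k ×ˢ (Finset.univ : Finset (Fin n → Bits n))) fun c s =>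
          H (fun i => tableauOf (completion hk (c i).1 (coinMatrix k (c i).2)) (s i))
    _ = _ := by
        refine expect_piFinset_congr (γ := fun _ => Tableau n) _ (fun _ => cliffords n)
          (fun i (d : (Matrix (Fin n ⊕ Fin n) (Fin n ⊕ Fin k) (ZMod 2) × (Fin n → Bits n)) ×
            PVec n) => tableauOf (completion hk d.1.1 (coinMatrix k d.1.2)) d.2)
          (fun _ τ => τ) (fun i f => ?_) H
        rw [expect_product_univ, expect_product_univ, expect_cliffords]
        exact expect_completion hk fun S => 𝔼 s : PVec n, f (tableauOf S s)

/-- The reduced columns are orthogonal to the first half of the encoder and pair with the second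
half as `[0; I]`. The pairing vector of a structured sample is therefore the padded secret plus the
syndrome of the same error, which is the label of the noisy codeword. -/
theorem classicalStructured_toQuantum (hk : k ≤ n) (hℓ : ℓ ≤ n + 1) (p : ℝ)
    (O : QuantumOracle n m ℓ) (y : Bits k) (out : Bits ℓ) :
    classicalStructured p (toQuantum.withQuantum k O) y out = quantumStructured p O.solver y out := by
  have key : ∀ e : Fin m → PVec n,
      𝔼 G ∈ Fintype.piFinset (fun _ : Fin m => encoders n k), 𝔼 r : Fin m → Bits n,
        toQuantum.withQuantum k O (fun i => (G i, (G i).mulVec (Sum.elim (r i) y) + e i)) out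
      = 𝔼 τ ∈ Fintype.piFinset (fun _ : Fin m => cliffords n),
        O.solver τ (productState fun i => noisyCodeword (τ i) (e i) y) out := by
    intro e
    rw [← expect_pi_completion hk fun τ =>
      O.solver τ (productState fun i => noisyCodeword (τ i) (e i) y) out]
    refine Finset.expect_congr rfl fun G hG => ?_
    rw [Fintype.mem_piFinset] at hG
    have hu : (Finset.univ : Finset (Fin m → Bits n)).Nonempty := Finset.univ_nonempty
    -- The mask `r'` only adds vectors orthogonal to the reduced columns, so each of its values
    -- gives the same result.
    refine (Finset.expect_congr rfl fun r' _ => ?_).trans (Finset.expect_const hu _)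
    rw [withQuantum_toQuantum hk hℓ O hG]
    refine Finset.expect_congr rfl fun r _ => Finset.expect_congr rfl fun s _ => ?_
    set τ : Fin m → Tableau n :=
      fun i => tableauOf (completion hk (G i) (coinMatrix k (r i))) (s i) with hτ
    have hmem : ∀ i, τ i ∈ cliffords n := fun i =>
      mem_cliffords.mpr (completion_spec hk (hG i) (isShear_coinMatrix (r i))).1
    choose c hc hcw using fun i => noisyCodeword_eq (hmem i) (e i) y
    have h1 : (productState fun i => noisyCodeword (τ i) (e i) y)
        = (∏ i, c i) • jointState τ fun i => pad n y + syndrome (τ i) (e i) := by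
      rw [jointState, ← productState_smul]
      exact congrArg productState (funext hcw)
    have h2 : (fun i => ((reducedColumns hk (G i))ᵀ * symJ n).mulVec
        ((G i).mulVec (Sum.elim (r' i) y) + e i)) = fun i => pad n y + syndrome (τ i) (e i) := by
      funext i
      obtain ⟨-, -, g1, g2, -⟩ := completion_spec hk (hG i) (isShear_coinMatrix (r i))
      have h3 : (tableauMatrix (τ i)).toCols₂ = reducedColumns hk (G i) :=
        completion_toCols₂ hk _ _
      rw [syndrome_eq, h3, mulVec_add]
      congr 1
      conv_lhs => rw [← fromCols_toCols (G i)]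
      rw [fromCols_mulVec, Sum.elim_comp_inl, Sum.elim_comp_inr, mulVec_add, mulVec_mulVec,
        mulVec_mulVec]
      simp only [fromCols_toCols]
      rw [g1, g2, zero_mulVec, zero_add, padMatrix_mulVec]
    rw [h1, O.solver_smul, norm_prod, Finset.prod_eq_one fun i _ => hc i, one_pow, one_mul, h2]
  rw [quantumStructured, classicalStructured, Finset.expect_sum_comm]
  simp only [Finset.expect_sum_comm, ← Finset.mul_expect, key]

/-- Both averages are the normalized trace of the effect, taken in two orthonormal bases. -/
theorem expect_solver_jointState (O : QuantumOracle n m ℓ) (τ : Fin m → Tableau n) (out : Bits ℓ) :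
    𝔼 z : Fin m → Bits n, O.solver τ (jointState τ z) out
      = 𝔼 s : Fin m → Bits n, O.solver τ (Pi.single s 1) out := by
  have h1 : ∑ z, star (jointState τ z) ⬝ᵥ (O.effect τ out).mulVec (jointState τ z)
      = ((jointMatrix τ)ᴴ * (O.effect τ out * jointMatrix τ)).trace := rfl
  have h2 : ∑ s : Fin m → Bits n, star (Pi.single s (1 : ℂ)) ⬝ᵥ
      (O.effect τ out).mulVec (Pi.single s 1) = (O.effect τ out).trace := by
    refine Finset.sum_congr rfl fun s _ => ?_
    rw [← Pi.single_star, star_one, single_dotProduct, one_mul, mulVec_single_one]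
    rfl
  rw [Fintype.expect_eq_sum_div_card, Fintype.expect_eq_sum_div_card]
  congr 1
  simp only [QuantumOracle.solver, ← Complex.re_sum]
  rw [h1, h2, trace_mul_comm, Matrix.mul_assoc, (jointMatrix_unitary τ).2, Matrix.mul_one]

/-- In symplectic coordinates the pairing with the `Z` columns reads off the `X` coordinates, which
are uniform for a uniform vector. -/
theorem expect_pairing {S : Matrix (Fin n ⊕ Fin n) (Fin n ⊕ Fin n) (ZMod 2)}
    (hS : S ∈ symplectics n) (f : Bits n → ℝ) :
    𝔼 u : PVec n, f ((S.toCols₂ᵀ * symJ n).mulVec u) = 𝔼 z, f z := by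
  rw [← expect_symplectic_mulVec hS fun u => f ((S.toCols₂ᵀ * symJ n).mulVec u)]
  obtain ⟨-, h2, h3, -⟩ := toCols_of_mem_symplectics hS
  have hu : (Finset.univ : Finset (Bits n)).Nonempty := Finset.univ_nonempty
  refine (Finset.expect_congr rfl fun r _ => ?_).trans (Finset.expect_const hu _)
  simp only [mulVec_add, mulVec_mulVec, h2, h3, zero_mulVec, one_mulVec, add_zero]

/-- A uniform vector gives a uniform label, and a uniformly random code state is a maximally mixed
register, whatever the Clifford operator. -/
theorem classicalUnstructured_toQuantum (hk : k ≤ n) (hℓ : ℓ ≤ n + 1) (O : QuantumOracle n m ℓ)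
    (out : Bits ℓ) :
    classicalUnstructured (toQuantum.withQuantum k O) out = quantumUnstructured O.solver out := by
  rw [quantumUnstructured, classicalUnstructured, ← expect_pi_completion hk fun τ =>
      𝔼 s : Fin m → Bits n, O.solver τ (Pi.single s 1) out]
  refine Finset.expect_congr rfl fun G hG => ?_
  rw [Fintype.mem_piFinset] at hG
  rw [Finset.expect_congr rfl fun u _ => withQuantum_toQuantum hk hℓ O (inst := fun i => (G i, u i))
    hG out, Finset.expect_comm]
  refine Finset.expect_congr rfl fun r _ => ?_
  rw [Finset.expect_comm]
  refine Finset.expect_congr rfl fun s _ => ?_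
  rw [← expect_solver_jointState, ← Fintype.piFinset_univ, ← Fintype.piFinset_univ]
  refine expect_piFinset_congr (γ := fun _ => Bits n) (fun _ => Finset.univ) (fun _ => Finset.univ)
    (fun i (u : PVec n) => ((reducedColumns hk (G i))ᵀ * symJ n).mulVec u) (fun _ z => z)
    (fun i f => ?_) fun z =>
      O.solver (fun i => tableauOf (completion hk (G i) (coinMatrix k (r i))) (s i))
        (jointState (fun i => tableauOf (completion hk (G i) (coinMatrix k (r i))) (s i)) z) out
  have := expect_pairing (completion_spec hk (hG i) (isShear_coinMatrix (r i))).1 f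
  rwa [completion_toCols₂] at this

end

end LSN

/-! ### The four reductions -/

theorem mainTheorem2 :
    -- Search: the quantum problem reduces to its classical representation
    (∃ (R : LSN.OneCallAlgorithm) (f : Polynomial ℕ), ∀ n k m : ℕ, k ≤ n →
      R.QuantumTimeLe n k m k (f.eval (n + m)) ∧
      ∀ p : ℝ, 0 ≤ p → p ≤ 1 → ∀ O : LSN.ClassicalOracle n k m k,
        LSN.quantumSearchSuccess p (R.withClassical O) = LSN.classicalSearchSuccess p O.solver) ∧
    -- Search: the classical representation reduces to the quantum problem
    (∃ (R : LSN.OneCallAlgorithm) (f : Polynomial ℕ), ∀ n k m : ℕ, k ≤ n →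
      R.ClassicalTimeLe n k m k (f.eval (n + m)) ∧
      ∀ p : ℝ, 0 ≤ p → p ≤ 1 → ∀ O : LSN.QuantumOracle n m k,
        LSN.classicalSearchSuccess p (R.withQuantum k O) = LSN.quantumSearchSuccess p O.solver) ∧
    -- Decision: the quantum problem reduces to its classical representation
    (∃ (R : LSN.OneCallAlgorithm) (f : Polynomial ℕ), ∀ n k m : ℕ, k ≤ n →
      R.QuantumTimeLe n k m 1 (f.eval (n + m)) ∧
      ∀ p : ℝ, 0 ≤ p → p ≤ 1 → ∀ O : LSN.ClassicalOracle n k m 1,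
        LSN.quantumDecisionSuccess k p (R.withClassical O)
          = LSN.classicalDecisionSuccess p O.solver) ∧
    -- Decision: the classical representation reduces to the quantum problem
    (∃ (R : LSN.OneCallAlgorithm) (f : Polynomial ℕ), ∀ n k m : ℕ, k ≤ n →
      R.ClassicalTimeLe n k m 1 (f.eval (n + m)) ∧
      ∀ p : ℝ, 0 ≤ p → p ≤ 1 → ∀ O : LSN.QuantumOracle n m 1,
        LSN.classicalDecisionSuccess p (R.withQuantum k O)
          = LSN.quantumDecisionSuccess k p O.solver) := by
  have h₁ : LSN.toClassical.post.hasParamLoops := by decide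
  have h₂ : LSN.toQuantum.post.hasParamLoops := by decide
  refine ⟨⟨LSN.toClassical, LSN.toClassical.timeBound, fun n k m hk =>
      ⟨LSN.OneCallAlgorithm.quantumTimeLe LSN.Cmd.toClassical_hasParamLoops h₁ hk k,
        fun p _ _ O => ?_⟩⟩,
    ⟨LSN.toQuantum, LSN.toQuantum.timeBound, fun n k m hk =>
      ⟨LSN.OneCallAlgorithm.classicalTimeLe LSN.Cmd.toQuantum_hasParamLoops h₂ hk k,
        fun p _ _ O => ?_⟩⟩,
    ⟨LSN.toClassical, LSN.toClassical.timeBound, fun n k m hk =>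
      ⟨LSN.OneCallAlgorithm.quantumTimeLe LSN.Cmd.toClassical_hasParamLoops h₁ hk 1,
        fun p _ _ O => ?_⟩⟩,
    ⟨LSN.toQuantum, LSN.toQuantum.timeBound, fun n k m hk =>
      ⟨LSN.OneCallAlgorithm.classicalTimeLe LSN.Cmd.toQuantum_hasParamLoops h₂ hk 1,
        fun p _ _ O => ?_⟩⟩⟩
  · exact Finset.expect_congr rfl fun x _ =>
      LSN.quantumStructured_toClassical hk (by omega) p O x x
  · exact Finset.expect_congr rfl fun y _ =>
      LSN.classicalStructured_toQuantum hk (by omega) p O y y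
  · rw [LSN.quantumDecisionSuccess, LSN.classicalDecisionSuccess,
      LSN.quantumUnstructured_toClassical hk (by omega)]
    simp only [LSN.quantumStructured_toClassical hk (Nat.le_add_left 1 n)]
  · rw [LSN.quantumDecisionSuccess, LSN.classicalDecisionSuccess,
      LSN.classicalUnstructured_toQuantum hk (by omega)]
    simp only [LSN.classicalStructured_toQuantum hk (Nat.le_add_left 1 n)]
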